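/- Let $m\ge 1$ and $n>2m$ be integers. There is $k_0=k_0(n,m)$ with the following property. Let $V:\mathbb R^n\to\mathbb R$ be measurable with $|V(x)|\le C\langle x\rangle^{-\beta}$, $\langle x\rangle=(1+|x|^2)^{1/2}$, where $\beta>n+4$ if $n$ is odd and $\beta>n+3$ if $n$ is even. Let $H=(-\Delta)^m+V$ and assume that zero is a regular point of the spectrum of $H$, that is, the only distributional solution $\psi$ of $H\psi=0$ with $\psi\in L^2(\mathbb R^n)$ (eigenfunction), or with $\langle x\rangle^{-s}\psi\in L^2(\mathbb R^n)$ for all $s>2m-\frac n2$ (resonance), is $\psi=0$. Let $\mathcal R_0^+(\lambda^{2m})=\lim_{\varepsilon\downarrow 0}\big((-\Delta)^m-\lambda^{2m}-i\varepsilon\big)^{-1}$ (as an operator with an integral kernel), $v=|V|^{1/2}$, $U(x)=1$ if $V(x)\ge 0$ and $U(x)=-1$ if $V(x)<0$, and $M^+(\lambda)=U+v\mathcal R_0^+(\lambda^{2m})v$ on $L^2(\mathbb R^n)$. Put $\Gamma_0(\lambda)=M^+(\lambda)^{-1}$ and, for $k\ge 1$, $$\Gamma_k(\lambda)=Uv\mathcal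 R_0^+(\lambda^{2m})\big(V\mathcal R_0^+(\lambda^{2m})\big)^{k-1}vM^+(\lambda)^{-1}v\big(\mathcal R_0^+(\lambda^{2m})V\big)^{k-1}\mathcal R_0^+(\lambda^{2m})vU .$$ Then there is $\lambda_0>0$ such that $M^+(\lambda)$ is a bounded, boundedly invertible operator on $L^2(\mathbb R^n)$ for $0<\lambda<\lambda_0$, and the following holds for all $k\ge 0$ if $2m<n<4m$, and for all $k\ge k_0$ if $n\ge 4m$. For $0<\lambda<\lambda_0$ the operator $\Gamma_k(\lambda)$ has an integral kernel $\Gamma_k(\lambda)(x,y)$ (for $k=0$: a kernel $U(x)\delta(x-y)+K(\lambda)(x,y)$, whose singular part does not depend on $\lambda$ and enters $|\Gamma_0(\lambda)|$ and $\widetilde\Gamma_0$ below as $|U(x)|\delta(x-y)$) that is $\lceil \frac n2\rceil+1$ times continuously differentiable in $\lambda$; it is absolutely bounded, i.e. the operator with kernel $|\Gamma_k(\lambda)(x,y)|$ is bounded on $L^2(\mathbb R^n)$; and the kernel $$\widetilde\Gamma_k(x,y)=\sup_{0<\lambda<\lambda_0}\Big[|\Gamma_k(\lambda)(x,y)|+\sup_{1\le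 j\le\lceil n/2\rceil+1}\big|\lambda^{j-1}\partial_\lambda^j\Gamma_k(\lambda)(x,y)\big|\Big]$$ satisfies: if $2m<n<4m$, the operator with kernel $\widetilde\Gamma_k$ is bounded on $L^2(\mathbb R^n)$; if $n\ge 4m$, there are $\varepsilon>0$ and $C$ with $\widetilde\Gamma_k(x,y)\le C\langle x\rangle^{-\frac n2-\varepsilon}\langle y\rangle^{-\frac n2-\varepsilon}$ for all $x,y$. -/

import Mathlib

open MeasureTheory Filter Topology Set
open scoped ENNReal ContDiff

namespace HigherSchrodinger

/-- Euclidean space `ℝⁿ`. -/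
abbrev Space (n : ℕ) : Type := EuclideanSpace ℝ (Fin n)

/-- The complex Hilbert space `L²(ℝⁿ)`. -/
abbrev L2 (n : ℕ) : Type := Lp ℂ 2 (volume : Measure (Space n))

/-- The Japanese bracket `⟨x⟩ = (1 + |x|²)^{1/2}`. -/
noncomputable def bracket {n : ℕ} (x : Space n) : ℝ := Real.sqrt (1 + ‖x‖ ^ 2)

/-- `v = |V|^{1/2}`. -/
noncomputable def vRoot {n : ℕ} (V : Space n → ℝ) (x : Space n) : ℝ := Real.sqrt |V x|

/-- The sign `U` of the potential: `U = 1` where `V ≥ 0`, and `U = -1` where `V < 0`. -/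
noncomputable def signU {n : ℕ} (V : Space n → ℝ) (x : Space n) : ℂ :=
  open Classical in if 0 ≤ V x then 1 else -1

/-! ### The free resolvent -/

/-- The inverse Fourier integral of the symbol `(|ξ|^{2m} - z)⁻¹` of the free resolvent
`((-Δ)^m - z)⁻¹`, made absolutely convergent by the Gaussian factor `exp (-δ |ξ|²)`. -/
noncomputable def regularizedKernel {n : ℕ} (m : ℕ) (z : ℂ) (δ : ℝ) (x : Space n) : ℂ :=
  ((2 * Real.pi : ℝ) : ℂ)⁻¹ ^ n *
    ∫ ξ : Space n, Complex.exp (Complex.I * ((inner ℝ x ξ : ℝ) : ℂ)) *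
      ((Real.exp (-δ * ‖ξ‖ ^ 2) : ℝ) : ℂ) / (((‖ξ‖ ^ (2 * m) : ℝ) : ℂ) - z)

/-- The convolution kernel of the free resolvent `((-Δ)^m - z)⁻¹`, `z ∉ [0, ∞)`, at `x ≠ 0`: the
(Gauss summed) inverse Fourier transform of `(|ξ|^{2m} - z)⁻¹`. -/
noncomputable def resolventKernel {n : ℕ} (m : ℕ) (z : ℂ) (x : Space n) : ℂ :=
  limUnder (𝓝[>] (0 : ℝ)) fun δ => regularizedKernel m z δ x

/-- The convolution kernel of the boundary value `R₀⁺(λ^{2m})` of the free resolvent: the limit of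
the kernel of `((-Δ)^m - z)⁻¹` as `z = λ^{2m} + iε` approaches `λ^{2m}` from the upper half plane. -/
noncomputable def resolventKernelPlus {n : ℕ} (m : ℕ) (lam : ℝ) (x : Space n) : ℂ :=
  limUnder (𝓝[>] (0 : ℝ)) fun ε : ℝ =>
    resolventKernel m (((lam ^ (2 * m) : ℝ) : ℂ) + (ε : ℂ) * Complex.I) x

/-- The integral kernel `v(x) R₀⁺(λ^{2m})(x,y) v(y)` of `v R₀⁺(λ^{2m}) v`. -/
noncomputable def sandwichKernel {n : ℕ} (m : ℕ) (V : Space n → ℝ) (lam : ℝ) (x y : Space n) : ℂ :=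
  (vRoot V x : ℂ) * resolventKernelPlus m lam (x - y) * (vRoot V y : ℂ)

/-! ### Operators with kernels -/

/-- The bounded operator `T` on `L²` has the (generalised) integral kernel
`a(x) δ(x - y) + K(x, y)`; for `a = 0` it is the integral operator with kernel `K`. -/
def HasKernel {n : ℕ} (T : L2 n →L[ℂ] L2 n) (a : Space n → ℂ) (K : Space n → Space n → ℂ) : Prop :=
  ∀ f : L2 n, ∀ᵐ x : Space n, Integrable (fun y => K x y * f y) ∧
    T f x = a x * f x + ∫ y, K x y * f y

/-- The bounded operator on `L²` with kernel `a(x) δ(x - y) + K(x, y)`. It is unique; if there is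
none, the value is `0`. -/
noncomputable def kernelOp {n : ℕ} (a : Space n → ℂ) (K : Space n → Space n → ℂ) :
    L2 n →L[ℂ] L2 n :=
  open Classical in if h : ∃ T, HasKernel T a K then h.choose else 0

/-- The operator with the nonnegative kernel `a(x) δ(x - y) + K(x, y)` is bounded on `L²`. -/
def NonnegKernelBounded {n : ℕ} (a : Space n → ℝ≥0∞) (K : Space n → Space n → ℝ≥0∞) : Prop :=
  ∃ C : NNReal, ∀ f : Space n → ℝ≥0∞, Measurable f →
    ∫⁻ x, (a x * f x + ∫⁻ y, K x y * f y) ^ 2 ≤ C * ∫⁻ x, f x ^ 2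

/-! ### The operators `M⁺(λ)` and `Γ_k(λ)` -/

/-- Multiplication by `U` on `L²`. -/
noncomputable def opU {n : ℕ} (V : Space n → ℝ) : L2 n →L[ℂ] L2 n := kernelOp (signU V) 0

/-- The operator `v R₀⁺(λ^{2m}) v` on `L²`. -/
noncomputable def sandwich {n : ℕ} (m : ℕ) (V : Space n → ℝ) (lam : ℝ) : L2 n →L[ℂ] L2 n :=
  kernelOp 0 (sandwichKernel m V lam)

/-- `M⁺(λ) = U + v R₀⁺(λ^{2m}) v`. -/
noncomputable def opM {n : ℕ} (m : ℕ) (V : Space n → ℝ) (lam : ℝ) : L2 n →L[ℂ] L2 n :=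
  opU V + sandwich m V lam

/-- `Γ_0(λ) = M⁺(λ)⁻¹` and, for `k ≥ 1`,
`Γ_k(λ) = U v R (V R)^{k-1} v M⁺(λ)⁻¹ v (R V)^{k-1} R v U` with `R = R₀⁺(λ^{2m})`.
As `V = v U v`, the outer factors are words in the bounded operators `S = v R v` and `U`:
`U v R (V R)^{k-1} v = U S (U S)^{k-1}` and `v (R V)^{k-1} R v U = (S U)^{k-1} S U`. -/
noncomputable def opGamma {n : ℕ} (m : ℕ) (V : Space n → ℝ) : ℕ → ℝ → (L2 n →L[ℂ] L2 n)
  | 0, lam => Ring.inverse (opM m V lam)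
  | k + 1, lam =>
      (opU V * sandwich m V lam) * (opU V * sandwich m V lam) ^ k * Ring.inverse (opM m V lam) *
        (sandwich m V lam * opU V) ^ k * (sandwich m V lam * opU V)

/-! ### Zero as a regular point of the spectrum -/

/-- `ψ` solves `H ψ = (-Δ)^m ψ + V ψ = 0` on `ℝⁿ` in the sense of distributions. -/
def IsZeroSolution {n : ℕ} (m : ℕ) (V : Space n → ℝ) (ψ : Space n → ℂ) : Prop :=
  ∀ φ : Space n → ℂ, ContDiff ℝ ∞ φ → HasCompactSupport φ →
    ∫ x, ψ x * ((-1) ^ m * (Laplacian.laplacian^[m] φ) x + (V x : ℂ) * φ x) = 0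

/-- Zero is a regular point of the spectrum of `H = (-Δ)^m + V`: it is neither an eigenvalue (a
nonzero solution of `H ψ = 0` in `L²`) nor a resonance (a nonzero solution with
`⟨x⟩^{-s} ψ ∈ L²` for all `s > 2m - n/2`). -/
def ZeroIsRegular {n : ℕ} (m : ℕ) (V : Space n → ℝ) : Prop :=
  ∀ ψ : Space n → ℂ, IsZeroSolution m V ψ →
    (MemLp ψ 2 ∨ ∀ s : ℝ, 2 * (m : ℝ) - (n : ℝ) / 2 < s →
      MemLp (fun x => ((bracket x ^ (-s) : ℝ) : ℂ) * ψ x) 2) →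
    ψ =ᵐ[volume] 0

/-! ### The hypotheses on `Γ(λ)` -/

/-- The number `⌈n/2⌉ + 1` of derivatives in `λ`. -/
noncomputable def numDeriv (n : ℕ) : ℕ := ⌈(n : ℝ) / 2⌉₊ + 1

/-- `Γ̃(x,y) = sup_{0<λ<λ₀} [ |K(λ)(x,y)| + sup_{1≤j≤⌈n/2⌉+1} |λ^{j-1} ∂_λ^j K(λ)(x,y)| ]`. -/
noncomputable def tildeKernel {n : ℕ} (lam0 : ℝ) (K : ℝ → Space n → Space n → ℂ)
    (x y : Space n) : ℝ≥0∞ :=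
  ⨆ lam ∈ Ioo 0 lam0, (‖K lam x y‖ₑ + ⨆ j ∈ Icc 1 (numDeriv n),
    ‖(lam : ℂ) ^ (j - 1) * iteratedDeriv j (fun μ => K μ x y) lam‖ₑ)

/-- The `λ`-dependent operator `Γ(λ)`, `0 < λ < λ₀`, has a kernel `a(x) δ(x - y) + K(λ)(x, y)`
(for `a = 0`, a genuine integral kernel) with `⌈n/2⌉ + 1` derivatives in `λ`, it is absolutely
bounded, and `Γ̃`, the kernel `|a(x)| δ(x - y) + tildeKernel`, is bounded on `L²` when `2m < n < 4m`,
and is a function bounded by a multiple of `⟨x⟩^{-n/2-ε} ⟨y⟩^{-n/2-ε}` for some `ε > 0` when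
`n ≥ 4m`. -/
def SatisfiesHypotheses {n : ℕ} (m : ℕ) (lam0 : ℝ) (a : Space n → ℂ)
    (Γ : ℝ → (L2 n →L[ℂ] L2 n)) : Prop :=
  ∃ K : ℝ → Space n → Space n → ℂ,
    (∀ lam ∈ Ioo 0 lam0, Measurable (Function.uncurry (K lam))) ∧
    (∀ x y, ContDiffOn ℝ (numDeriv n) (fun lam => K lam x y) (Ioo 0 lam0)) ∧
    (∀ lam ∈ Ioo 0 lam0, HasKernel (Γ lam) a (K lam)) ∧
    (∀ lam ∈ Ioo 0 lam0, NonnegKernelBounded (fun x => ‖a x‖ₑ) (fun x y => ‖K lam x y‖ₑ)) ∧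
    (n < 4 * m → NonnegKernelBounded (fun x => ‖a x‖ₑ) (tildeKernel lam0 K)) ∧
    (4 * m ≤ n → a =ᵐ[volume] 0 ∧ ∃ ε : ℝ, 0 < ε ∧ ∃ C : ℝ, ∀ x y,
      tildeKernel lam0 K x y ≤ ENNReal.ofReal
        (C * bracket x ^ (-((n : ℝ) / 2) - ε) * bracket y ^ (-((n : ℝ) / 2) - ε)))

end HigherSchrodinger

/-! Write `S(λ) = v R₀⁺(λ^{2m}) v`, so that `M⁺ = U + S`. The proof rests on a precise description
of the kernel of `S(λ)` and its `λ`-derivatives, on the invertibility of `U + S(0)`, and on a way to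
read pointwise kernel bounds off an operator of which only the norm is known.

Free kernel. Partial fractions in `|ξ|²` split the resolvent of `(-Δ)^m` into `m` resolvents of the
Laplacian at the points `-κ²λ²`, where `-κ²` runs over the `m`-th roots of unity; each has a Bessel
kernel. The sum is `|x|^{2m-n} F(λ|x|)`. The separate terms are more singular, but sums of powers of
roots of unity vanish (`exists_norm_rootSum_sub_coeff_le`), which leaves `F(s) = F(0) + O(s)` at the
origin, with `F(0)` the Riesz constant of `(-Δ)^{-m}`; at infinity `F(s) = O(s^{(n+1)/2-2m})`.
Cauchy's estimates on discs of radius `λ/4` for `λr ≤ 1` and `1/(4r)` for `λr ≥ 1` bound `λ^{j-1}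
∂_λ^j` of the kernel by `1 + r^{2m-n} + r^g`, where `g = ⌈n/2⌉ + 1 - (n-1)/2`
(`exists_symB_freeKernel`). Here `g = 2` for odd and `g = 3/2` for even `n`. The decay of `v` pays
for `r^g` and must leave a weight `⟨x⟩^{-σ}` with `σ > n/2` on each side; this is the condition on
`β`.

From kernels to operators. Kernels dominated by `⟨x⟩^{-σ} ⟨y⟩^{-σ} (1 + |x-y|^{-γ})` with `γ < n`
are controlled by Schur's test near the diagonal and by the Hilbert–Schmidt norm away from it. This
gives boundedness, compactness and dominated convergence in operator norm. Hence `S(λ)` converges in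
norm as `λ → 0`, and its pointwise derivative bounds become bounds in operator norm
(`SymB.realise`).

Invertibility. If `(U + S(0)) f = 0`, then `ψ = (-Δ)^{-m} v f` is a distributional solution of `Hψ =
0` in the space of eigenfunctions or resonances, so `ψ = 0` and then `f = 0`. Since `U S(0)` is
compact, the Fredholm alternative makes `U + S(0)` invertible, and `M⁺(λ)` is uniformly invertible
for small `λ`. The derivative of an inverse is `-W M' W` with `W = M⁻¹`, so the bounds pass to `W`
by induction.

Kernels of `Γ_k`. If `A` and `B` have square integrable rows and columns, that is `2γ < n`, then `A
W B` has the kernel `⟨A(x,·)*, W B(·,y)⟩`, which obeys the same derivative bounds with no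
singularity on the diagonal. For `n < 4m` the order `γ = n - 2m` of `S` itself qualifies, and `W = U
- U S U + U S W S U` covers `k = 0`. For `n ≥ 4m` each extra factor `S` lowers `γ` by at least one
until `γ = 0`, so that large `k` qualify. -/

namespace HigherSchrodinger

/-! ### The modified Bessel functions -/

/-- The integral `∫₀^∞ e^{-u} u^a (u + 2ρ)^b du`. -/
noncomputable def besselInt (a b : ℝ) (ρ : ℂ) : ℂ :=
  ∫ u in Ioi (0 : ℝ), ((Real.exp (-u) * u ^ a : ℝ) : ℂ) * ((u : ℂ) + 2 * ρ) ^ (b : ℂ)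

/-- The function `e^{-ρ} ∫₀^∞ e^{-u} u^a (u + 2ρ)^a du`, a multiple of `ρ^ν K_ν(ρ)` for
`ν = a + 1/2`. -/
noncomputable def besselE (a : ℝ) (ρ : ℂ) : ℂ := Complex.exp (-ρ) * besselInt a a ρ

theorem integrableOn_exp_rpow {a : ℝ} (ha : -1 < a) :
    IntegrableOn (fun u : ℝ => Real.exp (-u) * u ^ a) (Ioi 0) := by
  have := Real.GammaIntegral_convergent (s := a + 1) (by linarith)
  simpa using this

theorem integrableOn_exp_rpow_mul_rpow {a b M : ℝ} (ha : -1 < a) (hb : 0 ≤ b) (hM : 0 ≤ M) :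
    IntegrableOn (fun u : ℝ => Real.exp (-u) * u ^ a * (u + M) ^ b) (Ioi 0) := by
  have h1 : IntegrableOn (fun u : ℝ => 2 ^ b * (Real.exp (-u) * u ^ (a + b)) +
      (2 * M) ^ b * (Real.exp (-u) * u ^ a)) (Ioi 0) :=
    ((integrableOn_exp_rpow (by linarith)).const_mul _).add
      ((integrableOn_exp_rpow ha).const_mul _)
  refine Integrable.mono' h1 ?_ ?_
  · refine (Measurable.aestronglyMeasurable ?_)
    fun_prop
  · filter_upwards [ae_restrict_mem measurableSet_Ioi] with u hu
    have hu0 : (0 : ℝ) < u := hu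
    rw [Real.norm_of_nonneg (by positivity)]
    -- The sum is at most twice the larger summand; with both cases added, the integrand is below
    -- two Gamma integrands.
    have h2 : (u + M) ^ b ≤ 2 ^ b * u ^ b + (2 * M) ^ b := by
      rcases le_total u M with h | h
      · have : (u + M) ^ b ≤ (2 * M) ^ b := Real.rpow_le_rpow (by positivity) (by linarith) hb
        have : 0 ≤ (2 : ℝ) ^ b * u ^ b := by positivity
        linarith
      · have : (u + M) ^ b ≤ (2 * u) ^ b := Real.rpow_le_rpow (by positivity) (by linarith) hb
        rw [Real.mul_rpow (by norm_num) hu0.le] at this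
        have : 0 ≤ (2 * M) ^ b := by positivity
        linarith
    rw [Real.rpow_add hu0]
    have h3 : 0 ≤ Real.exp (-u) * u ^ a := by positivity
    nlinarith [mul_le_mul_of_nonneg_left h2 h3]

theorem add_two_mul_mem_slitPlane {u : ℝ} (hu : 0 ≤ u) {ρ : ℂ} (hρ : ρ ∈ Complex.slitPlane) :
    (u : ℂ) + 2 * ρ ∈ Complex.slitPlane := by
  rw [Complex.mem_slitPlane_iff] at hρ ⊢
  simp only [Complex.add_re, Complex.ofReal_re, Complex.mul_re, Complex.re_ofNat, Complex.im_ofNat,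
    zero_mul, sub_zero, Complex.add_im, Complex.ofReal_im, Complex.mul_im, add_zero, zero_add]
  rcases hρ with h | h
  · left; linarith
  · right; simpa using h

/-- The sign of `b` is left open: a positive power is largest at the upper end `M`, a negative one
at the lower end `c`, and the other term is only nonnegative. -/
theorem rpow_le_add_rpow_abs {c x M b : ℝ} (hc : 0 < c) (hcx : c ≤ x) (hxM : x ≤ M) :
    x ^ b ≤ c ^ b + M ^ |b| := by
  have hx : 0 < x := hc.trans_le hcx
  rcases le_total 0 b with h | h
  · rw [abs_of_nonneg h]
    have := Real.rpow_le_rpow hx.le hxM h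
    have : 0 ≤ c ^ b := by positivity
    linarith
  · have := Real.rpow_le_rpow_of_nonpos hc hcx h
    have : 0 ≤ M ^ |b| := Real.rpow_nonneg (hx.le.trans hxM) _
    linarith

theorem measurable_besselIntegrand (a b : ℝ) (ρ : ℂ) : Measurable fun u : ℝ =>
    ((Real.exp (-u) * u ^ a : ℝ) : ℂ) * ((u : ℂ) + 2 * ρ) ^ (b : ℂ) := by
  fun_prop

theorem norm_besselIntegrand {a b : ℝ} {ρ : ℂ} {u : ℝ} (hu : 0 < u) :
    ‖((Real.exp (-u) * u ^ a : ℝ) : ℂ) * ((u : ℂ) + 2 * ρ) ^ (b : ℂ)‖ =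
      Real.exp (-u) * u ^ a * ‖(u : ℂ) + 2 * ρ‖ ^ b := by
  rw [norm_mul, Complex.norm_cpow_real, Complex.norm_real, Real.norm_of_nonneg (by positivity)]

/-- Near a point of the slit plane, the integrands of `besselInt` have a common integrable bound. -/
theorem exists_besselIntegrand_bound {a : ℝ} (ha : -1 < a) (b : ℝ) {ρ₀ : ℂ}
    (hρ : ρ₀ ∈ Complex.slitPlane) : ∃ s ∈ 𝓝 ρ₀, s ⊆ Complex.slitPlane ∧ ∃ B : ℝ → ℝ,
      IntegrableOn B (Ioi 0) ∧ ∀ ρ ∈ s, ∀ u : ℝ, 0 < u →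
        ‖((Real.exp (-u) * u ^ a : ℝ) : ℂ) * ((u : ℂ) + 2 * ρ) ^ (b : ℂ)‖ ≤ B u := by
  obtain ⟨ε, hε, hball⟩ := Metric.isOpen_iff.1 Complex.isOpen_slitPlane ρ₀ hρ
  refine ⟨Metric.ball ρ₀ (ε / 2), Metric.ball_mem_nhds _ (by positivity),
    (Metric.ball_subset_ball (by linarith)).trans hball,
    fun u => ε ^ b * (Real.exp (-u) * u ^ a) +
      Real.exp (-u) * u ^ a * (u + 2 * (‖ρ₀‖ + ε)) ^ |b|,
    ((integrableOn_exp_rpow ha).const_mul _).add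
      (integrableOn_exp_rpow_mul_rpow ha (abs_nonneg b) (by positivity)), ?_⟩
  intro ρ hρ' u hu
  rw [norm_besselIntegrand hu]
  -- The point `-u/2` lies on the cut, hence at distance at least `ε` from `ρ₀` and at least `ε/2`
  -- from `ρ`; and `u + 2ρ = -2(-u/2 - ρ)`.
  have hlow : ε ≤ ‖(u : ℂ) + 2 * ρ‖ := by
    have h1 : ((-(u / 2) : ℝ) : ℂ) ∉ Metric.ball ρ₀ ε := fun h => by
      have := hball h
      rw [Complex.mem_slitPlane_iff] at this
      simp only [Complex.ofReal_re, Complex.ofReal_im, ne_eq, not_true_eq_false, or_false] at this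
      linarith
    rw [Metric.mem_ball, dist_eq_norm, not_lt] at h1
    rw [Metric.mem_ball, dist_eq_norm] at hρ'
    have h2 : ‖((-(u / 2) : ℝ) : ℂ) - ρ₀‖ ≤ ‖((-(u / 2) : ℝ) : ℂ) - ρ‖ + ‖ρ - ρ₀‖ :=
      norm_sub_le_norm_sub_add_norm_sub _ _ _
    have h3 : ((u : ℂ) + 2 * ρ) = -2 * (((-(u / 2) : ℝ) : ℂ) - ρ) := by push_cast; ring
    rw [h3, norm_mul]
    norm_num
    norm_num at h1 h2
    linarith
  have hup : ‖(u : ℂ) + 2 * ρ‖ ≤ u + 2 * (‖ρ₀‖ + ε) := by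
    rw [Metric.mem_ball, dist_eq_norm] at hρ'
    have h2 : ‖ρ‖ ≤ ‖ρ₀‖ + ‖ρ - ρ₀‖ := by
      have := norm_add_le ρ₀ (ρ - ρ₀); simpa using this
    calc ‖(u : ℂ) + 2 * ρ‖ ≤ ‖(u : ℂ)‖ + ‖2 * ρ‖ := norm_add_le _ _
      _ = u + 2 * ‖ρ‖ := by rw [norm_mul, Complex.norm_real, Real.norm_of_nonneg hu.le]; norm_num
      _ ≤ _ := by linarith
  have := rpow_le_add_rpow_abs (b := b) hε hlow hup
  have h3 : 0 ≤ Real.exp (-u) * u ^ a := by positivity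
  nlinarith [mul_le_mul_of_nonneg_left this h3]

theorem integrableOn_besselIntegrand {a : ℝ} (ha : -1 < a) (b : ℝ) {ρ : ℂ}
    (hρ : ρ ∈ Complex.slitPlane) : IntegrableOn (fun u : ℝ =>
      ((Real.exp (-u) * u ^ a : ℝ) : ℂ) * ((u : ℂ) + 2 * ρ) ^ (b : ℂ)) (Ioi 0) := by
  obtain ⟨s, hs, -, B, hB, hle⟩ := exists_besselIntegrand_bound ha b hρ
  refine Integrable.mono' hB (measurable_besselIntegrand a b ρ).aestronglyMeasurable ?_
  filter_upwards [ae_restrict_mem measurableSet_Ioi] with u hu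
  exact hle ρ (mem_of_mem_nhds hs) u hu

/-- Differentiation lowers only the second exponent, which is why `besselInt` has two independent
exponents and the second is not restricted in sign. -/
theorem hasDerivAt_besselInt {a : ℝ} (ha : -1 < a) (b : ℝ) {ρ : ℂ}
    (hρ : ρ ∈ Complex.slitPlane) :
    HasDerivAt (besselInt a b) (2 * b * besselInt a (b - 1) ρ) ρ := by
  obtain ⟨s, hs, hsl, B, hB, hle⟩ := exists_besselIntegrand_bound ha (b - 1) hρ
  have key := hasDerivAt_integral_of_dominated_loc_of_deriv_le (μ := volume.restrict (Ioi (0 : ℝ)))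
    (F := fun (ρ : ℂ) (u : ℝ) =>
      ((Real.exp (-u) * u ^ a : ℝ) : ℂ) * ((u : ℂ) + 2 * ρ) ^ (b : ℂ))
    (F' := fun (ρ : ℂ) (u : ℝ) => 2 * b *
      (((Real.exp (-u) * u ^ a : ℝ) : ℂ) * ((u : ℂ) + 2 * ρ) ^ ((b - 1 : ℝ) : ℂ)))
    (bound := fun u => 2 * |b| * B u) hs
    (Eventually.of_forall fun ρ => (measurable_besselIntegrand a b ρ).aestronglyMeasurable)
    (integrableOn_besselIntegrand ha b hρ)
    ((measurable_besselIntegrand a (b - 1) ρ).const_mul _).aestronglyMeasurable ?_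
    (hB.const_mul _) ?_
  · have h2 := key.2
    rw [integral_const_mul] at h2
    exact h2
  · filter_upwards [ae_restrict_mem measurableSet_Ioi] with u hu ρ hρ
    rw [norm_mul]
    gcongr
    · rw [norm_mul, Complex.norm_real]; simp
    · exact hle ρ hρ u hu
  · filter_upwards [ae_restrict_mem measurableSet_Ioi] with u hu ρ hρ
    have h1 : HasDerivAt (fun ρ : ℂ => (u : ℂ) + 2 * ρ) 2 ρ := by
      simpa using ((hasDerivAt_id ρ).const_mul 2).const_add (u : ℂ)
    have h2 := (h1.cpow_const (c := (b : ℂ))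
      (add_two_mul_mem_slitPlane (le_of_lt hu) (hsl hρ))).const_mul
        ((Real.exp (-u) * u ^ a : ℝ) : ℂ)
    refine h2.congr_deriv ?_
    push_cast
    ring

/-- Integration by parts in `besselInt`. -/
theorem besselInt_self {a : ℝ} (ha : 1 ≤ a) {ρ : ℂ} (hρ : ρ ∈ Complex.slitPlane) :
    besselInt a a ρ = 2 * a * besselInt a (a - 1) ρ + 2 * a * ρ * besselInt (a - 1) (a - 1) ρ := by
  have hI := integrableOn_besselIntegrand (a := a) (by linarith) a hρ
  have hI1 := integrableOn_besselIntegrand (a := a) (by linarith) (a - 1) hρ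
  have hI2 := integrableOn_besselIntegrand (a := a - 1) (by linarith) (a - 1) hρ
  set f : ℝ → ℂ := fun u : ℝ => ((Real.exp (-u) * u ^ a : ℝ) : ℂ) * ((u : ℂ) + 2 * ρ) ^ (a : ℂ)
    with hf
  set f1 : ℝ → ℂ := fun u : ℝ =>
    ((Real.exp (-u) * u ^ a : ℝ) : ℂ) * ((u : ℂ) + 2 * ρ) ^ ((a - 1 : ℝ) : ℂ) with hf1
  set f2 : ℝ → ℂ := fun u : ℝ =>
    ((Real.exp (-u) * u ^ (a - 1) : ℝ) : ℂ) * ((u : ℂ) + 2 * ρ) ^ ((a - 1 : ℝ) : ℂ) with hf2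
  -- The product rule gives `a u^{a-1} (u+2ρ)^{a-1} ((u+2ρ) + u)`, and `(u+2ρ) + u = 2u + 2ρ`
  -- produces the two integrals on the right. The integral of `f'` vanishes because `f` is zero at
  -- both ends.
  have hd : ∀ u ∈ Ioi (0 : ℝ), HasDerivAt f (2 * a * f1 u + 2 * a * ρ * f2 u - f u) u := by
    intro u hu
    have hu0 : (0 : ℝ) < u := hu
    have hsl := add_two_mul_mem_slitPlane hu0.le hρ
    have h1 : HasDerivAt (fun u : ℝ => (u : ℂ) + 2 * ρ) 1 u :=
      (Complex.ofRealCLM.hasDerivAt (x := u)).add_const _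
    have h2 : HasDerivAt (fun z : ℂ => z ^ (a : ℂ)) ((a : ℂ) * ((u : ℂ) + 2 * ρ) ^ ((a : ℂ) - 1))
        ((u : ℂ) + 2 * ρ) := by
      simpa using (hasDerivAt_id _).cpow_const hsl
    have h3 := h2.comp u h1
    have h4 : HasDerivAt (fun u : ℝ => Real.exp (-u) * u ^ a)
        (-Real.exp (-u) * u ^ a + Real.exp (-u) * (a * u ^ (a - 1))) u := by
      have := ((hasDerivAt_id u).neg.exp).mul (Real.hasDerivAt_rpow_const (p := a) (Or.inl hu0.ne'))
      exact this.congr_deriv (by simp)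
    have h5 := h4.ofReal_comp.mul h3
    refine h5.congr_deriv ?_
    have e1 : ((u : ℂ) + 2 * ρ) ^ (a : ℂ) =
        ((u : ℂ) + 2 * ρ) ^ ((a - 1 : ℝ) : ℂ) * ((u : ℂ) + 2 * ρ) := by
      have hne : (u : ℂ) + 2 * ρ ≠ 0 := Complex.slitPlane_ne_zero hsl
      push_cast
      rw [Complex.cpow_sub _ _ hne, Complex.cpow_one]
      field_simp
    have e2 : u ^ a = u ^ (a - 1) * u := by
      rw [Real.rpow_sub_one hu0.ne']; field_simp
    simp only [hf, hf1, hf2, e1, e2, Function.comp]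
    push_cast
    ring
  have hInt : IntegrableOn (fun u => 2 * a * f1 u + 2 * a * ρ * f2 u - f u) (Ioi 0) :=
    ((hI1.const_mul _).add (hI2.const_mul _)).sub hI
  have hlim := tendsto_zero_of_hasDerivAt_of_integrableOn_Ioi hd hInt hI
  have hcont : ContinuousWithinAt f (Ici 0) 0 := by
    have h1 : ContinuousAt (fun u : ℝ => ((u : ℂ) + 2 * ρ) ^ (a : ℂ)) 0 := by
      refine ContinuousAt.cpow (by fun_prop) continuousAt_const ?_
      exact add_two_mul_mem_slitPlane le_rfl hρ
    have h2 : ContinuousAt (fun u : ℝ => ((Real.exp (-u) * u ^ a : ℝ) : ℂ)) 0 := by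
      refine Complex.continuous_ofReal.continuousAt.comp ?_
      exact (by fun_prop : ContinuousAt (fun u : ℝ => Real.exp (-u)) 0).mul
        (Real.continuousAt_rpow_const _ _ (Or.inr (by linarith)))
    exact (h2.mul h1).continuousWithinAt
  have key := integral_Ioi_of_hasDerivAt_of_tendsto hcont hd hInt hlim
  rw [integral_sub (f := fun u => 2 * a * f1 u + 2 * a * ρ * f2 u)
      ((hI1.const_mul _).add (hI2.const_mul _)) hI,
    integral_add (hI1.const_mul _) (hI2.const_mul _), integral_const_mul, integral_const_mul] at key
  have hf0 : f 0 = 0 := by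
    simp [hf, Real.zero_rpow (by linarith : a ≠ 0)]
  rw [hf0, sub_zero, sub_eq_zero] at key
  exact key.symm

theorem hasDerivAt_besselE {a : ℝ} (ha : 0 ≤ a) {ρ : ℂ} (hρ : ρ ∈ Complex.slitPlane) :
    HasDerivAt (besselE a)
      (Complex.exp (-ρ) * (2 * a * besselInt a (a - 1) ρ - besselInt a a ρ)) ρ := by
  have h1 : HasDerivAt (fun ρ : ℂ => Complex.exp (-ρ)) (-Complex.exp (-ρ)) ρ := by
    simpa using (hasDerivAt_id ρ).neg.cexp
  refine (h1.mul (hasDerivAt_besselInt (by linarith) a hρ)).congr_deriv ?_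
  ring

/-- The lowering relation for the modified Bessel functions. -/
theorem hasDerivAt_besselE_of_one_le {a : ℝ} (ha : 1 ≤ a) {ρ : ℂ} (hρ : ρ ∈ Complex.slitPlane) :
    HasDerivAt (besselE a) (-(2 * a * ρ * besselE (a - 1) ρ)) ρ := by
  refine (hasDerivAt_besselE (by linarith) hρ).congr_deriv ?_
  rw [besselInt_self ha hρ, besselE]
  ring

/-- Growth of the modified Bessel functions at infinity. -/
theorem exists_norm_besselE_le {a : ℝ} (ha : 0 ≤ a) : ∃ C : ℝ, 0 ≤ C ∧ ∀ ρ : ℂ,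
    1 / 2 ≤ ‖ρ‖ → ‖besselE a ρ‖ ≤ C * ‖ρ‖ ^ a * Real.exp (-ρ.re) := by
  have hInt := integrableOn_exp_rpow_mul_rpow (a := a) (b := a) (M := 1) (by linarith) ha
    zero_le_one
  refine ⟨2 ^ a * ∫ u in Ioi (0 : ℝ), Real.exp (-u) * u ^ a * (u + 1) ^ a,
    mul_nonneg (by positivity) (setIntegral_nonneg measurableSet_Ioi fun u hu => by
      have : (0 : ℝ) < u := hu
      positivity), fun ρ hρ => ?_⟩
  rw [besselE, norm_mul, Complex.norm_exp, Complex.neg_re, mul_comm]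
  gcongr
  rw [mul_right_comm, ← integral_const_mul]
  refine norm_integral_le_of_norm_le (hInt.const_mul _) ?_
  filter_upwards [ae_restrict_mem measurableSet_Ioi] with u hu
  have hu0 : (0 : ℝ) < u := hu
  rw [norm_besselIntegrand hu0]
  -- This is where `‖ρ‖ ≥ 1/2` enters: it gives `u ≤ 2‖ρ‖u`, so the power of `‖ρ‖` factors out of
  -- the integral.
  have h1 : ‖(u : ℂ) + 2 * ρ‖ ≤ 2 * ‖ρ‖ * (u + 1) := by
    calc ‖(u : ℂ) + 2 * ρ‖ ≤ ‖(u : ℂ)‖ + ‖2 * ρ‖ := norm_add_le _ _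
      _ = u + 2 * ‖ρ‖ := by rw [norm_mul, Complex.norm_real, Real.norm_of_nonneg hu0.le]; norm_num
      _ ≤ _ := by nlinarith
  have h2 := Real.rpow_le_rpow (norm_nonneg _) h1 ha
  rw [Real.mul_rpow (by positivity) (by positivity),
    Real.mul_rpow (by positivity) (by positivity)] at h2
  have h3 : 0 ≤ Real.exp (-u) * u ^ a := by positivity
  nlinarith [mul_le_mul_of_nonneg_left h2 h3]

/-- In the sector `cos arg ρ ≥ -4/5`, completing the square gives `‖u + ρ‖² ≥ (3u/5)² + (4u/5 -
‖ρ‖)²`. -/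
theorem besselSector_norm_le {u : ℝ} (hu : 0 ≤ u) {ρ : ℂ} (hρ : -(4 * ‖ρ‖) ≤ 5 * ρ.re) :
    3 / 5 * u ≤ ‖(u : ℂ) + ρ‖ := by
  refine le_of_sq_le_sq ?_ (norm_nonneg _)
  have h1 : ‖(u : ℂ) + ρ‖ ^ 2 = u ^ 2 + 2 * u * ρ.re + ‖ρ‖ ^ 2 := by
    rw [← Complex.normSq_eq_norm_sq, ← Complex.normSq_eq_norm_sq, Complex.normSq_apply,
      Complex.normSq_apply]
    simp
    ring
  rw [h1]
  nlinarith [sq_nonneg (4 / 5 * u - ‖ρ‖), mul_le_mul_of_nonneg_left hρ hu]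

/-- Behaviour of the modified Bessel functions at the origin. -/
theorem exists_norm_besselE_sub_le {a : ℝ} (ha : a = 0 ∨ 1 / 2 ≤ a) : ∃ C : ℝ, 0 ≤ C ∧ ∀ ρ : ℂ,
    ρ ∈ Complex.slitPlane → -(4 * ‖ρ‖) ≤ 5 * ρ.re → ‖ρ‖ ≤ 2 →
      ‖besselE a ρ - Real.Gamma (2 * a + 1)‖ ≤ C * ‖ρ‖ := by
  have ha0 : 0 ≤ a := by rcases ha with h | h <;> linarith
  -- the value at the origin
  set I0 : ℂ := ∫ u in Ioi (0 : ℝ), ((Real.exp (-u) * u ^ a : ℝ) : ℂ) * (u : ℂ) ^ (a : ℂ) with hI0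
  have hint0 : IntegrableOn (fun u : ℝ => ((Real.exp (-u) * u ^ a : ℝ) : ℂ) * (u : ℂ) ^ (a : ℂ))
      (Ioi 0) := by
    have h0 : IntegrableOn (fun u : ℝ => ((Real.exp (-u) * u ^ a * (u + 0) ^ a : ℝ) : ℂ))
        (Ioi 0) := (integrableOn_exp_rpow_mul_rpow (by linarith) ha0 le_rfl).ofReal
    refine h0.congr_fun ?_ measurableSet_Ioi
    intro u hu
    have hu0 : (0 : ℝ) < u := hu
    simp only [add_zero]
    rw [← Complex.ofReal_cpow hu0.le]
    push_cast
    rfl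
  have hG : I0 = Real.Gamma (2 * a + 1) := by
    rw [hI0, Real.Gamma_eq_integral (by linarith), ← integral_complex_ofReal]
    refine setIntegral_congr_fun measurableSet_Ioi fun u hu => ?_
    have hu0 : (0 : ℝ) < u := hu
    rw [← Complex.ofReal_cpow hu0.le, ← Complex.ofReal_mul, mul_assoc, ← Real.rpow_add hu0]
    congr 3
    ring
  -- the difference of the integrands
  obtain ⟨B, hB, hB0, hBle⟩ : ∃ B : ℝ → ℝ, IntegrableOn B (Ioi 0) ∧ (∀ u, 0 < u → 0 ≤ B u) ∧
      ∀ u : ℝ, 0 < u → ∀ ρ : ℂ, ρ ∈ Complex.slitPlane → -(4 * ‖ρ‖) ≤ 5 * ρ.re → ‖ρ‖ ≤ 2 →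
        Real.exp (-u) * u ^ a * ‖((u : ℂ) + 2 * ρ) ^ (a : ℂ) - (u : ℂ) ^ (a : ℂ)‖ ≤
          ‖ρ‖ * B u := by
    -- For `a = 0` the integrands coincide. Otherwise the mean value inequality along `t ↦ tρ` is
    -- used; the power `a - 1` may be negative, and the sector keeps `‖u + 2tρ‖ ≥ 3u/5`, so that the
    -- worst term `u^{2a-1}` is integrable at `0`.
    rcases ha with rfl | ha
    · exact ⟨0, integrableOn_zero, by simp, by simp⟩
    refine ⟨fun u => 2 * a * ((3 / 5) ^ (a - 1) * (Real.exp (-u) * u ^ (2 * a - 1)) +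
      Real.exp (-u) * u ^ a * (u + 4) ^ |a - 1|), ?_, ?_, ?_⟩
    · exact (((integrableOn_exp_rpow (by linarith)).const_mul _).add
        (integrableOn_exp_rpow_mul_rpow (by linarith) (abs_nonneg _) (by norm_num))).const_mul _
    · intro u hu; positivity
    intro u hu ρ hρ hsec hρ2
    have hmem : ∀ t ∈ Icc (0 : ℝ) 1, (u : ℂ) + 2 * (t * ρ) ∈ Complex.slitPlane := by
      intro t ht
      have := add_two_mul_mem_slitPlane (ρ := ρ) (u := 0) le_rfl hρ
      rw [Complex.mem_slitPlane_iff] at hρ ⊢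
      simp only [Complex.add_re, Complex.ofReal_re, Complex.mul_re, Complex.re_ofNat,
        Complex.im_ofNat, zero_mul, sub_zero, Complex.add_im, Complex.ofReal_im, Complex.mul_im,
        add_zero, zero_add]
      rcases ht.1.eq_or_lt with h | h
      · left; rw [← h]; simpa using hu
      rcases hρ with h' | h'
      · left; have := mul_pos h h'; linarith
      · right; simp [h.ne', h']
    set D : ℝ := a * (((3 / 5) * u) ^ (a - 1) + (u + 4) ^ |a - 1|) with hD
    have key : ‖((u : ℂ) + 2 * ((1 : ℝ) * ρ)) ^ (a : ℂ) - ((u : ℂ) + 2 * ((0 : ℝ) * ρ)) ^ (a : ℂ)‖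
        ≤ (2 * ‖ρ‖ * D) * (1 - 0) := by
      refine norm_image_sub_le_of_norm_deriv_le_segment' (f := fun t : ℝ =>
        ((u : ℂ) + 2 * (t * ρ)) ^ (a : ℂ))
        (f' := fun t : ℝ => (a : ℂ) * ((u : ℂ) + 2 * (t * ρ)) ^ ((a : ℂ) - 1) * (2 * ρ))
        (fun t ht => ?_) (fun t ht => ?_) 1 (right_mem_Icc.2 zero_le_one)
      · have h1 : HasDerivAt (fun t : ℝ => (u : ℂ) + 2 * (t * ρ)) (2 * ρ) t := by
          have := (((Complex.ofRealCLM.hasDerivAt (x := t)).mul_const ρ).const_mul 2).const_add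
            (u : ℂ)
          simpa using this
        have h2 : HasDerivAt (fun z : ℂ => z ^ (a : ℂ))
            ((a : ℂ) * ((u : ℂ) + 2 * (t * ρ)) ^ ((a : ℂ) - 1)) ((u : ℂ) + 2 * (t * ρ)) := by
          simpa using (hasDerivAt_id _).cpow_const (hmem t ht)
        exact (h2.comp t h1).hasDerivWithinAt
      · have ht' : t ∈ Icc (0 : ℝ) 1 := ⟨ht.1, ht.2.le⟩
        have e1 : ((a : ℂ) - 1) = ((a - 1 : ℝ) : ℂ) := by push_cast; ring
        rw [e1, norm_mul, norm_mul, norm_mul, Complex.norm_cpow_real, Complex.norm_real,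
          Real.norm_of_nonneg ha0]
        have hlow : 3 / 5 * u ≤ ‖(u : ℂ) + 2 * (t * ρ)‖ := by
          have e2 : (2 : ℂ) * (t * ρ) = ((2 * t : ℝ) : ℂ) * ρ := by push_cast; ring
          rw [e2]
          refine besselSector_norm_le hu.le ?_
          rw [norm_mul, Complex.norm_real, Real.norm_of_nonneg (by linarith [ht.1]),
            Complex.re_ofReal_mul]
          nlinarith [mul_le_mul_of_nonneg_left hsec ht.1]
        have hup : ‖(u : ℂ) + 2 * (t * ρ)‖ ≤ u + 4 := by
          refine (norm_add_le _ _).trans ?_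
          rw [norm_mul, norm_mul, Complex.norm_real, Complex.norm_real, Real.norm_of_nonneg hu.le,
            Real.norm_of_nonneg ht.1, Complex.norm_ofNat]
          nlinarith [mul_le_mul ht.2.le hρ2 (norm_nonneg ρ) zero_le_one]
        have h3 := rpow_le_add_rpow_abs (b := a - 1) (by positivity) hlow hup
        rw [Complex.norm_ofNat]
        calc a * ‖(u : ℂ) + 2 * (t * ρ)‖ ^ (a - 1) * (2 * ‖ρ‖)
            ≤ a * (((3 / 5) * u) ^ (a - 1) + (u + 4) ^ |a - 1|) * (2 * ‖ρ‖) := by gcongr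
          _ = _ := by rw [hD]; ring
    simp only [Complex.ofReal_one, one_mul, Complex.ofReal_zero, zero_mul, mul_zero, add_zero,
      sub_zero, mul_one] at key
    calc _ ≤ Real.exp (-u) * u ^ a * (2 * ‖ρ‖ * D) := by gcongr
      _ = _ := by
        rw [hD, Real.mul_rpow (by norm_num) hu.le]
        have : u ^ (2 * a - 1) = u ^ a * u ^ (a - 1) := by
          rw [← Real.rpow_add hu]; congr 1; ring
        beta_reduce
        rw [this]
        ring
  have hK : 0 ≤ ∫ u in Ioi (0 : ℝ), B u :=
    setIntegral_nonneg measurableSet_Ioi fun u hu => hB0 u hu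
  refine ⟨Real.exp 2 * (∫ u in Ioi (0 : ℝ), B u) + Real.exp 2 * ‖I0‖, by positivity,
    fun ρ hρ hsec hρ2 => ?_⟩
  have h1 : ‖besselInt a a ρ - I0‖ ≤ ‖ρ‖ * ∫ u in Ioi (0 : ℝ), B u := by
    rw [hI0, besselInt, ← integral_sub (integrableOn_besselIntegrand (by linarith) a hρ) hint0,
      ← integral_const_mul]
    refine norm_integral_le_of_norm_le (hB.const_mul _) ?_
    filter_upwards [ae_restrict_mem measurableSet_Ioi] with u hu
    have hu0 : (0 : ℝ) < u := hu
    rw [← mul_sub, norm_mul, Complex.norm_real, Real.norm_of_nonneg (by positivity)]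
    exact hBle u hu ρ hρ hsec hρ2
  have h2 : ‖Complex.exp (-ρ)‖ ≤ Real.exp 2 := by
    rw [Complex.norm_exp]
    refine Real.exp_le_exp.2 ?_
    have := (Complex.abs_re_le_norm ρ)
    rw [abs_le] at this
    simp only [Complex.neg_re]
    linarith
  have h3 : ‖Complex.exp (-ρ) - 1‖ ≤ Real.exp 2 * ‖ρ‖ := by
    have h4 := Complex.norm_exp_sub_sum_le_norm_mul_exp (-ρ) 1
    simp only [Finset.range_one, Finset.sum_singleton, pow_zero, Nat.factorial_zero, Nat.cast_one,
      div_one, pow_one, norm_neg] at h4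
    refine h4.trans ?_
    rw [mul_comm]
    gcongr
  rw [← hG, besselE]
  calc ‖Complex.exp (-ρ) * besselInt a a ρ - I0‖
      = ‖Complex.exp (-ρ) * (besselInt a a ρ - I0) + (Complex.exp (-ρ) - 1) * I0‖ := by
        congr 1; ring
    _ ≤ ‖Complex.exp (-ρ)‖ * ‖besselInt a a ρ - I0‖ + ‖Complex.exp (-ρ) - 1‖ * ‖I0‖ := by
        refine (norm_add_le _ _).trans ?_
        rw [norm_mul, norm_mul]
    _ ≤ Real.exp 2 * (‖ρ‖ * ∫ u in Ioi (0 : ℝ), B u) + Real.exp 2 * ‖ρ‖ * ‖I0‖ := by gcongr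
    _ = _ := by ring

end HigherSchrodinger

namespace HigherSchrodinger

/-! ### The kernel of the free resolvent as a function of the spectral parameter -/

/-- The numbers `κ` of modulus one in the closed right half plane with `(-κ²)^m = 1`. -/
noncomputable def unitRoot (m l : ℕ) : ℂ :=
  -Complex.I * Complex.exp (((Real.pi * l / m : ℝ) : ℂ) * Complex.I)

/-- An open cone around the positive half line. -/
def cone : Set ℂ := {s | |s.im| < s.re}

/-- `∑ (-κ²)^p E_a(κ s)` over the numbers `κ = unitRoot m l`. -/
noncomputable def rootSum (m : ℕ) (a : ℝ) (p : ℕ) (s : ℂ) : ℂ :=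
  ∑ l ∈ Finset.range m, (-(unitRoot m l) ^ 2) ^ p * besselE a (unitRoot m l * s)

theorem norm_unitRoot (m l : ℕ) : ‖unitRoot m l‖ = 1 := by
  rw [unitRoot, norm_mul, Complex.norm_exp_ofReal_mul_I]; simp

theorem unitRoot_re (m l : ℕ) : (unitRoot m l).re = Real.sin (Real.pi * l / m) := by
  rw [unitRoot, Complex.mul_re, Complex.exp_ofReal_mul_I_re, Complex.exp_ofReal_mul_I_im]
  simp

theorem unitRoot_re_nonneg {m l : ℕ} (hl : l < m) : 0 ≤ (unitRoot m l).re := by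
  rw [unitRoot_re]
  have hm : (0 : ℝ) < m := by exact_mod_cast (Nat.zero_le _).trans_lt hl
  refine Real.sin_nonneg_of_nonneg_of_le_pi (by positivity) ?_
  rw [div_le_iff₀ hm]
  have : (l : ℝ) ≤ m := by exact_mod_cast hl.le
  exact mul_le_mul_of_nonneg_left this Real.pi_pos.le

/-- The factor `-i` in `unitRoot` makes `-κ²` run through all `m`-th roots of unity, which are the
poles required by the partial fractions of `1/(t^m - w^m)`. -/
theorem neg_unitRoot_sq (m l : ℕ) :
    -(unitRoot m l) ^ 2 = Complex.exp (2 * Real.pi * Complex.I / m) ^ l := by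
  rw [unitRoot, mul_pow, neg_sq, Complex.I_sq, ← Complex.exp_nat_mul, ← Complex.exp_nat_mul]
  rw [neg_mul, one_mul, neg_neg]
  congr 1
  push_cast
  ring

theorem neg_unitRoot_sq_pow {m : ℕ} (hm : m ≠ 0) (l : ℕ) : (-(unitRoot m l) ^ 2) ^ m = 1 := by
  rw [neg_unitRoot_sq, ← pow_mul, mul_comm l, pow_mul, (Complex.isPrimitiveRoot_exp m hm).pow_eq_one,
    one_pow]

/-- A geometric sum with ratio `ζ^p ≠ 1` whose `m`-th power is `1`. All cancellation in the
resolvent kernel comes from here. -/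
theorem sum_neg_unitRoot_sq_pow {m p : ℕ} (hp : 0 < p) (hpm : p < m) :
    ∑ l ∈ Finset.range m, (-(unitRoot m l) ^ 2) ^ p = 0 := by
  have hζ := Complex.isPrimitiveRoot_exp m (by omega)
  set ζ := Complex.exp (2 * Real.pi * Complex.I / m)
  have h1 : ∀ l ∈ Finset.range m, (-(unitRoot m l) ^ 2) ^ p = (ζ ^ p) ^ l := fun l _ => by
    rw [neg_unitRoot_sq, ← pow_mul, mul_comm l, pow_mul]
  rw [Finset.sum_congr rfl h1]
  have h2 := mul_neg_geom_sum (ζ ^ p) m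
  rw [← pow_mul, mul_comm p, pow_mul, hζ.pow_eq_one, one_pow, sub_self] at h2
  refine (mul_eq_zero.1 h2).resolve_left fun h => ?_
  exact hζ.pow_ne_one_of_pos_of_lt hp.ne' hpm (sub_eq_zero.1 h).symm

theorem isOpen_cone : IsOpen cone :=
  isOpen_lt (by fun_prop) (by fun_prop)

theorem smul_mem_cone {t : ℝ} (ht : 0 < t) {s : ℂ} (hs : s ∈ cone) : (t : ℂ) * s ∈ cone := by
  simp only [cone, mem_ofPred_eq, Complex.re_ofReal_mul, Complex.im_ofReal_mul, abs_mul,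
    abs_of_pos ht] at hs ⊢
  gcongr

theorem cone_ne_zero {s : ℂ} (hs : s ∈ cone) : s ≠ 0 := by
  rintro rfl
  simp [cone] at hs

/-- The argument of `κ` is at most `π/2` in modulus and that of `s` is below `π/4`, so their sum
stays away from `π`. -/
theorem mul_mem_slitPlane_of_mem_cone {κ s : ℂ} (h1 : ‖κ‖ = 1) (hκ : 0 ≤ κ.re) (hs : s ∈ cone) :
    κ * s ∈ Complex.slitPlane := by
  have hs' : |s.im| < s.re := hs
  rw [Complex.mem_slitPlane_iff, Complex.mul_re, Complex.mul_im]
  by_contra! h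
  obtain ⟨h2, h3⟩ := h
  obtain ⟨h4, h5⟩ := abs_lt.1 hs'
  have hx : 0 < s.re := (abs_nonneg _).trans_lt hs'
  rcases hκ.eq_or_lt with h0 | h0
  · rw [← h0] at h3 h2
    have : κ.im = 0 := by
      simpa [hx.ne'] using h3
    have : κ = 0 := Complex.ext h0.symm this
    simp [this] at h1
  · have h6 : κ.re * s.re ^ 2 + κ.re * s.im ^ 2 ≤ 0 := by
      have e1 : κ.im * s.re = -(κ.re * s.im) := by linarith
      have := mul_nonpos_of_nonpos_of_nonneg h2 hx.le
      nlinarith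
    have : 0 < κ.re * s.re ^ 2 := by positivity
    have : 0 ≤ κ.re * s.im ^ 2 := by positivity
    linarith

/-- As the argument of `κs` is below `3π/4` in modulus, its cosine exceeds `-1/√2 > -4/5`. -/
theorem mul_mem_sector_of_mem_cone {κ s : ℂ} (h1 : ‖κ‖ = 1) (hκ : 0 ≤ κ.re) (hs : s ∈ cone) :
    -(4 * ‖κ * s‖) ≤ 5 * (κ * s).re := by
  have hs' : |s.im| < s.re := hs
  rw [norm_mul, h1, one_mul, Complex.mul_re]
  have hx : 0 < s.re := (abs_nonneg _).trans_lt hs'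
  have h2 : |κ.im| ≤ 1 := (Complex.abs_im_le_norm κ).trans_eq h1
  have h3 : κ.im * s.im ≤ |s.im| := by
    calc κ.im * s.im ≤ |κ.im * s.im| := le_abs_self _
      _ = |κ.im| * |s.im| := abs_mul _ _
      _ ≤ _ := mul_le_of_le_one_left (abs_nonneg _) h2
  have h4 : 5 * |s.im| ≤ 4 * ‖s‖ := by
    refine le_of_sq_le_sq ?_ (by positivity)
    rw [mul_pow, mul_pow, ← Complex.normSq_eq_norm_sq, Complex.normSq_apply]
    nlinarith [abs_nonneg s.im, sq_abs s.im]
  nlinarith [mul_nonneg hκ hx.le]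

/-- The lowering relation trades one unit of the Bessel order for one more factor `-κ²`. Integrated
from the origin, this gains two powers of `s` at each stage of the induction on the order of
vanishing. -/
theorem hasDerivAt_rootSum {m : ℕ} {a : ℝ} (ha : 1 ≤ a) (p : ℕ) {s : ℂ} (hs : s ∈ cone) :
    HasDerivAt (rootSum m a p) (2 * a * s * rootSum m (a - 1) (p + 1) s) s := by
  have h : ∀ l ∈ Finset.range m, HasDerivAt
      (fun s => (-(unitRoot m l) ^ 2) ^ p * besselE a (unitRoot m l * s))
      (2 * a * s * ((-(unitRoot m l) ^ 2) ^ (p + 1) * besselE (a - 1) (unitRoot m l * s))) s := by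
    intro l hl
    have hmem := mul_mem_slitPlane_of_mem_cone (norm_unitRoot m l)
      (unitRoot_re_nonneg (Finset.mem_range.1 hl)) hs
    have h1 : HasDerivAt (fun s => unitRoot m l * s) (unitRoot m l) s := by
      simpa using (hasDerivAt_id s).const_mul (unitRoot m l)
    refine (((hasDerivAt_besselE_of_one_le ha hmem).comp s h1).const_mul _).congr_deriv ?_
    ring
  have := HasDerivAt.fun_sum h
  rw [rootSum, Finset.mul_sum]
  exact this

theorem differentiableOn_rootSum {m : ℕ} {a : ℝ} (ha : 0 ≤ a) (p : ℕ) :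
    DifferentiableOn ℂ (rootSum m a p) cone := by
  intro s hs
  refine DifferentiableAt.differentiableWithinAt ?_
  refine DifferentiableAt.fun_sum fun l hl => DifferentiableAt.const_mul ?_ _
  have hmem := mul_mem_slitPlane_of_mem_cone (norm_unitRoot m l)
    (unitRoot_re_nonneg (Finset.mem_range.1 hl)) hs
  exact (hasDerivAt_besselE ha hmem).differentiableAt.comp s (by fun_prop)

/-- The Taylor coefficients of `rootSum`. -/
noncomputable def rootCoeff (m : ℕ) (a : ℝ) : ℕ → ℝ
  | 0 => m * Real.Gamma (2 * a + 1)
  | k + 1 => rootCoeff m a k * ((a + (k + 1)) / (k + 1))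

theorem exists_norm_rootSum_sub_le (m : ℕ) {a : ℝ} (ha : a = 0 ∨ 1 / 2 ≤ a) (p : ℕ) :
    ∃ C : ℝ, 0 ≤ C ∧ ∀ s ∈ cone, ‖s‖ ≤ 2 →
      ‖rootSum m a p s - (∑ l ∈ Finset.range m, (-(unitRoot m l) ^ 2) ^ p) *
        Real.Gamma (2 * a + 1)‖ ≤ C * ‖s‖ := by
  obtain ⟨C, hC, h⟩ := exists_norm_besselE_sub_le ha
  refine ⟨m * C, by positivity, fun s hs hs2 => ?_⟩
  rw [rootSum, Finset.sum_mul, ← Finset.sum_sub_distrib]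
  refine (norm_sum_le _ _).trans ?_
  have h1 : ∀ l ∈ Finset.range m, ‖(-(unitRoot m l) ^ 2) ^ p * besselE a (unitRoot m l * s) -
      (-(unitRoot m l) ^ 2) ^ p * Real.Gamma (2 * a + 1)‖ ≤ C * ‖s‖ := by
    intro l hl
    have hre := unitRoot_re_nonneg (Finset.mem_range.1 hl)
    have hn := norm_unitRoot m l
    have hns : ‖unitRoot m l * s‖ = ‖s‖ := by rw [norm_mul, hn, one_mul]
    rw [← mul_sub, norm_mul, norm_pow, norm_neg, norm_pow, hn, one_pow, one_pow, one_mul, ← hns]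
    exact h _ (mul_mem_slitPlane_of_mem_cone hn hre hs) (mul_mem_sector_of_mem_cone hn hre hs)
      (hns.trans_le hs2)
  refine (Finset.sum_le_sum h1).trans_eq ?_
  simp [mul_assoc]

/-- The sums `rootSum` vanish at the origin to high order, due to the cancellation between the
roots of unity. -/
theorem exists_norm_rootSum_sub_coeff_le {m : ℕ} {a : ℝ} (ha : a = 0 ∨ 1 / 2 ≤ a) (k : ℕ)
    (hk : k < m) : ∃ C : ℝ, 0 ≤ C ∧ ∀ s ∈ cone, ‖s‖ ≤ 2 →
      ‖rootSum m (a + k) (m - k) s - rootCoeff m a k * s ^ (2 * k)‖ ≤ C * ‖s‖ ^ (2 * k + 1) := by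
  have ha0 : 0 ≤ a := by rcases ha with h | h <;> linarith
  induction k with
  | zero =>
    obtain ⟨C, hC, h⟩ := exists_norm_rootSum_sub_le m ha m
    refine ⟨C, hC, fun s hs hs2 => ?_⟩
    have := h s hs hs2
    -- For `k = 0` the power is `p = m`, and all `m` summands equal one: this is the leading
    -- coefficient.
    rw [Finset.sum_congr rfl fun l _ => neg_unitRoot_sq_pow (by omega) l] at this
    simpa [rootCoeff] using this
  | succ k ih =>
    obtain ⟨C, hC, h⟩ := ih (by omega)
    have hk0 : (0 : ℝ) ≤ k := Nat.cast_nonneg k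
    obtain ⟨C', hC', h'⟩ := exists_norm_rootSum_sub_le m (a := a + (k + 1 : ℕ))
      (Or.inr (by push_cast; linarith)) (m - (k + 1))
    rw [sum_neg_unitRoot_sq_pow (by omega) (by omega)] at h'
    set b : ℝ := a + (k + 1 : ℕ) with hb
    have hb1 : 1 ≤ b := by rw [hb]; push_cast; linarith
    refine ⟨2 * b * C, by positivity, fun s hs hs2 => ?_⟩
    set D : ℂ → ℂ := fun z => rootSum m b (m - (k + 1)) z - rootCoeff m a (k + 1) * z ^ (2 * (k + 1))
      with hD
    -- The recursion in `rootCoeff` is the identity `2 b c_k = 2 (k+1) c_{k+1}` with `b = a + k +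
    -- 1`, so the monomials satisfy the same relation as the sums.
    have hderiv : ∀ z ∈ cone, HasDerivAt D
        (2 * b * z * (rootSum m (a + k) (m - k) z - rootCoeff m a k * z ^ (2 * k))) z := by
      intro z hz
      have h1 := (hasDerivAt_rootSum (m := m) hb1 (m - (k + 1)) hz).sub
        ((hasDerivAt_pow (2 * (k + 1)) z).const_mul (rootCoeff m a (k + 1) : ℂ))
      have e1 : b - 1 = a + k := by rw [hb]; push_cast; ring
      have e2 : m - (k + 1) + 1 = m - k := by omega
      have e3 : 2 * (k + 1) - 1 = 2 * k + 1 := by omega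
      rw [e1, e2, e3] at h1
      refine h1.congr_deriv ?_
      have hk1 : (k : ℂ) + 1 ≠ 0 := by exact_mod_cast Nat.succ_ne_zero k
      simp only [rootCoeff, hb]
      push_cast
      field_simp
      ring
    have hbound : ∀ t ∈ Ioc (0 : ℝ) 1, ‖D s - D (t * s)‖ ≤ 2 * b * C * ‖s‖ ^ (2 * (k + 1) + 1) := by
      intro t ht
      have hseg : ∀ τ ∈ Icc t 1, HasDerivWithinAt (fun τ : ℝ => D (τ * s))
          (2 * b * (τ * s) * (rootSum m (a + k) (m - k) (τ * s) -
            rootCoeff m a k * (τ * s) ^ (2 * k)) * s) (Icc t 1) τ := by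
        intro τ hτ
        have h1 : HasDerivAt (fun τ : ℝ => (τ : ℂ) * s) s τ := by
          simpa using (Complex.ofRealCLM.hasDerivAt (x := τ)).mul_const s
        exact ((hderiv _ (smul_mem_cone (ht.1.trans_le hτ.1) hs)).comp τ h1).hasDerivWithinAt
      have key := norm_image_sub_le_of_norm_deriv_le_segment' hseg
        (C := 2 * b * C * ‖s‖ ^ (2 * (k + 1) + 1)) (fun τ hτ => ?_) 1 (right_mem_Icc.2 ht.2)
      · simp only [Complex.ofReal_one, one_mul] at key
        refine key.trans (mul_le_of_le_one_right (by positivity) (by linarith [ht.1]))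
      · have hτ0 : 0 < τ := ht.1.trans_le hτ.1
        have hn : ‖(τ : ℂ) * s‖ ≤ ‖s‖ := by
          rw [norm_mul, Complex.norm_real, Real.norm_of_nonneg hτ0.le]
          exact mul_le_of_le_one_left (norm_nonneg _) hτ.2.le
        have h2 := h _ (smul_mem_cone hτ0 hs) (hn.trans hs2)
        rw [norm_mul, norm_mul, norm_mul, norm_mul, Complex.norm_ofNat, Complex.norm_real,
          Real.norm_of_nonneg (by linarith)]
        calc 2 * b * ‖(τ : ℂ) * s‖ * _ * ‖s‖
            ≤ 2 * b * ‖s‖ * (C * ‖s‖ ^ (2 * k + 1)) * ‖s‖ := by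
              gcongr
              refine h2.trans ?_
              gcongr
          _ = _ := by ring
    -- The constant of integration is zero: the value at the origin is a multiple of `∑ (-κ²)^p`
    -- with `0 < p < m`.
    have hlim : Tendsto (fun t : ℝ => D (t * s)) (𝓝[>] 0) (𝓝 0) := by
      have hc : Tendsto (fun t : ℝ => C' * ‖(t : ℂ) * s‖ +
          ‖(rootCoeff m a (k + 1) : ℂ) * ((t : ℂ) * s) ^ (2 * (k + 1))‖) (𝓝[>] 0) (𝓝 0) := by
        have : ContinuousAt (fun t : ℝ => C' * ‖(t : ℂ) * s‖ +
          ‖(rootCoeff m a (k + 1) : ℂ) * ((t : ℂ) * s) ^ (2 * (k + 1))‖) 0 := by fun_prop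
        have h0 := this.tendsto.mono_left (nhdsWithin_le_nhds (s := Ioi 0))
        simpa using h0
      refine squeeze_zero_norm' ?_ hc
      filter_upwards [Ioo_mem_nhdsGT (zero_lt_one' ℝ)] with t ht
      have hn : ‖(t : ℂ) * s‖ ≤ ‖s‖ := by
        rw [norm_mul, Complex.norm_real, Real.norm_of_nonneg ht.1.le]
        exact mul_le_of_le_one_left (norm_nonneg _) ht.2.le
      have h2 := h' _ (smul_mem_cone ht.1 hs) (hn.trans hs2)
      rw [zero_mul, sub_zero] at h2
      exact (norm_sub_le _ _).trans (by gcongr)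
    have hfin := (tendsto_const_nhds (x := D s)).sub hlim |>.norm
    rw [sub_zero] at hfin
    refine le_of_tendsto hfin ?_
    filter_upwards [Ioo_mem_nhdsGT (zero_lt_one' ℝ)] with t ht
    exact hbound t ⟨ht.1, ht.2.le⟩

/-- The normalising constant of the free resolvent kernel in dimension `n`. -/
noncomputable def kernelConst (n : ℕ) : ℝ :=
  (2 * Real.pi) ^ (-(n : ℝ) / 2) * 2 ^ (1 - (n : ℝ) / 2) * Real.sqrt Real.pi /
    Real.Gamma (((n : ℝ) - 1) / 2)

/-- The profile `F` of the resolvent kernel: `R₀⁺(λ^{2m})(x) = |x|^{2m-n} F(λ |x|)`. -/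
noncomputable def profile (n m : ℕ) (s : ℂ) : ℂ :=
  kernelConst n / m * (s ^ (2 * (m - 1)))⁻¹ * rootSum m (((n : ℝ) - 3) / 2) 1 s

/-- The value of `profile` at the origin. -/
noncomputable def profileZero (n m : ℕ) : ℝ :=
  kernelConst n / m * rootCoeff m (((n : ℝ) - 2 * m - 1) / 2) (m - 1)

variable {n m : ℕ}

theorem differentiableOn_profile (hm : 1 ≤ m) (hn : 2 * m < n) :
    DifferentiableOn ℂ (profile n m) cone := by
  have hn3 : (3 : ℝ) ≤ n := by exact_mod_cast (by omega : 3 ≤ n)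
  have h1 := differentiableOn_rootSum (m := m) (a := ((n : ℝ) - 3) / 2) (by linarith) 1
  have h2 : DifferentiableOn ℂ (fun s : ℂ => (s ^ (2 * (m - 1)))⁻¹) cone := by
    intro s hs
    refine DifferentiableAt.differentiableWithinAt ?_
    exact DifferentiableAt.fun_inv (by fun_prop) (pow_ne_zero _ (cone_ne_zero hs))
  exact (h2.const_mul (kernelConst n / m : ℂ)).mul h1

/-- This is the last stage `k = m - 1` of the cancellation, starting from the order `(n-2m-1)/2`.
The condition `2m < n` makes this order either `0` or at least `1/2`, and the factor `s^{-2(m-1)}`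
is exactly compensated. -/
theorem exists_norm_profile_sub_le (hm : 1 ≤ m) (hn : 2 * m < n) :
    ∃ C : ℝ, 0 ≤ C ∧ ∀ s ∈ cone, ‖s‖ ≤ 2 → ‖profile n m s - profileZero n m‖ ≤ C * ‖s‖ := by
  have ha : ((n : ℝ) - 2 * m - 1) / 2 = 0 ∨ 1 / 2 ≤ ((n : ℝ) - 2 * m - 1) / 2 := by
    rcases (show 2 * m + 1 ≤ n from hn).eq_or_lt with h | h
    · left; rw [← h]; push_cast; ring
    · right
      have : (2 * m + 2 : ℝ) ≤ n := by exact_mod_cast (by omega : 2 * m + 2 ≤ n)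
      linarith
  obtain ⟨C, hC, h⟩ := exists_norm_rootSum_sub_coeff_le (m := m) ha (m - 1) (by omega)
  have e1 : ((n : ℝ) - 2 * m - 1) / 2 + ((m - 1 : ℕ) : ℝ) = ((n : ℝ) - 3) / 2 := by
    rw [Nat.cast_sub hm]; push_cast; ring
  have e2 : m - (m - 1) = 1 := by omega
  rw [e1, e2] at h
  refine ⟨|kernelConst n / m| * C, by positivity, fun s hs hs2 => ?_⟩
  have hs0 := cone_ne_zero hs
  have e3 : profile n m s - profileZero n m = ((kernelConst n / m : ℝ) : ℂ) *
      ((s ^ (2 * (m - 1)))⁻¹ * (rootSum m (((n : ℝ) - 3) / 2) 1 s -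
        rootCoeff m (((n : ℝ) - 2 * m - 1) / 2) (m - 1) * s ^ (2 * (m - 1)))) := by
    have : s ^ (2 * (m - 1)) ≠ 0 := pow_ne_zero _ hs0
    rw [profile, profileZero]
    push_cast
    field_simp
  rw [e3, norm_mul, norm_mul, Complex.norm_real, Real.norm_eq_abs, mul_assoc]
  refine mul_le_mul_of_nonneg_left ?_ (abs_nonneg _)
  rw [norm_inv, norm_pow, inv_mul_le_iff₀ (pow_pos (norm_pos_iff.2 hs0) _)]
  refine (h s hs hs2).trans_eq ?_
  ring

/-- In the strip `|Im s| ≤ 1` one has `Re(κs) ≥ -1`, so the exponentials are bounded and only powers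
count: `(n-3)/2 - 2(m-1) = (n+1)/2 - 2m`. -/
theorem exists_norm_profile_le (hm : 1 ≤ m) (hn : 2 * m < n) :
    ∃ C : ℝ, 0 ≤ C ∧ ∀ s ∈ cone, 1 / 2 ≤ ‖s‖ → |s.im| ≤ 1 →
      ‖profile n m s‖ ≤ C * ‖s‖ ^ (((n : ℝ) + 1) / 2 - 2 * m) := by
  have hn3 : (3 : ℝ) ≤ n := by exact_mod_cast (by omega : 3 ≤ n)
  obtain ⟨C, hC, h⟩ := exists_norm_besselE_le (a := ((n : ℝ) - 3) / 2) (by linarith)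
  refine ⟨|kernelConst n / m| * (m * (C * Real.exp 1)), by positivity, fun s hs hs1 him => ?_⟩
  have hs0 : 0 < ‖s‖ := norm_pos_iff.2 (cone_ne_zero hs)
  have hx : 0 < s.re := (abs_nonneg _).trans_lt hs
  have h1 : ‖rootSum m (((n : ℝ) - 3) / 2) 1 s‖ ≤
      m * (C * Real.exp 1) * ‖s‖ ^ (((n : ℝ) - 3) / 2) := by
    refine (norm_sum_le _ _).trans ?_
    have h2 : ∀ l ∈ Finset.range m, ‖(-(unitRoot m l) ^ 2) ^ 1 *
        besselE (((n : ℝ) - 3) / 2) (unitRoot m l * s)‖ ≤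
          C * Real.exp 1 * ‖s‖ ^ (((n : ℝ) - 3) / 2) := by
      intro l hl
      have hre := unitRoot_re_nonneg (Finset.mem_range.1 hl)
      have hn1 := norm_unitRoot m l
      have hns : ‖unitRoot m l * s‖ = ‖s‖ := by rw [norm_mul, hn1, one_mul]
      rw [norm_mul, norm_pow, norm_neg, norm_pow, hn1, one_pow, one_pow, one_mul]
      have h3 := h (unitRoot m l * s) (by rw [hns]; exact hs1)
      rw [hns] at h3
      refine h3.trans ?_
      rw [mul_right_comm]
      gcongr
      rw [Complex.mul_re]
      have h4 : |(unitRoot m l).im| ≤ 1 := (Complex.abs_im_le_norm _).trans_eq hn1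
      have h5 : (unitRoot m l).im * s.im ≤ 1 := by
        calc (unitRoot m l).im * s.im ≤ |(unitRoot m l).im * s.im| := le_abs_self _
          _ = |(unitRoot m l).im| * |s.im| := abs_mul _ _
          _ ≤ 1 * 1 := by gcongr
          _ = 1 := one_mul 1
      nlinarith [mul_nonneg hre hx.le]
    refine (Finset.sum_le_sum h2).trans_eq ?_
    simp [mul_assoc]
  have e : ((kernelConst n : ℂ) / m) = ((kernelConst n / m : ℝ) : ℂ) := by push_cast; rfl
  rw [profile, norm_mul, norm_mul, e, Complex.norm_real, Real.norm_eq_abs, norm_inv, norm_pow]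
  have e2 : ‖s‖ ^ (((n : ℝ) + 1) / 2 - 2 * m) =
      (‖s‖ ^ (2 * (m - 1)))⁻¹ * ‖s‖ ^ (((n : ℝ) - 3) / 2) := by
    rw [← Real.rpow_natCast, ← Real.rpow_neg hs0.le, ← Real.rpow_add hs0]
    congr 1
    push_cast [Nat.cast_sub hm]
    ring
  rw [e2]
  calc _ ≤ |kernelConst n / m| * (‖s‖ ^ (2 * (m - 1)))⁻¹ *
        (m * (C * Real.exp 1) * ‖s‖ ^ (((n : ℝ) - 3) / 2)) := by gcongr
    _ = _ := by ring

end HigherSchrodinger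

/-! ### Symbol bounds in `λ` for the free kernel. -/

namespace HigherSchrodinger

/-- `f` has `N` continuous derivatives on `(0, L)`, with `λ^{j-e} ‖f⁽ʲ⁾(λ)‖ ≤ C` for `j ≤ N`
(truncated subtraction). -/
def SymB {X : Type*} [NormedAddCommGroup X] [NormedSpace ℝ X] (e N : ℕ) (L C : ℝ) (f : ℝ → X) :
    Prop :=
  ContDiffOn ℝ N f (Ioo 0 L) ∧ ∀ j ≤ N, ∀ lam ∈ Ioo 0 L, lam ^ (j - e) * ‖iteratedDeriv j f lam‖ ≤ C

theorem analyticAt_of_isOpen {U : Set ℂ} (hU : IsOpen U) {f : ℂ → ℂ} (hf : DifferentiableOn ℂ f U)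
    {z : ℂ} (hz : z ∈ U) : AnalyticAt ℂ f z :=
  hf.analyticAt (hU.mem_nhds hz)

theorem iteratedDeriv_comp_ofReal {U : Set ℂ} (hU : IsOpen U) {f : ℂ → ℂ}
    (hf : DifferentiableOn ℂ f U) (j : ℕ) {t : ℝ} (ht : (t : ℂ) ∈ U) :
    iteratedDeriv j (fun t : ℝ => f t) t = iteratedDeriv j f t := by
  induction j generalizing t with
  | zero => simp
  | succ j ih =>
    rw [iteratedDeriv_succ, iteratedDeriv_succ]
    have h1 : iteratedDeriv j (fun t : ℝ => f t) =ᶠ[𝓝 t] fun t : ℝ => iteratedDeriv j f t := by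
      have : ∀ᶠ s : ℝ in 𝓝 t, (s : ℂ) ∈ U :=
        Complex.continuous_ofReal.continuousAt.eventually (hU.mem_nhds ht)
      filter_upwards [this] with s hs using ih hs
    rw [h1.deriv_eq]
    have h2 : DifferentiableAt ℂ (iteratedDeriv j f) t := by
      rw [iteratedDeriv_eq_iterate]
      exact ((analyticAt_of_isOpen hU hf ht).iterated_deriv j).differentiableAt
    exact h2.hasDerivAt.comp_ofReal.deriv

theorem contDiffOn_comp_ofReal {U : Set ℂ} (hU : IsOpen U) {f : ℂ → ℂ}
    (hf : DifferentiableOn ℂ f U) {s : Set ℝ} (hs : ∀ t ∈ s, (t : ℂ) ∈ U) (N : ℕ) :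
    ContDiffOn ℝ N (fun t : ℝ => f t) s := by
  intro t ht
  have h1 : ContDiffAt ℝ N f t :=
    (analyticAt_of_isOpen hU hf (hs t ht)).contDiffAt.restrict_scalars ℝ
  exact (h1.comp t Complex.ofRealCLM.contDiff.contDiffAt).contDiffWithinAt

theorem rpow_le_of_mem_Icc {x y c d e : ℝ} (hc : 0 < c) (hx : 0 < x) (h1 : c * x ≤ y)
    (h2 : y ≤ d * x) : y ^ e ≤ (c ^ e + d ^ e) * x ^ e := by
  have hd : 0 < d := by
    by_contra! h
    have := mul_nonpos_of_nonpos_of_nonneg h hx.le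
    have := mul_pos hc hx
    linarith
  rw [add_mul, ← Real.mul_rpow hc.le hx.le, ← Real.mul_rpow hd.le hx.le]
  rcases le_total 0 e with h | h
  · have := Real.rpow_le_rpow ((mul_pos hc hx).le.trans h1) h2 h
    have : 0 ≤ (c * x) ^ e := by positivity
    linarith
  · have := Real.rpow_le_rpow_of_nonpos (mul_pos hc hx) h1 h
    have : 0 ≤ (d * x) ^ e := by positivity
    linarith

theorem mem_cone_of_dist_le {t ρ : ℝ} {z : ℂ} (h : ‖z - t‖ ≤ ρ) (hρ : 2 * ρ < t) : z ∈ cone := by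
  have h1 := (Complex.abs_re_le_norm (z - t)).trans h
  have h2 := (Complex.abs_im_le_norm (z - t)).trans h
  simp only [Complex.sub_re, Complex.ofReal_re, Complex.sub_im, Complex.ofReal_im, sub_zero] at h1 h2
  rw [abs_le] at h1
  simp only [cone, mem_ofPred_eq]
  linarith [h1.1]

variable {n m : ℕ}

/-- The kernel of `R₀⁺(λ^{2m})` as a function of `λ` and the distance `r`. -/
noncomputable def freeKernel (n m : ℕ) (lam r : ℝ) : ℂ :=
  (((r ^ (n - 2 * m))⁻¹ : ℝ) : ℂ) * profile n m ((lam : ℂ) * r)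

/-- The excess growth `⌈n/2⌉ + 1 - (n-1)/2` of the derivatives of the resolvent kernel. -/
noncomputable def growth (n : ℕ) : ℝ := numDeriv n - ((n : ℝ) - 1) / 2

theorem growth_nonneg (n : ℕ) : 0 ≤ growth n := by
  have : (n : ℝ) / 2 ≤ ⌈(n : ℝ) / 2⌉₊ := Nat.le_ceil _
  rw [growth, numDeriv]
  push_cast
  linarith

/-- Cauchy's estimates for the resolvent kernel, `λ r ≤ 1`. -/
theorem exists_freeKernel_small (hm : 1 ≤ m) (hn : 2 * m < n) (N : ℕ) : ∃ C : ℝ, 0 ≤ C ∧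
    ∀ r : ℝ, 0 < r → ∀ lam : ℝ, 0 < lam → lam * r ≤ 1 → ∀ j ≤ N,
      lam ^ (j - 1) * ‖iteratedDeriv j (fun z : ℂ => (((r ^ (n - 2 * m))⁻¹ : ℝ) : ℂ) *
        profile n m (z * r)) lam‖ ≤ C * (1 + (r ^ (n - 2 * m))⁻¹) := by
  obtain ⟨C, hC, h⟩ := exists_norm_profile_sub_le hm hn
  have hdiff := differentiableOn_profile hm hn
  refine ⟨(|profileZero n m| + 2 * C) * (N.factorial * 4 ^ N), by positivity,
    fun r hr lam hlam hlr j hj => ?_⟩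
  set A : ℝ := (r ^ (n - 2 * m))⁻¹ with hA
  have hA0 : 0 < A := by positivity
  set q : ℂ → ℂ := fun z : ℂ => (A : ℂ) * profile n m (z * r) with hq
  have hfac : (1 : ℝ) ≤ N.factorial * 4 ^ N := by
    have h1 : (1 : ℝ) ≤ N.factorial := by exact_mod_cast N.factorial_pos
    have h2 : (1 : ℝ) ≤ 4 ^ N := one_le_pow₀ (by norm_num)
    nlinarith
  have hrn : ‖(r : ℂ)‖ = r := by rw [Complex.norm_real, Real.norm_of_nonneg hr.le]
  -- the estimate for `q - q(0)`
  have hest : ∀ z : ℂ, ‖z - lam‖ ≤ lam / 4 → z * r ∈ cone ∧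
      ‖q z - A * profileZero n m‖ ≤ A * (C * (5 / 4 * lam * r)) := by
    intro z hz
    have hzc : z ∈ cone := mem_cone_of_dist_le hz (by linarith)
    have hzr : z * r ∈ cone := by rw [mul_comm]; exact smul_mem_cone hr hzc
    have hzn : ‖z‖ ≤ 5 / 4 * lam := by
      have := norm_add_le (z - lam) lam
      rw [sub_add_cancel, Complex.norm_real, Real.norm_of_nonneg hlam.le] at this
      linarith
    have hn2 : ‖z * r‖ ≤ 5 / 4 * lam * r := by
      rw [norm_mul, hrn]; gcongr
    refine ⟨hzr, ?_⟩
    rw [hq]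
    beta_reduce
    rw [← mul_sub, norm_mul, Complex.norm_real, Real.norm_of_nonneg hA0.le]
    gcongr
    exact (h _ hzr (by nlinarith)).trans (by gcongr)
  rcases j with _ | j
  · have h1 := (hest lam (by simpa using (by linarith : 0 ≤ lam / 4))).2
    simp only [zero_tsub, pow_zero, one_mul, iteratedDeriv_zero]
    have h2 : ‖q lam‖ ≤ A * |profileZero n m| + A * (2 * C) := by
      have h3 := norm_add_le (q lam - A * profileZero n m) (A * profileZero n m)
      rw [sub_add_cancel, norm_mul (A : ℂ) (profileZero n m : ℂ), Complex.norm_real,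
        Complex.norm_real, Real.norm_of_nonneg hA0.le, Real.norm_eq_abs] at h3
      have h4 : A * (C * (5 / 4 * lam * r)) ≤ A * (2 * C) := by
        have : C * (5 / 4 * (lam * r)) ≤ C * 2 := by gcongr; linarith
        have := mul_le_mul_of_nonneg_left this hA0.le
        nlinarith
      linarith
    calc ‖q lam‖ ≤ (|profileZero n m| + 2 * C) * 1 * A := by linarith
      _ ≤ (|profileZero n m| + 2 * C) * (N.factorial * 4 ^ N) * (1 + A) := by gcongr; linarith
  -- For `j ≥ 1` the constant `q(0)` may be subtracted before Cauchy's estimate on the disc of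
  -- radius `λ/4`. The bound then carries a factor `λr`, which saves one power of `λ`: hence
  -- `λ^{j-1}` and not `λ^j`.
  · have hdq : DiffContOnCl ℂ (fun z => q z - A * profileZero n m)
        (Metric.ball (lam : ℂ) (lam / 4)) := by
      refine DifferentiableOn.diffContOnCl (s := Metric.ball (lam : ℂ) (lam / 4)) ?_
      intro z hz
      have hz' := Metric.closure_ball_subset_closedBall hz
      rw [Metric.mem_closedBall, dist_eq_norm] at hz'
      refine DifferentiableAt.differentiableWithinAt ?_
      refine DifferentiableAt.sub_const (DifferentiableAt.const_mul ?_ _) _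
      exact (hdiff.differentiableAt (isOpen_cone.mem_nhds (hest z hz').1)).comp z
        (by fun_prop : DifferentiableAt ℂ (fun z => z * (r : ℂ)) z)
    have hcau := Complex.norm_iteratedDeriv_le_of_forall_mem_sphere_norm_le (j + 1)
      (by positivity : 0 < lam / 4) hdq fun z hz => (hest z (by
        rw [mem_sphere_iff_norm] at hz; exact hz.le)).2
    rw [iteratedDeriv_succ', show deriv (fun z => q z - A * profileZero n m) = deriv q from
      funext fun z => deriv_sub_const _, ← iteratedDeriv_succ'] at hcau
    -- The factor `r` left over is harmless for `r ≥ 1` because `n - 2m ≥ 1`.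
    have hrA : r * A ≤ 1 + A := by
      rcases le_total r 1 with h1 | h1
      · nlinarith
      · have h2 : r ≤ r ^ (n - 2 * m) := le_self_pow₀ h1 (by omega)
        have : r * A ≤ 1 := by
          rw [hA, ← div_eq_mul_inv, div_le_one (by positivity)]; exact h2
        linarith
    have hf1 : ((j + 1).factorial : ℝ) ≤ N.factorial := by exact_mod_cast Nat.factorial_le hj
    have hf2 : (4 : ℝ) ^ (j + 1) ≤ 4 ^ N := pow_le_pow_right₀ (by norm_num) hj
    calc lam ^ (j + 1 - 1) * ‖iteratedDeriv (j + 1) q lam‖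
        ≤ lam ^ j * ((j + 1).factorial * (A * (C * (5 / 4 * lam * r))) / (lam / 4) ^ (j + 1)) := by
          rw [Nat.add_sub_cancel]; gcongr
      _ = 5 / 4 * C * ((j + 1).factorial * 4 ^ (j + 1)) * (r * A) := by
          rw [div_pow]
          field_simp
          ring
      _ ≤ (|profileZero n m| + 2 * C) * (N.factorial * 4 ^ N) * (1 + A) := by
          gcongr
          have := abs_nonneg (profileZero n m)
          linarith

/-- Cauchy's estimates for the resolvent kernel, `λ r ≥ 1`. -/
theorem exists_freeKernel_large (hm : 1 ≤ m) (hn : 2 * m < n) : ∃ C : ℝ, 0 ≤ C ∧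
    ∀ r : ℝ, 0 < r → ∀ lam : ℝ, 0 < lam → lam < 1 → 1 ≤ lam * r → ∀ j ≤ numDeriv n,
      lam ^ (j - 1) * ‖iteratedDeriv j (fun z : ℂ => (((r ^ (n - 2 * m))⁻¹ : ℝ) : ℂ) *
        profile n m (z * r)) lam‖ ≤ C * (1 + r ^ growth n) := by
  obtain ⟨C, hC, h⟩ := exists_norm_profile_le hm hn
  have hdiff := differentiableOn_profile hm hn
  set N := numDeriv n with hN
  set e : ℝ := ((n : ℝ) + 1) / 2 - 2 * m with he
  set c : ℝ := (3 / 4) ^ e + (5 / 4) ^ e with hc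
  have hc0 : 0 ≤ c := by positivity
  refine ⟨C * c * (N.factorial * 4 ^ N), by positivity, fun r hr lam hlam hlam1 hlr j hj => ?_⟩
  have hr1 : 1 ≤ r := by nlinarith
  set A : ℝ := (r ^ (n - 2 * m))⁻¹ with hA
  have hA0 : 0 < A := by positivity
  have hrn : ‖(r : ℂ)‖ = r := by rw [Complex.norm_real, Real.norm_of_nonneg hr.le]
  set q : ℂ → ℂ := fun z : ℂ => (A : ℂ) * profile n m (z * r) with hq
  -- The kernel oscillates in `λ` at frequency `r`. On discs of radius `1/(4r)` the variable `zr`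
  -- stays within `1/4` of the real point `λr ≥ 1`, so the exponentials do not grow.
  have hest : ∀ z : ℂ, ‖z - lam‖ ≤ (4 * r)⁻¹ → z * r ∈ cone ∧
      ‖q z‖ ≤ A * (C * (c * (lam * r) ^ e)) := by
    intro z hz
    have hd : ‖z * r - (lam * r : ℝ)‖ ≤ 1 / 4 := by
      have : z * r - (lam * r : ℝ) = (z - lam) * r := by push_cast; ring
      rw [this, norm_mul, hrn]
      calc ‖z - lam‖ * r ≤ (4 * r)⁻¹ * r := by gcongr
        _ = 1 / 4 := by field_simp
    have hzr : z * r ∈ cone := mem_cone_of_dist_le hd (by linarith)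
    have hlow : 3 / 4 * (lam * r) ≤ ‖z * r‖ := by
      have h1 := norm_sub_norm_le ((lam * r : ℝ) : ℂ) (z * r)
      rw [norm_sub_rev, Complex.norm_real, Real.norm_of_nonneg (by positivity)] at h1
      linarith
    have hup : ‖z * r‖ ≤ 5 / 4 * (lam * r) := by
      have h1 := norm_add_le (z * r - (lam * r : ℝ)) ((lam * r : ℝ) : ℂ)
      rw [sub_add_cancel, Complex.norm_real, Real.norm_of_nonneg (by positivity)] at h1
      linarith
    refine ⟨hzr, ?_⟩
    rw [hq]
    beta_reduce
    rw [norm_mul, Complex.norm_real, Real.norm_of_nonneg hA0.le]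
    gcongr
    refine (h _ hzr (by linarith) ?_).trans ?_
    · have := (Complex.abs_im_le_norm _).trans hd
      simp only [Complex.sub_im, Complex.ofReal_im, sub_zero] at this
      linarith
    · gcongr
      exact rpow_le_of_mem_Icc (by norm_num) (by positivity) hlow hup
  have hdq : DiffContOnCl ℂ q (Metric.ball (lam : ℂ) (4 * r)⁻¹) := by
    refine DifferentiableOn.diffContOnCl (s := Metric.ball (lam : ℂ) (4 * r)⁻¹) ?_
    intro z hz
    have hz' := Metric.closure_ball_subset_closedBall hz
    rw [Metric.mem_closedBall, dist_eq_norm] at hz'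
    refine DifferentiableAt.differentiableWithinAt (DifferentiableAt.const_mul ?_ _)
    exact (hdiff.differentiableAt (isOpen_cone.mem_nhds (hest z hz').1)).comp z
      (by fun_prop : DifferentiableAt ℂ (fun z => z * (r : ℂ)) z)
  have hcau := Complex.norm_iteratedDeriv_le_of_forall_mem_sphere_norm_le j
    (by positivity : 0 < (4 * r)⁻¹) hdq fun z hz => (hest z (by
      rw [mem_sphere_iff_norm] at hz; exact hz.le)).2
  have hf1 : (j.factorial : ℝ) ≤ N.factorial := by exact_mod_cast Nat.factorial_le hj
  have hf2 : (4 : ℝ) ^ j ≤ 4 ^ N := pow_le_pow_right₀ (by norm_num) hj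
  -- Each `λ` is paired with an `r`. Since `1 ≤ λr ≤ r`, the power of `λr` is at most `1` or at most
  -- the same power of `r`; in the second case the exponent of `r` is `j + e - (n - 2m) = j -
  -- (n-1)/2 ≤ growth n`.
  have hmain : lam ^ (j - 1) * (A * (lam * r) ^ e * r ^ j) ≤ 1 + r ^ growth n := by
    have hlr' : lam * r ≤ r := by nlinarith
    have e1 : lam ^ (j - 1) * (A * (lam * r) ^ e * r ^ j) =
        A * r ^ (j - (j - 1)) * (lam * r) ^ (((j - 1 : ℕ) : ℝ) + e) := by
      rw [Real.rpow_add (by positivity), Real.rpow_natCast, mul_pow]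
      have : r ^ j = r ^ (j - (j - 1)) * r ^ (j - 1) := by rw [← pow_add]; congr 1; omega
      rw [this]
      ring
    have e2 : (lam * r) ^ (((j - 1 : ℕ) : ℝ) + e) ≤ 1 + r ^ (((j - 1 : ℕ) : ℝ) + e) := by
      rcases le_total 0 (((j - 1 : ℕ) : ℝ) + e) with h0 | h0
      · have := Real.rpow_le_rpow (by positivity) hlr' h0
        linarith
      · have := Real.rpow_le_one_of_one_le_of_nonpos hlr h0
        have : 0 ≤ r ^ (((j - 1 : ℕ) : ℝ) + e) := by positivity
        linarith
    have e3 : A * r ^ (j - (j - 1)) ≤ 1 := by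
      rw [hA, inv_mul_le_iff₀ (by positivity), mul_one]
      exact pow_le_pow_right₀ hr1 (by omega)
    have e4 : A * r ^ (j - (j - 1)) * r ^ (((j - 1 : ℕ) : ℝ) + e) ≤ r ^ growth n := by
      rw [hA, ← Real.rpow_natCast, ← Real.rpow_natCast, ← Real.rpow_neg hr.le, ← Real.rpow_add hr,
        ← Real.rpow_add hr]
      refine Real.rpow_le_rpow_of_exponent_le hr1 ?_
      have h1 : ((j - (j - 1) : ℕ) : ℝ) + ((j - 1 : ℕ) : ℝ) = j := by
        rw [← Nat.cast_add]; congr 1; omega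
      have h2 : ((n - 2 * m : ℕ) : ℝ) = n - 2 * m := by
        rw [Nat.cast_sub hn.le]; push_cast; ring
      have h3 : (j : ℝ) ≤ N := by exact_mod_cast hj
      rw [growth, h2]
      linarith
    rw [e1]
    calc _ ≤ A * r ^ (j - (j - 1)) * (1 + r ^ (((j - 1 : ℕ) : ℝ) + e)) := by gcongr
      _ = A * r ^ (j - (j - 1)) + A * r ^ (j - (j - 1)) * r ^ (((j - 1 : ℕ) : ℝ) + e) := by ring
      _ ≤ _ := add_le_add e3 e4
  calc lam ^ (j - 1) * ‖iteratedDeriv j q lam‖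
      ≤ lam ^ (j - 1) * (j.factorial * (A * (C * (c * (lam * r) ^ e))) / (4 * r)⁻¹ ^ j) := by
        gcongr
    _ = C * c * (j.factorial * 4 ^ j) * (lam ^ (j - 1) * (A * (lam * r) ^ e * r ^ j)) := by
        rw [inv_pow, div_inv_eq_mul, mul_pow]; ring
    _ ≤ C * c * (N.factorial * 4 ^ N) * (1 + r ^ growth n) := by
        gcongr

/-- The resolvent kernel and its derivatives in `λ`. -/
theorem exists_symB_freeKernel (hm : 1 ≤ m) (hn : 2 * m < n) : ∃ C : ℝ, 0 ≤ C ∧ ∀ r : ℝ, 0 ≤ r →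
    SymB 1 (numDeriv n) 1 (C * (1 + (r ^ (n - 2 * m))⁻¹ + r ^ growth n))
      (fun lam => freeKernel n m lam r) := by
  obtain ⟨C1, hC1, h1⟩ := exists_freeKernel_small hm hn (numDeriv n)
  obtain ⟨C2, hC2, h2⟩ := exists_freeKernel_large hm hn
  refine ⟨C1 + C2, by positivity, fun r hr => ?_⟩
  rcases hr.eq_or_lt with rfl | hr
  -- With `0⁻¹ = 0` and `n - 2m ≠ 0` the kernel vanishes on the diagonal, so the bounds hold at
  -- every `r ≥ 0`.
  · have hz : (fun lam => freeKernel n m lam 0) = fun _ => 0 := by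
      funext lam
      simp [freeKernel, zero_pow (by omega : n - 2 * m ≠ 0)]
    rw [hz]
    refine ⟨contDiffOn_const, fun j _ lam hlam => ?_⟩
    rw [iteratedDeriv_fun_const_zero, norm_zero, mul_zero]
    positivity
  · set q : ℂ → ℂ := fun z : ℂ => (((r ^ (n - 2 * m))⁻¹ : ℝ) : ℂ) * profile n m (z * r) with hq
    have hd : DifferentiableOn ℂ q cone := by
      intro z hz
      have hzr : z * r ∈ cone := by rw [mul_comm]; exact smul_mem_cone hr hz
      refine DifferentiableAt.differentiableWithinAt (DifferentiableAt.const_mul ?_ _)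
      exact ((differentiableOn_profile hm hn).differentiableAt (isOpen_cone.mem_nhds hzr)).comp z
        (by fun_prop : DifferentiableAt ℂ (fun z => z * (r : ℂ)) z)
    have hmem : ∀ lam ∈ Ioo (0 : ℝ) 1, (lam : ℂ) ∈ cone := fun lam hlam => by
      simpa [cone] using hlam.1
    refine ⟨contDiffOn_comp_ofReal isOpen_cone hd hmem _, fun j hj lam hlam => ?_⟩
    have e : iteratedDeriv j (fun lam => freeKernel n m lam r) lam = iteratedDeriv j q lam :=
      iteratedDeriv_comp_ofReal isOpen_cone hd j (hmem lam hlam)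
    rw [e]
    have p1 : 0 ≤ (r ^ (n - 2 * m))⁻¹ := by positivity
    have p2 : 0 ≤ r ^ growth n := by positivity
    rcases le_total (lam * r) 1 with h | h
    · refine (h1 r hr lam hlam.1 h j hj).trans ?_
      nlinarith [mul_nonneg hC1 p2, mul_nonneg hC2 p1, mul_nonneg hC2 p2]
    · refine (h2 r hr lam hlam.1 hlam.2 h j hj).trans ?_
      nlinarith [mul_nonneg hC1 p2, mul_nonneg hC1 p1, mul_nonneg hC2 p1]

theorem continuousOn_profile_ofReal (hm : 1 ≤ m) (hn : 2 * m < n) :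
    ContinuousOn (fun t : ℝ => profile n m t) (Ioi 0) := by
  refine (differentiableOn_profile hm hn).continuousOn.comp Complex.continuous_ofReal.continuousOn ?_
  intro t ht
  have : (0 : ℝ) < t := ht
  simpa [cone] using this

theorem measurable_freeKernel (hm : 1 ≤ m) (hn : 2 * m < n) {lam : ℝ} (hlam : 0 < lam) :
    Measurable fun r : ℝ => freeKernel n m lam |r| := by
  have h1 : Measurable ((Ioi (0 : ℝ)).indicator fun t : ℝ => profile n m t) := by
    rw [← piecewise_eq_indicator]
    exact (continuousOn_profile_ofReal hm hn).measurable_piecewise continuousOn_const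
      measurableSet_Ioi
  have h2 : (fun r : ℝ => freeKernel n m lam |r|) = fun r : ℝ =>
      (((|r| ^ (n - 2 * m))⁻¹ : ℝ) : ℂ) *
        (Ioi (0 : ℝ)).indicator (fun t : ℝ => profile n m t) (lam * |r|) := by
    funext r
    rcases eq_or_ne r 0 with rfl | hr
    · simp [freeKernel, zero_pow (by omega : n - 2 * m ≠ 0)]
    · have : lam * |r| ∈ Ioi (0 : ℝ) := mul_pos hlam (abs_pos.2 hr)
      rw [indicator_of_mem this, freeKernel]
      push_cast
      rfl
  rw [h2]
  have h3 : Measurable fun r : ℝ => (((|r| ^ (n - 2 * m))⁻¹ : ℝ) : ℂ) := by fun_prop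
  exact h3.mul (h1.comp (by fun_prop))

end HigherSchrodinger

namespace HigherSchrodinger

/-! ### Subordination -/

/-- The Cauchy–Schlömilch substitution for the Gauss integral. -/
theorem integral_exp_neg_sub_inv_sq {b : ℝ} (hb : 0 < b) :
    ∫ q in Ioi (0 : ℝ), Real.exp (-b * (q - q⁻¹) ^ 2) = Real.sqrt (Real.pi / b) / 2 := by
  set φ : ℝ → ℝ := fun q => q - q⁻¹ with hφ
  have hderiv : ∀ q ∈ Ioi (0 : ℝ), HasDerivWithinAt φ (1 + (q ^ 2)⁻¹) (Ioi 0) q := by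
    intro q hq
    have h1 := (hasDerivAt_id q).sub (hasDerivAt_inv (ne_of_gt hq))
    exact (h1.congr_deriv (by ring)).hasDerivWithinAt
  have hinj : InjOn φ (Ioi 0) := by
    intro x hx y hy hxy
    have hx0 : (0 : ℝ) < x := hx
    have hy0 : (0 : ℝ) < y := hy
    simp only [hφ] at hxy
    have h1 : (x - y) * (1 + (x * y)⁻¹) = 0 := by
      field_simp at hxy ⊢
      linarith
    have h2 : 1 + (x * y)⁻¹ ≠ 0 := by positivity
    have := (mul_eq_zero.1 h1).resolve_right h2
    linarith
  have himg : φ '' (Ioi 0) = univ := by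
    refine eq_univ_of_forall fun y => ?_
    have hs : |y| < Real.sqrt (y ^ 2 + 4) := by
      rw [← Real.sqrt_sq_eq_abs]
      exact Real.sqrt_lt_sqrt (sq_nonneg y) (by linarith)
    have hpos : 0 < (y + Real.sqrt (y ^ 2 + 4)) / 2 := by
      have := neg_abs_le y
      linarith
    refine ⟨(y + Real.sqrt (y ^ 2 + 4)) / 2, hpos, ?_⟩
    have h4 : Real.sqrt (y ^ 2 + 4) ^ 2 = y ^ 2 + 4 := Real.sq_sqrt (by positivity)
    simp only [hφ]
    rw [sub_eq_iff_eq_add, ← sub_eq_iff_eq_add', ← mul_eq_one_iff_eq_inv₀ hpos.ne']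
    nlinarith
  have hg : Integrable (fun y : ℝ => Real.exp (-b * y ^ 2)) := integrable_exp_neg_mul_sq hb
  have h1 := integral_image_eq_integral_abs_deriv_smul measurableSet_Ioi hderiv hinj
    (fun y : ℝ => Real.exp (-b * y ^ 2))
  have h2 := (integrableOn_image_iff_integrableOn_abs_deriv_smul measurableSet_Ioi hderiv hinj
    (fun y : ℝ => Real.exp (-b * y ^ 2))).1 (by rw [himg]; exact hg.integrableOn)
  rw [himg, setIntegral_univ, integral_gaussian] at h1
  have hJ : IntegrableOn (fun q : ℝ => Real.exp (-b * (q - q⁻¹) ^ 2)) (Ioi 0) := by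
    refine Integrable.mono' h2 (Measurable.aestronglyMeasurable (by fun_prop)) ?_
    filter_upwards [ae_restrict_mem measurableSet_Ioi] with q hq
    have hq0 : (0 : ℝ) < q := hq
    rw [Real.norm_of_nonneg (Real.exp_pos _).le, smul_eq_mul, abs_of_pos (by positivity)]
    exact le_mul_of_one_le_left (Real.exp_pos _).le (by
      have : 0 ≤ (q ^ 2)⁻¹ := by positivity
      linarith)
  -- The inversion `q ↦ 1/q` preserves `(q - 1/q)²`, so the two parts of the Jacobian `1 + q^{-2}`
  -- contribute equally; this is the factor `1/2`.
  have h3 : ∫ q in Ioi (0 : ℝ), (q ^ 2)⁻¹ * Real.exp (-b * (q - q⁻¹) ^ 2) =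
      ∫ q in Ioi (0 : ℝ), Real.exp (-b * (q - q⁻¹) ^ 2) := by
    have h4 := integral_comp_rpow_Ioi (fun q : ℝ => Real.exp (-b * (q - q⁻¹) ^ 2))
      (p := -1) (by norm_num)
    rw [← h4]
    refine setIntegral_congr_fun measurableSet_Ioi fun q hq => ?_
    have hq0 : (0 : ℝ) < q := hq
    have e1 : q ^ (-1 - 1 : ℝ) = (q ^ 2)⁻¹ := by
      rw [← Real.rpow_natCast, ← Real.rpow_neg hq0.le]; norm_num
    simp only [Real.rpow_neg_one, inv_inv, e1, abs_neg, abs_one, one_mul, smul_eq_mul]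
    congr 3
    ring
  have h5 : IntegrableOn (fun q : ℝ => (q ^ 2)⁻¹ * Real.exp (-b * (q - q⁻¹) ^ 2)) (Ioi 0) := by
    refine (h2.sub hJ).congr ?_
    filter_upwards [ae_restrict_mem measurableSet_Ioi] with q hq
    have hq0 : (0 : ℝ) < q := hq
    simp only [Pi.sub_apply, smul_eq_mul]
    rw [abs_of_pos (by positivity)]
    simp only [hφ]
    ring
  have h6 : ∫ q in Ioi (0 : ℝ), |1 + (q ^ 2)⁻¹| • Real.exp (-b * φ q ^ 2) =
      ∫ q in Ioi (0 : ℝ), (Real.exp (-b * (q - q⁻¹) ^ 2) +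
        (q ^ 2)⁻¹ * Real.exp (-b * (q - q⁻¹) ^ 2)) := by
    refine setIntegral_congr_fun measurableSet_Ioi fun q hq => ?_
    have hq0 : (0 : ℝ) < q := hq
    simp only [smul_eq_mul]
    rw [abs_of_pos (by positivity)]
    simp only [hφ]
    ring
  rw [h6, integral_add hJ h5, h3] at h1
  linarith

/-- The exponential function as a superposition of Gaussians. -/
theorem integral_subordination {x : ℝ} (hx : 0 < x) :
    ∫ t in Ioi (0 : ℝ), t ^ (-3 / 2 : ℝ) * Real.exp (-t - x ^ 2 / (4 * t)) =
      2 * Real.sqrt Real.pi * Real.exp (-x) / x := by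
  -- first `t = (x/2) s`, then `s = q^{-2}`
  have h1 := integral_comp_mul_left_Ioi (fun t : ℝ => t ^ (-3 / 2 : ℝ) *
    Real.exp (-t - x ^ 2 / (4 * t))) 0 (by positivity : 0 < x / 2)
  rw [mul_zero] at h1
  have h2 := integral_comp_rpow_Ioi (fun s : ℝ => (x / 2 * s) ^ (-3 / 2 : ℝ) *
    Real.exp (-(x / 2 * s) - x ^ 2 / (4 * (x / 2 * s)))) (p := -2) (by norm_num)
  have h3 : ∫ q in Ioi (0 : ℝ), (|(-2 : ℝ)| * q ^ (-2 - 1 : ℝ)) •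
      ((x / 2 * q ^ (-2 : ℝ)) ^ (-3 / 2 : ℝ) *
        Real.exp (-(x / 2 * q ^ (-2 : ℝ)) - x ^ 2 / (4 * (x / 2 * q ^ (-2 : ℝ))))) =
      (2 * (x / 2) ^ (-3 / 2 : ℝ) * Real.exp (-x)) *
        ∫ q in Ioi (0 : ℝ), Real.exp (-(x / 2) * (q - q⁻¹) ^ 2) := by
    rw [← integral_const_mul]
    refine setIntegral_congr_fun measurableSet_Ioi fun q hq => ?_
    have hq0 : (0 : ℝ) < q := hq
    have e1 : q ^ (-2 : ℝ) = (q ^ 2)⁻¹ := by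
      rw [← Real.rpow_natCast, ← Real.rpow_neg hq0.le]; norm_num
    have e2 : (x / 2 * q ^ (-2 : ℝ)) ^ (-3 / 2 : ℝ) = (x / 2) ^ (-3 / 2 : ℝ) * q ^ (3 : ℝ) := by
      rw [Real.mul_rpow (by positivity) (by positivity), ← Real.rpow_mul hq0.le]; norm_num
    have e3 : q ^ (-2 - 1 : ℝ) = (q ^ (3 : ℝ))⁻¹ := by
      rw [← Real.rpow_neg hq0.le]; norm_num
    rw [e2, e3, e1, smul_eq_mul, abs_neg, abs_two]
    have e4 : -(x / 2 * (q ^ 2)⁻¹) - x ^ 2 / (4 * (x / 2 * (q ^ 2)⁻¹)) =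
        -x + -(x / 2) * (q - q⁻¹) ^ 2 := by
      field_simp
      ring
    rw [e4, Real.exp_add]
    have : q ^ (3 : ℝ) ≠ 0 := by positivity
    field_simp
  rw [h3, integral_exp_neg_sub_inv_sq (by positivity), h1] at h2
  have e5 : (x / 2) ^ (-3 / 2 : ℝ) = (x / 2)⁻¹ * (Real.sqrt (x / 2))⁻¹ := by
    rw [Real.sqrt_eq_rpow, ← Real.rpow_neg_one, ← Real.rpow_neg (by positivity),
      ← Real.rpow_add (by positivity)]
    norm_num
  have e6 : Real.sqrt (Real.pi / (x / 2)) = Real.sqrt Real.pi / Real.sqrt (x / 2) :=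
    Real.sqrt_div Real.pi_pos.le _
  rw [e5, e6, smul_eq_mul] at h2
  have hsq : Real.sqrt (x / 2) * Real.sqrt (x / 2) = x / 2 := Real.mul_self_sqrt (by positivity)
  have h7 : ∫ t in Ioi (0 : ℝ), t ^ (-3 / 2 : ℝ) * Real.exp (-t - x ^ 2 / (4 * t)) =
      (x / 2) * (2 * ((x / 2)⁻¹ * (Real.sqrt (x / 2))⁻¹) * Real.exp (-x) *
        (Real.sqrt Real.pi / Real.sqrt (x / 2) / 2)) := by
    rw [h2, ← mul_assoc, mul_inv_cancel₀ (by positivity), one_mul]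
  rw [h7]
  have h8 : Real.sqrt (x / 2) ≠ 0 := by positivity
  calc _ = Real.exp (-x) * Real.sqrt Real.pi / (Real.sqrt (x / 2) * Real.sqrt (x / 2)) := by
        field_simp
    _ = _ := by rw [hsq]; field_simp

theorem integrableOn_rpow_mul_exp_neg_mul {a b : ℝ} (ha : -1 < a) (hb : 0 < b) :
    IntegrableOn (fun y : ℝ => y ^ a * Real.exp (-b * y)) (Ioi 0) := by
  have := integrableOn_rpow_mul_exp_neg_mul_rpow (p := 1) ha one_pos hb
  simpa using this

/-- The functions `t^c e^{-t-ρ²/(4t)}` are integrable. -/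
theorem integrableOn_rpow_mul_exp_neg_sub_div (c : ℝ) {b ρ : ℝ} (hb : 0 < b) (hρ : 0 < ρ) :
    IntegrableOn (fun t : ℝ => t ^ c * Real.exp (-b * t - ρ / t)) (Ioi 0) := by
  -- The bound `e^{-ρ/t} ≤ k! ρ^{-k} t^k` raises the exponent at the origin to `c + k ≥ 0`.
  obtain ⟨k, hk⟩ := exists_nat_ge (-c)
  have h1 : IntegrableOn (fun t : ℝ => (k.factorial / ρ ^ k) * (t ^ (c + k) * Real.exp (-b * t)))
      (Ioi 0) := (integrableOn_rpow_mul_exp_neg_mul (by linarith) hb).const_mul _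
  refine Integrable.mono' h1 (Measurable.aestronglyMeasurable (by fun_prop)) ?_
  filter_upwards [ae_restrict_mem measurableSet_Ioi] with t ht
  have ht0 : (0 : ℝ) < t := ht
  rw [Real.norm_of_nonneg (by positivity), Real.rpow_add ht0, Real.rpow_natCast, sub_eq_add_neg,
    Real.exp_add]
  have h2 : Real.exp (-(ρ / t)) ≤ k.factorial / ρ ^ k * t ^ k := by
    have h3 := Real.pow_div_factorial_le_exp (ρ / t) (by positivity) k
    rw [Real.exp_neg, inv_le_comm₀ (Real.exp_pos _) (by positivity)]
    refine le_trans (le_of_eq ?_) h3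
    rw [div_pow]
    field_simp
  calc t ^ c * (Real.exp (-b * t) * Real.exp (-(ρ / t)))
      ≤ t ^ c * (Real.exp (-b * t) * (k.factorial / ρ ^ k * t ^ k)) := by gcongr
    _ = _ := by ring

/-- The substitution `y = u (u + 2ρ)`. -/
theorem integral_gauss_shift {a ρ b : ℝ} (ha : 0 ≤ a) (hρ : 0 < ρ) (hb : 0 < b) :
    IntegrableOn (fun u : ℝ => (u + ρ) * (u * (u + 2 * ρ)) ^ a * Real.exp (-b * (u * (u + 2 * ρ))))
      (Ioi 0) ∧
    ∫ u in Ioi (0 : ℝ), (u + ρ) * (u * (u + 2 * ρ)) ^ a * Real.exp (-b * (u * (u + 2 * ρ))) =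
      (1 / b) ^ (a + 1) * Real.Gamma (a + 1) / 2 := by
  set φ : ℝ → ℝ := fun u => u * (u + 2 * ρ) with hφ
  have hderiv : ∀ u ∈ Ioi (0 : ℝ), HasDerivWithinAt φ (2 * (u + ρ)) (Ioi 0) u := by
    intro u _
    have h1 := (hasDerivAt_id u).mul ((hasDerivAt_id u).add_const (2 * ρ))
    exact (h1.congr_deriv (by simp; ring)).hasDerivWithinAt
  have hinj : InjOn φ (Ioi 0) := by
    intro x hx y hy hxy
    have hx0 : (0 : ℝ) < x := hx
    have hy0 : (0 : ℝ) < y := hy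
    simp only [hφ] at hxy
    have h1 : (x - y) * (x + y + 2 * ρ) = 0 := by linarith
    have h2 : x + y + 2 * ρ ≠ 0 := by positivity
    have := (mul_eq_zero.1 h1).resolve_right h2
    linarith
  have himg : φ '' (Ioi 0) = Ioi 0 := by
    refine Subset.antisymm ?_ fun y hy => ?_
    · rintro _ ⟨u, hu, rfl⟩
      have hu0 : (0 : ℝ) < u := hu
      exact mem_Ioi.2 (by simp only [hφ]; positivity)
    · have hy0 : (0 : ℝ) < y := hy
      have h4 : Real.sqrt (ρ ^ 2 + y) ^ 2 = ρ ^ 2 + y := Real.sq_sqrt (by positivity)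
      refine ⟨Real.sqrt (ρ ^ 2 + y) - ρ, ?_, ?_⟩
      · have : ρ < Real.sqrt (ρ ^ 2 + y) := Real.lt_sqrt_of_sq_lt (by linarith)
        exact mem_Ioi.2 (by linarith)
      · simp only [hφ]; nlinarith
  have hgi : IntegrableOn (fun y : ℝ => y ^ a * Real.exp (-b * y)) (φ '' (Ioi 0)) := by
    rw [himg]; exact integrableOn_rpow_mul_exp_neg_mul (by linarith) hb
  have h1 := integral_image_eq_integral_abs_deriv_smul measurableSet_Ioi hderiv hinj
    (fun y : ℝ => y ^ a * Real.exp (-b * y))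
  have h2 := (integrableOn_image_iff_integrableOn_abs_deriv_smul measurableSet_Ioi hderiv hinj
    (fun y : ℝ => y ^ a * Real.exp (-b * y))).1 hgi
  have hG := Real.integral_rpow_mul_exp_neg_mul_Ioi (a := a + 1) (r := b) (by linarith) hb
  simp only [add_sub_cancel_right, ← neg_mul] at hG
  rw [himg, hG] at h1
  have e : ∀ u ∈ Ioi (0 : ℝ), |2 * (u + ρ)| • (φ u ^ a * Real.exp (-b * φ u)) =
      2 * ((u + ρ) * (u * (u + 2 * ρ)) ^ a * Real.exp (-b * (u * (u + 2 * ρ)))) := by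
    intro u hu
    have hu0 : (0 : ℝ) < u := hu
    rw [abs_of_pos (by positivity), smul_eq_mul]
    simp only [hφ]
    ring
  constructor
  · have := (integrableOn_congr_fun e measurableSet_Ioi).1 h2
    refine (this.const_mul (1 / 2)).congr (Eventually.of_forall fun u => ?_)
    beta_reduce
    ring
  · rw [setIntegral_congr_fun measurableSet_Ioi e, integral_const_mul] at h1
    rw [h1]
    ring

/-- The heat representation of the modified Bessel functions. -/
theorem integral_bessel_eq_heat {a ρ : ℝ} (ha : 0 ≤ a) (hρ : 0 < ρ) :
    ∫ u in Ioi (0 : ℝ), Real.exp (-(u + ρ)) * (u * (u + 2 * ρ)) ^ a =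
      4 ^ a * Real.Gamma (a + 1) / Real.sqrt Real.pi *
        ∫ t in Ioi (0 : ℝ), t ^ (a - 1 / 2) * Real.exp (-t - ρ ^ 2 / (4 * t)) := by
  -- A double integral evaluated in both orders. Over `u` first, the substitution `y = u(u+2ρ)`
  -- gives a Gamma integral and leaves the heat integral; over `t` first, subordination at `u + ρ`
  -- gives `e^{-(u+ρ)}`, because `(u+ρ)² = u(u+2ρ) + ρ²`.
  set f : ℝ → ℝ → ℝ := fun u t => ((u + ρ) * (u * (u + 2 * ρ)) ^ a *
    Real.exp (-(1 / (4 * t)) * (u * (u + 2 * ρ)))) *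
      (t ^ (-3 / 2 : ℝ) * Real.exp (-t - ρ ^ 2 / (4 * t))) with hf
  have hmeas : Measurable (Function.uncurry f) := by
    simp only [hf, Function.uncurry_def]
    fun_prop
  have hinner : ∀ t ∈ Ioi (0 : ℝ), ∫ u in Ioi (0 : ℝ), f u t =
      4 ^ (a + 1) * Real.Gamma (a + 1) / 2 *
        (t ^ (a - 1 / 2) * Real.exp (-t - ρ ^ 2 / (4 * t))) := by
    intro t ht
    have ht0 : (0 : ℝ) < t := ht
    simp only [hf]
    rw [integral_mul_const, (integral_gauss_shift ha hρ (by positivity : 0 < 1 / (4 * t))).2,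
      one_div_one_div, Real.mul_rpow (by norm_num) ht0.le]
    have : t ^ (a - 1 / 2) = t ^ (a + 1) * t ^ (-3 / 2 : ℝ) := by
      rw [← Real.rpow_add ht0]; congr 1; ring
    rw [this]
    ring
  have houter : ∀ u ∈ Ioi (0 : ℝ), ∫ t in Ioi (0 : ℝ), f u t =
      2 * Real.sqrt Real.pi * (Real.exp (-(u + ρ)) * (u * (u + 2 * ρ)) ^ a) := by
    intro u hu
    have hu0 : (0 : ℝ) < u := hu
    have h1 : ∀ t ∈ Ioi (0 : ℝ), f u t = ((u + ρ) * (u * (u + 2 * ρ)) ^ a) *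
        (t ^ (-3 / 2 : ℝ) * Real.exp (-t - (u + ρ) ^ 2 / (4 * t))) := by
      intro t ht
      have ht0 : (0 : ℝ) < t := ht
      have e : -t - (u + ρ) ^ 2 / (4 * t) =
          -(1 / (4 * t)) * (u * (u + 2 * ρ)) + (-t - ρ ^ 2 / (4 * t)) := by
        field_simp; ring
      simp only [hf]
      rw [e, Real.exp_add]
      ring
    rw [setIntegral_congr_fun measurableSet_Ioi h1, integral_const_mul,
      integral_subordination (by positivity)]
    field_simp
  have hInt : Integrable (Function.uncurry f)
      ((volume.restrict (Ioi (0 : ℝ))).prod (volume.restrict (Ioi (0 : ℝ)))) := by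
    rw [integrable_prod_iff' hmeas.aestronglyMeasurable]
    constructor
    · filter_upwards [ae_restrict_mem measurableSet_Ioi] with t ht
      have ht0 : (0 : ℝ) < t := ht
      have h0 := (integral_gauss_shift ha hρ (by positivity : 0 < 1 / (4 * t))).1.mul_const
        (t ^ (-3 / 2 : ℝ) * Real.exp (-t - ρ ^ 2 / (4 * t)))
      exact h0
    · have h2 : IntegrableOn (fun t : ℝ => 4 ^ (a + 1) * Real.Gamma (a + 1) / 2 *
          (t ^ (a - 1 / 2) * Real.exp (-t - ρ ^ 2 / (4 * t)))) (Ioi 0) := by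
        refine Integrable.const_mul ?_ _
        refine (integrableOn_rpow_mul_exp_neg_sub_div (a - 1 / 2) one_pos
          (by positivity : 0 < ρ ^ 2 / 4)).congr (Eventually.of_forall fun t => ?_)
        beta_reduce
        congr 3
        · ring
        · rw [div_div]
      refine h2.congr ?_
      filter_upwards [ae_restrict_mem measurableSet_Ioi] with t ht
      have ht0 : (0 : ℝ) < t := ht
      rw [← hinner t ht]
      refine setIntegral_congr_fun measurableSet_Ioi fun u hu => ?_
      have hu0 : (0 : ℝ) < u := hu
      simp only [hf, Function.uncurry_apply_pair]
      rw [Real.norm_of_nonneg (by positivity)]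
  have hswap := integral_integral_swap hInt
  rw [setIntegral_congr_fun measurableSet_Ioi houter, setIntegral_congr_fun measurableSet_Ioi hinner,
    integral_const_mul, integral_const_mul] at hswap
  have hpi : Real.sqrt Real.pi ≠ 0 := by positivity
  rw [Real.rpow_add (by norm_num), Real.rpow_one] at hswap
  rw [div_mul_eq_mul_div, eq_div_iff hpi]
  linarith

end HigherSchrodinger

/-! ### The heat representation for complex spectral parameters. -/

namespace HigherSchrodinger

/-- The integral `∫₀^∞ s^{-ν} exp (-κ (s + r² / 4s)) ds`. -/
noncomputable def heatInt (ν : ℝ) (r : ℝ) (κ : ℂ) : ℂ :=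
  ∫ s in Ioi (0 : ℝ), ((s ^ (-ν) : ℝ) : ℂ) * Complex.exp (-κ * (s + r ^ 2 / (4 * s) : ℝ))

theorem norm_heatIntegrand (ν r : ℝ) (κ : ℂ) {s : ℝ} (hs : 0 < s) :
    ‖((s ^ (-ν) : ℝ) : ℂ) * Complex.exp (-κ * (s + r ^ 2 / (4 * s) : ℝ))‖ =
      s ^ (-ν) * Real.exp (-κ.re * s - κ.re * r ^ 2 / 4 / s) := by
  rw [norm_mul, Complex.norm_exp, Complex.norm_real, Real.norm_of_nonneg (by positivity),
    Complex.re_mul_ofReal, Complex.neg_re]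
  congr 2
  field_simp
  ring

/-- Only holomorphy in the right half plane is needed, for the identity theorem, so the value of the
derivative is not recorded. -/
theorem hasDerivAt_heatInt (ν : ℝ) {r : ℝ} (hr : 0 < r) {κ : ℂ} (hκ : 0 < κ.re) :
    ∃ d, HasDerivAt (heatInt ν r) d κ := by
  set c : ℝ := κ.re / 2 with hc
  have hc0 : 0 < c := by positivity
  set s : Set ℂ := {z | c < z.re} with hs
  have hsn : s ∈ 𝓝 κ := (isOpen_lt continuous_const Complex.continuous_re).mem_nhds
    (by simp only [mem_ofPred_eq, hc]; linarith)
  have hmeas : ∀ z : ℂ, Measurable fun t : ℝ =>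
      ((t ^ (-ν) : ℝ) : ℂ) * Complex.exp (-z * (t + r ^ 2 / (4 * t) : ℝ)) := fun z => by fun_prop
  have hInt : ∀ μ : ℝ, IntegrableOn
      (fun t : ℝ => t ^ μ * Real.exp (-c * t - c * r ^ 2 / 4 / t)) (Ioi 0) := fun μ =>
    integrableOn_rpow_mul_exp_neg_sub_div μ hc0 (by positivity)
  have hB : IntegrableOn (fun t : ℝ => (t + r ^ 2 / (4 * t)) *
      (t ^ (-ν) * Real.exp (-c * t - c * r ^ 2 / 4 / t))) (Ioi 0) := by
    refine ((hInt (1 - ν)).add ((hInt (-1 - ν)).const_mul (r ^ 2 / 4))).congr ?_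
    filter_upwards [ae_restrict_mem measurableSet_Ioi] with t ht
    have ht0 : (0 : ℝ) < t := ht
    simp only [Pi.add_apply]
    rw [show (1 - ν) = 1 + -ν by ring, show (-1 - ν) = -1 + -ν by ring, Real.rpow_add ht0,
      Real.rpow_add ht0, Real.rpow_one, Real.rpow_neg_one]
    field_simp
  have hle : ∀ z ∈ s, ∀ t : ℝ, 0 < t →
      ‖((t ^ (-ν) : ℝ) : ℂ) * Complex.exp (-z * (t + r ^ 2 / (4 * t) : ℝ))‖ ≤
        t ^ (-ν) * Real.exp (-c * t - c * r ^ 2 / 4 / t) := by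
    intro z hz t ht
    have hz' : c < z.re := hz
    rw [norm_heatIntegrand ν r z ht]
    gcongr
  have key := hasDerivAt_integral_of_dominated_loc_of_deriv_le
    (μ := volume.restrict (Ioi (0 : ℝ)))
    (F := fun (z : ℂ) (t : ℝ) => ((t ^ (-ν) : ℝ) : ℂ) *
      Complex.exp (-z * (t + r ^ 2 / (4 * t) : ℝ)))
    (F' := fun (z : ℂ) (t : ℝ) => -((t + r ^ 2 / (4 * t) : ℝ) : ℂ) * (((t ^ (-ν) : ℝ) : ℂ) *
      Complex.exp (-z * (t + r ^ 2 / (4 * t) : ℝ))))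
    (bound := fun t => (t + r ^ 2 / (4 * t)) *
      (t ^ (-ν) * Real.exp (-c * t - c * r ^ 2 / 4 / t))) hsn
    (Eventually.of_forall fun z => (hmeas z).aestronglyMeasurable) ?_ ?_ ?_ hB ?_
  · exact ⟨_, key.2⟩
  · refine Integrable.mono' (hInt (-ν)) (hmeas κ).aestronglyMeasurable ?_
    filter_upwards [ae_restrict_mem measurableSet_Ioi] with t ht
    exact hle κ (mem_of_mem_nhds hsn) t ht
  · exact (Measurable.mul (by fun_prop) (hmeas κ)).aestronglyMeasurable
  · filter_upwards [ae_restrict_mem measurableSet_Ioi] with t ht z hz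
    have ht0 : (0 : ℝ) < t := ht
    rw [norm_mul, norm_neg, Complex.norm_real, Real.norm_of_nonneg (by positivity)]
    gcongr
    exact hle z hz t ht0
  · filter_upwards [ae_restrict_mem measurableSet_Ioi] with t ht z hz
    have h1 : HasDerivAt (fun z : ℂ => -z * (t + r ^ 2 / (4 * t) : ℝ))
        (-((t + r ^ 2 / (4 * t) : ℝ) : ℂ)) z := by
      exact ((hasDerivAt_id z).neg.mul_const ((t + r ^ 2 / (4 * t) : ℝ) : ℂ)).congr_deriv
        (neg_one_mul _)
    refine (h1.cexp.const_mul _).congr_deriv ?_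
    ring

theorem besselE_ofReal {a ρ : ℝ} (hρ : 0 < ρ) : besselE a ρ =
    ((∫ u in Ioi (0 : ℝ), Real.exp (-(u + ρ)) * (u * (u + 2 * ρ)) ^ a : ℝ) : ℂ) := by
  rw [besselE, besselInt, ← integral_const_mul, ← integral_complex_ofReal]
  refine setIntegral_congr_fun measurableSet_Ioi fun u hu => ?_
  have hu0 : (0 : ℝ) < u := hu
  rw [Real.mul_rpow hu0.le (by positivity), neg_add, Real.exp_add]
  push_cast
  rw [Complex.ofReal_cpow (by positivity : 0 ≤ u + 2 * ρ)]
  push_cast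
  ring

/-- The substitution `t = A/s` with `A = κr²/4` interchanges the two terms of the exponent and
reduces the claim to `integral_bessel_eq_heat` at `ρ = κr`. -/
theorem heatInt_ofReal {a κ r : ℝ} (ha : 0 ≤ a) (hκ : 0 < κ) (hr : 0 < r) :
    (κ : ℂ) ^ ((a + 1 / 2 : ℝ) : ℂ) * heatInt (a + 3 / 2) r κ =
      ((2 * Real.sqrt Real.pi / Real.Gamma (a + 1) * (r ^ (2 * a + 1))⁻¹ : ℝ) : ℂ) *
        besselE a ((κ : ℂ) * r) := by
  have hG : 0 < Real.Gamma (a + 1) := Real.Gamma_pos_of_pos (by linarith)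
  have h0 := integral_bessel_eq_heat ha (by positivity : 0 < κ * r)
  set A : ℝ := κ * r ^ 2 / 4 with hA
  have hA0 : 0 < A := by positivity
  set g : ℝ → ℝ := fun t => t ^ (a - 1 / 2) * Real.exp (-t - (κ * r) ^ 2 / (4 * t)) with hg
  have h1 := integral_comp_mul_left_Ioi g 0 hA0
  rw [mul_zero, smul_eq_mul] at h1
  have h2 := integral_comp_rpow_Ioi (fun t => g (A * t)) (p := -1) (by norm_num)
  rw [h1] at h2
  have h3 : ∫ s in Ioi (0 : ℝ), (|(-1 : ℝ)| * s ^ (-1 - 1 : ℝ)) • g (A * s ^ (-1 : ℝ)) =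
      A ^ (a - 1 / 2) * ∫ s in Ioi (0 : ℝ), s ^ (-(a + 3 / 2)) *
        Real.exp (-κ * (s + r ^ 2 / (4 * s))) := by
    rw [← integral_const_mul]
    refine setIntegral_congr_fun measurableSet_Ioi fun s hs => ?_
    have hs0 : (0 : ℝ) < s := hs
    simp only [hg, abs_neg, abs_one, one_mul, smul_eq_mul]
    rw [Real.mul_rpow hA0.le (by positivity), ← Real.rpow_mul hs0.le, Real.rpow_neg_one]
    have e1 : s ^ (-(a + 3 / 2)) = s ^ (-1 - 1 : ℝ) * s ^ (-1 * (a - 1 / 2)) := by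
      rw [← Real.rpow_add hs0]; congr 1; ring
    have e2 : -(A * s⁻¹) - (κ * r) ^ 2 / (4 * (A * s⁻¹)) = -κ * (s + r ^ 2 / (4 * s)) := by
      rw [hA]; field_simp; ring
    rw [e1, e2]
    ring
  rw [h3] at h2
  set J : ℝ := ∫ s in Ioi (0 : ℝ), s ^ (-(a + 3 / 2)) * Real.exp (-κ * (s + r ^ 2 / (4 * s)))
  have h4 : heatInt (a + 3 / 2) r κ = (J : ℂ) := by
    rw [heatInt, ← integral_complex_ofReal]
    refine setIntegral_congr_fun measurableSet_Ioi fun s _ => ?_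
    push_cast
    rfl
  have e3 : A ^ (a + 1 / 2) = A ^ (a - 1 / 2) * A := by
    rw [← Real.rpow_add_one hA0.ne']; congr 1; ring
  have e4 : A ^ (a + 1 / 2) = κ ^ (a + 1 / 2) * r ^ (2 * a + 1) * (4 ^ a * 2)⁻¹ := by
    rw [hA, Real.div_rpow (by positivity) (by norm_num), Real.mul_rpow hκ.le (by positivity),
      ← Real.rpow_natCast, ← Real.rpow_mul hr.le, Real.rpow_add (by norm_num : (0 : ℝ) < 4),
      ← Real.sqrt_eq_rpow 4, show (4 : ℝ) = 2 ^ 2 by norm_num, Real.sqrt_sq (by norm_num),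
      div_eq_mul_inv]
    congr 3
    push_cast
    ring
  have h5 : A ^ (a + 1 / 2) * J = ∫ t in Ioi (0 : ℝ), g t := by
    rw [e3, mul_right_comm, h2]
    field_simp
  rw [← h5, e4] at h0
  rw [h4, ← Complex.ofReal_cpow hκ.le, ← Complex.ofReal_mul κ r, besselE_ofReal (by positivity), h0,
    ← Complex.ofReal_mul, ← Complex.ofReal_mul]
  congr 1
  have : Real.sqrt Real.pi ≠ 0 := by positivity
  field_simp

/-- The heat representation of the modified Bessel functions in the right half plane. -/
theorem heatInt_eq_besselE {a r : ℝ} (ha : 0 ≤ a) (hr : 0 < r) {κ : ℂ} (hκ : 0 < κ.re) :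
    κ ^ ((a + 1 / 2 : ℝ) : ℂ) * heatInt (a + 3 / 2) r κ =
      ((2 * Real.sqrt Real.pi / Real.Gamma (a + 1) * (r ^ (2 * a + 1))⁻¹ : ℝ) : ℂ) *
        besselE a (κ * r) := by
  set U : Set ℂ := {z | 0 < z.re} with hU
  have hUo : IsOpen U := isOpen_lt continuous_const Complex.continuous_re
  have hf : DifferentiableOn ℂ (fun κ : ℂ => κ ^ ((a + 1 / 2 : ℝ) : ℂ) * heatInt (a + 3 / 2) r κ)
      U := by
    intro z hz
    obtain ⟨d, hd⟩ := hasDerivAt_heatInt (a + 3 / 2) hr hz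
    exact (DifferentiableAt.mul (differentiableAt_id.cpow_const (Or.inl hz))
      hd.differentiableAt).differentiableWithinAt
  have hg : DifferentiableOn ℂ (fun κ : ℂ =>
      ((2 * Real.sqrt Real.pi / Real.Gamma (a + 1) * (r ^ (2 * a + 1))⁻¹ : ℝ) : ℂ) *
        besselE a (κ * r)) U := by
    intro z hz
    have hz' : z * r ∈ Complex.slitPlane := by
      left
      rw [Complex.re_mul_ofReal]
      exact mul_pos hz hr
    refine DifferentiableAt.differentiableWithinAt (DifferentiableAt.const_mul ?_ _)
    exact (hasDerivAt_besselE ha hz').differentiableAt.comp z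
      (by fun_prop : DifferentiableAt ℂ (fun z => z * (r : ℂ)) z)
  have hpre : IsPreconnected U := (convex_halfSpace_re_gt 0).isPreconnected
  refine AnalyticOnNhd.eqOn_of_preconnected_of_frequently_eq (hf.analyticOnNhd hUo)
    (hg.analyticOnNhd hUo) hpre (by simp [hU] : (1 : ℂ) ∈ U) ?_ hκ
  -- Both sides are holomorphic and agree at real points accumulating at `1`.
  have h1 : Tendsto (fun t : ℝ => (t : ℂ)) (𝓝[>] 1) (𝓝[≠] 1) := by
    refine tendsto_nhdsWithin_iff.2 ⟨?_, ?_⟩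
    · have := (Complex.continuous_ofReal.tendsto 1).mono_left (nhdsWithin_le_nhds (s := Ioi 1))
      simpa using this
    · filter_upwards [self_mem_nhdsWithin] with t ht
      have : (1 : ℝ) < t := ht
      simpa using this.ne'
  refine h1.frequently (Eventually.frequently ?_)
  filter_upwards [self_mem_nhdsWithin] with t ht
  have : (1 : ℝ) < t := ht
  exact heatInt_ofReal ha (by linarith) hr

/-! ### The regularised resolvent kernel of the Laplacian -/

/-- The regularised kernel of `(-Δ + κ²)⁻¹`. -/
noncomputable def laplaceReg {n : ℕ} (κ : ℂ) (δ : ℝ) (x : Space n) : ℂ :=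
  ((2 * Real.pi : ℝ) : ℂ)⁻¹ ^ n *
    ∫ ξ : Space n, Complex.exp (Complex.I * ((inner ℝ x ξ : ℝ) : ℂ)) *
      ((Real.exp (-δ * ‖ξ‖ ^ 2) : ℝ) : ℂ) / (((‖ξ‖ ^ 2 : ℝ) : ℂ) + κ ^ 2)

/-- The regularised heat integral. -/
noncomputable def heatReg (n : ℕ) (κ : ℂ) (δ r s : ℝ) : ℂ :=
  Complex.exp (-κ * s) * ((Real.pi : ℂ) / (δ + s / κ)) ^ ((n / 2 : ℝ) : ℂ) *
    Complex.exp (-(r : ℂ) ^ 2 / (4 * (δ + s / κ)))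

variable {n : ℕ}

theorem re_inv_pos {κ : ℂ} (hκ : 0 < κ.re) : 0 < (κ⁻¹).re := by
  rw [Complex.inv_re]
  exact div_pos hκ (Complex.normSq_pos.2 fun h => by simp [h] at hκ)

theorem re_heatWeight {κ : ℂ} (δ s : ℝ) :
    ((δ : ℂ) + s / κ).re = δ + s * (κ⁻¹).re := by
  rw [div_eq_mul_inv, Complex.add_re, Complex.ofReal_re, Complex.re_ofReal_mul]

theorem integral_gaussian_heatWeight {b : ℂ} (hb : 0 < b.re) (x : Space n) :
    ∫ ξ : Space n, Complex.exp (-b * ‖ξ‖ ^ 2 + Complex.I * ((inner ℝ x ξ : ℝ) : ℂ)) =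
      (Real.pi / b) ^ ((n / 2 : ℝ) : ℂ) * Complex.exp (-(‖x‖ : ℂ) ^ 2 / (4 * b)) := by
  rw [GaussianFourier.integral_cexp_neg_mul_sq_norm_add hb Complex.I x, Complex.I_sq, neg_one_mul,
    finrank_euclideanSpace_fin]
  push_cast
  rfl

theorem add_sq_ne_zero {κ : ℂ} (hκ : 0 < κ.re) {t : ℝ} (ht : 0 ≤ t) : (t : ℂ) + κ ^ 2 ≠ 0 := by
  intro h
  have hre := congrArg Complex.re h
  have him := congrArg Complex.im h
  simp only [Complex.add_re, Complex.ofReal_re, Complex.add_im, Complex.ofReal_im, sq,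
    Complex.mul_re, Complex.mul_im, Complex.zero_re, Complex.zero_im, zero_add] at hre him
  have h1 : κ.im = 0 := by
    have : κ.re * κ.im = 0 := by linarith
    exact (mul_eq_zero.1 this).resolve_left hκ.ne'
  rw [h1] at hre
  nlinarith

/-- The Laplace transform representation of `1 / (t + κ²)`. -/
theorem integral_laplace {κ : ℂ} (hκ : 0 < κ.re) {t : ℝ} (ht : 0 ≤ t) :
    ∫ s in Ioi (0 : ℝ), Complex.exp (-κ * s) * Complex.exp (-(s / κ) * t) =
      κ / ((t : ℂ) + κ ^ 2) := by
  have hκ0 : κ ≠ 0 := fun h => by simp [h] at hκ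
  -- The rotated parameter `s/κ` is essential: `κ + t/κ` has positive real part whenever `Re κ > 0`,
  -- whereas `t + κ²` need not.
  have hre : (-(κ + t / κ)).re < 0 := by
    rw [div_eq_mul_inv, Complex.neg_re, Complex.add_re, Complex.re_ofReal_mul]
    have := mul_nonneg ht (re_inv_pos hκ).le
    linarith
  have h1 := integral_exp_mul_complex_Ioi hre 0
  have h2 : ∀ s ∈ Ioi (0 : ℝ), Complex.exp (-κ * s) * Complex.exp (-(s / κ) * t) =
      Complex.exp (-(κ + t / κ) * s) := by
    intro s _
    rw [← Complex.exp_add]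
    congr 1
    ring
  rw [setIntegral_congr_fun measurableSet_Ioi h2, h1]
  have h3 : (t : ℂ) + κ ^ 2 ≠ 0 := add_sq_ne_zero hκ ht
  have h4 : κ + t / κ ≠ 0 := by
    intro h
    apply h3
    field_simp at h
    linear_combination h
  simp only [Complex.ofReal_zero, mul_zero, Complex.exp_zero]
  rw [div_eq_div_iff (neg_ne_zero.2 h4) h3]
  field_simp
  ring

theorem integrable_laplaceReg {κ : ℂ} (hκ : 0 < κ.re) {δ : ℝ} (hδ : 0 < δ) (x : Space n) :
    Integrable fun ξ : Space n => Complex.exp (Complex.I * ((inner ℝ x ξ : ℝ) : ℂ)) *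
      ((Real.exp (-δ * ‖ξ‖ ^ 2) : ℝ) : ℂ) / (((‖ξ‖ ^ 2 : ℝ) : ℂ) + κ ^ 2) := by
  have hg : Integrable fun ξ : Space n =>
      Complex.exp (-(δ : ℂ) * ‖ξ‖ ^ 2 + Complex.I * ((inner ℝ x ξ : ℝ) : ℂ)) :=
    GaussianFourier.integrable_cexp_neg_mul_sq_norm_add (by simpa using hδ) _ _
  have hcont : Continuous fun ξ : Space n => (((‖ξ‖ ^ 2 : ℝ) : ℂ) + κ ^ 2)⁻¹ :=
    Continuous.inv₀ (by fun_prop) fun ξ => add_sq_ne_zero hκ (by positivity)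
  have hbdd : ∃ C, ∀ ξ : Space n, ‖(((‖ξ‖ ^ 2 : ℝ) : ℂ) + κ ^ 2)⁻¹‖ ≤ C := by
    have h1 : ∀ t : ℝ, 0 ≤ t → ‖((t : ℂ) + κ ^ 2)⁻¹‖ ≤ ‖κ⁻¹‖ * κ.re⁻¹ := by
      intro t ht
      have h2 : ((t : ℂ) + κ ^ 2)⁻¹ = κ⁻¹ * (κ + t / κ)⁻¹ := by
        have hκ0 : κ ≠ 0 := fun h => by simp [h] at hκ
        rw [← mul_inv]
        congr 1
        field_simp
        ring
      rw [h2, norm_mul, norm_inv (κ + t / κ)]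
      gcongr
      refine le_trans ?_ (Complex.re_le_norm _)
      rw [div_eq_mul_inv, Complex.add_re, Complex.re_ofReal_mul]
      have := mul_nonneg ht (re_inv_pos hκ).le
      linarith
    exact ⟨_, fun ξ => h1 _ (by positivity)⟩
  obtain ⟨C, hC⟩ := hbdd
  refine (hg.bdd_mul (c := C) hcont.aestronglyMeasurable (Eventually.of_forall hC)).congr
    (Eventually.of_forall fun ξ => ?_)
  beta_reduce
  rw [Complex.exp_add, div_eq_mul_inv]
  push_cast
  ring

/-- The Gaussian regularisation makes the double integral in `ξ` and `s` absolutely convergent,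
since `|e^{-(s/κ)|ξ|²}| ≤ 1`; the inner integral over `ξ` is then an explicit Gaussian. -/
theorem laplaceReg_eq {κ : ℂ} (hκ : 0 < κ.re) {δ : ℝ} (hδ : 0 < δ) (x : Space n) :
    laplaceReg κ δ x = ((2 * Real.pi : ℝ) : ℂ)⁻¹ ^ n * κ⁻¹ *
      ∫ s in Ioi (0 : ℝ), heatReg n κ δ ‖x‖ s := by
  have hκ0 : κ ≠ 0 := fun h => by simp [h] at hκ
  set f : Space n → ℝ → ℂ := fun ξ s =>
    Complex.exp (-(δ : ℂ) * ‖ξ‖ ^ 2 + Complex.I * ((inner ℝ x ξ : ℝ) : ℂ)) *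
      (Complex.exp (-κ * s) * Complex.exp (-(s / κ) * (‖ξ‖ ^ 2 : ℝ))) with hf
  have hmeas : Measurable (Function.uncurry f) := by
    simp only [hf, Function.uncurry_def]
    fun_prop
  have hg : Integrable fun ξ : Space n =>
      Complex.exp (-(δ : ℂ) * ‖ξ‖ ^ 2 + Complex.I * ((inner ℝ x ξ : ℝ) : ℂ)) :=
    GaussianFourier.integrable_cexp_neg_mul_sq_norm_add (by simpa using hδ) _ _
  have he : IntegrableOn (fun s : ℝ => Complex.exp (-κ * s)) (Ioi 0) :=
    integrableOn_exp_mul_complex_Ioi (by simpa using hκ) 0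
  have hInt : Integrable (Function.uncurry f)
      ((volume : Measure (Space n)).prod (volume.restrict (Ioi (0 : ℝ)))) := by
    have h1 : Integrable (fun p : Space n × ℝ =>
        Complex.exp (-(δ : ℂ) * ‖p.1‖ ^ 2 + Complex.I * ((inner ℝ x p.1 : ℝ) : ℂ)) *
          Complex.exp (-κ * p.2))
        ((volume : Measure (Space n)).prod (volume.restrict (Ioi (0 : ℝ)))) := hg.mul_prod he
    refine h1.mono hmeas.aestronglyMeasurable ?_
    have h2 : ∀ᵐ p : Space n × ℝ ∂((volume : Measure (Space n)).prod
        (volume.restrict (Ioi (0 : ℝ)))), p.2 ∈ Ioi (0 : ℝ) :=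
      Measure.quasiMeasurePreserving_snd.ae (ae_restrict_mem measurableSet_Ioi)
    filter_upwards [h2] with p hp
    have hp0 : (0 : ℝ) < p.2 := hp
    simp only [hf, Function.uncurry_def]
    rw [← mul_assoc, norm_mul _ (Complex.exp (-(p.2 / κ) * (‖p.1‖ ^ 2 : ℝ)))]
    refine mul_le_of_le_one_right (norm_nonneg _) ?_
    rw [Complex.norm_exp, Real.exp_le_one_iff, Complex.re_mul_ofReal, Complex.neg_re,
      div_eq_mul_inv, Complex.re_ofReal_mul]
    have := mul_nonneg (mul_nonneg hp0.le (re_inv_pos hκ).le) (sq_nonneg ‖p.1‖)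
    linarith
  have hswap := integral_integral_swap hInt
  have h1 : ∀ ξ : Space n, ∫ s in Ioi (0 : ℝ), f ξ s = κ *
      (Complex.exp (Complex.I * ((inner ℝ x ξ : ℝ) : ℂ)) *
        ((Real.exp (-δ * ‖ξ‖ ^ 2) : ℝ) : ℂ) / (((‖ξ‖ ^ 2 : ℝ) : ℂ) + κ ^ 2)) := by
    intro ξ
    simp only [hf]
    rw [integral_const_mul, integral_laplace hκ (by positivity), Complex.exp_add]
    push_cast
    ring
  have h2 : ∀ s ∈ Ioi (0 : ℝ), ∫ ξ : Space n, f ξ s = heatReg n κ δ ‖x‖ s := by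
    intro s hs
    have hs0 : (0 : ℝ) < s := hs
    have hb : 0 < ((δ : ℂ) + s / κ).re := by
      rw [re_heatWeight]
      have := mul_pos hs0 (re_inv_pos hκ)
      linarith
    have h3 : ∀ ξ : Space n, f ξ s = Complex.exp (-κ * s) *
        Complex.exp (-(δ + s / κ) * ‖ξ‖ ^ 2 + Complex.I * ((inner ℝ x ξ : ℝ) : ℂ)) := by
      intro ξ
      simp only [hf]
      rw [mul_left_comm, ← Complex.exp_add]
      congr 2
      push_cast
      ring
    simp_rw [h3]
    rw [integral_const_mul, integral_gaussian_heatWeight hb x, heatReg, mul_assoc]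
  simp_rw [h1] at hswap
  rw [integral_const_mul, setIntegral_congr_fun measurableSet_Ioi h2] at hswap
  rw [laplaceReg, ← hswap]
  field_simp

theorem exists_rpow_mul_exp_neg_le (p : ℝ) (hp : 0 ≤ p) {c : ℝ} (hc : 0 < c) :
    ∃ C : ℝ, 0 ≤ C ∧ ∀ y : ℝ, 0 ≤ y → y ^ p * Real.exp (-c * y) ≤ C := by
  obtain ⟨k, hk⟩ := exists_nat_ge p
  refine ⟨1 + k.factorial / c ^ k, by positivity, fun y hy => ?_⟩
  have h1 : y ^ p ≤ 1 + y ^ k := by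
    rcases le_total y 1 with h | h
    · have := Real.rpow_le_one hy h hp
      have : 0 ≤ y ^ k := by positivity
      linarith
    · have := Real.rpow_le_rpow_of_exponent_le h hk
      rw [Real.rpow_natCast] at this
      linarith
  have h2 : y ^ k * Real.exp (-c * y) ≤ k.factorial / c ^ k := by
    have h3 := Real.pow_div_factorial_le_exp (c * y) (by positivity) k
    rw [neg_mul, Real.exp_neg, ← div_eq_mul_inv, div_le_iff₀ (Real.exp_pos _)]
    rw [mul_pow, div_le_iff₀ (by positivity)] at h3
    rw [div_mul_eq_mul_div, le_div_iff₀ (by positivity)]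
    linarith
  have h4 : Real.exp (-c * y) ≤ 1 := Real.exp_le_one_iff.2 (by
    have := mul_nonneg hc.le hy; linarith)
  calc y ^ p * Real.exp (-c * y) ≤ (1 + y ^ k) * Real.exp (-c * y) := by gcongr
    _ = Real.exp (-c * y) + y ^ k * Real.exp (-c * y) := by ring
    _ ≤ _ := add_le_add h4 h2

/-- Dominated convergence in `s`. With `b = δ + s/κ`, the singular factor `|b|^{-n/2}` is beaten
uniformly in `δ` by the Gaussian `e^{-|x|²/(4b)}`; this needs `x ≠ 0`. -/
theorem tendsto_laplaceReg {κ : ℂ} (hκ : 0 < κ.re) {x : Space n} (hx : x ≠ 0) :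
    Tendsto (fun δ => laplaceReg κ δ x) (𝓝[>] 0)
      (𝓝 (((2 * Real.pi : ℝ) : ℂ)⁻¹ ^ n * κ⁻¹ * ∫ s in Ioi (0 : ℝ), heatReg n κ 0 ‖x‖ s)) := by
  have hκ0 : κ ≠ 0 := fun h => by simp [h] at hκ
  have hxn : 0 < ‖x‖ := norm_pos_iff.2 hx
  have h1 : (fun δ => ((2 * Real.pi : ℝ) : ℂ)⁻¹ ^ n * κ⁻¹ *
      ∫ s in Ioi (0 : ℝ), heatReg n κ δ ‖x‖ s) =ᶠ[𝓝[>] 0] fun δ => laplaceReg κ δ x := by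
    filter_upwards [self_mem_nhdsWithin] with δ hδ
    exact (laplaceReg_eq hκ hδ x).symm
  refine Tendsto.congr' h1 (Tendsto.const_mul _ ?_)
  set θ : ℝ := κ.re / ‖κ‖ with hθ
  have hκn : 0 < ‖κ‖ := norm_pos_iff.2 hκ0
  have hθ0 : 0 < θ := by positivity
  have hθ1 : θ ≤ 1 := (div_le_one hκn).2 (Complex.re_le_norm κ)
  obtain ⟨C, hC, hle⟩ := exists_rpow_mul_exp_neg_le (n / 2 : ℝ) (by positivity)
    (by positivity : 0 < ‖x‖ ^ 2 * θ / (4 * Real.pi))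
  -- With `θ = cos(arg κ)`, the weight `b = δ + s/κ` stays in the fixed sector `Re b ≥ θ|b|`, so
  -- that `Re(1/b) ≥ θ/|b|`.
  have hre : ∀ δ s : ℝ, 0 ≤ δ → 0 < s → 0 < ((δ : ℂ) + s / κ).re ∧
      θ * ‖(δ : ℂ) + s / κ‖ ≤ ((δ : ℂ) + s / κ).re := by
    intro δ s hδ hs
    rw [re_heatWeight]
    have h3 := mul_pos hs (re_inv_pos hκ)
    refine ⟨by linarith, ?_⟩
    have h4 : ‖(δ : ℂ) + s / κ‖ ≤ δ + s / ‖κ‖ := by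
      refine (norm_add_le _ _).trans_eq ?_
      rw [norm_div, Complex.norm_real, Complex.norm_real, Real.norm_of_nonneg hδ,
        Real.norm_of_nonneg hs.le]
    have h5 : s * (κ⁻¹).re = θ * (s / ‖κ‖) := by
      rw [Complex.inv_re, Complex.normSq_eq_norm_sq, hθ]
      field_simp
    rw [h5]
    calc θ * ‖(δ : ℂ) + s / κ‖ ≤ θ * (δ + s / ‖κ‖) := by gcongr
      _ ≤ δ + θ * (s / ‖κ‖) := by nlinarith
  have hmeas : ∀ δ : ℝ, Measurable (heatReg n κ δ ‖x‖) := fun δ => by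
    unfold heatReg
    fun_prop
  refine tendsto_integral_filter_of_dominated_convergence
    (fun s => Real.exp (-κ.re * s) * C) ?_ ?_ ?_ ?_
  · exact Eventually.of_forall fun δ => (hmeas δ).aestronglyMeasurable
  · filter_upwards [self_mem_nhdsWithin] with δ hδ
    filter_upwards [ae_restrict_mem measurableSet_Ioi] with s hs
    have hδ0 : (0 : ℝ) < δ := hδ
    obtain ⟨hb, hbn⟩ := hre δ s hδ0.le hs
    rw [heatReg]
    set b : ℂ := (δ : ℂ) + s / κ with hbdef
    have hb0 : b ≠ 0 := fun h => by simp [h] at hb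
    have hbn0 : 0 < ‖b‖ := norm_pos_iff.2 hb0
    rw [mul_assoc, norm_mul, Complex.norm_exp, Complex.re_mul_ofReal, Complex.neg_re]
    gcongr
    have e1 : (-((‖x‖ : ℝ) : ℂ) ^ 2 / (4 * b)).re = -(‖x‖ ^ 2 / 4) * (b.re / ‖b‖ ^ 2) := by
      have : -((‖x‖ : ℝ) : ℂ) ^ 2 / (4 * b) = ((-(‖x‖ ^ 2 / 4) : ℝ) : ℂ) * b⁻¹ := by
        push_cast
        field_simp
      rw [this, Complex.re_ofReal_mul, Complex.inv_re, Complex.normSq_eq_norm_sq]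
    rw [norm_mul, Complex.norm_cpow_real, Complex.norm_exp, e1, norm_div, Complex.norm_real,
      Real.norm_of_nonneg Real.pi_pos.le]
    refine le_trans ?_ (hle (Real.pi / ‖b‖) (by positivity))
    refine mul_le_mul_of_nonneg_left (Real.exp_le_exp.2 ?_) (by positivity)
    have e2 : -(‖x‖ ^ 2 * θ / (4 * Real.pi)) * (Real.pi / ‖b‖) = -(‖x‖ ^ 2 / 4) * (θ / ‖b‖) := by
      field_simp
    rw [e2, neg_mul, neg_mul, neg_le_neg_iff]
    refine mul_le_mul_of_nonneg_left ?_ (by positivity)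
    rw [div_le_div_iff₀ hbn0 (by positivity)]
    nlinarith
  · have := (integrableOn_exp_mul_Ioi (a := -κ.re) (by linarith) 0).mul_const C
    exact this
  · filter_upwards [ae_restrict_mem measurableSet_Ioi] with s hs
    have hb := (hre 0 s le_rfl hs).1
    have hb0 : ((0 : ℝ) : ℂ) + s / κ ≠ 0 := fun h => by rw [h] at hb; simp at hb
    have hcont : ContinuousAt (fun δ : ℝ => heatReg n κ δ ‖x‖ s) 0 := by
      unfold heatReg
      refine ContinuousAt.mul (ContinuousAt.mul continuousAt_const ?_) ?_
      · refine ContinuousAt.cpow (ContinuousAt.div continuousAt_const (by fun_prop) hb0)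
          continuousAt_const ?_
        left
        rw [div_eq_mul_inv, Complex.re_ofReal_mul]
        exact mul_pos Real.pi_pos (re_inv_pos hb)
      · refine ContinuousAt.cexp (ContinuousAt.div continuousAt_const (by fun_prop) ?_)
        exact mul_ne_zero (by norm_num) hb0
    exact hcont.tendsto.mono_left nhdsWithin_le_nhds

theorem ofReal_mul_cpow {t : ℝ} (ht : 0 < t) {z : ℂ} (hz : z ≠ 0) (w : ℂ) :
    ((t : ℂ) * z) ^ w = (t : ℂ) ^ w * z ^ w := by
  have ht' : (t : ℂ) ≠ 0 := by exact_mod_cast ht.ne'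
  rw [Complex.cpow_def_of_ne_zero (mul_ne_zero ht' hz), Complex.cpow_def_of_ne_zero ht',
    Complex.cpow_def_of_ne_zero hz, Complex.log_ofReal_mul ht hz, ← Complex.exp_add,
    Complex.ofReal_log ht.le]
  ring_nf

/-- The kernel of the resolvent of the Laplacian. -/
theorem laplaceLimit_eq (hn : 3 ≤ n) {κ : ℂ} (hκ : 0 < κ.re) {r : ℝ} (hr : 0 < r) :
    ((2 * Real.pi : ℝ) : ℂ)⁻¹ ^ n * κ⁻¹ * ∫ s in Ioi (0 : ℝ), heatReg n κ 0 r s =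
      kernelConst n * ((r ^ (n - 2))⁻¹ : ℝ) * besselE (((n : ℝ) - 3) / 2) (κ * r) := by
  have hκ0 : κ ≠ 0 := fun h => by simp [h] at hκ
  have hn' : (3 : ℝ) ≤ n := by exact_mod_cast hn
  have ha : (0 : ℝ) ≤ ((n : ℝ) - 3) / 2 := by linarith
  have h1 : ∀ s ∈ Ioi (0 : ℝ), heatReg n κ 0 r s = (((Real.pi ^ (n / 2 : ℝ) : ℝ) : ℂ) *
      κ ^ ((n / 2 : ℝ) : ℂ)) * (((s ^ (-(((n : ℝ) - 3) / 2 + 3 / 2)) : ℝ) : ℂ) *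
        Complex.exp (-κ * (s + r ^ 2 / (4 * s) : ℝ))) := by
    intro s hs
    have hs0 : (0 : ℝ) < s := hs
    have hsc : (s : ℂ) ≠ 0 := by exact_mod_cast hs0.ne'
    have e1 : (Real.pi : ℂ) / (((0 : ℝ) : ℂ) + s / κ) = ((Real.pi / s : ℝ) : ℂ) * κ := by
      push_cast
      rw [zero_add]
      field_simp
    have e2 : -(r : ℂ) ^ 2 / (4 * (((0 : ℝ) : ℂ) + s / κ)) = -κ * (r ^ 2 / (4 * s) : ℝ) := by
      push_cast
      rw [zero_add]
      field_simp
    have e3 : -(((n : ℝ) - 3) / 2 + 3 / 2) = -(n / 2 : ℝ) := by ring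
    rw [heatReg, e1, e2, ofReal_mul_cpow (by positivity) hκ0, ← Complex.ofReal_cpow (by positivity),
      Real.div_rpow Real.pi_pos.le hs0.le, e3, Real.rpow_neg hs0.le]
    push_cast
    rw [mul_add, Complex.exp_add]
    ring
  have h2 := heatInt_eq_besselE ha hr hκ
  have h3 : κ ^ ((n / 2 : ℝ) : ℂ) = κ * κ ^ ((((n : ℝ) - 3) / 2 + 1 / 2 : ℝ) : ℂ) := by
    nth_rw 2 [← Complex.cpow_one κ]
    rw [← Complex.cpow_add _ _ hκ0]
    congr 1
    push_cast
    ring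
  have h4 : r ^ (2 * (((n : ℝ) - 3) / 2) + 1) = r ^ (n - 2) := by
    rw [← Real.rpow_natCast, Nat.cast_sub (by omega)]
    congr 1
    push_cast
    ring
  rw [setIntegral_congr_fun measurableSet_Ioi h1, integral_const_mul]
  change _ * (_ * heatInt (((n : ℝ) - 3) / 2 + 3 / 2) r κ) = _
  rw [h3]
  have h5 : kernelConst n = (2 * Real.pi)⁻¹ ^ n * Real.pi ^ (n / 2 : ℝ) *
      (2 * Real.sqrt Real.pi / Real.Gamma (((n : ℝ) - 3) / 2 + 1)) := by
    have e : ((n : ℝ) - 3) / 2 + 1 = ((n : ℝ) - 1) / 2 := by ring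
    have hpi := Real.pi_pos
    rw [kernelConst, e, Real.mul_rpow (by norm_num) hpi.le, inv_pow, mul_pow, ← Real.rpow_natCast,
      ← Real.rpow_natCast, mul_inv, ← Real.rpow_neg (by norm_num), ← Real.rpow_neg hpi.le,
      show Real.pi ^ (-(n : ℝ) / 2) = Real.pi ^ (-(n : ℝ)) * Real.pi ^ ((n : ℝ) / 2) by
        rw [← Real.rpow_add hpi]; congr 1; ring,
      show (2 : ℝ) ^ (1 - (n : ℝ) / 2) = 2 * 2 ^ (-(n : ℝ) / 2) by
        rw [sub_eq_add_neg, Real.rpow_add (by norm_num), Real.rpow_one, neg_div],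
      show (2 : ℝ) ^ (-(n : ℝ)) = 2 ^ (-(n : ℝ) / 2) * 2 ^ (-(n : ℝ) / 2) by
        rw [← Real.rpow_add (by norm_num)]; congr 1; ring]
    ring
  rw [h5]
  rw [h4] at h2
  calc _ = ((2 * Real.pi : ℝ) : ℂ)⁻¹ ^ n * ((Real.pi ^ (n / 2 : ℝ) : ℝ) : ℂ) *
        (κ ^ ((((n : ℝ) - 3) / 2 + 1 / 2 : ℝ) : ℂ) *
          heatInt (((n : ℝ) - 3) / 2 + 3 / 2) r κ) := by field_simp
    _ = _ := by
        rw [h2]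
        push_cast
        ring

end HigherSchrodinger

namespace HigherSchrodinger

variable {n m : ℕ}

/-! ### The kernel of the free resolvent -/

/-- Partial fractions for `1 / (t^m - w^m)`. -/
theorem partial_fractions (hm : 1 ≤ m) {t w : ℂ} (hw : w ≠ 0)
    (h : ∀ l ∈ Finset.range m, t - -(unitRoot m l) ^ 2 * w ≠ 0) :
    (t ^ m - w ^ m)⁻¹ = ∑ l ∈ Finset.range m,
      -(unitRoot m l) ^ 2 * w / (m * w ^ m) * (t - -(unitRoot m l) ^ 2 * w)⁻¹ := by
  have hm0 : (m : ℂ) ≠ 0 := by exact_mod_cast (by omega : m ≠ 0)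
  have hgeom : ∀ l, t ^ m - w ^ m = (t - -(unitRoot m l) ^ 2 * w) *
      ∑ j ∈ Finset.range m, t ^ (m - 1 - j) * (-(unitRoot m l) ^ 2 * w) ^ j := by
    intro l
    have h1 := Commute.mul_geom_sum₂ (Commute.all t (-(unitRoot m l) ^ 2 * w)) m
    rw [mul_pow, neg_unitRoot_sq_pow (by omega), one_mul] at h1
    rw [← h1]
    congr 1
    rw [← Finset.sum_range_reflect]
    refine Finset.sum_congr rfl fun j hj => ?_
    have hj' := Finset.mem_range.1 hj
    congr 2
    omega
  have hne : t ^ m - w ^ m ≠ 0 := by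
    have hprod : ∀ l ∈ Finset.range m, t ≠ -(unitRoot m l) ^ 2 * w := fun l hl =>
      sub_ne_zero.1 (h l hl)
    intro h0
    have hζ := Complex.isPrimitiveRoot_exp m (by omega)
    have h1 : (t / w) ^ m = 1 := by
      rw [div_pow, div_eq_one_iff_eq (pow_ne_zero _ hw)]; exact sub_eq_zero.1 h0
    have : NeZero m := ⟨by omega⟩
    obtain ⟨l, hl, hl'⟩ := hζ.eq_pow_of_pow_eq_one h1
    refine hprod l (Finset.mem_range.2 hl) ?_
    rw [neg_unitRoot_sq, hl']
    field_simp
  have hterm : ∀ l ∈ Finset.range m, -(unitRoot m l) ^ 2 * w / (m * w ^ m) *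
      (t - -(unitRoot m l) ^ 2 * w)⁻¹ = (t ^ m - w ^ m)⁻¹ / (m * w ^ m) *
        ∑ j ∈ Finset.range m, t ^ (m - 1 - j) * w ^ (j + 1) * (-(unitRoot m l) ^ 2) ^ (j + 1) := by
    intro l hl
    have h1 : (t - -(unitRoot m l) ^ 2 * w)⁻¹ = (t ^ m - w ^ m)⁻¹ *
        ∑ j ∈ Finset.range m, t ^ (m - 1 - j) * (-(unitRoot m l) ^ 2 * w) ^ j := by
      rw [eq_inv_mul_iff_mul_eq₀ hne, hgeom l, mul_comm, ← mul_assoc, inv_mul_cancel₀ (h l hl),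
        one_mul]
    rw [h1, mul_comm ((t ^ m - w ^ m)⁻¹), ← mul_assoc, Finset.mul_sum, div_mul_eq_mul_div,
      Finset.mul_sum, Finset.sum_mul, Finset.sum_div]
    refine Finset.sum_congr rfl fun j _ => ?_
    rw [mul_pow, pow_succ w, pow_succ (-(unitRoot m l) ^ 2)]
    ring
  rw [Finset.sum_congr rfl hterm, ← Finset.mul_sum, Finset.sum_comm]
  -- After exchanging the sums, the powers of the roots of unity add up to zero except for the
  -- exponent `j + 1 = m`.
  have hsum : ∑ j ∈ Finset.range m, ∑ l ∈ Finset.range m,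
      t ^ (m - 1 - j) * w ^ (j + 1) * (-(unitRoot m l) ^ 2) ^ (j + 1) = m * w ^ m := by
    rw [Finset.sum_eq_single (m - 1)]
    · rw [Nat.sub_self, Nat.sub_add_cancel hm]
      simp only [neg_unitRoot_sq_pow (by omega : m ≠ 0)]
      simp
    · intro j hj hjm
      have hj' := Finset.mem_range.1 hj
      rw [← Finset.mul_sum, sum_neg_unitRoot_sq_pow (by omega) (by omega), mul_zero]
    · intro h0
      exact absurd (Finset.mem_range.2 (by omega)) h0
  rw [hsum, div_mul_cancel₀ _ (mul_ne_zero hm0 (pow_ne_zero _ hw))]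

/-- The value of the resolvent kernel at the spectral parameter `μ^{2m}`. -/
noncomputable def resolventValue (n m : ℕ) (μ : ℂ) (r : ℝ) : ℂ :=
  kernelConst n / m * (μ ^ (2 * (m - 1)))⁻¹ * ((r ^ (n - 2))⁻¹ : ℝ) *
    ∑ l ∈ Finset.range m, -(unitRoot m l) ^ 2 * besselE (((n : ℝ) - 3) / 2) (unitRoot m l * μ * r)

/-- Partial fractions in `t = |ξ|²`, `w = μ²`: the pole at `-κ²μ²` belongs to the Laplace resolvent
with parameter `κμ`, and `Re(κμ) > 0` keeps it off the spectrum. -/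
theorem regularizedKernel_eq_sum (hm : 1 ≤ m) {μ : ℂ} (hμ : μ ≠ 0)
    (hre : ∀ l < m, 0 < (unitRoot m l * μ).re) {δ : ℝ} (hδ : 0 < δ) (x : Space n) :
    regularizedKernel m (μ ^ (2 * m)) δ x = ∑ l ∈ Finset.range m,
      -(unitRoot m l) ^ 2 * μ ^ 2 / (m * μ ^ (2 * m)) * laplaceReg (unitRoot m l * μ) δ x := by
  rw [regularizedKernel]
  simp only [laplaceReg]
  have h1 : ∀ ξ : Space n, Complex.exp (Complex.I * ((inner ℝ x ξ : ℝ) : ℂ)) *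
      ((Real.exp (-δ * ‖ξ‖ ^ 2) : ℝ) : ℂ) / (((‖ξ‖ ^ (2 * m) : ℝ) : ℂ) - μ ^ (2 * m)) =
      ∑ l ∈ Finset.range m, -(unitRoot m l) ^ 2 * μ ^ 2 / (m * μ ^ (2 * m)) *
        (Complex.exp (Complex.I * ((inner ℝ x ξ : ℝ) : ℂ)) *
      ((Real.exp (-δ * ‖ξ‖ ^ 2) : ℝ) : ℂ) / (((‖ξ‖ ^ 2 : ℝ) : ℂ) + (unitRoot m l * μ) ^ 2)) := by
    intro ξ
    have hs : ∀ l, (((‖ξ‖ ^ 2 : ℝ) : ℂ) - -(unitRoot m l) ^ 2 * μ ^ 2) =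
        (((‖ξ‖ ^ 2 : ℝ) : ℂ) + (unitRoot m l * μ) ^ 2) := fun l => by ring
    have hpf := partial_fractions hm (t := ((‖ξ‖ ^ 2 : ℝ) : ℂ)) (pow_ne_zero 2 hμ)
      (fun l hl => by
        rw [hs l]
        exact add_sq_ne_zero (hre l (Finset.mem_range.1 hl)) (by positivity))
    have e1 : (((‖ξ‖ ^ (2 * m) : ℝ) : ℂ) - μ ^ (2 * m)) =
        ((‖ξ‖ ^ 2 : ℝ) : ℂ) ^ m - (μ ^ 2) ^ m := by
      push_cast
      rw [pow_mul, pow_mul]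
    rw [div_eq_mul_inv, e1, hpf, Finset.mul_sum]
    refine Finset.sum_congr rfl fun l _ => ?_
    rw [hs l, ← pow_mul]
    ring
  simp_rw [h1]
  rw [integral_finsetSum _ fun l hl =>
    (integrable_laplaceReg (hre l (Finset.mem_range.1 hl)) hδ x).const_mul _, Finset.mul_sum]
  refine Finset.sum_congr rfl fun l _ => ?_
  rw [integral_const_mul]
  ring

theorem resolventKernel_eq (hm : 1 ≤ m) (hn : 3 ≤ n) {μ : ℂ} (hμ : μ ≠ 0)
    (hre : ∀ l < m, 0 < (unitRoot m l * μ).re) {x : Space n} (hx : x ≠ 0) :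
    resolventKernel m (μ ^ (2 * m)) x = resolventValue n m μ ‖x‖ := by
  have hlim : Tendsto (fun δ => regularizedKernel m (μ ^ (2 * m)) δ x) (𝓝[>] 0)
      (𝓝 (resolventValue n m μ ‖x‖)) := by
    have h1 : Tendsto (fun δ => ∑ l ∈ Finset.range m,
        -(unitRoot m l) ^ 2 * μ ^ 2 / (m * μ ^ (2 * m)) * laplaceReg (unitRoot m l * μ) δ x)
        (𝓝[>] 0) (𝓝 (∑ l ∈ Finset.range m, -(unitRoot m l) ^ 2 * μ ^ 2 / (m * μ ^ (2 * m)) *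
          (kernelConst n * ((‖x‖ ^ (n - 2))⁻¹ : ℝ) *
            besselE (((n : ℝ) - 3) / 2) (unitRoot m l * μ * ‖x‖)))) := by
      refine tendsto_finsetSum _ fun l hl => Tendsto.const_mul _ ?_
      have hl' := hre l (Finset.mem_range.1 hl)
      rw [← laplaceLimit_eq hn hl' (norm_pos_iff.2 hx)]
      exact tendsto_laplaceReg hl' hx
    have e : resolventValue n m μ ‖x‖ = ∑ l ∈ Finset.range m,
        -(unitRoot m l) ^ 2 * μ ^ 2 / (m * μ ^ (2 * m)) *
          (kernelConst n * ((‖x‖ ^ (n - 2))⁻¹ : ℝ) *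
            besselE (((n : ℝ) - 3) / 2) (unitRoot m l * μ * ‖x‖)) := by
      rw [resolventValue, Finset.mul_sum]
      refine Finset.sum_congr rfl fun l _ => ?_
      have e2 : μ ^ (2 * m) = μ ^ (2 * (m - 1)) * μ ^ 2 := by
        rw [← pow_add]; congr 1; omega
      rw [e2]
      field_simp
    rw [e]
    refine Tendsto.congr' ?_ h1
    filter_upwards [self_mem_nhdsWithin] with δ hδ
    exact (regularizedKernel_eq_sum hm hμ hre hδ x).symm
  exact hlim.limUnder_eq

/-- The argument of `κ_l e^z` is `-π/2 + πl/m + Im z`, which lies strictly between `-π/2` and `π/2`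
when `0 < Im z < π/m`. -/
theorem unitRoot_mul_exp_re_pos (hm : 1 ≤ m) {l : ℕ} (hl : l < m) {z : ℂ} (hz : 0 < z.im)
    (hz' : z.im < Real.pi / m) : 0 < (unitRoot m l * Complex.exp z).re := by
  have hm0 : (0 : ℝ) < m := by exact_mod_cast hm
  have h1 : unitRoot m l * Complex.exp z = -Complex.I *
      Complex.exp ((z.re : ℂ) + ((Real.pi * l / m + z.im : ℝ) : ℂ) * Complex.I) := by
    rw [unitRoot, mul_assoc, ← Complex.exp_add]
    congr 2
    nth_rw 1 [← Complex.re_add_im z]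
    push_cast
    ring
  rw [h1, Complex.exp_add, Complex.exp_mul_I, ← Complex.ofReal_cos,
    ← Complex.ofReal_sin, ← Complex.ofReal_exp]
  have h2 : (-Complex.I * (((Real.exp z.re : ℝ) : ℂ) *
      (((Real.cos (Real.pi * l / m + z.im) : ℝ) : ℂ) +
        ((Real.sin (Real.pi * l / m + z.im) : ℝ) : ℂ) * Complex.I))).re =
      Real.exp z.re * Real.sin (Real.pi * l / m + z.im) := by
    simp [Complex.mul_re, Complex.mul_im, -Complex.ofReal_exp, -Complex.ofReal_sin,
      -Complex.ofReal_cos]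
  rw [h2]
  refine mul_pos (Real.exp_pos _) (Real.sin_pos_of_pos_of_lt_pi (by positivity) ?_)
  have h3 : Real.pi * l / m + Real.pi / m ≤ Real.pi := by
    rw [← add_div, div_le_iff₀ hm0]
    have : (l : ℝ) + 1 ≤ m := by exact_mod_cast hl
    nlinarith [Real.pi_pos]
  linarith

/-- The boundary values of the free resolvent kernel. -/
theorem resolventKernelPlus_eq (hm : 1 ≤ m) (hn : 2 * m < n) {lam : ℝ} (hlam : 0 < lam)
    {x : Space n} (hx : x ≠ 0) : resolventKernelPlus m lam x = freeKernel n m lam ‖x‖ := by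
  have hxn : 0 < ‖x‖ := norm_pos_iff.2 hx
  have hn3 : (3 : ℝ) ≤ n := by exact_mod_cast (by omega : 3 ≤ n)
  have hm0 : (0 : ℝ) < m := by exact_mod_cast hm
  have hmc : (m : ℂ) ≠ 0 := by exact_mod_cast (by omega : m ≠ 0)
  set z : ℝ → ℂ := fun ε => ((lam ^ (2 * m) : ℝ) : ℂ) + (ε : ℂ) * Complex.I with hz
  -- The branch of the `2m`-th root that tends to `λ` from the upper half plane; its argument is in
  -- `(0, π/m)`, so every `κ_l μ` is in the right half plane. This choice yields the outgoing
  -- kernel.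
  set μ : ℝ → ℂ := fun ε => Complex.exp (Complex.log (z ε) / (2 * m)) with hμ
  have hzre : ∀ ε, (z ε).re = lam ^ (2 * m) := fun ε => by
    simp only [hz, Complex.add_re, Complex.ofReal_re, Complex.mul_re, Complex.I_re, mul_zero,
      Complex.ofReal_im, Complex.I_im, mul_one, sub_self, add_zero]
  have hzim : ∀ ε, (z ε).im = ε := fun ε => by
    simp only [hz, Complex.add_im, Complex.ofReal_im, Complex.mul_im, Complex.ofReal_re,
      Complex.I_im, mul_one, Complex.I_re, mul_zero, add_zero, zero_add]
  have hzpos : ∀ ε, 0 < (z ε).re := fun ε => by rw [hzre]; positivity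
  have hz0 : ∀ ε, z ε ≠ 0 := fun ε h => by have := hzpos ε; simp [h] at this
  have hpow : ∀ ε, μ ε ^ (2 * m) = z ε := by
    intro ε
    rw [hμ, ← Complex.exp_nat_mul]
    push_cast
    rw [mul_div_cancel₀ _ (mul_ne_zero two_ne_zero hmc), Complex.exp_log (hz0 ε)]
  have hμ0 : μ 0 = lam := by
    simp only [hμ, hz]
    rw [Complex.ofReal_zero, zero_mul, add_zero, ← Complex.ofReal_log (by positivity),
      Real.log_pow]
    push_cast
    rw [mul_div_cancel_left₀ _ (mul_ne_zero two_ne_zero hmc), ← Complex.ofReal_exp,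
      Real.exp_log hlam]
  have hμc : ContinuousAt μ 0 := by
    refine ContinuousAt.cexp (ContinuousAt.div_const (ContinuousAt.clog ?_ (Or.inl (hzpos 0))) _)
    exact Continuous.continuousAt (by simp only [hz]; fun_prop)
  have hre : ∀ ε > 0, ∀ l < m, 0 < (unitRoot m l * μ ε).re := by
    intro ε hε l hl
    have h1 : (Complex.log (z ε) / (2 * m)).im = Complex.arg (z ε) / (2 * m) := by
      have : Complex.log (z ε) / (2 * m) = ((1 / (2 * m) : ℝ) : ℂ) * Complex.log (z ε) := by
        push_cast; ring
      rw [this, Complex.im_ofReal_mul, Complex.log_im]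
      ring
    have harg0 : 0 < Complex.arg (z ε) := by
      have h2 : 0 ≤ Complex.arg (z ε) := Complex.arg_nonneg_iff.2 (by rw [hzim]; exact hε.le)
      refine h2.lt_of_ne fun h => ?_
      have := (Complex.arg_eq_zero_iff.1 h.symm).2
      rw [hzim] at this
      exact hε.ne' this
    refine unitRoot_mul_exp_re_pos hm hl ?_ ?_
    · rw [h1]; positivity
    · rw [h1]
      have := Complex.arg_le_pi (z ε)
      rw [div_lt_div_iff₀ (by positivity) hm0]
      nlinarith [Real.pi_pos]
  have hval : resolventValue n m (μ 0) ‖x‖ = freeKernel n m lam ‖x‖ := by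
    have hlc : (lam : ℂ) ≠ 0 := by exact_mod_cast hlam.ne'
    have hxc : (‖x‖ : ℂ) ≠ 0 := by exact_mod_cast hxn.ne'
    rw [hμ0, resolventValue, freeKernel, profile, rootSum]
    have e : n - 2 = (n - 2 * m) + 2 * (m - 1) := by omega
    rw [e]
    push_cast
    have e3 : ∀ l, unitRoot m l * (lam : ℂ) * ‖x‖ = unitRoot m l * (lam * ‖x‖) := fun l =>
      mul_assoc _ _ _
    simp only [pow_one, e3]
    generalize (∑ l ∈ Finset.range m, -(unitRoot m l) ^ 2 *
      besselE (((n : ℝ) - 3) / 2) (unitRoot m l * (lam * ‖x‖))) = S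
    rw [pow_add, mul_pow]
    field_simp
  -- At `ε = 0` the parameter `κ_0 μ` reaches the imaginary axis. Nothing is lost, because `besselE`
  -- is holomorphic on the whole slit plane.
  have hcont : ContinuousAt (fun ε => resolventValue n m (μ ε) ‖x‖) 0 := by
    unfold resolventValue
    refine ContinuousAt.mul (ContinuousAt.mul (ContinuousAt.mul continuousAt_const ?_)
      continuousAt_const) ?_
    · refine ContinuousAt.inv₀ (hμc.pow _) (pow_ne_zero _ ?_)
      rw [hμ0]
      exact_mod_cast hlam.ne'
    · refine tendsto_finsetSum _ fun l hl => Tendsto.const_mul _ ?_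
      have hmem : unitRoot m l * μ 0 * ‖x‖ ∈ Complex.slitPlane := by
        rw [hμ0, mul_assoc]
        refine mul_mem_slitPlane_of_mem_cone (norm_unitRoot m l)
          (unitRoot_re_nonneg (Finset.mem_range.1 hl)) ?_
        rw [← Complex.ofReal_mul]
        simp only [cone, mem_ofPred_eq, Complex.ofReal_im, abs_zero, Complex.ofReal_re]
        positivity
      have h1 : ContinuousAt (besselE (((n : ℝ) - 3) / 2)) (unitRoot m l * μ 0 * ‖x‖) :=
        (hasDerivAt_besselE (by linarith) hmem).continuousAt
      exact h1.comp (f := fun ε => unitRoot m l * μ ε * ‖x‖) ((hμc.const_mul _).mul continuousAt_const)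
  have hlim : Tendsto (fun ε : ℝ => resolventKernel m (z ε) x) (𝓝[>] 0)
      (𝓝 (freeKernel n m lam ‖x‖)) := by
    rw [← hval]
    refine Tendsto.congr' ?_ (hcont.tendsto.mono_left nhdsWithin_le_nhds)
    filter_upwards [self_mem_nhdsWithin] with ε hε
    rw [← hpow ε, resolventKernel_eq hm (by omega) (Complex.exp_ne_zero _) (hre ε hε) hx]
  exact hlim.limUnder_eq

end HigherSchrodinger

namespace HigherSchrodinger

variable {n m : ℕ}

/-! ### Locally integrable singularities -/

theorem integrableOn_inv_norm_pow {γ : ℕ} (hγ : γ < n) :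
    IntegrableOn (fun y : Space n => (‖y‖ ^ γ)⁻¹) (Metric.ball 0 1) := by
  have : NeZero n := ⟨by omega⟩
  have : Nontrivial (Space n) := by
    apply Module.nontrivial_of_finrank_pos (R := ℝ)
    rw [finrank_euclideanSpace_fin]; omega
  have := (integrableOn_fun_norm_addHaar (E := Space n) (volume : Measure (Space n))
    (f := fun r : ℝ => (r ^ γ)⁻¹) (r := 1)).2
  refine this ?_
  rw [finrank_euclideanSpace_fin]
  have h1 : IntegrableOn (fun y : ℝ => y ^ (n - 1 - γ)) (Ioo 0 1) :=
    ((continuous_pow _).integrableOn_Icc (a := 0) (b := 1)).mono_set Ioo_subset_Icc_self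
  refine h1.congr_fun (fun y hy => ?_) measurableSet_Ioo
  have hy0 : y ≠ 0 := hy.1.ne'
  have e : n - 1 = (n - 1 - γ) + γ := by omega
  simp only [smul_eq_mul]
  rw [e, pow_add]
  simp only [Nat.add_sub_cancel]
  field_simp

theorem setLIntegral_ball_eq (γ : ℕ) (x : Space n) (r : ℝ) :
    ∫⁻ y in Metric.ball x r, ENNReal.ofReal ((‖x - y‖ ^ γ)⁻¹) =
      ∫⁻ y in Metric.ball (0 : Space n) r, ENNReal.ofReal ((‖y‖ ^ γ)⁻¹) := by
  rw [← lintegral_indicator measurableSet_ball, ← lintegral_indicator measurableSet_ball,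
    ← lintegral_sub_left_eq_self _ x]
  congr 1
  ext y
  simp only [indicator, Metric.mem_ball, dist_eq_norm]
  simp only [sub_sub_cancel_left, norm_neg, sub_sub_cancel, sub_zero]

theorem measurable_inv_norm_pow (γ : ℕ) (x : Space n) :
    Measurable fun y : Space n => ENNReal.ofReal ((‖x - y‖ ^ γ)⁻¹) := by
  fun_prop

/-- In the unit ball around `x` the weight is bounded and the singularity integrable; outside it the
singular factor is at most one. The constant does not depend on `x`. -/
theorem exists_lintegral_inv_norm_pow_mul_le {γ : ℕ} (hγ : γ < n) :
    ∃ C : NNReal, ∀ (w : Space n → ℝ≥0∞) (W : ℝ≥0∞), (∀ y, w y ≤ W) → ∀ x,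
      ∫⁻ y, ENNReal.ofReal ((‖x - y‖ ^ γ)⁻¹) * w y ≤ C * W + ∫⁻ y, w y := by
  have hfin : ∫⁻ y in Metric.ball (0 : Space n) 1, ENNReal.ofReal ((‖y‖ ^ γ)⁻¹) < ⊤ :=
    (integrableOn_inv_norm_pow hγ).lintegral_lt_top
  refine ⟨(∫⁻ y in Metric.ball (0 : Space n) 1, ENNReal.ofReal ((‖y‖ ^ γ)⁻¹)).toNNReal,
    fun w W hW x => ?_⟩
  rw [ENNReal.coe_toNNReal hfin.ne, ← setLIntegral_ball_eq γ x 1,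
    ← lintegral_add_compl _ (measurableSet_ball (x := x) (ε := 1))]
  refine add_le_add ?_ ?_
  · rw [← lintegral_mul_const _ (measurable_inv_norm_pow γ x)]
    exact lintegral_mono fun y => mul_le_mul_right (hW y) _
  · refine (setLIntegral_mono' measurableSet_ball.compl fun y hy => ?_).trans
      (setLIntegral_le_lintegral _ _)
    have h1 : 1 ≤ ‖x - y‖ := by
      simpa [Metric.mem_ball, dist_eq_norm, norm_sub_rev] using hy
    calc _ ≤ 1 * w y := by
          refine mul_le_mul_left ?_ _
          rw [ENNReal.ofReal_le_one]
          exact inv_le_one_of_one_le₀ (one_le_pow₀ h1)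
      _ = w y := one_mul _

/-! ### The value of the profile at the origin -/

/-- The recursion telescopes into a quotient of Gamma values, the form to which the duplication
formula applies. -/
theorem rootCoeff_mul_Gamma (m : ℕ) {a : ℝ} (ha : 0 ≤ a) (k : ℕ) :
    rootCoeff m a k * (Real.Gamma (a + 1) * k.factorial) =
      m * Real.Gamma (2 * a + 1) * Real.Gamma (a + k + 1) := by
  induction k with
  | zero => simp [rootCoeff]
  | succ k ih =>
    rw [rootCoeff, Nat.factorial_succ]
    have h1 : Real.Gamma (a + (k + 1 : ℕ) + 1) = (a + k + 1) * Real.Gamma (a + k + 1) := by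
      rw [← Real.Gamma_add_one (by positivity)]
      push_cast
      ring_nf
    rw [h1]
    have h2 : (k : ℝ) + 1 ≠ 0 := by positivity
    push_cast
    generalize Real.Gamma (2 * a + 1) = G at *
    field_simp
    linear_combination (a + k + 1) * ih

/-- Legendre's duplication formula at `n/2 - m`. The value is the constant of the Riesz potential,
which identifies the limit `λ → 0` with `(-Δ)^{-m}`. -/
theorem profileZero_eq (hm : 1 ≤ m) (hn : 2 * m < n) : profileZero n m =
    Real.pi ^ (-(n : ℝ) / 2) * Real.Gamma ((n : ℝ) / 2 - m) / (4 ^ m * (m - 1).factorial) := by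
  have hn' : (2 : ℝ) * m + 1 ≤ n := by exact_mod_cast hn
  have hm' : (1 : ℝ) ≤ m := by exact_mod_cast hm
  have h1 := rootCoeff_mul_Gamma m (a := ((n : ℝ) - 2 * m - 1) / 2) (by linarith) (m - 1)
  rw [Nat.cast_sub hm] at h1
  have e1 : 2 * (((n : ℝ) - 2 * m - 1) / 2) + 1 = 2 * ((n : ℝ) / 2 - m) := by ring
  have e2 : ((n : ℝ) - 2 * m - 1) / 2 + (m - (1 : ℕ)) + 1 = ((n : ℝ) - 1) / 2 := by
    push_cast; ring
  have e3 : ((n : ℝ) - 2 * m - 1) / 2 + 1 = ((n : ℝ) / 2 - m) + 1 / 2 := by ring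
  rw [e1, e2, e3] at h1
  have h2 := Real.Gamma_mul_Gamma_add_half ((n : ℝ) / 2 - m)
  have hs : 0 < (n : ℝ) / 2 - m := by linarith
  have g1 : Real.Gamma ((n : ℝ) / 2 - m + 1 / 2) ≠ 0 := (Real.Gamma_pos_of_pos (by linarith)).ne'
  have g2 : Real.Gamma (((n : ℝ) - 1) / 2) ≠ 0 := (Real.Gamma_pos_of_pos (by linarith)).ne'
  have g3 : ((m - 1).factorial : ℝ) ≠ 0 := by positivity
  have hpi := Real.pi_pos
  rw [profileZero, kernelConst, Real.mul_rpow (by norm_num) hpi.le]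
  set R := rootCoeff m (((n : ℝ) - 2 * m - 1) / 2) (m - 1)
  have e4 : (2 : ℝ) ^ (1 - 2 * ((n : ℝ) / 2 - m)) =
      ((2 : ℝ) ^ (-(n : ℝ) / 2) * 2 ^ (1 - (n : ℝ) / 2)) * 4 ^ m := by
    rw [← Real.rpow_add two_pos, show (4 : ℝ) = 2 ^ 2 by norm_num, ← pow_mul,
      ← Real.rpow_natCast, ← Real.rpow_add two_pos]
    congr 1
    push_cast
    ring
  rw [e4] at h2
  have hR : R = m * Real.Gamma (2 * ((n : ℝ) / 2 - m)) * Real.Gamma (((n : ℝ) - 1) / 2) /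
      (Real.Gamma ((n : ℝ) / 2 - m + 1 / 2) * (m - 1).factorial) := by
    rw [eq_div_iff (mul_ne_zero g1 g3)]
    exact h1
  rw [hR]
  have hm0 : (m : ℝ) ≠ 0 := by positivity
  have hG : Real.Gamma ((n : ℝ) / 2 - m) = Real.Gamma (2 * ((n : ℝ) / 2 - m)) *
      ((2 : ℝ) ^ (-(n : ℝ) / 2) * 2 ^ (1 - (n : ℝ) / 2) * 4 ^ m) * Real.sqrt Real.pi /
        Real.Gamma ((n : ℝ) / 2 - m + 1 / 2) := by
    rw [eq_div_iff g1]
    exact h2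
  rw [hG]
  field_simp

/-! ### The fundamental solution of `(-Δ)^m` -/

open FourierTransform in
theorem fourier_laplacian_iterate (φ : SchwartzMap (Space n) ℂ) (k : ℕ) (ξ : Space n) :
    𝓕 (Laplacian.laplacian^[k] φ) ξ = (-(2 * Real.pi) ^ 2 * ‖ξ‖ ^ 2 : ℝ) ^ k * 𝓕 φ ξ := by
  induction k generalizing φ with
  | zero => simp
  | succ k ih =>
    rw [Function.iterate_succ_apply, ih, SchwartzMap.laplacian_eq_fourierMultiplierCLM,
      SchwartzMap.fourierMultiplierCLM_apply, FourierTransform.fourier_smul,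
      FourierTransform.fourier_fourierInv_eq]
    rw [smul_apply, SchwartzMap.smulLeftCLM_apply_apply (by fun_prop), pow_succ]
    simp only [Complex.real_smul]
    push_cast
    ring

/-- With `A = |ξ|²` this writes `|ξ|^{-2m}` as a superposition of the Gaussians `e^{-|ξ|²/c}`, whose
Fourier transforms are explicit. -/
theorem integral_rpow_mul_exp_neg_div (hm : 1 ≤ m) {A : ℝ} (hA : 0 < A) :
    ∫ c in Ioi (0 : ℝ), c ^ (-(m : ℝ) - 1) * Real.exp (-(A / c)) =
      (m - 1).factorial * (A ^ m)⁻¹ := by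
  have hm' : (0 : ℝ) < m := by exact_mod_cast hm
  have h1 := integral_comp_rpow_Ioi (fun s : ℝ => s ^ ((m : ℝ) - 1) * Real.exp (-(A * s)))
    (p := -1) (by norm_num)
  rw [Real.integral_rpow_mul_exp_neg_mul_Ioi hm' hA] at h1
  have h2 : Real.Gamma m = (m - 1).factorial := by
    rw [← Real.Gamma_nat_eq_factorial, Nat.cast_sub hm]; simp
  rw [h2, one_div, Real.rpow_natCast, inv_pow, mul_comm] at h1
  rw [← h1]
  refine setIntegral_congr_fun measurableSet_Ioi fun c (hc : 0 < c) => ?_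
  simp only [abs_neg, abs_one, one_mul, smul_eq_mul, Real.rpow_neg_one]
  rw [← Real.rpow_neg_one c, ← Real.rpow_mul hc.le, ← mul_assoc, ← Real.rpow_add hc,
    Real.rpow_neg_one, div_eq_mul_inv]
  congr 2
  ring

theorem integrable_schwartz_inv_norm_pow {γ : ℕ} (hγ : γ < n) (g : SchwartzMap (Space n) ℂ)
    (x : Space n) : Integrable fun y => (((‖x - y‖ ^ γ)⁻¹ : ℝ) : ℂ) * g y := by
  obtain ⟨C, hC⟩ := exists_lintegral_inv_norm_pow_mul_le (n := n) hγ
  obtain ⟨W, -, hW⟩ := g.decay 0 0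
  refine ⟨?_, ?_⟩
  · refine AEStronglyMeasurable.mul ?_ g.continuous.aestronglyMeasurable
    exact (by fun_prop : Measurable fun y : Space n =>
      (((‖x - y‖ ^ γ)⁻¹ : ℝ) : ℂ)).aestronglyMeasurable
  · have h1 := hC (fun y => ‖g y‖ₑ) (ENNReal.ofReal W) (fun y => by
      rw [← ofReal_norm]
      exact ENNReal.ofReal_le_ofReal (by simpa using hW y)) x
    refine lt_of_eq_of_lt ?_ (h1.trans_lt ?_)
    · refine lintegral_congr fun y => ?_
      rw [enorm_mul, ← ofReal_norm (((‖x - y‖ ^ γ)⁻¹ : ℝ) : ℂ), Complex.norm_real,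
        Real.norm_of_nonneg (by positivity)]
    · exact ENNReal.add_lt_top.2 ⟨ENNReal.mul_lt_top (by simp) (by simp), g.integrable.2⟩

open FourierTransform in
/-- Convolution of a Schwartz function with a Gaussian in terms of the Fourier transform. -/
theorem integral_gaussian_mul_schwartz (g : SchwartzMap (Space n) ℂ) (x : Space n) {c : ℝ}
    (hc : 0 < c) :
    ∫ ξ, Complex.exp (-(c⁻¹ : ℝ) * ‖ξ‖ ^ 2 + 2 * Real.pi * Complex.I * (inner ℝ x ξ : ℝ)) * 𝓕 g ξ =
      ∫ w, (((Real.pi * c) ^ ((n : ℝ) / 2) * Real.exp (-Real.pi ^ 2 * c * ‖x - w‖ ^ 2) : ℝ) : ℂ) *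
        g w := by
  have hb : 0 < (((c⁻¹ : ℝ) : ℂ)).re := by rw [Complex.ofReal_re]; positivity
  have J : Integrable (fun w : Space n =>
      Complex.exp (-(c⁻¹ : ℝ) * ‖w‖ ^ 2 + 2 * Real.pi * Complex.I * (inner ℝ x w : ℝ))) :=
    GaussianFourier.integrable_cexp_neg_mul_sq_norm_add hb _ _
  have h1 := VectorFourier.integral_fourierIntegral_smul_eq_flip (L := innerₗ (Space n))
      Real.continuous_fourierChar continuous_inner J (g.integrable (μ := volume))
  have h2 : ∀ w, VectorFourier.fourierIntegral Real.fourierChar volume (innerₗ (Space n))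
      (fun w : Space n =>
      Complex.exp (-(c⁻¹ : ℝ) * ‖w‖ ^ 2 + 2 * Real.pi * Complex.I * (inner ℝ x w : ℝ))) w =
      (((Real.pi * c) ^ ((n : ℝ) / 2) * Real.exp (-Real.pi ^ 2 * c * ‖x - w‖ ^ 2) : ℝ) : ℂ) := by
    intro w
    have := fourier_gaussian_innerProductSpace' hb x w
    rw [Real.fourier_eq] at this
    refine Eq.trans ?_ (this.trans ?_)
    · rfl
    · rw [finrank_euclideanSpace_fin, ← Complex.ofReal_div, div_inv_eq_mul]
      push_cast
      rw [Complex.ofReal_cpow (by positivity)]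
      congr 1
      · push_cast; rfl
      · congr 1
        field_simp
  simp_rw [h2] at h1
  rw [flip_innerₗ] at h1
  exact h1.symm

/-- As `h ≥ 0`, integrability of `H u` alone justifies Fubini. It is applied once in frequency and
once in position. -/
theorem integral_integral_mul_of_nonneg {h : ℝ → Space n → ℝ} {H : Space n → ℝ} {u : Space n → ℂ}
    (hmeas : Measurable (Function.uncurry h)) (h0 : ∀ c > 0, ∀ ξ, 0 ≤ h c ξ)
    (hi : ∀ᵐ ξ, IntegrableOn (fun c => h c ξ) (Ioi 0) ∧ ∫ c in Ioi 0, h c ξ = H ξ)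
    (hu : Continuous u) (hHu : Integrable fun ξ => (H ξ : ℂ) * u ξ) :
    ∫ c in Ioi 0, ∫ ξ, (h c ξ : ℂ) * u ξ = ∫ ξ, (H ξ : ℂ) * u ξ := by
  have hm' : Measurable (Function.uncurry fun c ξ => (h c ξ : ℂ) * u ξ) :=
    (Complex.measurable_ofReal.comp hmeas).mul (hu.measurable.comp measurable_snd)
  have hInt : Integrable (Function.uncurry fun c ξ => (h c ξ : ℂ) * u ξ)
      ((volume.restrict (Ioi 0)).prod volume) := by
    rw [integrable_prod_iff' hm'.aestronglyMeasurable]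
    constructor
    · filter_upwards [hi] with ξ hξ
      exact (hξ.1.ofReal (𝕜 := ℂ)).mul_const (u ξ)
    · refine hHu.norm.congr ?_
      filter_upwards [hi] with ξ hξ
      simp only [Function.uncurry, norm_mul]
      rw [integral_mul_const, ← hξ.2, Complex.norm_real]
      congr 1
      rw [Real.norm_of_nonneg (setIntegral_nonneg measurableSet_Ioi fun c hc => h0 c hc ξ)]
      refine setIntegral_congr_fun measurableSet_Ioi fun c hc => ?_
      rw [Complex.norm_real, Real.norm_of_nonneg (h0 c hc ξ)]
  rw [integral_integral_swap hInt]
  refine integral_congr_ae ?_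
  filter_upwards [hi] with ξ hξ
  rw [integral_mul_const, integral_complex_ofReal, hξ.2]

open FourierTransform in
/-- `|x|^{2m-n}`, normalised, is a fundamental solution of `(-Δ)^m`. -/
theorem integral_riesz (hm : 1 ≤ m) (hn : 2 * m < n) (φ : SchwartzMap (Space n) ℂ) (x : Space n) :
    ∫ y, (profileZero n m : ℂ) * (((‖x - y‖ ^ (n - 2 * m))⁻¹ : ℝ) : ℂ) *
      ((-1) ^ m * Laplacian.laplacian^[m] φ y) = φ x := by
  have : NeZero n := ⟨by omega⟩
  have : Nontrivial (Space n) := by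
    apply Module.nontrivial_of_finrank_pos (R := ℝ)
    rw [finrank_euclideanSpace_fin]; omega
  have hn' : (2 : ℝ) * m + 1 ≤ n := by exact_mod_cast hn
  have hpi := Real.pi_pos
  set g := Laplacian.laplacian^[m] φ with hg
  have hne : ∀ z : Space n, ∀ᵐ ξ : Space n, ξ ≠ z := fun z => by simp [ae_iff, measure_singleton]
  have hphase : Continuous fun ξ : Space n =>
      Complex.exp (2 * Real.pi * Complex.I * (inner ℝ x ξ : ℝ)) := by fun_prop
  -- The multiplier `|ξ|^{2m}` of `Δ^m` cancels the singularity `|ξ|^{-2m}`, so the frequency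
  -- integral converges absolutely although `|ξ|^{-2m}` itself does not decay fast enough at
  -- infinity in general.
  have e1 : ∀ ξ ≠ 0, ((((m - 1).factorial * ((‖ξ‖ ^ 2) ^ m)⁻¹ : ℝ)) : ℂ) *
      (Complex.exp (2 * Real.pi * Complex.I * (inner ℝ x ξ : ℝ)) * 𝓕 g ξ) =
      ((m - 1).factorial * (-(2 * Real.pi) ^ 2) ^ m : ℝ) *
        (Complex.exp (2 * Real.pi * Complex.I * (inner ℝ x ξ : ℝ)) * 𝓕 φ ξ) := by
    intro ξ hξ
    rw [hg, fourier_laplacian_iterate]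
    have : (‖ξ‖ : ℂ) ≠ 0 := by exact_mod_cast (norm_pos_iff.2 hξ).ne'
    push_cast
    rw [mul_pow]
    field_simp
  have hphase1 : ∀ ξ : Space n,
      ‖Complex.exp (2 * Real.pi * Complex.I * (inner ℝ x ξ : ℝ))‖ = 1 := by
    intro ξ
    rw [show 2 * (Real.pi : ℂ) * Complex.I * (inner ℝ x ξ : ℝ) =
      ((2 * Real.pi * inner ℝ x ξ : ℝ) : ℂ) * Complex.I by push_cast; ring,
      Complex.norm_exp_ofReal_mul_I]
  have hIφ : Integrable fun ξ => Complex.exp (2 * Real.pi * Complex.I * (inner ℝ x ξ : ℝ)) *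
      𝓕 φ ξ :=
    (𝓕 φ).integrable.bdd_mul hphase.aestronglyMeasurable (ae_of_all _ fun ξ => (hphase1 ξ).le)
  have hA := integral_integral_mul_of_nonneg (n := n)
    (h := fun c ξ => c ^ (-(m : ℝ) - 1) * Real.exp (-(‖ξ‖ ^ 2 / c)))
    (H := fun ξ => (m - 1).factorial * ((‖ξ‖ ^ 2) ^ m)⁻¹)
    (u := fun ξ => Complex.exp (2 * Real.pi * Complex.I * (inner ℝ x ξ : ℝ)) * 𝓕 g ξ)
    (by unfold Function.uncurry; fun_prop) (fun c hc ξ => by positivity)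
    (by
      filter_upwards [hne 0] with ξ hξ
      have hξ' := norm_pos_iff.2 hξ
      have h1 := integral_rpow_mul_exp_neg_div hm (A := ‖ξ‖ ^ 2) (by positivity)
      exact ⟨.of_integral_ne_zero (by rw [h1]; positivity), h1⟩)
    (hphase.mul (𝓕 g).continuous)
    ((hIφ.const_mul _).congr (by filter_upwards [hne 0] with ξ hξ using (e1 ξ hξ).symm))
  set K : ℝ := Real.pi ^ ((n : ℝ) / 2) * (1 / Real.pi ^ 2) ^ ((n : ℝ) / 2 - m) *
    Real.Gamma ((n : ℝ) / 2 - m) with hK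
  have hB := integral_integral_mul_of_nonneg (n := n)
    (h := fun c w => c ^ (-(m : ℝ) - 1) *
      ((Real.pi * c) ^ ((n : ℝ) / 2) * Real.exp (-Real.pi ^ 2 * c * ‖x - w‖ ^ 2)))
    (H := fun w => K * (‖x - w‖ ^ (n - 2 * m))⁻¹) (u := g)
    (by unfold Function.uncurry; fun_prop) (fun c hc ξ => by positivity)
    (by
      filter_upwards [hne x] with w hw
      have hw' : 0 < ‖x - w‖ := norm_pos_iff.2 (sub_ne_zero.2 hw.symm)
      have hs : 0 < (n : ℝ) / 2 - m := by linarith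
      have h1 := Real.integral_rpow_mul_exp_neg_mul_Ioi hs
        (r := Real.pi ^ 2 * ‖x - w‖ ^ 2) (by positivity)
      have h2 : ∫ c in Ioi (0 : ℝ), c ^ (-(m : ℝ) - 1) *
          ((Real.pi * c) ^ ((n : ℝ) / 2) * Real.exp (-Real.pi ^ 2 * c * ‖x - w‖ ^ 2)) =
          K * (‖x - w‖ ^ (n - 2 * m))⁻¹ := by
        have h3 : (1 / (Real.pi ^ 2 * ‖x - w‖ ^ 2)) ^ ((n : ℝ) / 2 - m) =
            (1 / Real.pi ^ 2) ^ ((n : ℝ) / 2 - m) * (‖x - w‖ ^ (n - 2 * m))⁻¹ := by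
          rw [one_div, mul_inv, Real.mul_rpow (by positivity) (by positivity), one_div]
          congr 1
          rw [Real.inv_rpow (by positivity), ← Real.rpow_natCast ‖x - w‖ 2,
            ← Real.rpow_mul hw'.le, ← Real.rpow_natCast _ (n - 2 * m), Nat.cast_sub hn.le]
          congr 2
          push_cast
          ring
        have h4 : K * (‖x - w‖ ^ (n - 2 * m))⁻¹ = Real.pi ^ ((n : ℝ) / 2) *
            ((1 / (Real.pi ^ 2 * ‖x - w‖ ^ 2)) ^ ((n : ℝ) / 2 - m) *
              Real.Gamma ((n : ℝ) / 2 - m)) := by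
          rw [h3, hK]; ring
        rw [h4, ← h1, ← integral_const_mul]
        refine setIntegral_congr_fun measurableSet_Ioi fun c (hc : 0 < c) => ?_
        beta_reduce
        rw [Real.mul_rpow hpi.le hc.le, show (n : ℝ) / 2 - m - 1 = (-(m : ℝ) - 1) + n / 2 by ring,
          Real.rpow_add hc, show -(Real.pi ^ 2 * ‖x - w‖ ^ 2 * c) =
            -Real.pi ^ 2 * c * ‖x - w‖ ^ 2 by ring]
        ring
      have hG := Real.Gamma_pos_of_pos hs
      exact ⟨.of_integral_ne_zero (by rw [h2, hK]; positivity), h2⟩)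
    g.continuous
    (by
      refine ((integrable_schwartz_inv_norm_pow (γ := n - 2 * m) (by omega) g x).const_mul
        (K : ℂ)).congr (ae_of_all _ fun w => ?_)
      simp only
      push_cast
      ring)
  -- For each fixed `c` the frequency side `hA` and the position side `hB` agree, by the Fourier
  -- transform of one Gaussian. Superposing over `c` gives `|ξ|^{-2m}` on the first and
  -- `|x-w|^{2m-n}` on the second.
  have hinner : ∀ c > 0, ∫ ξ, ((c ^ (-(m : ℝ) - 1) * Real.exp (-(‖ξ‖ ^ 2 / c)) : ℝ) : ℂ) *
      (Complex.exp (2 * Real.pi * Complex.I * (inner ℝ x ξ : ℝ)) * 𝓕 g ξ) =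
      ∫ w, ((c ^ (-(m : ℝ) - 1) * ((Real.pi * c) ^ ((n : ℝ) / 2) *
        Real.exp (-Real.pi ^ 2 * c * ‖x - w‖ ^ 2)) : ℝ) : ℂ) * g w := by
    intro c hc
    have h1 := integral_gaussian_mul_schwartz g x hc
    have h2 := congrArg (fun z => ((c ^ (-(m : ℝ) - 1) : ℝ) : ℂ) * z) h1
    simp only [← integral_const_mul] at h2
    refine Eq.trans (integral_congr_ae (ae_of_all _ fun ξ => ?_))
      (h2.trans (integral_congr_ae (ae_of_all _ fun w => ?_)))
    · simp only
      rw [Complex.exp_add]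
      push_cast
      rw [div_eq_mul_inv, mul_comm ((‖ξ‖ : ℂ) ^ 2), neg_mul]
      ring
    · simp only
      push_cast
      ring
  rw [setIntegral_congr_fun measurableSet_Ioi hinner] at hA
  rw [hA] at hB
  have hinv : ∫ ξ, Complex.exp (2 * Real.pi * Complex.I * (inner ℝ x ξ : ℝ)) * 𝓕 φ ξ = φ x := by
    have h1 : 𝓕⁻ (𝓕 φ) x = φ x := by rw [FourierTransform.fourierInv_fourier_eq]
    rw [← h1, SchwartzMap.fourierInv_coe, Real.fourierInv_eq']
    refine integral_congr_ae (ae_of_all _ fun ξ => ?_)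
    simp only [smul_eq_mul]
    rw [real_inner_comm]
    push_cast
    congr 2
    ring
  have hleft : ∫ ξ : Space n, ((((m - 1).factorial * ((‖ξ‖ ^ 2) ^ m)⁻¹ : ℝ)) : ℂ) *
      (Complex.exp (2 * Real.pi * Complex.I * (inner ℝ x ξ : ℝ)) * 𝓕 g ξ) =
      ((m - 1).factorial * (-(2 * Real.pi) ^ 2) ^ m : ℝ) * φ x := by
    rw [← hinv, ← integral_const_mul]
    exact integral_congr_ae (by filter_upwards [hne 0] with ξ hξ using e1 ξ hξ)
  rw [hleft] at hB
  have hconst : profileZero n m * ((m - 1).factorial * (2 * Real.pi) ^ (2 * m)) = K := by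
    rw [profileZero_eq hm hn, hK, one_div, Real.inv_rpow (by positivity), ← Real.rpow_natCast _ 2,
      ← Real.rpow_mul hpi.le, ← Real.rpow_neg hpi.le, ← Real.rpow_add hpi, mul_pow, pow_mul,
      ← Real.rpow_natCast Real.pi (2 * m)]
    have : Real.pi ^ ((n : ℝ) / 2 + -(((2 : ℕ) : ℝ) * ((n : ℝ) / 2 - m))) =
        Real.pi ^ (-(n : ℝ) / 2) * Real.pi ^ (((2 * m : ℕ) : ℝ)) := by
      rw [← Real.rpow_add hpi]
      congr 1
      push_cast
      ring
    rw [this]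
    have : ((m - 1).factorial : ℝ) ≠ 0 := by positivity
    norm_num
    field_simp
  have hq : ((m - 1).factorial * (2 * Real.pi) ^ (2 * m) : ℝ) ≠ 0 := by positivity
  have hqc : (((m - 1).factorial * (2 * Real.pi) ^ (2 * m) : ℝ) : ℂ) ≠ 0 := by exact_mod_cast hq
  have hsgn : (((m - 1).factorial * (-(2 * Real.pi) ^ 2) ^ m : ℝ) : ℂ) =
      ((m - 1).factorial * (2 * Real.pi) ^ (2 * m) : ℝ) * (-1) ^ m := by
    push_cast
    rw [neg_pow, ← pow_mul]
    ring
  rw [← mul_right_inj' hqc]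
  have hs1 : ((-1 : ℂ) ^ m) * (-1) ^ m = 1 := by rw [← mul_pow]; simp
  calc _ = (-1) ^ m * ∫ w, ((K * (‖x - w‖ ^ (n - 2 * m))⁻¹ : ℝ) : ℂ) * g w := by
        rw [← integral_const_mul, ← integral_const_mul]
        refine integral_congr_ae (ae_of_all _ fun w => ?_)
        simp only
        rw [← hconst]
        push_cast
        ring
    _ = _ := by
        rw [← hB, hsgn]
        linear_combination (((m - 1).factorial * (2 * Real.pi) ^ (2 * m) : ℝ) : ℂ) * φ x * hs1

end HigherSchrodinger

namespace HigherSchrodinger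

variable {n m : ℕ}

/-! ### Integral operators on `L²` -/

/-- The operator with the nonnegative kernel `k` has squared norm at most `C` on `L²`. -/
def SqBdd (k : Space n → Space n → ℝ≥0∞) (C : ℝ≥0∞) : Prop :=
  ∀ f : Space n → ℝ≥0∞, Measurable f → ∫⁻ x, (∫⁻ y, k x y * f y) ^ 2 ≤ C * ∫⁻ x, f x ^ 2

theorem SqBdd.mono {k k' : Space n → Space n → ℝ≥0∞} {C C' : ℝ≥0∞} (h : SqBdd k C)
    (hk : ∀ x, ∀ᵐ y, k' x y ≤ k x y) (hC : C ≤ C') : SqBdd k' C' := fun f hf =>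
  (lintegral_mono fun x => pow_le_pow_left₀ zero_le
    (lintegral_mono_ae ((hk x).mono fun _ hy => mul_le_mul_left hy _)) 2).trans
      ((h f hf).trans (mul_le_mul_left hC _))

theorem SqBdd.const_mul {k : Space n → Space n → ℝ≥0∞} {C : ℝ≥0∞} (h : SqBdd k C) {c : ℝ≥0∞}
    (hc : c ≠ ⊤) : SqBdd (fun x y => c * k x y) (c ^ 2 * C) := fun f hf => by
  have h1 : ∀ x, (∫⁻ y, c * k x y * f y) ^ 2 = c ^ 2 * (∫⁻ y, k x y * f y) ^ 2 := fun x => by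
    simp_rw [mul_assoc]
    rw [lintegral_const_mul' _ _ hc, mul_pow]
  simp_rw [h1]
  rw [lintegral_const_mul' _ _ (ENNReal.pow_ne_top hc), mul_assoc]
  exact mul_le_mul_right (h f hf) _

theorem add_sq_le_two_mul (a b : ℝ≥0∞) : (a + b) ^ 2 ≤ 2 * (a ^ 2 + b ^ 2) := by
  rcases eq_or_ne a ⊤ with rfl | ha
  · simp
  rcases eq_or_ne b ⊤ with rfl | hb
  · simp
  lift a to NNReal using ha
  lift b to NNReal using hb
  norm_cast
  exact add_sq_le

theorem SqBdd.add {k k' : Space n → Space n → ℝ≥0∞} {C C' : ℝ≥0∞} (h : SqBdd k C)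
    (h' : SqBdd k' C') (hk : Measurable (Function.uncurry k)) :
    SqBdd (fun x y => k x y + k' x y) (2 * (C + C')) := fun f hf => by
  have hm : ∀ x, Measurable fun y => k x y * f y := fun x =>
    (hk.comp (measurable_const.prodMk measurable_id)).mul hf
  have hm2 : Measurable fun x => (∫⁻ y, k x y * f y) ^ 2 :=
    (Measurable.lintegral_prod_right' (f := fun p : Space n × Space n => k p.1 p.2 * f p.2)
      (hk.mul (hf.comp measurable_snd))).pow_const 2
  calc _ ≤ ∫⁻ x, 2 * ((∫⁻ y, k x y * f y) ^ 2 + (∫⁻ y, k' x y * f y) ^ 2) := by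
        refine lintegral_mono fun x => ?_
        simp_rw [add_mul]
        rw [lintegral_add_left (hm x)]
        exact add_sq_le_two_mul _ _
    _ = 2 * ((∫⁻ x, (∫⁻ y, k x y * f y) ^ 2) + ∫⁻ x, (∫⁻ y, k' x y * f y) ^ 2) := by
        rw [lintegral_const_mul' _ _ (by simp), lintegral_add_left hm2]
    _ ≤ 2 * (C * (∫⁻ x, f x ^ 2) + C' * ∫⁻ x, f x ^ 2) := by
        gcongr
        · exact h f hf
        · exact h' f hf
    _ = _ := by ring

theorem lintegral_mul_sq_le {α : Type*} [MeasurableSpace α] (μ : Measure α) {f g : α → ℝ≥0∞}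
    (hf : AEMeasurable f μ) (hg : AEMeasurable g μ) :
    (∫⁻ a, f a * g a ∂μ) ^ 2 ≤ (∫⁻ a, f a ^ 2 ∂μ) * ∫⁻ a, g a ^ 2 ∂μ := by
  have h := ENNReal.lintegral_mul_le_Lp_mul_Lq μ Real.HolderConjugate.two_two hf hg
  have h2 := pow_le_pow_left₀ zero_le h 2
  rw [mul_pow, ← ENNReal.rpow_natCast, ← ENNReal.rpow_natCast, ← ENNReal.rpow_natCast,
    ← ENNReal.rpow_mul, ← ENNReal.rpow_mul] at h2
  simpa using h2

/-- Schur's test. -/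
theorem sqBdd_of_schur {k : Space n → Space n → ℝ≥0∞} (hk : Measurable (Function.uncurry k))
    {p : Space n → ℝ≥0∞} (hp : Measurable p) (hp0 : ∀ x, p x ≠ 0) (hp1 : ∀ x, p x ≠ ⊤) {A : ℝ≥0∞}
    (h1 : ∀ x, ∫⁻ y, k x y * p y ≤ A * p x) (h2 : ∀ y, ∫⁻ x, k x y * p x ≤ A * p y) :
    SqBdd k (A ^ 2) := fun f hf => by
  have hkx : ∀ x, Measurable fun y => k x y := fun x =>
    hk.comp (measurable_const.prodMk measurable_id)
  have e : ∀ a : ℝ≥0∞, (a ^ (2⁻¹ : ℝ)) ^ 2 = a := fun a => by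
    rw [← ENNReal.rpow_natCast, ← ENNReal.rpow_mul]; simp
  have e' : ∀ a : ℝ≥0∞, a ^ (2⁻¹ : ℝ) * a ^ (2⁻¹ : ℝ) = a := fun a => by rw [← sq, e]
  have hcs : ∀ x, (∫⁻ y, k x y * f y) ^ 2 ≤ A * p x * ∫⁻ y, k x y * ((p y)⁻¹ * f y ^ 2) := by
    intro x
    -- The test function `p` is inserted as `p^{1/2} p^{-1/2}`, so that Cauchy–Schwarz produces the
    -- row integral `∫ k p`.
    have hpt : ∀ y, k x y * f y = (k x y * p y) ^ (2⁻¹ : ℝ) *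
        ((k x y * (p y)⁻¹) ^ (2⁻¹ : ℝ) * f y) := by
      intro y
      rw [ENNReal.mul_rpow_of_nonneg _ _ (by norm_num), ENNReal.mul_rpow_of_nonneg _ _ (by norm_num)]
      calc k x y * f y = (k x y ^ (2⁻¹ : ℝ) * k x y ^ (2⁻¹ : ℝ)) *
            (p y * (p y)⁻¹) ^ (2⁻¹ : ℝ) * f y := by
            rw [e', ENNReal.mul_inv_cancel (hp0 y) (hp1 y)]; simp
        _ = _ := by
            rw [ENNReal.mul_rpow_of_nonneg _ _ (by norm_num)]; ring
    simp_rw [hpt]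
    refine (lintegral_mul_sq_le volume (((hkx x).mul hp).pow_const _).aemeasurable
      ((((hkx x).mul hp.inv).pow_const _).mul hf).aemeasurable).trans ?_
    have h3 : ∀ y, ((k x y * (p y)⁻¹) ^ (2⁻¹ : ℝ) * f y) ^ 2 = k x y * ((p y)⁻¹ * f y ^ 2) :=
      fun y => by rw [mul_pow, e, mul_assoc]
    simp_rw [e]
    exact mul_le_mul' (h1 x) (lintegral_mono fun y => (h3 y).le)
  calc _ ≤ ∫⁻ x, A * p x * ∫⁻ y, k x y * ((p y)⁻¹ * f y ^ 2) := lintegral_mono hcs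
    _ = ∫⁻ x, ∫⁻ y, A * p x * (k x y * ((p y)⁻¹ * f y ^ 2)) := by
        refine lintegral_congr fun x => ?_
        have hmy : Measurable fun y => k x y * ((p y)⁻¹ * f y ^ 2) :=
          (hkx x).mul (hp.inv.mul (hf.pow_const 2))
        rw [lintegral_const_mul _ hmy]
    _ = ∫⁻ y, ∫⁻ x, A * p x * (k x y * ((p y)⁻¹ * f y ^ 2)) := by
        refine lintegral_lintegral_swap (Measurable.aemeasurable ?_)
        exact ((hp.comp measurable_fst).const_mul A).mul
          (hk.mul ((hp.inv.mul (hf.pow_const 2)).comp measurable_snd))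
    _ = ∫⁻ y, A * ((p y)⁻¹ * f y ^ 2) * ∫⁻ x, k x y * p x := by
        refine lintegral_congr fun y => ?_
        have hmx : Measurable fun x => k x y * p x :=
          (hk.comp (measurable_id.prodMk measurable_const)).mul hp
        rw [← lintegral_const_mul _ hmx]
        refine lintegral_congr fun x => ?_
        ring
    _ ≤ ∫⁻ y, A * ((p y)⁻¹ * f y ^ 2) * (A * p y) :=
        lintegral_mono fun y => mul_le_mul_right (h2 y) _
    _ = ∫⁻ y, A ^ 2 * f y ^ 2 := by
        refine lintegral_congr fun y => ?_
        calc _ = A ^ 2 * (p y * (p y)⁻¹) * f y ^ 2 := by ring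
          _ = _ := by rw [ENNReal.mul_inv_cancel (hp0 y) (hp1 y), mul_one]
    _ = _ := lintegral_const_mul _ (hf.pow_const 2)

/-- Hilbert–Schmidt kernels. -/
theorem sqBdd_of_hilbertSchmidt {k : Space n → Space n → ℝ≥0∞}
    (hk : Measurable (Function.uncurry k)) : SqBdd k (∫⁻ x, ∫⁻ y, k x y ^ 2) := fun f hf => by
  have hkx : ∀ x, Measurable fun y => k x y := fun x =>
    hk.comp (measurable_const.prodMk measurable_id)
  have hm : Measurable fun x => ∫⁻ y, k x y ^ 2 :=
    Measurable.lintegral_prod_right' (f := fun p : Space n × Space n => k p.1 p.2 ^ 2)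
      (hk.pow_const 2)
  rw [← lintegral_mul_const _ hm]
  exact lintegral_mono fun x => lintegral_mul_sq_le _ (hkx x).aemeasurable hf.aemeasurable

theorem nonnegKernelBounded_of_sqBdd {a : Space n → ℝ≥0∞} (ha : ∀ x, a x ≤ 1)
    {k : Space n → Space n → ℝ≥0∞} {C : ℝ≥0∞} (hC : C ≠ ⊤) (h : SqBdd k C) :
    NonnegKernelBounded a k := by
  lift C to NNReal using hC
  refine ⟨2 * (1 + C), fun f hf => ?_⟩
  calc _ ≤ ∫⁻ x, 2 * (f x ^ 2 + (∫⁻ y, k x y * f y) ^ 2) := by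
        refine lintegral_mono fun x => (add_sq_le_two_mul _ _).trans ?_
        gcongr
        exact (mul_le_mul_left (ha x) _).trans_eq (one_mul _)
    _ = 2 * ((∫⁻ x, f x ^ 2) + ∫⁻ x, (∫⁻ y, k x y * f y) ^ 2) := by
        rw [lintegral_const_mul' _ _ (by simp), lintegral_add_left (hf.pow_const 2)]
    _ ≤ 2 * ((∫⁻ x, f x ^ 2) + C * ∫⁻ x, f x ^ 2) := by
        gcongr
        exact h f hf
    _ = _ := by push_cast; ring

theorem eLpNorm_two_sq {α E : Type*} [MeasurableSpace α] [NormedAddCommGroup E] {μ : Measure α}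
    (f : α → E) : eLpNorm f 2 μ ^ 2 = ∫⁻ x, ‖f x‖ₑ ^ 2 ∂μ := by
  rw [eLpNorm_eq_lintegral_rpow_enorm_toReal (by simp) (by simp), ← ENNReal.rpow_natCast,
    ← ENNReal.rpow_mul]
  simp

theorem lintegral_enorm_sq (f : L2 n) : ∫⁻ x, ‖f x‖ₑ ^ 2 = ‖f‖ₑ ^ 2 := by
  rw [← eLpNorm_two_sq, Lp.enorm_def]

theorem memLp_two_of_lintegral {f : Space n → ℂ} (hf : AEStronglyMeasurable f)
    (h : ∫⁻ x, ‖f x‖ₑ ^ 2 < ⊤) : MemLp f 2 := by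
  refine ⟨hf, ?_⟩
  rw [← eLpNorm_two_sq] at h
  by_contra h0
  rw [not_lt, top_le_iff] at h0
  simp [h0] at h

theorem measurable_enorm_coe (f : L2 n) : Measurable fun x => ‖f x‖ₑ :=
  (Lp.stronglyMeasurable f).enorm

theorem SqBdd.integrable_ae {K : Space n → Space n → ℂ} (hK : Measurable (Function.uncurry K))
    {C : ℝ≥0∞} (hC : C ≠ ⊤) (h : SqBdd (fun x y => ‖K x y‖ₑ) C) (f : L2 n) :
    ∀ᵐ x, Integrable fun y => K x y * f y := by
  have h1 := h _ (measurable_enorm_coe f)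
  rw [lintegral_enorm_sq] at h1
  have hm : Measurable fun x => (∫⁻ y, ‖K x y‖ₑ * ‖f y‖ₑ) ^ 2 :=
    (Measurable.lintegral_prod_right'
      (f := fun p : Space n × Space n => ‖K p.1 p.2‖ₑ * ‖f p.2‖ₑ)
      (hK.enorm.mul ((measurable_enorm_coe f).comp measurable_snd))).pow_const 2
  have h2 := ae_lt_top hm (h1.trans_lt (ENNReal.mul_lt_top hC.lt_top (by simp))).ne
  filter_upwards [h2] with x hx
  refine ⟨((hK.comp (measurable_const.prodMk measurable_id)).mul
    (Lp.stronglyMeasurable f).measurable).aestronglyMeasurable, ?_⟩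
  have h3 : (∫⁻ y, ‖K x y‖ₑ * ‖f y‖ₑ) < ⊤ := by
    by_contra h0
    rw [not_lt, top_le_iff] at h0
    simp [h0] at hx
  simpa [HasFiniteIntegral, enorm_mul] using h3

theorem HasKernel.enorm_sq_le {T : L2 n →L[ℂ] L2 n} {K : Space n → Space n → ℂ} {C : ℝ≥0∞}
    (hT : HasKernel T 0 K) (h : SqBdd (fun x y => ‖K x y‖ₑ) C) (f : L2 n) :
    ‖T f‖ₑ ^ 2 ≤ C * ‖f‖ₑ ^ 2 := by
  have h1 := h _ (measurable_enorm_coe f)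
  rw [lintegral_enorm_sq] at h1
  rw [← lintegral_enorm_sq]
  refine le_trans (lintegral_mono_ae ?_) h1
  filter_upwards [hT f] with x hx
  rw [hx.2]
  simp only [Pi.zero_apply, zero_mul, zero_add]
  refine pow_le_pow_left₀ zero_le ((enorm_integral_le_lintegral_enorm _).trans_eq ?_) 2
  simp_rw [enorm_mul]

theorem HasKernel.norm_le {T : L2 n →L[ℂ] L2 n} {K : Space n → Space n → ℂ} {C : ℝ}
    (hC : 0 ≤ C) (hT : HasKernel T 0 K) (h : SqBdd (fun x y => ‖K x y‖ₑ) (ENNReal.ofReal (C ^ 2))) :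
    ‖T‖ ≤ C := by
  refine T.opNorm_le_bound hC fun f => ?_
  have h1 := hT.enorm_sq_le h f
  rw [← ofReal_norm, ← ofReal_norm, ← ENNReal.ofReal_pow (norm_nonneg _),
    ← ENNReal.ofReal_pow (norm_nonneg _), ← ENNReal.ofReal_mul (by positivity),
    ENNReal.ofReal_le_ofReal_iff (by positivity), ← mul_pow] at h1
  exact (sq_le_sq₀ (norm_nonneg _) (by positivity)).1 h1

theorem HasKernel.unique {T T' : L2 n →L[ℂ] L2 n} {a : Space n → ℂ} {K K' : Space n → Space n → ℂ}
    (hT : HasKernel T a K) (hT' : HasKernel T' a K') (hK : ∀ x, ∀ᵐ y, K x y = K' x y) :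
    T = T' := by
  ext1 f
  refine Lp.ext ?_
  filter_upwards [hT f, hT' f] with x h1 h2
  rw [h1.2, h2.2]
  congr 1
  exact integral_congr_ae ((hK x).mono fun y hy => by simp only [hy])

/-- Kernels matter only up to a null set of `y` for each `x`. This permits arbitrary values on the
diagonal throughout. -/
theorem HasKernel.congr {T : L2 n →L[ℂ] L2 n} {a : Space n → ℂ} {K K' : Space n → Space n → ℂ}
    (hT : HasKernel T a K) (hK : ∀ x, ∀ᵐ y, K x y = K' x y) : HasKernel T a K' := by
  intro f
  filter_upwards [hT f] with x h1
  have h2 : (fun y => K x y * f y) =ᵐ[volume] fun y => K' x y * f y :=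
    (hK x).mono fun y hy => by simp only [hy]
  exact ⟨h1.1.congr h2, by rw [h1.2, integral_congr_ae h2]⟩

theorem HasKernel.kernelOp_eq {T : L2 n →L[ℂ] L2 n} {a : Space n → ℂ} {K : Space n → Space n → ℂ}
    (hT : HasKernel T a K) : kernelOp a K = T := by
  have h : ∃ T, HasKernel T a K := ⟨T, hT⟩
  rw [kernelOp, dif_pos h]
  exact h.choose_spec.unique hT fun x => ae_of_all _ fun y => rfl

theorem exists_hasKernel {K : Space n → Space n → ℂ} (hK : Measurable (Function.uncurry K))
    {C : ℝ≥0∞} (hC : C ≠ ⊤) (h : SqBdd (fun x y => ‖K x y‖ₑ) C) : ∃ T, HasKernel T 0 K := by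
  have hmeas : ∀ f : L2 n, StronglyMeasurable fun x => ∫ y, K x y * f y := fun f =>
    StronglyMeasurable.integral_prod_right' (f := fun p : Space n × Space n => K p.1 p.2 * f p.2)
      (hK.mul ((Lp.stronglyMeasurable f).measurable.comp measurable_snd)).stronglyMeasurable
  have hle : ∀ f : L2 n, ∫⁻ x, ‖∫ y, K x y * f y‖ₑ ^ 2 ≤ C * ‖f‖ₑ ^ 2 := fun f => by
    have h1 := h _ (measurable_enorm_coe f)
    rw [lintegral_enorm_sq] at h1
    refine le_trans (lintegral_mono fun x => ?_) h1
    refine pow_le_pow_left₀ zero_le ((enorm_integral_le_lintegral_enorm _).trans_eq ?_) 2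
    simp_rw [enorm_mul]
  have hmem : ∀ f : L2 n, MemLp (fun x => ∫ y, K x y * f y) 2 := fun f =>
    memLp_two_of_lintegral (hmeas f).aestronglyMeasurable
      ((hle f).trans_lt (ENNReal.mul_lt_top hC.lt_top (by simp)))
  have hInt := fun f => h.integrable_ae hK hC f
  let T₀ : L2 n →ₗ[ℂ] L2 n :=
    { toFun := fun f => (hmem f).toLp
      map_add' := fun f g => by
        refine Lp.ext ?_
        filter_upwards [(hmem (f + g)).coeFn_toLp, (hmem f).coeFn_toLp, (hmem g).coeFn_toLp,
          Lp.coeFn_add (hmem f).toLp (hmem g).toLp, hInt f, hInt g] with x h1 h2 h3 h4 h5 h6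
        rw [h1, h4, Pi.add_apply, h2, h3, ← integral_add h5 h6]
        refine integral_congr_ae ?_
        filter_upwards [Lp.coeFn_add f g] with y hy
        rw [hy, Pi.add_apply, mul_add]
      map_smul' := fun c f => by
        refine Lp.ext ?_
        filter_upwards [(hmem (c • f)).coeFn_toLp, (hmem f).coeFn_toLp,
          Lp.coeFn_smul c (hmem f).toLp] with x h1 h2 h3
        rw [h1, RingHom.id_apply, h3, Pi.smul_apply, h2, smul_eq_mul, ← integral_const_mul]
        refine integral_congr_ae ?_
        filter_upwards [Lp.coeFn_smul c f] with y hy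
        rw [hy, Pi.smul_apply, smul_eq_mul]
        ring }
  lift C to NNReal using hC
  have hbd : ∀ f, ‖T₀ f‖ ≤ NNReal.sqrt C * ‖f‖ := fun f => by
    have h1 := hle f
    have h2 : ‖T₀ f‖ₑ ^ 2 ≤ C * ‖f‖ₑ ^ 2 := by
      rw [← lintegral_enorm_sq]
      refine le_trans (lintegral_mono_ae ?_) h1
      filter_upwards [(hmem f).coeFn_toLp] with x hx
      rw [← hx]
      exact le_rfl
    rw [enorm_eq_nnnorm, enorm_eq_nnnorm] at h2
    norm_cast at h2
    have h3 : ‖T₀ f‖₊ ≤ NNReal.sqrt C * ‖f‖₊ := by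
      rw [← NNReal.sqrt_sq ‖f‖₊, ← NNReal.sqrt_mul, ← NNReal.sqrt_sq ‖T₀ f‖₊]
      exact NNReal.sqrt_le_sqrt.2 h2
    exact NNReal.coe_le_coe.2 h3
  refine ⟨T₀.mkContinuous _ hbd, fun f => ?_⟩
  filter_upwards [hInt f, (hmem f).coeFn_toLp] with x h1 h2
  refine ⟨h1, ?_⟩
  simp only [Pi.zero_apply, zero_mul, zero_add]
  rw [← h2]
  rfl

/-- Bounded multiplication operators. -/
theorem exists_hasKernel_mul {a : Space n → ℂ} (ha : Measurable a) (ha1 : ∀ x, ‖a x‖ ≤ 1) :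
    ∃ T, HasKernel T a 0 := by
  have hmem : ∀ f : L2 n, MemLp (fun x => a x * f x) 2 := fun f =>
    (Lp.memLp f).of_le (ha.aestronglyMeasurable.mul (Lp.aestronglyMeasurable f))
      (ae_of_all _ fun x => by
        rw [norm_mul]
        exact mul_le_of_le_one_left (norm_nonneg _) (ha1 x))
  let T₀ : L2 n →ₗ[ℂ] L2 n :=
    { toFun := fun f => (hmem f).toLp
      map_add' := fun f g => by
        refine Lp.ext ?_
        filter_upwards [(hmem (f + g)).coeFn_toLp, (hmem f).coeFn_toLp, (hmem g).coeFn_toLp,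
          Lp.coeFn_add (hmem f).toLp (hmem g).toLp, Lp.coeFn_add f g] with x h1 h2 h3 h4 h5
        rw [h1, h4, Pi.add_apply, h2, h3, h5, Pi.add_apply, mul_add]
      map_smul' := fun c f => by
        refine Lp.ext ?_
        filter_upwards [(hmem (c • f)).coeFn_toLp, (hmem f).coeFn_toLp,
          Lp.coeFn_smul c (hmem f).toLp, Lp.coeFn_smul c f] with x h1 h2 h3 h4
        rw [h1, RingHom.id_apply, h3, Pi.smul_apply, h2, h4, Pi.smul_apply, smul_eq_mul,
          smul_eq_mul]
        ring }
  have hbd : ∀ f, ‖T₀ f‖ ≤ 1 * ‖f‖ := fun f => by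
    refine Lp.norm_le_mul_norm_of_ae_le_mul ?_
    filter_upwards [(hmem f).coeFn_toLp] with x hx
    change ‖(hmem f).toLp _ x‖ ≤ _
    rw [hx, norm_mul]
    exact mul_le_mul_of_nonneg_right (ha1 x) (norm_nonneg _)
  refine ⟨T₀.mkContinuous _ hbd, fun f => ?_⟩
  filter_upwards [(hmem f).coeFn_toLp] with x h2
  simp only [Pi.zero_apply, zero_mul, integral_zero, add_zero]
  exact ⟨integrable_zero _ _ _, h2⟩

theorem HasKernel.add {T T' : L2 n →L[ℂ] L2 n} {a a' : Space n → ℂ}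
    {K K' : Space n → Space n → ℂ} (hT : HasKernel T a K) (hT' : HasKernel T' a' K') :
    HasKernel (T + T') (fun x => a x + a' x) (fun x y => K x y + K' x y) := by
  intro f
  filter_upwards [hT f, hT' f, Lp.coeFn_add (T f) (T' f)] with x h1 h2 h3
  simp_rw [add_mul]
  refine ⟨h1.1.add h2.1, ?_⟩
  rw [integral_add h1.1 h2.1, _root_.add_apply, h3, Pi.add_apply, h1.2, h2.2]
  ring

theorem HasKernel.neg {T : L2 n →L[ℂ] L2 n} {a : Space n → ℂ}
    {K : Space n → Space n → ℂ} (hT : HasKernel T a K) :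
    HasKernel (-T) (fun x => -a x) (fun x y => -K x y) := by
  intro f
  filter_upwards [hT f, Lp.coeFn_neg (T f)] with x h1 h3
  simp_rw [neg_mul]
  refine ⟨h1.1.neg, ?_⟩
  rw [integral_neg, _root_.neg_apply, h3, Pi.neg_apply, h1.2]
  ring

theorem HasKernel.mul_left {T W : L2 n →L[ℂ] L2 n} {a : Space n → ℂ}
    {K : Space n → Space n → ℂ} (hT : HasKernel T 0 K) (hW : HasKernel W a 0) :
    HasKernel (W * T) 0 (fun x y => a x * K x y) := by
  intro f
  filter_upwards [hT f, hW (T f)] with x h1 h2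
  simp_rw [mul_assoc]
  refine ⟨h1.1.const_mul _, ?_⟩
  rw [mul_apply_eq_comp, h2.2, h1.2, integral_const_mul]
  simp

theorem HasKernel.mul_right {T W : L2 n →L[ℂ] L2 n} {a : Space n → ℂ}
    {K : Space n → Space n → ℂ} (hT : HasKernel T 0 K) (hW : HasKernel W a 0) :
    HasKernel (T * W) 0 (fun x y => K x y * a y) := by
  intro f
  filter_upwards [hT (W f)] with x h1
  have h2 : (fun y => K x y * (W f) y) =ᵐ[volume] fun y => K x y * a y * f y := by
    filter_upwards [hW f] with y hy
    rw [hy.2]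
    simp [mul_assoc]
  refine ⟨h1.1.congr h2, ?_⟩
  rw [mul_apply_eq_comp, h1.2, integral_congr_ae h2]
  simp

end HigherSchrodinger

namespace HigherSchrodinger

variable {n m : ℕ}

/-! ### Weighted kernels with a singularity on the diagonal -/

/-- The weight `⟨x⟩^{-σ}`. -/
noncomputable def weight (σ : ℝ) (x : Space n) : ℝ := bracket x ^ (-σ)

/-- The majorant `⟨x⟩^{-σ} ⟨y⟩^{-σ} (1 + |x-y|^{-γ})`. -/
noncomputable def major (σ : ℝ) (γ : ℕ) (x y : Space n) : ℝ :=
  weight σ x * weight σ y * (1 + (‖x - y‖ ^ γ)⁻¹)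

theorem one_le_bracket (x : Space n) : 1 ≤ bracket x := by
  rw [bracket, Real.one_le_sqrt]
  nlinarith [sq_nonneg ‖x‖]

theorem bracket_pos (x : Space n) : 0 < bracket x := one_pos.trans_le (one_le_bracket x)

theorem weight_pos (σ : ℝ) (x : Space n) : 0 < weight σ x := Real.rpow_pos_of_pos (bracket_pos x) _

theorem weight_le_one {σ : ℝ} (hσ : 0 ≤ σ) (x : Space n) : weight σ x ≤ 1 :=
  Real.rpow_le_one_of_one_le_of_nonpos (one_le_bracket x) (by linarith)

theorem measurable_bracket : Measurable (bracket : Space n → ℝ) := by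
  unfold bracket; fun_prop

theorem measurable_weight (σ : ℝ) : Measurable (weight σ : Space n → ℝ) :=
  measurable_bracket.pow_const _

theorem lintegral_weight_sq_lt_top {σ : ℝ} (hσ : (n : ℝ) < 2 * σ) :
    ∫⁻ x : Space n, ENNReal.ofReal (weight σ x) ^ 2 < ⊤ := by
  have h := integrable_rpow_neg_one_add_norm_sq (E := Space n) (μ := volume) (r := 2 * σ)
    (by rwa [finrank_euclideanSpace_fin])
  refine lt_of_eq_of_lt (lintegral_congr fun x => ?_) h.lintegral_lt_top
  rw [← ENNReal.ofReal_pow (weight_pos σ x).le, weight, bracket, Real.sqrt_eq_rpow,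
    ← Real.rpow_mul (by positivity), ← Real.rpow_natCast, ← Real.rpow_mul (by positivity)]
  congr 2
  push_cast
  ring

theorem memLp_weight {σ : ℝ} (hσ : (n : ℝ) < 2 * σ) :
    MemLp (fun x : Space n => (weight σ x : ℂ)) 2 := by
  refine memLp_two_of_lintegral
    (Complex.measurable_ofReal.comp (measurable_weight σ)).aestronglyMeasurable ?_
  refine lt_of_eq_of_lt (lintegral_congr fun x => ?_) (lintegral_weight_sq_lt_top hσ)
  rw [← ofReal_norm, Complex.norm_real, Real.norm_of_nonneg (weight_pos σ x).le]

theorem major_pos (σ : ℝ) (γ : ℕ) (x y : Space n) : 0 < major σ γ x y :=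
  mul_pos (mul_pos (weight_pos σ x) (weight_pos σ y)) (by positivity)

theorem major_symm (σ : ℝ) (γ : ℕ) (x y : Space n) : major σ γ x y = major σ γ y x := by
  rw [major, major, norm_sub_rev, mul_comm (weight σ x)]

theorem measurable_major (σ : ℝ) (γ : ℕ) :
    Measurable (Function.uncurry (major σ γ : Space n → Space n → ℝ)) := by
  have h1 := (measurable_weight (n := n) σ).comp
    (measurable_fst : Measurable (Prod.fst : Space n × Space n → Space n))
  have h2 := (measurable_weight (n := n) σ).comp
    (measurable_snd : Measurable (Prod.snd : Space n × Space n → Space n))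
  exact (h1.mul h2).mul (by fun_prop :
    Measurable fun p : Space n × Space n => 1 + (‖p.1 - p.2‖ ^ γ)⁻¹)

theorem inv_pow_le_one_add {γ γ' : ℕ} (h : γ ≤ γ') {r : ℝ} (hr : 0 ≤ r) :
    1 + (r ^ γ)⁻¹ ≤ 2 * (1 + (r ^ γ')⁻¹) := by
  rcases hr.eq_or_lt with rfl | hr
  · rcases Nat.eq_zero_or_pos γ with rfl | h0
    · rcases Nat.eq_zero_or_pos γ' with rfl | h1
      · norm_num
      · simp [h1.ne']; norm_num
    · simp [h0.ne', (h0.trans_le h).ne']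
  rcases le_total 1 r with h1 | h1
  · have : (r ^ γ)⁻¹ ≤ 1 := inv_le_one_of_one_le₀ (one_le_pow₀ h1)
    have : 0 ≤ (r ^ γ')⁻¹ := by positivity
    linarith
  · have : (r ^ γ)⁻¹ ≤ (r ^ γ')⁻¹ :=
      inv_anti₀ (by positivity) (pow_le_pow_of_le_one hr.le h1 h)
    have : 0 ≤ (r ^ γ')⁻¹ := by positivity
    linarith

theorem major_le (σ : ℝ) {γ γ' : ℕ} (h : γ ≤ γ') (x y : Space n) :
    major σ γ x y ≤ 2 * major σ γ' x y := by
  have := mul_le_mul_of_nonneg_left (inv_pow_le_one_add h (norm_nonneg (x - y)))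
    (mul_pos (weight_pos σ x) (weight_pos σ y)).le
  rw [major, major]
  linarith

/-- The mass of the singularity in a ball. -/
noncomputable def ballMass (n γ : ℕ) (δ : ℝ) : ℝ≥0∞ :=
  ∫⁻ y in Metric.ball (0 : Space n) δ, ENNReal.ofReal (1 + (‖y‖ ^ γ)⁻¹)

theorem ballMass_one_lt_top {γ : ℕ} (hγ : γ < n) : ballMass n γ 1 < ⊤ := by
  have h1 : IntegrableOn (fun y : Space n => 1 + (‖y‖ ^ γ)⁻¹) (Metric.ball 0 1) :=
    (integrableOn_const (by exact measure_ball_lt_top.ne)).add (integrableOn_inv_norm_pow hγ)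
  exact h1.lintegral_lt_top

/-- Absolute continuity of the integral, as the volume of the balls tends to zero. -/
theorem tendsto_ballMass {γ : ℕ} (hγ : γ < n) :
    Tendsto (fun i : ℕ => ballMass n γ (1 / ((i : ℝ) + 1))) atTop (𝓝 0) := by
  have hnull : Tendsto (fun i : ℕ => (volume.restrict (Metric.ball (0 : Space n) 1))
      (Metric.ball (0 : Space n) (1 / ((i : ℝ) + 1)))) atTop (𝓝 0) := by
    have hvol : ∀ i : ℕ, (volume.restrict (Metric.ball (0 : Space n) 1))
        (Metric.ball (0 : Space n) (1 / ((i : ℝ) + 1))) ≤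
        ENNReal.ofReal ((1 / ((i : ℝ) + 1)) ^ n) * volume (Metric.ball (0 : Space n) 1) := by
      intro i
      refine (Measure.restrict_apply_le _ _).trans ?_
      rw [Measure.addHaar_ball_of_pos _ _ (by positivity), finrank_euclideanSpace_fin]
    refine tendsto_of_tendsto_of_tendsto_of_le_of_le tendsto_const_nhds ?_ (fun _ => zero_le) hvol
    have h1 : Tendsto (fun i : ℕ => (1 / ((i : ℝ) + 1)) ^ n) atTop (𝓝 0) := by
      have := (tendsto_one_div_add_atTop_nhds_zero_nat (𝕜 := ℝ)).pow n
      rwa [zero_pow (by omega)] at this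
    have h2 := ENNReal.Tendsto.mul_const (b := volume (Metric.ball (0 : Space n) 1))
      (ENNReal.tendsto_ofReal h1) (Or.inr measure_ball_lt_top.ne)
    simpa using h2
  have h := tendsto_setLIntegral_zero (μ := volume.restrict (Metric.ball (0 : Space n) 1))
    (f := fun y : Space n => ENNReal.ofReal (1 + (‖y‖ ^ γ)⁻¹)) (ballMass_one_lt_top hγ).ne hnull
  refine h.congr fun i => ?_
  rw [Measure.restrict_restrict measurableSet_ball, inter_eq_left.2, ballMass]
  refine Metric.ball_subset_ball ?_
  rw [div_le_one (by positivity)]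
  linarith [(Nat.cast_nonneg i : (0 : ℝ) ≤ i)]

theorem setLIntegral_ball_add_eq (γ : ℕ) (x : Space n) (r : ℝ) :
    ∫⁻ y in Metric.ball x r, ENNReal.ofReal (1 + (‖x - y‖ ^ γ)⁻¹) = ballMass n γ r := by
  rw [ballMass, ← lintegral_indicator measurableSet_ball, ← lintegral_indicator measurableSet_ball,
    ← lintegral_sub_left_eq_self _ x]
  congr 1
  ext y
  simp only [indicator, Metric.mem_ball, dist_eq_norm]
  simp only [sub_sub_cancel_left, norm_neg, sub_sub_cancel, sub_zero]

theorem measurableSet_dist_lt (δ : ℝ) :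
    MeasurableSet {p : Space n × Space n | ‖p.1 - p.2‖ < δ} :=
  measurableSet_lt (by fun_prop) measurable_const

/-- Schur's test with the weight itself as test function: `⟨y⟩^{-σ}` occurs twice in a row integral
and is discarded, while `⟨x⟩^{-σ}` reproduces the test function. -/
theorem sqBdd_near {σ : ℝ} (hσ : 0 ≤ σ) (γ : ℕ) (δ : ℝ) :
    SqBdd (fun x y : Space n => if ‖x - y‖ < δ then ENNReal.ofReal (major σ γ x y) else 0)
      (ballMass n γ δ ^ 2) := by
  have hrow : ∀ x : Space n, ∫⁻ y, (if ‖x - y‖ < δ then ENNReal.ofReal (major σ γ x y) else 0) *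
      ENNReal.ofReal (weight σ y) ≤ ballMass n γ δ * ENNReal.ofReal (weight σ x) := by
    intro x
    rw [← setLIntegral_ball_add_eq γ x δ, ← lintegral_indicator measurableSet_ball,
      ← lintegral_mul_const _ (Measurable.indicator (by fun_prop) measurableSet_ball)]
    refine lintegral_mono fun y => ?_
    simp only [indicator, Metric.mem_ball, dist_eq_norm, norm_sub_rev y x]
    split_ifs with h
    · rw [← ENNReal.ofReal_mul (major_pos σ γ x y).le, ← ENNReal.ofReal_mul (by positivity)]
      refine ENNReal.ofReal_le_ofReal ?_
      rw [major]
      have h1 := weight_pos σ x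
      have h2 := weight_pos σ y
      have h3 : weight σ y * weight σ y ≤ 1 :=
        mul_le_one₀ (weight_le_one hσ y) h2.le (weight_le_one hσ y)
      have h4 : 0 ≤ weight σ x * (1 + (‖x - y‖ ^ γ)⁻¹) := by positivity
      nlinarith [mul_le_mul_of_nonneg_left h3 h4]
    · simp
  refine sqBdd_of_schur (p := fun x => ENNReal.ofReal (weight σ x)) ?_
    (measurable_weight σ).ennreal_ofReal (fun x => by simpa using weight_pos σ x)
    (fun x => ENNReal.ofReal_ne_top) hrow fun y => ?_
  · exact Measurable.ite (measurableSet_dist_lt δ) (measurable_major σ γ).ennreal_ofReal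
      measurable_const
  · refine le_of_eq_of_le (lintegral_congr fun x => ?_) (hrow y)
    rw [major_symm, norm_sub_rev]

/-- A singularity of order `γ < n` need not be square integrable, so the Hilbert–Schmidt norm is
used only for `|x - y| ≥ δ`. The near part costs `ballMass`, which is small with `δ`. -/
theorem sqBdd_split {σ : ℝ} (hσ : 0 ≤ σ) (γ : ℕ) (δ : ℝ) {k : Space n → Space n → ℝ≥0∞}
    (hk : Measurable (Function.uncurry k)) {c : ℝ≥0∞} (hc : c ≠ ⊤)
    (hle : ∀ x y, k x y ≤ c * ENNReal.ofReal (major σ γ x y)) :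
    SqBdd k (2 * (c ^ 2 * ballMass n γ δ ^ 2 +
      ∫⁻ x, ∫⁻ y, (if ‖x - y‖ < δ then 0 else k x y) ^ 2)) := by
  have h1 := (sqBdd_near (n := n) hσ γ δ).const_mul hc
  have hf : Measurable (Function.uncurry fun x y : Space n => if ‖x - y‖ < δ then 0 else k x y) :=
    Measurable.ite (measurableSet_dist_lt δ) measurable_const hk
  refine (h1.add (sqBdd_of_hilbertSchmidt hf) ?_).mono
    (fun x => ae_of_all _ fun y => ?_) le_rfl
  · exact (Measurable.ite (measurableSet_dist_lt δ) (measurable_major σ γ).ennreal_ofReal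
      measurable_const).const_mul c
  · split_ifs with h
    · rw [add_zero]; exact hle x y
    · rw [mul_zero, zero_add]

theorem far_le {σ : ℝ} {γ : ℕ} {δ : ℝ} (hδ : 0 < δ) {x y : Space n} (h : ¬ ‖x - y‖ < δ) :
    major σ γ x y ≤ weight σ x * weight σ y * (1 + (δ ^ γ)⁻¹) := by
  rw [major]
  have := mul_pos (weight_pos σ x) (weight_pos σ y)
  gcongr
  exact not_lt.1 h

theorem lintegral_weight_mul_lt_top {σ : ℝ} (hσ : (n : ℝ) < 2 * σ) {c : ℝ≥0∞} (hc : c ≠ ⊤) :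
    ∫⁻ x : Space n, ∫⁻ y : Space n,
      (c * (ENNReal.ofReal (weight σ x) * ENNReal.ofReal (weight σ y))) ^ 2 < ⊤ := by
  have hw : Measurable fun x : Space n => ENNReal.ofReal (weight σ x) ^ 2 :=
    (measurable_weight σ).ennreal_ofReal.pow_const 2
  simp_rw [mul_pow]
  have h1 : ∀ x : Space n, ∫⁻ y : Space n,
      c ^ 2 * (ENNReal.ofReal (weight σ x) ^ 2 * ENNReal.ofReal (weight σ y) ^ 2) =
      c ^ 2 * (∫⁻ y : Space n, ENNReal.ofReal (weight σ y) ^ 2) *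
        ENNReal.ofReal (weight σ x) ^ 2 := fun x => by
    rw [lintegral_const_mul _ (hw.const_mul _), lintegral_const_mul _ hw]
    ring
  simp_rw [h1]
  rw [lintegral_const_mul _ hw]
  have := lintegral_weight_sq_lt_top hσ
  exact ENNReal.mul_lt_top (ENNReal.mul_lt_top (ENNReal.pow_ne_top hc).lt_top this) this

theorem far_ofReal_le {σ : ℝ} {γ : ℕ} {δ : ℝ} (hδ : 0 < δ) {c : ℝ≥0∞} {k : ℝ≥0∞} {x y : Space n}
    (hle : k ≤ c * ENNReal.ofReal (major σ γ x y)) :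
    (if ‖x - y‖ < δ then 0 else k) ^ 2 ≤ (c * ENNReal.ofReal (1 + (δ ^ γ)⁻¹) *
      (ENNReal.ofReal (weight σ x) * ENNReal.ofReal (weight σ y))) ^ 2 := by
  refine pow_le_pow_left₀ zero_le ?_ 2
  split_ifs with h
  · exact zero_le
  · refine hle.trans ?_
    rw [mul_assoc]
    refine mul_le_mul_right ((ENNReal.ofReal_le_ofReal (far_le hδ h)).trans_eq ?_) _
    rw [ENNReal.ofReal_mul (mul_pos (weight_pos σ x) (weight_pos σ y)).le,
      ENNReal.ofReal_mul (weight_pos σ x).le, mul_comm]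

theorem exists_sqBdd_major {σ : ℝ} (hσ : (n : ℝ) < 2 * σ) {γ : ℕ} (hγ : γ < n) :
    ∃ A : NNReal, SqBdd (fun x y : Space n => ENNReal.ofReal (major σ γ x y)) A := by
  have hσ0 : 0 ≤ σ := by linarith [(Nat.cast_nonneg n : (0 : ℝ) ≤ n)]
  have h := sqBdd_split (n := n) hσ0 γ 1 (measurable_major σ γ).ennreal_ofReal
    (c := 1) (by simp) (fun x y => by rw [one_mul])
  have hfin : ∫⁻ x : Space n, ∫⁻ y : Space n,
      (if ‖x - y‖ < 1 then 0 else ENNReal.ofReal (major σ γ x y)) ^ 2 < ⊤ := by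
    refine lt_of_le_of_lt (lintegral_mono fun x => lintegral_mono fun y =>
      far_ofReal_le (σ := σ) (γ := γ) (c := 1) one_pos (by rw [one_mul]))
      (lintegral_weight_mul_lt_top hσ (by simp))
  have hne : 2 * (1 ^ 2 * ballMass n γ 1 ^ 2 + ∫⁻ x : Space n, ∫⁻ y : Space n,
      (if ‖x - y‖ < 1 then 0 else ENNReal.ofReal (major σ γ x y)) ^ 2) ≠ ⊤ := by
    refine (ENNReal.mul_lt_top (by simp) (ENNReal.add_lt_top.2 ⟨?_, hfin⟩)).ne
    rw [one_pow, one_mul]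
    exact (ENNReal.pow_ne_top (ballMass_one_lt_top hγ).ne).lt_top
  rw [← ENNReal.coe_toNNReal hne] at h
  exact ⟨_, h⟩

/-- Dominated convergence in operator norm. -/
theorem eventually_sqBdd {σ : ℝ} (hσ : (n : ℝ) < 2 * σ) {γ : ℕ} (hγ : γ < n)
    {k : ℕ → Space n → Space n → ℝ≥0∞} (hk : ∀ i, Measurable (Function.uncurry (k i))) {c : ℝ≥0∞}
    (hc : c ≠ ⊤) (hle : ∀ i x y, k i x y ≤ c * ENNReal.ofReal (major σ γ x y))
    (hlim : ∀ x y, Tendsto (fun i => k i x y) atTop (𝓝 0)) {ε : ℝ≥0∞} (hε : 0 < ε) :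
    ∀ᶠ i in atTop, SqBdd (k i) ε := by
  have hσ0 : 0 ≤ σ := by linarith [(Nat.cast_nonneg n : (0 : ℝ) ≤ n)]
  -- First `δ` is fixed so that the near part is below `ε` for all `i` at once; dominated
  -- convergence then removes the far part.
  obtain ⟨j, hj⟩ : ∃ j : ℕ, 2 * (c ^ 2 * ballMass n γ (1 / ((j : ℝ) + 1)) ^ 2) < ε := by
    have h1 : Tendsto (fun j : ℕ => 2 * (c ^ 2 * ballMass n γ (1 / ((j : ℝ) + 1)) ^ 2)) atTop
        (𝓝 0) := by
      have h2 := ((ENNReal.continuous_pow 2).tendsto 0).comp (tendsto_ballMass hγ)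
      have h3 := ENNReal.Tendsto.const_mul (a := 2 * c ^ 2) h2
        (Or.inr (ENNReal.mul_ne_top (by simp) (ENNReal.pow_ne_top hc)))
      simpa [mul_assoc, Function.comp_def] using h3
    exact ((tendsto_order.1 h1).2 ε hε).exists
  set δ : ℝ := 1 / ((j : ℝ) + 1)
  have hδ : 0 < δ := by positivity
  have hc' : c * ENNReal.ofReal (1 + (δ ^ γ)⁻¹) ≠ ⊤ := ENNReal.mul_ne_top hc (by simp)
  have hdom := lintegral_weight_mul_lt_top (n := n) hσ hc'
  have hmf : ∀ i, Measurable (Function.uncurry fun x y : Space n =>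
      (if ‖x - y‖ < δ then 0 else k i x y) ^ 2) := fun i =>
    (Measurable.ite (measurableSet_dist_lt δ) measurable_const (hk i)).pow_const 2
  have hprod : ∀ F : Space n → Space n → ℝ≥0∞, Measurable (Function.uncurry F) →
      ∫⁻ x, ∫⁻ y, F x y = ∫⁻ p : Space n × Space n, F p.1 p.2 := fun F hF =>
    (lintegral_prod (μ := (volume : Measure (Space n))) (ν := (volume : Measure (Space n)))
      (fun p => F p.1 p.2) hF.aemeasurable).symm
  have hfar : Tendsto (fun i => ∫⁻ x, ∫⁻ y, (if ‖x - y‖ < δ then 0 else k i x y) ^ 2) atTop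
      (𝓝 0) := by
    have hmw : Measurable (Function.uncurry fun x y : Space n =>
        (c * ENNReal.ofReal (1 + (δ ^ γ)⁻¹) *
          (ENNReal.ofReal (weight σ x) * ENNReal.ofReal (weight σ y))) ^ 2) :=
      ((((measurable_weight σ).ennreal_ofReal.comp measurable_fst).mul
        ((measurable_weight σ).ennreal_ofReal.comp measurable_snd)).const_mul _).pow_const 2
    rw [hprod _ hmw] at hdom
    have h := tendsto_lintegral_of_dominated_convergence
      (μ := (volume : Measure (Space n × Space n)))
      (F := fun i p => (if ‖p.1 - p.2‖ < δ then 0 else k i p.1 p.2) ^ 2) (f := fun _ => 0)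
      (fun p => (c * ENNReal.ofReal (1 + (δ ^ γ)⁻¹) *
        (ENNReal.ofReal (weight σ p.1) * ENNReal.ofReal (weight σ p.2))) ^ 2)
      hmf (fun i => ae_of_all _ fun p => far_ofReal_le hδ (hle i p.1 p.2)) hdom.ne
      (ae_of_all _ fun p => by
        split_ifs with h
        · simp
        · have := ((ENNReal.continuous_pow 2).tendsto 0).comp (hlim p.1 p.2)
          simpa [Function.comp_def] using this)
    rw [lintegral_zero] at h
    exact h.congr fun i => (hprod _ (hmf i)).symm
  have h5 : Tendsto (fun i => 2 * (c ^ 2 * ballMass n γ δ ^ 2 +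
      ∫⁻ x, ∫⁻ y, (if ‖x - y‖ < δ then 0 else k i x y) ^ 2)) atTop
      (𝓝 (2 * (c ^ 2 * ballMass n γ δ ^ 2 + 0))) :=
    ENNReal.Tendsto.const_mul (tendsto_const_nhds.add hfar) (Or.inr (by simp))
  rw [add_zero] at h5
  filter_upwards [(tendsto_order.1 h5).2 ε hj] with i hi
  exact (sqBdd_split hσ0 γ δ (hk i) hc (hle i)).mono (fun x => ae_of_all _ fun y => le_rfl) hi.le

end HigherSchrodinger

namespace HigherSchrodinger

variable {n m : ℕ}

/-! ### Calculus of symbol bounds -/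

section SymbolCalculus

variable {X Y Z : Type*} [NormedAddCommGroup X] [NormedSpace ℝ X] [NormedAddCommGroup Y]
  [NormedSpace ℝ Y] [NormedAddCommGroup Z] [NormedSpace ℝ Z] {e N : ℕ} {L C C' : ℝ}

theorem iteratedDeriv_of_chain {F : ℕ → ℝ → X} {s : Set ℝ} (hs : IsOpen s) {N : ℕ}
    (h : ∀ j < N, ∀ t ∈ s, HasDerivAt (F j) (F (j + 1) t) t) {j : ℕ} (hj : j ≤ N) {t : ℝ}
    (ht : t ∈ s) : iteratedDeriv j (F 0) t = F j t := by
  induction j generalizing t with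
  | zero => simp
  | succ j ih =>
    rw [iteratedDeriv_succ]
    have h1 : iteratedDeriv j (F 0) =ᶠ[𝓝 t] F j := by
      filter_upwards [hs.mem_nhds ht] with u hu using ih (by omega) hu
    rw [h1.deriv_eq, (h j (by omega) t ht).deriv]

theorem contDiffOn_of_chain {F : ℕ → ℝ → X} {s : Set ℝ} (hs : IsOpen s) {N : ℕ}
    (h : ∀ j < N, ∀ t ∈ s, HasDerivAt (F j) (F (j + 1) t) t) (hc : ContinuousOn (F N) s) :
    ContDiffOn ℝ N (F 0) s := by
  induction N generalizing F with
  | zero => exact contDiffOn_zero.2 hc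
  | succ N ih =>
    have h1 := ih (F := fun j => F (j + 1)) (fun j hj t ht => h (j + 1) (by omega) t ht) hc
    push_cast
    rw [contDiffOn_succ_iff_deriv_of_isOpen hs]
    refine ⟨fun t ht => (h 0 (by omega) t ht).differentiableAt.differentiableWithinAt,
      fun h => by simp at h, h1.congr fun t ht => (h 0 (by omega) t ht).deriv⟩

theorem symB_of_chain {F : ℕ → ℝ → X}
    (h : ∀ j < N, ∀ t ∈ Ioo 0 L, HasDerivAt (F j) (F (j + 1) t) t)
    (hc : ContinuousOn (F N) (Ioo 0 L))
    (hb : ∀ j ≤ N, ∀ t ∈ Ioo 0 L, t ^ (j - e) * ‖F j t‖ ≤ C) : SymB e N L C (F 0) :=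
  ⟨contDiffOn_of_chain isOpen_Ioo h hc, fun j hj t ht => by
    rw [iteratedDeriv_of_chain isOpen_Ioo h hj ht]; exact hb j hj t ht⟩

theorem hasDerivAt_iteratedDeriv {f : ℝ → X} {s : Set ℝ} (hs : IsOpen s) (hf : ContDiffOn ℝ N f s)
    {j : ℕ} (hj : j < N) {t : ℝ} (ht : t ∈ s) :
    HasDerivAt (iteratedDeriv j f) (iteratedDeriv (j + 1) f t) t := by
  rw [iteratedDeriv_succ]
  have h1 := hf.differentiableOn_iteratedDerivWithin (m := j) (by exact_mod_cast hj)
    hs.uniqueDiffOn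
  have h2 : DifferentiableOn ℝ (iteratedDeriv j f) s :=
    h1.congr fun u hu => (iteratedDerivWithin_of_isOpen hs hu).symm
  exact (h2.differentiableAt (hs.mem_nhds ht)).hasDerivAt

theorem continuousOn_iteratedDeriv {f : ℝ → X} {s : Set ℝ} (hs : IsOpen s)
    (hf : ContDiffOn ℝ N f s) {j : ℕ} (hj : j ≤ N) : ContinuousOn (iteratedDeriv j f) s :=
  (hf.continuousOn_iteratedDerivWithin (m := j) (by exact_mod_cast hj) hs.uniqueDiffOn).congr
    fun _ hu => (iteratedDerivWithin_of_isOpen hs hu).symm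

theorem SymB.mono {f : ℝ → X} (h : SymB e N L C f) (hC : C ≤ C') : SymB e N L C' f :=
  ⟨h.1, fun j hj t ht => (h.2 j hj t ht).trans hC⟩

theorem SymB.restrict {f : ℝ → X} (h : SymB e N L C f) {L' : ℝ} (hL : L' ≤ L) :
    SymB e N L' C f :=
  ⟨h.1.mono (Ioo_subset_Ioo_right hL), fun j hj t ht => h.2 j hj t ⟨ht.1, ht.2.trans_le hL⟩⟩

theorem SymB.of_le {f : ℝ → X} (h : SymB e N L C f) {N' : ℕ} (hN : N' ≤ N) : SymB e N' L C f :=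
  ⟨h.1.of_le (by exact_mod_cast hN), fun j hj => h.2 j (hj.trans hN)⟩

theorem SymB.congr {f g : ℝ → X} (h : SymB e N L C f) (hfg : EqOn g f (Ioo 0 L)) :
    SymB e N L C g := by
  refine ⟨h.1.congr hfg, fun j hj t ht => ?_⟩
  have h1 : g =ᶠ[𝓝 t] f := hfg.eventuallyEq_of_mem (isOpen_Ioo.mem_nhds ht)
  rw [h1.iteratedDeriv_eq]
  exact h.2 j hj t ht

theorem SymB.norm_le {f : ℝ → X} (h : SymB e N L C f) {t : ℝ} (ht : t ∈ Ioo 0 L) : ‖f t‖ ≤ C := by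
  simpa using h.2 0 (Nat.zero_le _) t ht

theorem SymB.weaken {f : ℝ → X} (h : SymB e N L C f) (hL : L ≤ 1) {e' : ℕ} (he : e' ≤ e) :
    SymB e' N L C f :=
  ⟨h.1, fun j hj t ht => (mul_le_mul_of_nonneg_right
    (pow_le_pow_of_le_one ht.1.le (ht.2.le.trans hL) (by omega)) (norm_nonneg _)).trans
      (h.2 j hj t ht)⟩

theorem symB_const (c : X) : SymB e N L ‖c‖ fun _ => c := by
  refine ⟨contDiffOn_const, fun j _ t ht => ?_⟩
  rcases Nat.eq_zero_or_pos j with rfl | hj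
  · simp
  · rw [iteratedDeriv_const, if_neg hj.ne', norm_zero, mul_zero]
    exact norm_nonneg _

theorem SymB.clm {f : ℝ → X} (h : SymB e N L C f) (T : X →L[ℝ] Y) (hT : ‖T‖ ≤ 1) :
    SymB e N L C fun t => T (f t) := by
  refine symB_of_chain (F := fun j t => T (iteratedDeriv j f t)) (fun j hj t ht => ?_) ?_ ?_
  · exact (T.hasFDerivAt.comp_hasDerivAt t (hasDerivAt_iteratedDeriv isOpen_Ioo h.1 hj ht))
  · exact T.continuous.comp_continuousOn (continuousOn_iteratedDeriv isOpen_Ioo h.1 le_rfl)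
  · intro j hj t ht
    refine le_trans (mul_le_mul_of_nonneg_left ?_ (pow_nonneg ht.1.le _)) (h.2 j hj t ht)
    exact (T.le_opNorm _).trans (mul_le_of_le_one_left (norm_nonneg _) hT)

theorem SymB.bilin (B : X →L[ℝ] Y →L[ℝ] Z) (hL : L ≤ 1) (hC : 0 ≤ C) (hC' : 0 ≤ C') {f : ℝ → X}
    {g : ℝ → Y} (hf : SymB e N L C f) (hg : SymB e N L C' g) :
    SymB e N L (2 ^ N * ‖B‖ * C * C') fun t => B (f t) (g t) := by
  refine ⟨B.isBoundedBilinearMap.contDiff.comp_contDiffOn (hf.1.prodMk hg.1), fun j hj t ht => ?_⟩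
  have h1 := B.norm_iteratedFDerivWithin_le_of_bilinear hf.1 hg.1 isOpen_Ioo.uniqueDiffOn ht
    (n := j) (by exact_mod_cast hj)
  simp only [norm_iteratedFDerivWithin_eq_norm_iteratedDerivWithin,
    iteratedDerivWithin_of_isOpen isOpen_Ioo ht] at h1
  have ht0 := ht.1.le
  have ht1 : t ≤ 1 := ht.2.le.trans hL
  calc t ^ (j - e) * ‖iteratedDeriv j (fun t => B (f t) (g t)) t‖
      ≤ t ^ (j - e) * (‖B‖ * ∑ i ∈ Finset.range (j + 1), (j.choose i : ℝ) *
          ‖iteratedDeriv i f t‖ * ‖iteratedDeriv (j - i) g t‖) := by gcongr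
    _ = ‖B‖ * ∑ i ∈ Finset.range (j + 1), t ^ (j - e) * ((j.choose i : ℝ) *
          ‖iteratedDeriv i f t‖ * ‖iteratedDeriv (j - i) g t‖) := by
        rw [← Finset.mul_sum]; ring
    _ ≤ ‖B‖ * ∑ i ∈ Finset.range (j + 1), (j.choose i : ℝ) * (C * C') := by
        refine mul_le_mul_of_nonneg_left (Finset.sum_le_sum fun i hi => ?_) (by positivity)
        have hi' := Finset.mem_range.1 hi
        -- Truncated subtraction gives `(i - e) + (j - i - e) ≤ j - e`, and `t ≤ 1`: the weights
        -- split along Leibniz' rule without loss.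
        have hp : t ^ (j - e) ≤ t ^ (i - e) * t ^ (j - i - e) := by
          rw [← pow_add]
          exact pow_le_pow_of_le_one ht0 ht1 (by omega)
        calc _ ≤ (t ^ (i - e) * t ^ (j - i - e)) * ((j.choose i : ℝ) *
              ‖iteratedDeriv i f t‖ * ‖iteratedDeriv (j - i) g t‖) := by gcongr
          _ = (j.choose i : ℝ) * ((t ^ (i - e) * ‖iteratedDeriv i f t‖) *
              (t ^ (j - i - e) * ‖iteratedDeriv (j - i) g t‖)) := by ring
          _ ≤ _ := by
            gcongr
            · exact hf.2 i (by omega) t ht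
            · exact hg.2 (j - i) (by omega) t ht
    _ = 2 ^ j * ‖B‖ * C * C' := by
        rw [← Finset.sum_mul]
        have : ∑ i ∈ Finset.range (j + 1), (j.choose i : ℝ) = 2 ^ j := by
          exact_mod_cast Nat.sum_range_choose j
        rw [this]; ring
    _ ≤ _ := by
        gcongr
        norm_num

/-- The weight `t^{j-1}` on the `j`-th derivative of `f` is the weight `t^{j-1}` on the `(j-1)`-st
derivative of `f'`; so the parameter `e` drops from `1` to `0` when one derivative is split off. -/
theorem SymB.of_deriv {f f' : ℝ → X} (h0 : ∀ t ∈ Ioo 0 L, ‖f t‖ ≤ C)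
    (hd : ∀ t ∈ Ioo 0 L, HasDerivAt f (f' t) t) (h : SymB 0 N L C f') :
    SymB 1 (N + 1) L C f := by
  have hs : ∀ j, ∀ t ∈ Ioo 0 L, iteratedDeriv (j + 1) f t = iteratedDeriv j f' t := by
    intro j t ht
    rw [iteratedDeriv_succ']
    have : deriv f =ᶠ[𝓝 t] f' := by
      filter_upwards [isOpen_Ioo.mem_nhds ht] with u hu using (hd u hu).deriv
    exact this.iteratedDeriv_eq j
  constructor
  · push_cast
    rw [contDiffOn_succ_iff_deriv_of_isOpen isOpen_Ioo]
    exact ⟨fun t ht => (hd t ht).differentiableAt.differentiableWithinAt,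
      fun h => by simp at h, h.1.congr fun t ht => (hd t ht).deriv⟩
  · intro j hj t ht
    rcases j with _ | j
    · simpa using h0 t ht
    · rw [hs j t ht]
      exact h.2 j (by omega) t ht

theorem SymB.deriv {f : ℝ → X} (h : SymB 1 (N + 1) L C f) : SymB 0 N L C (deriv f) := by
  have h1 := h.1
  push_cast at h1
  rw [contDiffOn_succ_iff_deriv_of_isOpen isOpen_Ioo] at h1
  refine ⟨h1.2.2, fun j hj t ht => ?_⟩
  rw [← iteratedDeriv_succ']
  exact h.2 (j + 1) (by omega) t ht

/-- Symbol bounds for the inverse of a bounded invertible family. -/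
theorem SymB.ringInverse {A : Type*} [NormedRing A] [NormedAlgebra ℝ A] [CompleteSpace A]
    (hL : L ≤ 1) (hC : 0 ≤ C) {f : ℝ → A} (hf : SymB 1 N L C f) (hu : ∀ t ∈ Ioo 0 L, IsUnit (f t))
    (hb : ∀ t ∈ Ioo 0 L, ‖Ring.inverse (f t)‖ ≤ C') :
    ∃ C'', 0 ≤ C'' ∧ SymB 1 N L C'' fun t => Ring.inverse (f t) := by
  induction N with
  | zero =>
    refine ⟨max C' 0, le_max_right _ _, ?_, fun j hj t ht => ?_⟩
    · intro t ht
      obtain ⟨u, hu'⟩ := hu t ht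
      have h1 : ContDiffAt ℝ (0 : ℕ) Ring.inverse (f t) := hu' ▸ contDiffAt_ringInverse ℝ u
      exact h1.comp_contDiffWithinAt t (hf.1 t ht)
    · obtain rfl : j = 0 := by omega
      simpa using Or.inl (hb t ht)
  | succ N ih =>
    -- The derivative of the inverse `W` is `-W f' W`, which involves `W` only to order `N`. Its
    -- bounds are weakened to `e = 0` to match those of `f'`, and the product rule closes the
    -- induction.
    obtain ⟨D, hD, h1⟩ := ih (hf.of_le (by omega))
    have h1' := h1.weaken hL (Nat.zero_le 1)
    have hder := hf.deriv
    have hprod := (h1'.bilin (ContinuousLinearMap.mul ℝ A) hL hD hC hder).bilin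
      (ContinuousLinearMap.mul ℝ A) hL (by positivity) hD h1'
    have hneg := hprod.clm (-ContinuousLinearMap.id ℝ A) (by
      rw [norm_neg]; exact ContinuousLinearMap.norm_id_le)
    set D' := 2 ^ N * ‖ContinuousLinearMap.mul ℝ A‖ *
      (2 ^ N * ‖ContinuousLinearMap.mul ℝ A‖ * D * C) * D
    refine ⟨max D D', hD.trans (le_max_left _ _), ?_⟩
    refine SymB.of_deriv (fun t ht => (h1.norm_le ht).trans (le_max_left _ _)) (fun t ht => ?_)
      (hneg.mono (le_max_right _ _))
    have h2 : HasDerivAt f (_root_.deriv f t) t := by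
      have h3 : ContDiffAt ℝ (N + 1 : ℕ) f t := hf.1.contDiffAt (isOpen_Ioo.mem_nhds ht)
      exact (h3.differentiableAt (by simp)).hasDerivAt
    obtain ⟨u, hu'⟩ := hu t ht
    have h4 : HasFDerivAt Ring.inverse (-ContinuousLinearMap.mulLeftRight ℝ A ↑u⁻¹ ↑u⁻¹) (f t) :=
      hu' ▸ hasFDerivAt_ringInverse (𝕜 := ℝ) u
    have h5 := h4.comp_hasDerivAt t h2
    refine h5.congr_deriv ?_
    simp [← hu']

end SymbolCalculus

/-! ### Realisations of dominated families -/

/-- `Φ` is a linear map on measurable functions dominated by multiples of `g`, bounded by `A` and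
continuous under dominated convergence. -/
structure DominatedMap {α X : Type*} [MeasurableSpace α] [NormedAddCommGroup X] [NormedSpace ℝ X]
    (Φ : (α → ℂ) → X) (g : α → ℝ) (A : ℝ) : Prop where
  smul_sub : ∀ (u v : α → ℂ) (C c : ℝ), Measurable u → Measurable v → (∀ a, ‖u a‖ ≤ C * g a) →
    (∀ a, ‖v a‖ ≤ C * g a) → Φ (fun a => c • (u a - v a)) = c • (Φ u - Φ v)
  norm_le : ∀ (u : α → ℂ) (C : ℝ), 0 ≤ C → Measurable u → (∀ a, ‖u a‖ ≤ C * g a) → ‖Φ u‖ ≤ A * C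
  tendsto : ∀ (u : ℕ → α → ℂ) (v : α → ℂ) (C : ℝ), 0 ≤ C → (∀ i, Measurable (u i)) →
    Measurable v → (∀ i a, ‖u i a‖ ≤ C * g a) → (∀ a, Tendsto (fun i => u i a) atTop (𝓝 (v a))) →
    Tendsto (fun i => Φ (u i)) atTop (𝓝 (Φ v))

section Realisation

variable {α X : Type*} [MeasurableSpace α] [NormedAddCommGroup X] [NormedSpace ℝ X]
  {e N : ℕ} {L C A : ℝ}

/-- Each derivative is a pointwise limit of difference quotients along a fixed sequence, chosen
inside `(0, L)`. -/
theorem measurable_iteratedDeriv {k : ℝ → α → ℂ} (hk : ∀ t ∈ Ioo 0 L, Measurable (k t))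
    (hs : ∀ a, ContDiffOn ℝ N (fun t => k t a) (Ioo 0 L)) {j : ℕ} (hj : j ≤ N) {t : ℝ}
    (ht : t ∈ Ioo 0 L) : Measurable fun a => iteratedDeriv j (fun t => k t a) t := by
  induction j generalizing t with
  | zero => simpa using hk t ht
  | succ j ih =>
    set h : ℕ → ℝ := fun i => (L - t) * (1 / ((i : ℝ) + 2)) with hh
    have hpos : ∀ i, 0 < h i := fun i => mul_pos (sub_pos.2 ht.2) (by positivity)
    have hmem : ∀ i, t + h i ∈ Ioo 0 L := fun i => by
      refine ⟨add_pos ht.1 (hpos i), ?_⟩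
      have : (1 / ((i : ℝ) + 2)) < 1 := by
        rw [div_lt_one (by positivity)]; linarith [(Nat.cast_nonneg i : (0 : ℝ) ≤ i)]
      have := mul_lt_of_lt_one_right (sub_pos.2 ht.2) this
      simp only [hh]
      linarith
    have hlim : Tendsto h atTop (𝓝 0) := by
      have h1 : Tendsto (fun i : ℕ => 1 / ((i : ℝ) + 2)) atTop (𝓝 0) := by
        simp_rw [one_div]
        exact tendsto_inv_atTop_zero.comp
          (tendsto_atTop_add_const_right _ _ tendsto_natCast_atTop_atTop)
      have h2 := h1.const_mul (L - t)
      rwa [mul_zero] at h2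
    have hlim' : Tendsto (fun i => t + h i) atTop (𝓝[≠] t) := by
      refine tendsto_nhdsWithin_iff.2 ⟨by simpa using hlim.const_add t, ?_⟩
      exact Eventually.of_forall fun i => by simpa using (hpos i).ne'
    refine measurable_of_tendsto_metrizable (f := fun (i : ℕ) a =>
      slope (iteratedDeriv j (fun t => k t a)) t (t + h i)) (fun i => ?_)
      (tendsto_pi_nhds.2 fun a => ?_)
    · simp only [slope, vsub_eq_sub]
      exact (((ih (by omega) (hmem i)).sub (ih (by omega) ht)).const_smul _)
    · exact (hasDerivAt_iff_tendsto_slope.1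
        (hasDerivAt_iteratedDeriv isOpen_Ioo (hs a) (by omega : j < N) ht)).comp hlim'

theorem norm_iteratedDeriv_le_of_symB {f : ℝ → X} (h : SymB e N L C f) {j : ℕ}
    (hj : j ≤ N) {r t : ℝ} (hr : 0 < r) (hrt : r ≤ t) (ht : t ∈ Ioo 0 L) :
    ‖iteratedDeriv j f t‖ ≤ C / r ^ (j - e) := by
  have h1 := h.2 j hj t ht
  rw [le_div_iff₀ (by positivity), mul_comm]
  refine le_trans ?_ h1
  gcongr

/-- Differentiation commutes with `Φ`: difference quotients at `t` stay dominated by a multiple of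
`g`, and `Φ` is continuous under dominated convergence. Integrals, vectors of `L²` and operators are
all instances, so pointwise bounds on kernels give norm bounds with no further work. -/
theorem SymB.realise {Φ : (α → ℂ) → X} {g : α → ℝ} (hΦ : DominatedMap Φ g A)
    (hC : 0 ≤ C) {k : ℝ → α → ℂ} (hk : ∀ t ∈ Ioo 0 L, Measurable (k t))
    (hs : ∀ a, SymB e N L (C * g a) fun t => k t a) :
    SymB e N L (A * C) fun t => Φ (k t) := by
  set F : ℕ → ℝ → X := fun j t => Φ fun a => iteratedDeriv j (fun t => k t a) t with hF
  have hmeas : ∀ j ≤ N, ∀ t ∈ Ioo 0 L, Measurable fun a => iteratedDeriv j (fun t => k t a) t :=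
    fun j hj t ht => measurable_iteratedDeriv hk (fun a => (hs a).1) hj ht
  have hbd : ∀ j ≤ N, ∀ r > 0, ∀ t ∈ Ioo 0 L, r ≤ t → ∀ a,
      ‖iteratedDeriv j (fun t => k t a) t‖ ≤ (C / r ^ (j - e)) * g a := by
    intro j hj r hr t ht hrt a
    have := norm_iteratedDeriv_le_of_symB (hs a) hj hr hrt ht
    rwa [mul_div_right_comm] at this
  have key : SymB e N L (A * C) (F 0) := by
    refine symB_of_chain (fun j hj t ht => ?_) ?_ fun j hj t ht => ?_
    · rw [hasDerivAt_iff_tendsto_slope]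
      refine tendsto_of_seq_tendsto fun u hu => ?_
      have ht2 : 0 < t / 2 := half_pos ht.1
      have hu' : ∀ᶠ i in atTop, u i ∈ Ioo (t / 2) L ∧ u i ≠ t := by
        have h1 := hu.eventually (eventually_mem_nhdsWithin (s := {t}ᶜ) (a := t))
        have h2 := (tendsto_nhdsWithin_iff.1 hu).1.eventually
          (isOpen_Ioo.mem_nhds (⟨half_lt_self ht.1, ht.2⟩ : t ∈ Ioo (t / 2) L))
        filter_upwards [h1, h2] with i h1 h2 using ⟨h2, h1⟩
      obtain ⟨i₀, hi₀⟩ := eventually_atTop.1 hu'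
      rw [← tendsto_add_atTop_iff_nat i₀]
      have hmem : ∀ i, u (i + i₀) ∈ Ioo (t / 2) L := fun i => (hi₀ _ (by omega)).1
      have hmem0 : ∀ i, u (i + i₀) ∈ Ioo 0 L := fun i => ⟨ht2.trans (hmem i).1, (hmem i).2⟩
      have hmul : Tendsto (fun i => u (i + i₀)) atTop (𝓝[≠] t) :=
        hu.comp (tendsto_add_atTop_nat i₀)
      have hslope : ∀ i, slope (F j) t (u (i + i₀)) = Φ fun a =>
          (u (i + i₀) - t)⁻¹ • (iteratedDeriv j (fun t => k t a) (u (i + i₀)) -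
            iteratedDeriv j (fun t => k t a) t) := by
        intro i
        rw [hΦ.smul_sub _ _ (C / (t / 2) ^ (j - e)) _ (hmeas j hj.le _ (hmem0 i))
          (hmeas j hj.le t ht) (hbd j hj.le _ ht2 _ (hmem0 i) (hmem i).1.le)
          (hbd j hj.le _ ht2 t ht (half_le_self ht.1.le))]
        rfl
      simp_rw [Function.comp_def, hslope]
      refine hΦ.tendsto _ _ (C / (t / 2) ^ (j + 1 - e)) (by positivity)
        (fun i => (Measurable.sub (hmeas j hj.le _ (hmem0 i)) (hmeas j hj.le t ht)).const_smul
          ((u (i + i₀) - t)⁻¹))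
        (hmeas (j + 1) hj t ht) (fun i a => ?_) (fun a => ?_)
      -- On `(t/2, L)` the next derivative is bounded uniformly, since its possible blow-up is only
      -- at the endpoint `0`; by the mean value inequality it dominates every difference quotient.
      · have hmv := Convex.norm_image_sub_le_of_norm_hasDerivWithin_le
          (f := iteratedDeriv j (fun t => k t a)) (f' := iteratedDeriv (j + 1) (fun t => k t a))
          (s := Ioo (t / 2) L) (x := t) (y := u (i + i₀)) (C := C / (t / 2) ^ (j + 1 - e) * g a)
          (fun x hx => (hasDerivAt_iteratedDeriv isOpen_Ioo (hs a).1 hj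
            ⟨ht2.trans hx.1, hx.2⟩).hasDerivWithinAt)
          (fun x hx => hbd (j + 1) hj _ ht2 x ⟨ht2.trans hx.1, hx.2⟩ hx.1.le a)
          (convex_Ioo _ _) ⟨half_lt_self ht.1, ht.2⟩ (hmem i)
        rw [norm_smul, norm_inv]
        have hne : 0 < ‖u (i + i₀) - t‖ := norm_pos_iff.2 (sub_ne_zero.2 (hi₀ _ (by omega)).2)
        rw [inv_mul_le_iff₀ hne, mul_comm]
        exact hmv
      · have h1 := (hasDerivAt_iff_tendsto_slope.1
          (hasDerivAt_iteratedDeriv isOpen_Ioo (hs a).1 hj ht)).comp hmul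
        exact h1
    · intro t ht
      refine ContinuousAt.continuousWithinAt ?_
      refine tendsto_of_seq_tendsto fun u hu => ?_
      have ht2 : 0 < t / 2 := half_pos ht.1
      have hu' := hu.eventually
          (isOpen_Ioo.mem_nhds (⟨half_lt_self ht.1, ht.2⟩ : t ∈ Ioo (t / 2) L))
      obtain ⟨i₀, hi₀⟩ := eventually_atTop.1 hu'
      rw [← tendsto_add_atTop_iff_nat i₀]
      have hmem : ∀ i, u (i + i₀) ∈ Ioo (t / 2) L := fun i => hi₀ _ (by omega)
      have hmem0 : ∀ i, u (i + i₀) ∈ Ioo 0 L := fun i => ⟨ht2.trans (hmem i).1, (hmem i).2⟩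
      have hul : Tendsto (fun i => u (i + i₀)) atTop (𝓝 t) := hu.comp (tendsto_add_atTop_nat i₀)
      refine hΦ.tendsto _ _ (C / (t / 2) ^ (N - e)) (by positivity)
        (fun i => hmeas N le_rfl _ (hmem0 i)) (hmeas N le_rfl t ht)
        (fun i a => hbd N le_rfl _ ht2 _ (hmem0 i) (hmem i).1.le a) fun a => ?_
      exact ((continuousOn_iteratedDeriv isOpen_Ioo (hs a).1 le_rfl).continuousAt
        (isOpen_Ioo.mem_nhds ht)).tendsto.comp hul
    · have h1 := hΦ.norm_le _ _ (by have := ht.1; positivity) (hmeas j hj t ht)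
        (hbd j hj t ht.1 t ht le_rfl)
      have h2 : 0 < t ^ (j - e) := pow_pos ht.1 _
      calc _ ≤ t ^ (j - e) * (A * (C / t ^ (j - e))) := by gcongr
        _ = A * C := by field_simp
  refine key.congr fun t ht => ?_
  simp [hF]

end Realisation

end HigherSchrodinger

namespace HigherSchrodinger

variable {n m : ℕ}

/-! ### Square integrable functions as vectors -/

/-- The class in `L²` of a function (`0` if it is not square integrable). -/
noncomputable def toL2 (u : Space n → ℂ) : L2 n :=
  open Classical in if h : MemLp u 2 then h.toLp u else 0

theorem coeFn_toL2 {u : Space n → ℂ} (h : MemLp u 2) : toL2 u =ᵐ[volume] u := by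
  rw [toL2, dif_pos h]
  exact h.coeFn_toLp

theorem enorm_toL2_sq {u : Space n → ℂ} (h : MemLp u 2) : ‖toL2 u‖ₑ ^ 2 = ∫⁻ x, ‖u x‖ₑ ^ 2 := by
  rw [← lintegral_enorm_sq]
  exact lintegral_congr_ae ((coeFn_toL2 h).mono fun x hx => by simp only [hx])

theorem inner_toL2 {u : Space n → ℂ} (h : MemLp u 2) (f : L2 n) :
    inner ℂ (toL2 u) f = ∫ y, (starRingEnd ℂ) (u y) * f y := by
  rw [L2.inner_def]
  refine integral_congr_ae ((coeFn_toL2 h).mono fun x hx => ?_)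
  simp only [hx, RCLike.inner_apply]
  ring

theorem tendsto_zero_of_enorm_sq {ι E : Type*} [NormedAddCommGroup E] {l : Filter ι} {f : ι → E}
    (h : Tendsto (fun i => ‖f i‖ₑ ^ 2) l (𝓝 0)) : Tendsto f l (𝓝 0) := by
  rw [tendsto_zero_iff_norm_tendsto_zero]
  have h1 : Tendsto (fun i => ENNReal.toReal (‖f i‖ₑ ^ 2)) l (𝓝 0) := by
    have h0 := (ENNReal.tendsto_toReal (by simp : (0 : ℝ≥0∞) ≠ ⊤)).comp h
    rw [ENNReal.toReal_zero] at h0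
    exact h0
  have h2 := (Real.continuous_sqrt.tendsto 0).comp h1
  rw [Real.sqrt_zero] at h2
  refine h2.congr fun i => ?_
  simp [Real.sqrt_sq]

theorem memLp_of_le_mul {g : Space n → ℝ} (hg : MemLp (fun x => (g x : ℂ)) 2) {u : Space n → ℂ}
    (hu : Measurable u) {C : ℝ} (hle : ∀ x, ‖u x‖ ≤ C * g x) : MemLp u 2 := by
  refine (hg.const_mul (C : ℂ)).mono hu.aestronglyMeasurable (ae_of_all _ fun x => ?_)
  refine (hle x).trans ?_
  rw [norm_mul, Complex.norm_real, Complex.norm_real, ← norm_mul]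
  exact Real.le_norm_self _

theorem dominatedMap_integral {α : Type*} [MeasurableSpace α] {μ : Measure α} {g : α → ℝ}
    (hg : Integrable g μ) :
    DominatedMap (fun u : α → ℂ => ∫ a, u a ∂μ) g (∫ a, g a ∂μ) where
  smul_sub u v C c hu hv hu' hv' := by
    have h1 : Integrable u μ := (hg.const_mul C).mono' hu.aestronglyMeasurable (ae_of_all _ hu')
    have h2 : Integrable v μ := (hg.const_mul C).mono' hv.aestronglyMeasurable (ae_of_all _ hv')
    rw [integral_smul, integral_sub h1 h2]
  norm_le u C _ hu hu' := by
    refine (norm_integral_le_of_norm_le (hg.const_mul C) (ae_of_all _ hu')).trans_eq ?_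
    rw [integral_const_mul, mul_comm]
  tendsto u v C _ hu hv hu' hlim :=
    tendsto_integral_of_dominated_convergence (fun a => C * g a)
      (fun i => (hu i).aestronglyMeasurable) (hg.const_mul C) (fun i => ae_of_all _ (hu' i))
      (ae_of_all _ hlim)

theorem toL2_smul_sub {u v : Space n → ℂ} (hu : MemLp u 2) (hv : MemLp v 2) (c : ℝ) :
    toL2 (fun a => c • (u a - v a)) = c • (toL2 u - toL2 v) := by
  refine Lp.ext ?_
  filter_upwards [coeFn_toL2 ((hu.sub hv).const_smul c), coeFn_toL2 hu, coeFn_toL2 hv,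
    Lp.coeFn_smul c (toL2 u - toL2 v), Lp.coeFn_sub (toL2 u) (toL2 v)] with x h1 h2 h3 h4 h5
  rw [h4, Pi.smul_apply, h5, Pi.sub_apply, h2, h3]
  exact h1

theorem dominatedMap_toL2 {g : Space n → ℝ} (hg : MemLp (fun x => (g x : ℂ)) 2) :
    DominatedMap toL2 g ‖toL2 fun x => (g x : ℂ)‖ where
  smul_sub u v C c hu hv hu' hv' :=
    toL2_smul_sub (memLp_of_le_mul hg hu hu') (memLp_of_le_mul hg hv hv') c
  norm_le u C hC hu hu' := by
    rw [mul_comm]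
    refine Lp.norm_le_mul_norm_of_ae_le_mul ?_
    filter_upwards [coeFn_toL2 (memLp_of_le_mul hg hu hu'), coeFn_toL2 hg] with x h1 h2
    rw [h1, h2, Complex.norm_real]
    exact (hu' x).trans (mul_le_mul_of_nonneg_left (Real.le_norm_self _) hC)
  tendsto u v C hC hu hv hu' hlim := by
    have hv' : ∀ a, ‖v a‖ ≤ C * g a := fun a =>
      le_of_tendsto (hlim a).norm (Eventually.of_forall fun i => hu' i a)
    rw [tendsto_iff_norm_sub_tendsto_zero, ← tendsto_zero_iff_norm_tendsto_zero]
    refine tendsto_zero_of_enorm_sq ?_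
    have hmi := fun i => memLp_of_le_mul hg (hu i) (hu' i)
    have hmv := memLp_of_le_mul hg hv hv'
    have e : ∀ i, ‖toL2 (u i) - toL2 v‖ₑ ^ 2 = ∫⁻ x, ‖u i x - v x‖ₑ ^ 2 := fun i => by
      have h1 := toL2_smul_sub (hmi i) hmv 1
      simp only [one_smul] at h1
      rw [← h1]
      exact enorm_toL2_sq ((hmi i).sub hmv)
    simp_rw [e]
    have hdom : ∫⁻ x, ‖((2 * C * g x : ℝ) : ℂ)‖ₑ ^ 2 ≠ ⊤ := by
      have h2 : MemLp (fun x => ((2 * C * g x : ℝ) : ℂ)) 2 := by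
        have := hg.const_mul ((2 * C : ℝ) : ℂ)
        simpa using this
      rw [← enorm_toL2_sq h2]
      simp
    have h := tendsto_lintegral_of_dominated_convergence (μ := (volume : Measure (Space n)))
      (F := fun i x => ‖u i x - v x‖ₑ ^ 2) (f := fun _ => 0)
      (fun x => ‖((2 * C * g x : ℝ) : ℂ)‖ₑ ^ 2)
      (fun i => ((hu i).sub hv).enorm.pow_const 2)
      (fun i => ae_of_all _ fun x => by
        refine pow_le_pow_left₀ zero_le ?_ 2
        rw [← ofReal_norm, ← ofReal_norm]
        refine ENNReal.ofReal_le_ofReal ((norm_sub_le _ _).trans ?_)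
        rw [Complex.norm_real]
        refine le_trans ?_ (Real.le_norm_self _)
        linarith [hu' i x, hv' x]) hdom
      (ae_of_all _ fun x => by
        have h3 : Tendsto (fun i => ‖u i x - v x‖ₑ) atTop (𝓝 0) := by
          have := ((hlim x).sub_const (v x)).enorm
          simpa using this
        have := ((ENNReal.continuous_pow 2).tendsto 0).comp h3
        simpa [Function.comp_def] using this)
    simpa using h

/-! ### Operators with dominated kernels -/

theorem sqBdd_of_le_major {σ : ℝ} {γ : ℕ} {A : NNReal}
    (hA : SqBdd (fun x y : Space n => ENNReal.ofReal (major σ γ x y)) A)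
    {K : Space n → Space n → ℂ} {C : ℝ} (hC : 0 ≤ C) (hK : ∀ x y, ‖K x y‖ ≤ C * major σ γ x y) :
    SqBdd (fun x y => ‖K x y‖ₑ) (ENNReal.ofReal ((Real.sqrt A * C) ^ 2)) := by
  refine (hA.const_mul (c := ENNReal.ofReal C) (by simp)).mono
    (fun x => ae_of_all _ fun y => ?_) ?_
  · rw [← ENNReal.ofReal_mul hC, ← ofReal_norm]
    exact ENNReal.ofReal_le_ofReal (hK x y)
  · have hA0 : (0 : ℝ) ≤ A := A.2
    rw [mul_pow, Real.sq_sqrt hA0, ENNReal.ofReal_mul hA0, ENNReal.ofReal_pow hC, mul_comm]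
    simp

theorem hasKernel_kernelOp {σ : ℝ} (hσ : (n : ℝ) < 2 * σ) {γ : ℕ} (hγ : γ < n)
    {K : Space n → Space n → ℂ} (hKm : Measurable (Function.uncurry K)) {C : ℝ} (hC : 0 ≤ C)
    (hK : ∀ x y, ‖K x y‖ ≤ C * major σ γ x y) : HasKernel (kernelOp 0 K) 0 K := by
  obtain ⟨A, hA⟩ := exists_sqBdd_major (n := n) hσ hγ
  obtain ⟨T, hT⟩ := exists_hasKernel hKm (by simp) (sqBdd_of_le_major hA hC hK)
  rwa [hT.kernelOp_eq]

theorem HasKernel.sub_smul {T T' : L2 n →L[ℂ] L2 n} {K K' : Space n → Space n → ℂ}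
    (hT : HasKernel T 0 K) (hT' : HasKernel T' 0 K') (c : ℝ) :
    HasKernel (c • (T - T')) 0 (fun x y => c • (K x y - K' x y)) := by
  intro f
  filter_upwards [hT f, hT' f, Lp.coeFn_sub (T f) (T' f), Lp.coeFn_smul c (T f - T' f)]
    with x h1 h2 h3 h4
  have e : (fun y => c • (K x y - K' x y) * f y) =
      fun y => c • (K x y * f y - K' x y * f y) := by
    ext y
    rw [smul_mul_assoc, sub_mul]
  rw [e]
  refine ⟨(h1.1.sub h2.1).smul c, ?_⟩
  rw [integral_smul, integral_sub h1.1 h2.1]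
  have h5 : (c • (T - T')) f = c • (T f - T' f) := rfl
  rw [h5, h4, Pi.smul_apply, h3, Pi.sub_apply, h1.2, h2.2]
  simp

/-- The continuity clause is convergence in operator norm, supplied by `eventually_sqBdd`. -/
theorem dominatedMap_kernelOp {σ : ℝ} (hσ : (n : ℝ) < 2 * σ) {γ : ℕ} (hγ : γ < n) :
    ∃ A, 0 ≤ A ∧ DominatedMap
      (fun u : Space n × Space n → ℂ => kernelOp (n := n) 0 fun x y => u (x, y))
      (fun p => major σ γ p.1 p.2) A := by
  obtain ⟨A, hA⟩ := exists_sqBdd_major (n := n) hσ hγ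
  have hker : ∀ (u : Space n × Space n → ℂ) (C : ℝ), 0 ≤ C → Measurable u →
      (∀ p, ‖u p‖ ≤ C * major σ γ p.1 p.2) →
      HasKernel (kernelOp (n := n) 0 fun x y => u (x, y)) 0 fun x y => u (x, y) :=
    fun u C hC hu hu' => hasKernel_kernelOp hσ hγ (K := fun x y => u (x, y)) hu hC
      fun x y => hu' (x, y)
  have hCpos : ∀ (u : Space n × Space n → ℂ) (C : ℝ),
      (∀ p, ‖u p‖ ≤ C * major σ γ p.1 p.2) → 0 ≤ C := by
    intro u C hu'
    have h1 := (norm_nonneg _).trans (hu' (0, 0))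
    exact nonneg_of_mul_nonneg_left h1 (major_pos σ γ 0 0)
  refine ⟨Real.sqrt A, Real.sqrt_nonneg _, ⟨fun u v C c hu hv hu' hv' => ?_,
    fun u C hC hu hu' => ?_, fun u v C hC hu hv hu' hlim => ?_⟩⟩
  · have hC := hCpos u C hu'
    exact ((hker u C hC hu hu').sub_smul (hker v C hC hv hv') c).kernelOp_eq
  · exact (hker u C hC hu hu').norm_le (by positivity)
      (sqBdd_of_le_major hA hC fun x y => hu' (x, y))
  · have hv' : ∀ p, ‖v p‖ ≤ C * major σ γ p.1 p.2 := fun p =>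
      le_of_tendsto (hlim p).norm (Eventually.of_forall fun i => hu' i p)
    rw [tendsto_iff_norm_sub_tendsto_zero, Metric.tendsto_atTop]
    intro ε hε
    have h1 := eventually_sqBdd (n := n) hσ hγ
      (k := fun i x y => ‖u i (x, y) - v (x, y)‖ₑ)
      (fun i => (((hu i).sub hv).enorm : Measurable fun p => ‖u i p - v p‖ₑ))
      (c := ENNReal.ofReal (2 * C)) ENNReal.ofReal_ne_top
      (fun i x y => by
        rw [← ENNReal.ofReal_mul (by positivity), ← ofReal_norm]
        refine ENNReal.ofReal_le_ofReal ((norm_sub_le _ _).trans ?_)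
        linarith [hu' i (x, y), hv' (x, y)])
      (fun x y => by
        have := ((hlim (x, y)).sub_const (v (x, y))).enorm
        simpa using this)
      (ε := ENNReal.ofReal ((ε / 2) ^ 2)) (by simpa using by positivity)
    obtain ⟨i₀, hi₀⟩ := eventually_atTop.1 h1
    refine ⟨i₀, fun i hi => ?_⟩
    have h2 := (hker (u i) C hC (hu i) (hu' i)).sub_smul (hker v C hC hv hv') 1
    simp only [one_smul] at h2
    have h3 := h2.norm_le (by positivity) (hi₀ i hi)
    rw [Real.dist_eq, sub_zero, abs_of_nonneg (norm_nonneg _)]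
    exact h3.trans_lt (half_lt_self hε)

/-! ### Measurability of vector valued columns -/

/-- In a separable metric space an open set is a countable union of balls. -/
theorem measurable_of_measurableSet_ball {α E : Type*} [MeasurableSpace α] [NormedAddCommGroup E]
    [MeasurableSpace E] [BorelSpace E] [SecondCountableTopology E] {f : α → E}
    (h : ∀ c r, MeasurableSet (f ⁻¹' Metric.ball c r)) : Measurable f := by
  refine measurable_of_isOpen fun U hU => ?_
  have hcover : ∀ x : U, ∃ r > 0, Metric.ball (x : E) r ⊆ U := fun x =>
    Metric.isOpen_iff.1 hU x x.2
  choose r hr hrU using hcover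
  obtain ⟨T, hT, hTU⟩ := TopologicalSpace.isOpen_iUnion_countable
    (fun x : U => Metric.ball (x : E) (r x)) fun _ => Metric.isOpen_ball
  have hU' : U = ⋃ x ∈ T, Metric.ball (x : E) (r x) := by
    rw [hTU]
    refine Subset.antisymm (fun y hy => mem_iUnion.2 ⟨⟨y, hy⟩, Metric.mem_ball_self (hr _)⟩) ?_
    exact iUnion_subset hrU
  rw [hU', preimage_iUnion₂]
  exact MeasurableSet.biUnion hT fun x _ => h _ _

theorem secondCountableTopology_L2 : SecondCountableTopology (L2 n) := by
  have : Fact ((2 : ℝ≥0∞) ≠ ⊤) := ⟨by simp⟩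
  infer_instance

/-- The preimage of a ball around `c` is a sublevel set of `∫ |K(a,x) - c(x)|² dx`, which is
measurable in `a` by Tonelli. -/
theorem stronglyMeasurable_toL2 {α : Type*} [MeasurableSpace α] {K : α → Space n → ℂ}
    (hK : Measurable (Function.uncurry K)) (hmem : ∀ a, MemLp (K a) 2) :
    StronglyMeasurable fun a => toL2 (K a) := by
  have : SecondCountableTopology (L2 n) := secondCountableTopology_L2
  borelize (L2 n)
  refine Measurable.stronglyMeasurable (measurable_of_measurableSet_ball fun c r => ?_)
  have h1 : ∀ a, ‖toL2 (K a) - c‖ₑ ^ 2 = ∫⁻ x, ‖K a x - c x‖ₑ ^ 2 := fun a => by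
    rw [← lintegral_enorm_sq]
    refine lintegral_congr_ae ?_
    filter_upwards [coeFn_toL2 (hmem a), Lp.coeFn_sub (toL2 (K a)) c] with x h2 h3
    rw [h3, Pi.sub_apply, h2]
  have h2 : Measurable fun a => ∫⁻ x, ‖K a x - c x‖ₑ ^ 2 :=
    Measurable.lintegral_prod_right' (f := fun p : α × Space n => ‖K p.1 p.2 - c p.2‖ₑ ^ 2)
      ((hK.sub ((Lp.stronglyMeasurable c).measurable.comp measurable_snd)).enorm.pow_const 2)
  have h3 : (fun a => toL2 (K a)) ⁻¹' Metric.ball c r =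
      {a | Real.sqrt (∫⁻ x, ‖K a x - c x‖ₑ ^ 2).toReal < r} := by
    ext a
    rw [mem_preimage, Metric.mem_ball, dist_eq_norm, mem_ofPred_eq, ← h1]
    simp [Real.sqrt_sq]
  rw [h3]
  exact measurableSet_lt h2.ennreal_toReal.sqrt measurable_const

/-! ### Compactness -/

theorem exists_finiteDimensional_exhaustion (n : ℕ) : ∃ U : ℕ → Submodule ℂ (L2 n),
    Monotone U ∧ (∀ i, FiniteDimensional ℂ (U i)) ∧ ⊤ ≤ (⨆ i, U i).topologicalClosure := by
  have : SecondCountableTopology (L2 n) := secondCountableTopology_L2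
  obtain ⟨d, hd⟩ := TopologicalSpace.exists_dense_seq (L2 n)
  refine ⟨fun i => Submodule.span ℂ (d '' {j | j ≤ i}), ?_, ?_, ?_⟩
  · exact fun i i' h => Submodule.span_mono (image_mono fun j hj => le_trans hj h)
  · exact fun i => FiniteDimensional.span_of_finite ℂ ((finite_le_nat i).image d)
  · intro x _
    have h1 : range d ⊆ (⨆ i, Submodule.span ℂ (d '' {j | j ≤ i}) : Submodule ℂ (L2 n)) := by
      rintro _ ⟨j, rfl⟩
      exact Submodule.mem_iSup_of_mem j (Submodule.subset_span ⟨j, le_refl j, rfl⟩)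
    exact closure_mono h1 (hd x)

/-- A Hilbert–Schmidt operator is `Tf(x) = ⟨a(x), f⟩` with `∫ ‖a(x)‖² dx` finite. For the
projections `P_i` onto an exhaustion by finite dimensional subspaces, `‖T P_i - T‖²` is at most `∫
‖a - P_i a‖²`, which tends to zero by dominated convergence, and `T P_i` has finite rank. -/
theorem isCompactOperator_of_weight_le {σ : ℝ} (hσ : (n : ℝ) < 2 * σ) {T : L2 n →L[ℂ] L2 n}
    {K : Space n → Space n → ℂ} (hKm : Measurable (Function.uncurry K)) (hT : HasKernel T 0 K)
    {C : ℝ} (hK : ∀ x y, ‖K x y‖ ≤ C * weight σ x * weight σ y) : IsCompactOperator T := by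
  obtain ⟨U, hmono, hfd, hdense⟩ := exists_finiteDimensional_exhaustion n
  have hrow : ∀ x, MemLp (fun y => (starRingEnd ℂ) (K x y)) 2 := fun x =>
    memLp_of_le_mul (memLp_weight hσ)
      (Complex.continuous_conj.measurable.comp
        (hKm.comp (measurable_const.prodMk measurable_id))) fun y => by
      simpa using hK x y
  set a : Space n → L2 n := fun x => toL2 fun y => (starRingEnd ℂ) (K x y) with ha
  have ham : StronglyMeasurable a :=
    stronglyMeasurable_toL2 (K := fun x y => (starRingEnd ℂ) (K x y))
      (Complex.continuous_conj.measurable.comp hKm) hrow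
  have hTa : ∀ f, ∀ᵐ x, T f x = inner ℂ (a x) f := fun f => by
    filter_upwards [hT f] with x hx
    rw [hx.2, ha, inner_toL2 (hrow x)]
    simp
  have hbound : ∫⁻ x, ‖a x‖ₑ ^ 2 < ⊤ := by
    have h1 : ∀ x, ‖a x‖ ≤ (C * ‖toL2 fun y : Space n => (weight σ y : ℂ)‖) * weight σ x := by
      intro x
      have h2 : ‖a x‖ ≤ (C * weight σ x) * ‖toL2 fun y : Space n => (weight σ y : ℂ)‖ := by
        refine Lp.norm_le_mul_norm_of_ae_le_mul ?_
        filter_upwards [coeFn_toL2 (hrow x), coeFn_toL2 (memLp_weight (n := n) hσ)] with y h3 h4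
        rw [h3, h4, Complex.norm_real, Real.norm_of_nonneg (weight_pos σ y).le]
        simpa using hK x y
      exact h2.trans_eq (by ring)
    have hm : MemLp (fun x => ((‖a x‖ : ℝ) : ℂ)) 2 :=
      memLp_of_le_mul (memLp_weight hσ) (Complex.measurable_ofReal.comp ham.norm.measurable)
        fun x => by simpa using h1 x
    have h5 := enorm_toL2_sq hm
    refine lt_of_eq_of_lt (lintegral_congr fun x => ?_) (h5.symm.trans_lt (by simp))
    rw [← ofReal_norm, ← ofReal_norm]
    simp
  have hP : ∀ i, IsCompactOperator (T ∘L (U i).starProjection) := fun i => by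
    have h1 : IsCompactOperator (U i).starProjection := by
      have h2 : IsCompactOperator ((U i).subtypeL : U i →L[ℂ] L2 n) :=
        isCompactOperator_of_locallyCompactSpace_rng _
      exact h2.comp_clm (U i).orthogonalProjectionOnto
    exact h1.clm_comp T
  refine isCompactOperator_of_tendsto (l := (atTop : Filter ℕ))
    (F := fun i => T ∘L (U i).starProjection) ?_ (Eventually.of_forall hP)
  have hdiff : ∀ i x, ‖a x - (U i).starProjection (a x)‖ ≤ ‖a x‖ := fun i x => by
    have h1 : a x - (U i).starProjection (a x) = (U i)ᗮ.starProjection (a x) := by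
      rw [Submodule.starProjection_orthogonal]; rfl
    rw [h1]
    exact Submodule.norm_starProjection_apply_le _ _
  have hlim : Tendsto (fun i => ∫⁻ x, ‖a x - (U i).starProjection (a x)‖ₑ ^ 2) atTop (𝓝 0) := by
    have h := tendsto_lintegral_of_dominated_convergence (μ := (volume : Measure (Space n)))
      (F := fun i x => ‖a x - (U i).starProjection (a x)‖ₑ ^ 2) (f := fun _ => 0)
      (fun x => ‖a x‖ₑ ^ 2)
      (fun i => ((ham.sub ((U i).starProjection.continuous.comp_stronglyMeasurable
        ham)).enorm).pow_const 2)
      (fun i => ae_of_all _ fun x => pow_le_pow_left₀ zero_le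
        (enorm_le_iff_norm_le.2 (hdiff i x)) 2) hbound.ne
      (ae_of_all _ fun x => by
        have h1 := (Submodule.starProjection_tendsto_self U hmono (a x) hdense).const_sub (a x)
        rw [sub_self] at h1
        have h3 := h1.enorm
        rw [enorm_zero] at h3
        have := ((ENNReal.continuous_pow 2).tendsto 0).comp h3
        simpa [Function.comp_def] using this)
    simpa using h
  rw [tendsto_iff_norm_sub_tendsto_zero]
  have hle : ∀ i, ‖T ∘L (U i).starProjection - T‖ ≤
      Real.sqrt (∫⁻ x, ‖a x - (U i).starProjection (a x)‖ₑ ^ 2).toReal := by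
    intro i
    refine ContinuousLinearMap.opNorm_le_bound _ (Real.sqrt_nonneg _) fun f => ?_
    set I := ∫⁻ x, ‖a x - (U i).starProjection (a x)‖ₑ ^ 2 with hI
    have hItop : I < ⊤ := lt_of_le_of_lt (lintegral_mono fun x => pow_le_pow_left₀ zero_le
        (enorm_le_iff_norm_le.2 (hdiff i x)) 2) hbound
    have h1 : ‖(T ∘L (U i).starProjection - T) f‖ₑ ^ 2 ≤ I * ‖f‖ₑ ^ 2 := by
      have hmI : Measurable fun x => ‖a x - (U i).starProjection (a x)‖ₑ ^ 2 :=
        (ham.sub ((U i).starProjection.continuous.comp_stronglyMeasurable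
          ham)).enorm.pow_const 2
      rw [← lintegral_enorm_sq, hI, ← lintegral_mul_const _ hmI]
      refine lintegral_mono_ae ?_
      filter_upwards [hTa f, hTa ((U i).starProjection f),
        Lp.coeFn_sub (T ((U i).starProjection f)) (T f)] with x h1 h2 h3
      have h4 : (T ∘L (U i).starProjection - T) f = T ((U i).starProjection f) - T f := rfl
      rw [h4, h3, Pi.sub_apply, h1, h2, ← mul_pow]
      refine pow_le_pow_left₀ zero_le ?_ 2
      have h5 : inner ℂ (a x) ((U i).starProjection f) =
          inner ℂ ((U i).starProjection (a x)) f :=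
        (Submodule.inner_starProjection_left_eq_right _ _ _).symm
      rw [h5, ← inner_sub_left, ← ofReal_norm, ← ofReal_norm, ← ofReal_norm,
        ← ENNReal.ofReal_mul (norm_nonneg _)]
      refine ENNReal.ofReal_le_ofReal ((norm_inner_le_norm _ _).trans_eq ?_)
      rw [norm_sub_rev]
    have h6 := ENNReal.toReal_mono (ENNReal.mul_ne_top hItop.ne (by simp)) h1
    rw [ENNReal.toReal_mul] at h6
    simp only [ENNReal.toReal_pow, toReal_enorm] at h6
    rw [← Real.sqrt_sq (norm_nonneg f), ← Real.sqrt_mul ENNReal.toReal_nonneg]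
    exact Real.le_sqrt_of_sq_le h6
  refine squeeze_zero (fun i => norm_nonneg _) hle ?_
  have h1 := (ENNReal.tendsto_toReal (by simp : (0 : ℝ≥0∞) ≠ ⊤)).comp hlim
  have h2 := (Real.continuous_sqrt.tendsto _).comp h1
  simpa [Function.comp_def] using h2

/-- Operators with dominated kernels are compact. -/
theorem isCompactOperator_of_major {σ : ℝ} (hσ : (n : ℝ) < 2 * σ) {γ : ℕ} (hγ : γ < n)
    {K : Space n → Space n → ℂ} (hKm : Measurable (Function.uncurry K)) {C : ℝ} (hC : 0 ≤ C)
    (hK : ∀ x y, ‖K x y‖ ≤ C * major σ γ x y) : IsCompactOperator (kernelOp 0 K) := by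
  obtain ⟨A, -, hA⟩ := dominatedMap_kernelOp (n := n) hσ hγ
  -- The kernel is cut off near the diagonal, leaving bounded kernels with the weights of
  -- `isCompactOperator_of_weight_le`. The diagonal values are kept only so that the convergence
  -- holds at every point; they are removed again as a null set.
  set u : ℕ → Space n × Space n → ℂ := fun i p =>
    if ‖p.1 - p.2‖ < 1 / ((i : ℝ) + 1) then (if p.1 = p.2 then K p.1 p.2 else 0)
      else K p.1 p.2 with hu
  have hdiag : MeasurableSet {p : Space n × Space n | p.1 = p.2} :=
    measurableSet_eq_fun measurable_fst measurable_snd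
  have hum : ∀ i, Measurable (u i) := fun i =>
    Measurable.ite (measurableSet_dist_lt _) (Measurable.ite hdiag hKm measurable_const) hKm
  have hule : ∀ i p, ‖u i p‖ ≤ C * major σ γ p.1 p.2 := fun i p => by
    have h0 : 0 ≤ C * major σ γ p.1 p.2 := mul_nonneg hC (major_pos σ γ _ _).le
    simp only [hu]
    split_ifs
    · exact hK _ _
    · simpa using h0
    · exact hK _ _
  have hlim : ∀ p : Space n × Space n,
      Tendsto (fun i => u i p) atTop (𝓝 (Function.uncurry K p)) := fun p => by
    refine tendsto_const_nhds.congr' ?_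
    by_cases hp : p.1 = p.2
    · exact Eventually.of_forall fun i => by simp [hu, hp, Function.uncurry]
    · have hpos : 0 < ‖p.1 - p.2‖ := norm_pos_iff.2 (sub_ne_zero.2 hp)
      filter_upwards [(tendsto_order.1 (tendsto_one_div_add_atTop_nhds_zero_nat (𝕜 := ℝ))).2 _ hpos]
        with i hi
      simp only [hu, if_neg (not_lt.2 hi.le), Function.uncurry]
  have h1 := hA.tendsto u (Function.uncurry K) C hC hum hKm hule hlim
  refine isCompactOperator_of_tendsto h1 (Eventually.of_forall fun i => ?_)
  have hker := hasKernel_kernelOp hσ hγ (K := fun x y => u i (x, y)) (hum i) hC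
    fun x y => hule i (x, y)
  have hoff : HasKernel (kernelOp 0 fun x y => u i (x, y)) 0 fun x y : Space n =>
      if ‖x - y‖ < 1 / ((i : ℝ) + 1) then 0 else K x y := by
    refine hker.congr fun x => ?_
    by_cases hn : n = 0
    · omega
    have : NeZero n := ⟨hn⟩
    have : Nontrivial (Space n) := by
      apply Module.nontrivial_of_finrank_pos (R := ℝ)
      rw [finrank_euclideanSpace_fin]; omega
    have hne : ∀ᵐ y : Space n, y ≠ x := by simp [ae_iff, measure_singleton]
    filter_upwards [hne] with y hy
    simp only [hu, if_neg hy.symm]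
  refine isCompactOperator_of_weight_le hσ
    (K := fun x y => if ‖x - y‖ < 1 / ((i : ℝ) + 1) then 0 else K x y)
    (Measurable.ite (measurableSet_dist_lt _) measurable_const hKm) hoff
    (C := C * (1 + ((1 / ((i : ℝ) + 1)) ^ γ)⁻¹)) fun x y => ?_
  have hw := mul_pos (weight_pos σ x) (weight_pos σ y)
  split_ifs with h
  · rw [norm_zero, mul_assoc]; positivity
  · refine (hK x y).trans ((mul_le_mul_of_nonneg_left
      (far_le (σ := σ) (γ := γ) (by positivity) h) hC).trans_eq ?_)
    ring

end HigherSchrodinger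

namespace HigherSchrodinger

variable {n m : ℕ}

/-! ### Families of kernels -/

/-- `K(λ)(x,y)`, `0 < λ < L`, satisfies symbol bounds with majorant
`⟨x⟩^{-σ} ⟨y⟩^{-σ} (1 + |x-y|^{-γ})`. -/
def SymKer (N : ℕ) (L σ : ℝ) (γ : ℕ) (K : ℝ → Space n → Space n → ℂ) : Prop :=
  (∀ t ∈ Ioo 0 L, Measurable (Function.uncurry (K t))) ∧
    ∃ C, 0 ≤ C ∧ ∀ x y, SymB 1 N L (C * major σ γ x y) fun t => K t x y

theorem SymB.const_mul {e N : ℕ} {L C : ℝ} {f : ℝ → ℂ} (h : SymB e N L C f) (c : ℂ) :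
    SymB e N L (‖c‖ * C) fun t => c * f t := by
  refine symB_of_chain (F := fun j t => c * iteratedDeriv j f t) (fun j hj t ht => ?_) ?_ ?_
  · exact (hasDerivAt_iteratedDeriv isOpen_Ioo h.1 hj ht).const_mul c
  · exact continuousOn_const.mul (continuousOn_iteratedDeriv isOpen_Ioo h.1 le_rfl)
  · intro j hj t ht
    rw [norm_mul, mul_left_comm]
    exact mul_le_mul_of_nonneg_left (h.2 j hj t ht) (norm_nonneg _)

theorem symB_zero {e N : ℕ} {L C : ℝ} (hC : 0 ≤ C) : SymB e N L C fun _ => (0 : ℂ) :=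
  (symB_const (0 : ℂ)).mono (by simpa using hC)

theorem SymKer.mono {N : ℕ} {L L' σ : ℝ} {γ γ' : ℕ} {K : ℝ → Space n → Space n → ℂ}
    (h : SymKer N L σ γ K) (hL : L' ≤ L) (hγ : γ ≤ γ') : SymKer N L' σ γ' K := by
  obtain ⟨h1, C, hC, h2⟩ := h
  refine ⟨fun t ht => h1 t ⟨ht.1, ht.2.trans_le hL⟩, 2 * C, by positivity, fun x y =>
    ((h2 x y).restrict hL).mono ?_⟩
  have := mul_le_mul_of_nonneg_left (major_le σ hγ x y) hC
  linarith

theorem SymKer.mul_left {N : ℕ} {L σ : ℝ} {γ : ℕ} {K : ℝ → Space n → Space n → ℂ}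
    (h : SymKer N L σ γ K) {a : Space n → ℂ} (ha : Measurable a) (ha1 : ∀ x, ‖a x‖ ≤ 1) :
    SymKer N L σ γ fun t x y => a x * K t x y := by
  obtain ⟨h1, C, hC, h2⟩ := h
  refine ⟨fun t ht => (ha.comp measurable_fst).mul (h1 t ht), C, hC, fun x y =>
    ((h2 x y).const_mul (a x)).mono ?_⟩
  exact mul_le_of_le_one_left (mul_nonneg hC (major_pos σ γ x y).le) (ha1 x)

theorem SymKer.mul_right {N : ℕ} {L σ : ℝ} {γ : ℕ} {K : ℝ → Space n → Space n → ℂ}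
    (h : SymKer N L σ γ K) {a : Space n → ℂ} (ha : Measurable a) (ha1 : ∀ x, ‖a x‖ ≤ 1) :
    SymKer N L σ γ fun t x y => K t x y * a y := by
  obtain ⟨h1, C, hC, h2⟩ := h
  refine ⟨fun t ht => (h1 t ht).mul (ha.comp measurable_snd), C, hC, fun x y => ?_⟩
  refine (((h2 x y).const_mul (a y)).mono ?_).congr fun t _ => mul_comm _ _
  exact mul_le_of_le_one_left (mul_nonneg hC (major_pos σ γ x y).le) (ha1 y)

theorem SymKer.hasKernel_kernelOp {N : ℕ} {L σ : ℝ} (hσ : (n : ℝ) < 2 * σ) {γ : ℕ} (hγ : γ < n)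
    {K : ℝ → Space n → Space n → ℂ} (h : SymKer N L σ γ K) {t : ℝ} (ht : t ∈ Ioo 0 L) :
    HasKernel (kernelOp 0 (K t)) 0 (K t) := by
  obtain ⟨h1, C, hC, h2⟩ := h
  exact HigherSchrodinger.hasKernel_kernelOp hσ hγ (h1 t ht) hC fun x y => (h2 x y).norm_le ht

theorem SymKer.exists_sqBdd {N : ℕ} {L σ : ℝ} (hσ : (n : ℝ) < 2 * σ) {γ : ℕ} (hγ : γ < n)
    {K : ℝ → Space n → Space n → ℂ} (h : SymKer N L σ γ K) {t : ℝ} (ht : t ∈ Ioo 0 L) :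
    ∃ B : ℝ≥0∞, B ≠ ⊤ ∧ SqBdd (fun x y => ‖K t x y‖ₑ) B := by
  obtain ⟨h1, C, hC, h2⟩ := h
  obtain ⟨A, hA⟩ := exists_sqBdd_major (n := n) hσ hγ
  exact ⟨_, ENNReal.ofReal_ne_top, sqBdd_of_le_major hA hC fun x y => (h2 x y).norm_le ht⟩

/-! ### Composition -/

/-- By the triangle inequality the larger of `a`, `b` is at least `r/2`. From it `γ - 1` powers are
extracted into `r^{-(γ-1)}`; the remaining `α + 1` powers are all moved to the smaller distance. -/
theorem singular_mul_le {α γ : ℕ} (hγ : γ ≤ α + 1) {a b r : ℝ} (ha : 0 ≤ a) (hb : 0 ≤ b)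
    (hr : 0 < r) (hab : r ≤ a + b) :
    (1 + (a ^ α)⁻¹) * (1 + (b ^ γ)⁻¹) ≤ (5 + 2 ^ γ) *
      (1 + (a ^ (α + 1))⁻¹ + (b ^ (α + 1))⁻¹) * (1 + (r ^ (γ - 1))⁻¹) := by
  have h1 := inv_pow_le_one_add (Nat.le_succ α) ha
  have h2 := inv_pow_le_one_add hγ hb
  rw [Nat.succ_eq_add_one] at h1
  set A := (a ^ (α + 1))⁻¹ with hA
  set B := (b ^ (α + 1))⁻¹ with hB
  have hA0 : 0 ≤ A := by positivity
  have hB0 : 0 ≤ B := by positivity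
  have hR0 : 0 ≤ (r ^ (γ - 1))⁻¹ := by positivity
  have h2γ : (1 : ℝ) ≤ 2 ^ γ := one_le_pow₀ (by norm_num)
  have hq : 0 ≤ (5 + 2 ^ γ) * (1 + A + B) := by positivity
  have hbase : ∀ X, X ≤ (5 + 2 ^ γ) * (1 + A + B) →
      X ≤ (5 + 2 ^ γ) * (1 + A + B) * (1 + (r ^ (γ - 1))⁻¹) := fun X hX =>
    hX.trans (le_mul_of_one_le_right hq (by linarith))
  have hsum : 5 * (1 + A + B) ≤ (5 + 2 ^ γ) * (1 + A + B) := by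
    gcongr; linarith
  rcases Nat.eq_zero_or_pos γ with rfl | hγ0
  · refine hbase _ ?_
    simp only [pow_zero, inv_one]
    nlinarith
  rcases ha.eq_or_lt with rfl | ha
  · refine hbase _ ?_
    have h3 : (((0 : ℝ) ^ α)⁻¹) ≤ 1 := by
      rcases Nat.eq_zero_or_pos α with rfl | h0
      · simp
      · simp [h0.ne']
    have h4 : 0 ≤ (b ^ γ)⁻¹ := by positivity
    nlinarith
  rcases hb.eq_or_lt with rfl | hb
  · refine hbase _ ?_
    simp only [ne_eq, hγ0.ne', not_false_eq_true, zero_pow, inv_zero, add_zero, mul_one]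
    nlinarith
  have hcross : (a ^ α)⁻¹ * (b ^ γ)⁻¹ ≤ (A + B) * (2 ^ γ * (r ^ (γ - 1))⁻¹) := by
    have hd : ∀ d, 0 < d → r ≤ 2 * d → (d ^ (γ - 1))⁻¹ ≤ 2 ^ γ * (r ^ (γ - 1))⁻¹ := by
      intro d hd hrd
      rw [inv_le_comm₀ (by positivity) (by positivity), mul_inv, inv_inv, inv_mul_le_iff₀ (by positivity)]
      calc r ^ (γ - 1) ≤ (2 * d) ^ (γ - 1) := pow_le_pow_left₀ hr.le hrd _
        _ = 2 ^ (γ - 1) * d ^ (γ - 1) := mul_pow _ _ _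
        _ ≤ _ := by
          gcongr
          · norm_num
          · omega
    rcases le_total a b with h | h
    · have e : (b ^ γ)⁻¹ = b⁻¹ * (b ^ (γ - 1))⁻¹ := by
        rw [← mul_inv, ← pow_succ', Nat.sub_add_cancel hγ0]
      have h3 : (a ^ α)⁻¹ * b⁻¹ ≤ A := by
        rw [hA, pow_succ, mul_inv]
        gcongr
      calc _ = (a ^ α)⁻¹ * b⁻¹ * (b ^ (γ - 1))⁻¹ := by rw [e]; ring
        _ ≤ A * (2 ^ γ * (r ^ (γ - 1))⁻¹) :=
            mul_le_mul h3 (hd b hb (by linarith)) (by positivity) hA0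
        _ ≤ _ := by gcongr; linarith
    · have e : (a ^ α)⁻¹ = (a ^ (α - (γ - 1)))⁻¹ * (a ^ (γ - 1))⁻¹ := by
        rw [← mul_inv, ← pow_add]; congr 2; omega
      have h3 : (a ^ (α - (γ - 1)))⁻¹ * (b ^ γ)⁻¹ ≤ B := by
        have e2 : B = (b ^ (α - (γ - 1)))⁻¹ * (b ^ γ)⁻¹ := by
          rw [hB, ← mul_inv, ← pow_add]; congr 2; omega
        rw [e2]
        gcongr
      calc _ = (a ^ (α - (γ - 1)))⁻¹ * (b ^ γ)⁻¹ * (a ^ (γ - 1))⁻¹ := by rw [e]; ring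
        _ ≤ B * (2 ^ γ * (r ^ (γ - 1))⁻¹) :=
            mul_le_mul h3 (hd a ha (by linarith)) (by positivity) hB0
        _ ≤ _ := by gcongr; linarith
  have hα0 : (a ^ α)⁻¹ ≤ 1 + 2 * A := by linarith
  have hγ1 : (b ^ γ)⁻¹ ≤ 1 + 2 * B := by linarith
  have hcross2 : (A + B) * (2 ^ γ * (r ^ (γ - 1))⁻¹) ≤
      2 ^ γ * (1 + A + B) * (1 + (r ^ (γ - 1))⁻¹) := by
    have : (A + B) * (r ^ (γ - 1))⁻¹ ≤ (1 + A + B) * (1 + (r ^ (γ - 1))⁻¹) := by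
      gcongr <;> linarith
    have := mul_le_mul_of_nonneg_left this (by linarith : (0 : ℝ) ≤ 2 ^ γ)
    linarith
  have hfirst : 1 + (a ^ α)⁻¹ + (b ^ γ)⁻¹ ≤ 5 * (1 + A + B) * (1 + (r ^ (γ - 1))⁻¹) := by
    have : 5 * (1 + A + B) ≤ 5 * (1 + A + B) * (1 + (r ^ (γ - 1))⁻¹) :=
      le_mul_of_one_le_right (by positivity) (by linarith)
    linarith
  linarith

/-- The intermediate majorant of a composition. -/
noncomputable def midMajor (σ : ℝ) (γ : ℕ) (x y z : Space n) : ℝ :=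
  weight σ z ^ 2 * (1 + (‖x - z‖ ^ γ)⁻¹ + (‖z - y‖ ^ γ)⁻¹)

theorem midMajor_nonneg (σ : ℝ) (γ : ℕ) (x y z : Space n) : 0 ≤ midMajor σ γ x y z := by
  unfold midMajor; positivity

theorem exists_integral_midMajor_le {σ : ℝ} (hσ : (n : ℝ) < 2 * σ) {γ : ℕ} (hγ : γ < n) :
    ∃ C, 0 ≤ C ∧ ∀ x y : Space n, Integrable (midMajor σ γ x y) ∧ ∫ z, midMajor σ γ x y z ≤ C := by
  have hσ0 : 0 ≤ σ := by linarith [(Nat.cast_nonneg n : (0 : ℝ) ≤ n)]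
  obtain ⟨D, hD⟩ := exists_lintegral_inv_norm_pow_mul_le (n := n) hγ
  set w : Space n → ℝ≥0∞ := fun z => ENNReal.ofReal (weight σ z) ^ 2
  have hw1 : ∀ z, w z ≤ 1 := fun z =>
    pow_le_one₀ zero_le (ENNReal.ofReal_le_one.2 (weight_le_one hσ0 z))
  have hwm : Measurable w := (measurable_weight σ).ennreal_ofReal.pow_const 2
  set I := ∫⁻ z, w z with hI
  have hItop : I < ⊤ := lintegral_weight_sq_lt_top hσ
  have hmeas : ∀ x y : Space n, Measurable (midMajor σ γ x y) := fun x y =>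
    ((measurable_weight σ).pow_const 2).mul (by fun_prop)
  have hbd : ∀ x y : Space n, ∫⁻ z, ENNReal.ofReal (midMajor σ γ x y z) ≤
      I + (D * 1 + I) + (D * 1 + I) := by
    intro x y
    have e : ∀ z, ENNReal.ofReal (midMajor σ γ x y z) =
        w z + ENNReal.ofReal ((‖x - z‖ ^ γ)⁻¹) * w z + ENNReal.ofReal ((‖y - z‖ ^ γ)⁻¹) * w z := by
      intro z
      rw [midMajor, norm_sub_rev z y, ENNReal.ofReal_mul (by positivity),
        ENNReal.ofReal_add (by positivity) (by positivity),
        ENNReal.ofReal_add (by positivity) (by positivity),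
        ENNReal.ofReal_pow (weight_pos σ z).le, ENNReal.ofReal_one]
      ring
    simp_rw [e]
    have hm1 : Measurable fun z => w z + ENNReal.ofReal ((‖x - z‖ ^ γ)⁻¹) * w z :=
      hwm.add ((measurable_inv_norm_pow γ x).mul hwm)
    rw [lintegral_add_left hm1, lintegral_add_left hwm]
    exact add_le_add (add_le_add le_rfl (hD w 1 hw1 x)) (hD w 1 hw1 y)
  have hne : I + (D * 1 + I) + (D * 1 + I) ≠ ⊤ := by
    simp [hItop.ne, ENNReal.add_eq_top]
  refine ⟨(I + (D * 1 + I) + (D * 1 + I)).toReal, ENNReal.toReal_nonneg, fun x y => ⟨?_, ?_⟩⟩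
  · refine ⟨(hmeas x y).aestronglyMeasurable, ?_⟩
    rw [hasFiniteIntegral_iff_ofReal (ae_of_all _ (midMajor_nonneg σ γ x y))]
    exact (hbd x y).trans_lt hne.lt_top
  · rw [integral_eq_lintegral_of_nonneg_ae (ae_of_all _ (midMajor_nonneg σ γ x y))
      (hmeas x y).aestronglyMeasurable]
    exact ENNReal.toReal_mono hne (hbd x y)

/-- The kernel of a composition, normalised to vanish on the diagonal. -/
noncomputable def compKer (K₁ K₂ : Space n → Space n → ℂ) (x y : Space n) : ℂ :=
  open Classical in if x = y then 0 else ∫ z, K₁ x z * K₂ z y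

/-- One unit of diagonal singularity is gained per composition. This is not sharp, but it suffices
and keeps the exponents integral; the price is an intermediate singularity of order `α + 1`,
integrable because `α + 1 < n`. -/
theorem SymKer.comp {N : ℕ} {L σ : ℝ} (hσ : (n : ℝ) < 2 * σ) (hL : L ≤ 1) {α γ : ℕ}
    (hα : α + 1 < n) (hγ : γ ≤ α + 1) {K₁ K₂ : ℝ → Space n → Space n → ℂ}
    (h₁ : SymKer N L σ α K₁) (h₂ : SymKer N L σ γ K₂) :
    SymKer N L σ (γ - 1) fun t => compKer (K₁ t) (K₂ t) := by
  obtain ⟨hm₁, C₁, hC₁, h₁⟩ := h₁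
  obtain ⟨hm₂, C₂, hC₂, h₂⟩ := h₂
  obtain ⟨D, hD, hI⟩ := exists_integral_midMajor_le (n := n) hσ hα
  have hdiag : MeasurableSet {p : Space n × Space n | p.1 = p.2} :=
    measurableSet_eq_fun measurable_fst measurable_snd
  refine ⟨fun t ht => ?_, D * (2 ^ N * ‖ContinuousLinearMap.mul ℝ ℂ‖ * C₁ * C₂ * (5 + 2 ^ γ)),
    by positivity, fun x y => ?_⟩
  · have h : Measurable fun p : Space n × Space n => ∫ z, K₁ t p.1 z * K₂ t z p.2 := by
      refine (StronglyMeasurable.integral_prod_right'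
        (f := fun q : (Space n × Space n) × Space n => K₁ t q.1.1 q.2 * K₂ t q.2 q.1.2)
        (Measurable.stronglyMeasurable ?_)).measurable
      exact ((hm₁ t ht).comp ((measurable_fst.comp measurable_fst).prodMk measurable_snd)).mul
        ((hm₂ t ht).comp (measurable_snd.prodMk (measurable_snd.comp measurable_fst)))
    classical
    have h' : Measurable fun p : Space n × Space n =>
        if p.1 = p.2 then (0 : ℂ) else ∫ z, K₁ t p.1 z * K₂ t z p.2 :=
      Measurable.ite hdiag measurable_const h
    convert h' using 1
    ext p
    simp only [Function.uncurry, compKer]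
  -- Setting the composed kernel to zero on the diagonal avoids integrals that may diverge there.
  · by_cases hxy : x = y
    · simp only [compKer, hxy, if_true]
      exact symB_zero (by have := major_pos σ (γ - 1) y y; positivity)
    have hr : 0 < ‖x - y‖ := norm_pos_iff.2 (sub_ne_zero.2 hxy)
    set C := 2 ^ N * ‖ContinuousLinearMap.mul ℝ ℂ‖ * C₁ * C₂ * (5 + 2 ^ γ) *
      major σ (γ - 1) x y with hCdef
    have hmaj := major_pos σ (γ - 1) x y
    have hpt : ∀ z, SymB 1 N L (C * midMajor σ (α + 1) x y z) fun t => K₁ t x z * K₂ t z y := by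
      intro z
      have h := (h₁ x z).bilin (ContinuousLinearMap.mul ℝ ℂ) hL
        (mul_nonneg hC₁ (major_pos σ α x z).le) (mul_nonneg hC₂ (major_pos σ γ z y).le) (h₂ z y)
      refine h.mono ?_
      have h3 := singular_mul_le (α := α) hγ (norm_nonneg (x - z)) (norm_nonneg (z - y)) hr
        (norm_sub_le_norm_sub_add_norm_sub x z y)
      have h4 : major σ α x z * major σ γ z y ≤
          (5 + 2 ^ γ) * major σ (γ - 1) x y * midMajor σ (α + 1) x y z := by
        have hw : 0 ≤ weight σ x * weight σ y * weight σ z ^ 2 := by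
          have := weight_pos σ x
          have := weight_pos σ y
          positivity
        have := mul_le_mul_of_nonneg_left h3 hw
        calc _ = weight σ x * weight σ y * weight σ z ^ 2 *
              ((1 + (‖x - z‖ ^ α)⁻¹) * (1 + (‖z - y‖ ^ γ)⁻¹)) := by
              rw [major, major]; ring
          _ ≤ _ := this
          _ = _ := by rw [major, midMajor]; ring
      have h5 : 0 ≤ 2 ^ N * ‖ContinuousLinearMap.mul ℝ ℂ‖ * C₁ * C₂ := by positivity
      calc _ = 2 ^ N * ‖ContinuousLinearMap.mul ℝ ℂ‖ * C₁ * C₂ *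
            (major σ α x z * major σ γ z y) := by ring
        _ ≤ _ := mul_le_mul_of_nonneg_left h4 h5
        _ = _ := by rw [hCdef]; ring
    have hreal := SymB.realise (dominatedMap_integral (hI x y).1) (by positivity)
      (fun t ht => Measurable.mul ((hm₁ t ht).comp (measurable_const.prodMk measurable_id))
        ((hm₂ t ht).comp (measurable_id.prodMk measurable_const))) hpt
    simp only [compKer, if_neg hxy]
    refine hreal.mono ?_
    calc _ ≤ D * C := mul_le_mul_of_nonneg_right (hI x y).2 (by positivity)
      _ = _ := by rw [hCdef]; ring

theorem HasKernel.comp {T₁ T₂ : L2 n →L[ℂ] L2 n} {K₁ K₂ : Space n → Space n → ℂ} (hn : 0 < n)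
    (h₁ : HasKernel T₁ 0 K₁) (h₂ : HasKernel T₂ 0 K₂) (hm₁ : Measurable (Function.uncurry K₁))
    (hm₂ : Measurable (Function.uncurry K₂)) {B₁ B₂ : ℝ≥0∞} (hB₁ : B₁ ≠ ⊤) (hB₂ : B₂ ≠ ⊤)
    (hs₁ : SqBdd (fun x y => ‖K₁ x y‖ₑ) B₁) (hs₂ : SqBdd (fun x y => ‖K₂ x y‖ₑ) B₂) :
    HasKernel (T₁ * T₂) 0 (compKer K₁ K₂) := by
  have : NeZero n := ⟨hn.ne'⟩
  have : Nontrivial (Space n) := by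
    apply Module.nontrivial_of_finrank_pos (R := ℝ)
    rw [finrank_euclideanSpace_fin]; omega
  intro f
  set F : Space n → ℝ≥0∞ := fun z => ∫⁻ y, ‖K₂ z y‖ₑ * ‖f y‖ₑ with hF
  have hFm : Measurable F := Measurable.lintegral_prod_right'
    (f := fun p : Space n × Space n => ‖K₂ p.1 p.2‖ₑ * ‖f p.2‖ₑ)
    (hm₂.enorm.mul ((measurable_enorm_coe f).comp measurable_snd))
  have h3 := hs₂ _ (measurable_enorm_coe f)
  rw [lintegral_enorm_sq] at h3
  have h4 := (hs₁ F hFm).trans (mul_le_mul_right h3 _)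
  have hm : Measurable fun x => (∫⁻ z, ‖K₁ x z‖ₑ * F z) ^ 2 :=
    (Measurable.lintegral_prod_right' (f := fun p : Space n × Space n => ‖K₁ p.1 p.2‖ₑ * F p.2)
      (hm₁.enorm.mul (hFm.comp measurable_snd))).pow_const 2
  have hfin := ae_lt_top hm (h4.trans_lt (ENNReal.mul_lt_top hB₁.lt_top
    (ENNReal.mul_lt_top hB₂.lt_top (by simp)))).ne
  filter_upwards [h₁ (T₂ f), hfin] with x h1 hx
  have hx' : ∫⁻ z, ‖K₁ x z‖ₑ * F z < ⊤ := by
    by_contra h0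
    rw [not_lt, top_le_iff] at h0
    simp [h0] at hx
  have hGm : Measurable fun p : Space n × Space n => K₁ x p.1 * (K₂ p.1 p.2 * f p.2) :=
    (hm₁.comp (measurable_const.prodMk measurable_fst)).mul
      (hm₂.mul ((Lp.stronglyMeasurable f).measurable.comp measurable_snd))
  have hInt : Integrable (Function.uncurry fun z y => K₁ x z * (K₂ z y * f y))
      ((volume : Measure (Space n)).prod volume) := by
    refine ⟨hGm.aestronglyMeasurable, ?_⟩
    change ∫⁻ p : Space n × Space n, ‖K₁ x p.1 * (K₂ p.1 p.2 * f p.2)‖ₑ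
      ∂((volume : Measure (Space n)).prod volume) < ⊤
    rw [lintegral_prod _ hGm.enorm.aemeasurable]
    refine lt_of_eq_of_lt (lintegral_congr fun z => ?_) hx'
    simp only [enorm_mul]
    have hmz : Measurable fun y => ‖K₂ z y‖ₑ * ‖f y‖ₑ :=
      Measurable.mul (hm₂.comp (measurable_const.prodMk measurable_id)).enorm
        (measurable_enorm_coe f)
    exact lintegral_const_mul _ hmz
  have hne : ∀ᵐ y : Space n, y ≠ x := by simp [ae_iff, measure_singleton]
  have hcomp : (fun y => ∫ z, K₁ x z * (K₂ z y * f y)) =ᵐ[volume]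
      fun y => compKer K₁ K₂ x y * f y := by
    filter_upwards [hne] with y hy
    rw [compKer, if_neg hy.symm, ← integral_mul_const]
    simp_rw [mul_assoc]
  refine ⟨hInt.integral_prod_right.congr hcomp, ?_⟩
  rw [mul_apply_eq_comp, h1.2, ← integral_congr_ae hcomp, ← integral_integral_swap hInt]
  simp only [Pi.zero_apply, zero_mul, zero_add]
  refine integral_congr_ae ?_
  filter_upwards [h₂ f] with z hz
  rw [hz.2, integral_const_mul]
  simp

end HigherSchrodinger

namespace HigherSchrodinger

variable {n m : ℕ}

/-! ### The sign and the root of the potential -/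

theorem norm_signU (V : Space n → ℝ) (x : Space n) : ‖signU V x‖ = 1 := by
  unfold signU; split_ifs <;> simp

theorem signU_mul_self (V : Space n → ℝ) (x : Space n) : signU V x * signU V x = 1 := by
  unfold signU; split_ifs <;> simp

theorem measurable_signU {V : Space n → ℝ} (hV : Measurable V) : Measurable (signU V) := by
  classical
  have : Measurable fun x => if 0 ≤ V x then (1 : ℂ) else -1 :=
    Measurable.ite (measurableSet_le measurable_const hV) measurable_const measurable_const
  convert this using 1
  ext x
  simp only [signU]

theorem measurable_vRoot {V : Space n → ℝ} (hV : Measurable V) : Measurable (vRoot V) :=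
  (by fun_prop : Measurable fun x => |V x|).sqrt

theorem vRoot_nonneg (V : Space n → ℝ) (x : Space n) : 0 ≤ vRoot V x := Real.sqrt_nonneg _

theorem ofReal_eq_signU_mul (V : Space n → ℝ) (x : Space n) :
    (V x : ℂ) = signU V x * ((vRoot V x : ℂ) * vRoot V x) := by
  rw [← Complex.ofReal_mul, vRoot, Real.mul_self_sqrt (abs_nonneg _), signU]
  split_ifs with h
  · rw [abs_of_nonneg h, one_mul]
  · rw [abs_of_neg (not_le.1 h)]; push_cast; ring

theorem vRoot_le {V : Space n → ℝ} {C β : ℝ} (h : ∀ x, |V x| ≤ C * bracket x ^ (-β)) (x : Space n) :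
    vRoot V x ≤ Real.sqrt C * weight (β / 2) x := by
  have hC : 0 ≤ C := by
    have h0 := Real.rpow_pos_of_pos (bracket_pos x) (-β)
    by_contra hC
    have := (abs_nonneg _).trans (h x)
    nlinarith [mul_pos_of_neg_of_neg (not_le.1 hC) (neg_neg_of_pos h0)]
  refine (Real.sqrt_le_sqrt (h x)).trans_eq ?_
  rw [Real.sqrt_mul hC, weight, Real.sqrt_eq_rpow (_ ^ _), ← Real.rpow_mul (bracket_pos x).le]
  congr 2
  ring

theorem hasKernel_opU {V : Space n → ℝ} (hV : Measurable V) : HasKernel (opU V) (signU V) 0 := by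
  obtain ⟨T, hT⟩ := exists_hasKernel_mul (measurable_signU hV) fun x => (norm_signU V x).le
  rwa [opU, hT.kernelOp_eq]

theorem coeFn_opU {V : Space n → ℝ} (hV : Measurable V) (f : L2 n) :
    ∀ᵐ x, opU V f x = signU V x * f x := by
  filter_upwards [hasKernel_opU hV f] with x hx
  simpa using hx.2

theorem opU_mul_self {V : Space n → ℝ} (hV : Measurable V) : opU V * opU V = 1 := by
  ext1 f
  refine Lp.ext ?_
  filter_upwards [coeFn_opU hV f, coeFn_opU hV (opU V f)] with x h1 h2
  rw [mul_apply_eq_comp, h2, h1, ← mul_assoc, signU_mul_self, one_mul]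
  rfl

/-! ### The kernel of `v R v` -/

theorem norm_sub_le_bracket (x y : Space n) : ‖x - y‖ ≤ 2 * (bracket x * bracket y) := by
  have h : ∀ z : Space n, ‖z‖ ≤ bracket z := fun z =>
    Real.le_sqrt_of_sq_le (by linarith)
  have h1 := norm_sub_le x y
  have hx := one_le_bracket x
  have hy := one_le_bracket y
  nlinarith [h x, h y]

/-- Since `|x - y| ≤ 2⟨x⟩⟨y⟩`, growth of order `g` costs `g` powers of decay in each variable. This
is where decay of the potential is spent. -/
theorem weight_mul_growth_le {τ g : ℝ} (hg : 0 ≤ g) (α : ℕ) (x y : Space n) :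
    weight τ x * weight τ y * (1 + (‖x - y‖ ^ α)⁻¹ + ‖x - y‖ ^ g) ≤
      (1 + 2 ^ g) * major (τ - g) α x y := by
  have hx := bracket_pos x
  have hy := bracket_pos y
  have hP : (bracket x * bracket y) ^ g = bracket x ^ g * bracket y ^ g :=
    Real.mul_rpow hx.le hy.le
  have e : ∀ z : Space n, weight (τ - g) z = weight τ z * bracket z ^ g := fun z => by
    rw [weight, weight, ← Real.rpow_add (bracket_pos z)]
    congr 1; ring
  have h1 : ‖x - y‖ ^ g ≤ 2 ^ g * (bracket x ^ g * bracket y ^ g) := by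
    rw [← hP, ← Real.mul_rpow (by norm_num) (by positivity)]
    exact Real.rpow_le_rpow (norm_nonneg _) (norm_sub_le_bracket x y) hg
  have h2 : 1 ≤ bracket x ^ g * bracket y ^ g :=
    one_le_mul_of_one_le_of_one_le (Real.one_le_rpow (one_le_bracket x) hg)
      (Real.one_le_rpow (one_le_bracket y) hg)
  have h3 : 0 ≤ (‖x - y‖ ^ α)⁻¹ := by positivity
  set P := bracket x ^ g * bracket y ^ g
  set R := (‖x - y‖ ^ α)⁻¹
  have h2g : (0 : ℝ) ≤ 2 ^ g := by positivity
  have h4 : 1 + R + ‖x - y‖ ^ g ≤ (1 + 2 ^ g) * P * (1 + R) := by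
    have a1 : 1 + R ≤ P * (1 + R) := le_mul_of_one_le_left (by linarith) h2
    have a2 : 2 ^ g * P ≤ 2 ^ g * P * (1 + R) :=
      le_mul_of_one_le_right (by positivity) (by linarith)
    linarith
  have hw : 0 ≤ weight τ x * weight τ y := (mul_pos (weight_pos τ x) (weight_pos τ y)).le
  calc _ ≤ weight τ x * weight τ y * ((1 + 2 ^ g) * P * (1 + R)) :=
        mul_le_mul_of_nonneg_left h4 hw
    _ = _ := by rw [major, e, e]; ring

/-- The kernel of `v R₀⁺(λ^{2m}) v`, set to `0` on the diagonal. -/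
noncomputable def offKernel (m : ℕ) (V : Space n → ℝ) (lam : ℝ) (x y : Space n) : ℂ :=
  (vRoot V x : ℂ) * freeKernel n m lam ‖x - y‖ * (vRoot V y : ℂ)

/-- The kernel of `v (-Δ)^{-m} v`. -/
noncomputable def zeroKernel (m : ℕ) (V : Space n → ℝ) (x y : Space n) : ℂ :=
  (vRoot V x : ℂ) * ((profileZero n m : ℂ) * (((‖x - y‖ ^ (n - 2 * m))⁻¹ : ℝ) : ℂ)) *
    (vRoot V y : ℂ)

theorem sandwichKernel_eq (hm : 1 ≤ m) (hn : 2 * m < n) (V : Space n → ℝ) {lam : ℝ} (hlam : 0 < lam)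
    {x y : Space n} (hxy : x ≠ y) : sandwichKernel m V lam x y = offKernel m V lam x y := by
  rw [sandwichKernel, resolventKernelPlus_eq hm hn hlam (sub_ne_zero.2 hxy), offKernel]

theorem ae_ne_of_pos (hn : 0 < n) (x : Space n) : ∀ᵐ y : Space n, x ≠ y := by
  have : NeZero n := ⟨hn.ne'⟩
  have : Nontrivial (Space n) := by
    apply Module.nontrivial_of_finrank_pos (R := ℝ)
    rw [finrank_euclideanSpace_fin]; omega
  simp [ae_iff, measure_singleton]

theorem measurable_offKernel (hm : 1 ≤ m) (hn : 2 * m < n) {V : Space n → ℝ} (hV : Measurable V)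
    {lam : ℝ} (hlam : 0 < lam) : Measurable (Function.uncurry (offKernel m V lam)) := by
  have hv := Complex.measurable_ofReal.comp (measurable_vRoot hV)
  have h1 : Measurable fun p : Space n × Space n => freeKernel n m lam |‖p.1 - p.2‖| :=
    (measurable_freeKernel hm hn hlam).comp (by fun_prop)
  simp only [abs_norm] at h1
  exact ((hv.comp measurable_fst).mul h1).mul (hv.comp measurable_snd)

theorem measurable_zeroKernel (m : ℕ) {V : Space n → ℝ} (hV : Measurable V) :
    Measurable (Function.uncurry (zeroKernel m V)) := by
  have hv := Complex.measurable_ofReal.comp (measurable_vRoot hV)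
  have h1 : Measurable fun p : Space n × Space n =>
      (profileZero n m : ℂ) * (((‖p.1 - p.2‖ ^ (n - 2 * m))⁻¹ : ℝ) : ℂ) := by fun_prop
  exact ((hv.comp measurable_fst).mul h1).mul (hv.comp measurable_snd)

theorem symKer_offKernel (hm : 1 ≤ m) (hn : 2 * m < n) {V : Space n → ℝ} (hV : Measurable V)
    {c τ : ℝ} (hc : 0 ≤ c) (hv : ∀ x, vRoot V x ≤ c * weight τ x) :
    SymKer (numDeriv n) 1 (τ - growth n) (n - 2 * m) (offKernel m V) := by
  obtain ⟨C, hC, h⟩ := exists_symB_freeKernel hm hn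
  refine ⟨fun t ht => measurable_offKernel hm hn hV ht.1, c * c * C * (1 + 2 ^ growth n),
    by positivity, fun x y => ?_⟩
  have h1 := (h ‖x - y‖ (norm_nonneg _)).const_mul ((vRoot V x : ℂ) * vRoot V y)
  refine (h1.mono ?_).congr fun t _ => by simp only [offKernel]; ring
  have e : ‖(vRoot V x : ℂ) * vRoot V y‖ = vRoot V x * vRoot V y := by
    rw [norm_mul, Complex.norm_real, Complex.norm_real, Real.norm_of_nonneg (vRoot_nonneg V x),
      Real.norm_of_nonneg (vRoot_nonneg V y)]
  rw [e]
  have h2 := weight_mul_growth_le (τ := τ) (growth_nonneg n) (n - 2 * m) x y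
  have h3 : vRoot V x * vRoot V y ≤ (c * weight τ x) * (c * weight τ y) :=
    mul_le_mul (hv x) (hv y) (vRoot_nonneg V y) (mul_nonneg hc (weight_pos τ x).le)
  have h4 : 0 ≤ C * (1 + (‖x - y‖ ^ (n - 2 * m))⁻¹ + ‖x - y‖ ^ growth n) := by positivity
  calc _ ≤ (c * weight τ x) * (c * weight τ y) *
        (C * (1 + (‖x - y‖ ^ (n - 2 * m))⁻¹ + ‖x - y‖ ^ growth n)) :=
        mul_le_mul_of_nonneg_right h3 h4
    _ = c * c * C * (weight τ x * weight τ y *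
        (1 + (‖x - y‖ ^ (n - 2 * m))⁻¹ + ‖x - y‖ ^ growth n)) := by ring
    _ ≤ c * c * C * ((1 + 2 ^ growth n) * major (τ - growth n) (n - 2 * m) x y) := by gcongr
    _ = _ := by ring

theorem norm_zeroKernel_le {V : Space n → ℝ} {c τ : ℝ} (hc : 0 ≤ c)
    (hv : ∀ x, vRoot V x ≤ c * weight τ x) (x y : Space n) :
    ‖zeroKernel m V x y‖ ≤ c * c * |profileZero n m| * (1 + 2 ^ growth n) *
      major (τ - growth n) (n - 2 * m) x y := by
  have h2 := weight_mul_growth_le (τ := τ) (growth_nonneg n) (n - 2 * m) x y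
  have h3 : vRoot V x * vRoot V y ≤ (c * weight τ x) * (c * weight τ y) :=
    mul_le_mul (hv x) (hv y) (vRoot_nonneg V y) (mul_nonneg hc (weight_pos τ x).le)
  have hp : (‖x - y‖ ^ (n - 2 * m))⁻¹ ≤ 1 + (‖x - y‖ ^ (n - 2 * m))⁻¹ + ‖x - y‖ ^ growth n := by
    have : 0 ≤ ‖x - y‖ ^ growth n := by positivity
    linarith
  have hw := mul_nonneg (mul_nonneg hc (weight_pos τ x).le) (mul_nonneg hc (weight_pos τ y).le)
  have hr : 0 ≤ (‖x - y‖ ^ (n - 2 * m))⁻¹ := by positivity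
  calc _ = (vRoot V x * vRoot V y) * (|profileZero n m| * (‖x - y‖ ^ (n - 2 * m))⁻¹) := by
        rw [zeroKernel, norm_mul, norm_mul, norm_mul, Complex.norm_real, Complex.norm_real,
          Complex.norm_real, Complex.norm_real, Real.norm_of_nonneg (vRoot_nonneg V x),
          Real.norm_of_nonneg (vRoot_nonneg V y), Real.norm_of_nonneg hr, Real.norm_eq_abs]
        ring
    _ ≤ (c * weight τ x) * (c * weight τ y) * (|profileZero n m| *
          (1 + (‖x - y‖ ^ (n - 2 * m))⁻¹ + ‖x - y‖ ^ growth n)) := by gcongr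
    _ = c * c * |profileZero n m| * (weight τ x * weight τ y *
        (1 + (‖x - y‖ ^ (n - 2 * m))⁻¹ + ‖x - y‖ ^ growth n)) := by ring
    _ ≤ c * c * |profileZero n m| *
        ((1 + 2 ^ growth n) * major (τ - growth n) (n - 2 * m) x y) := by gcongr
    _ = _ := by ring

/-- Off the diagonal this is `F(λr) → F(0)`; on it both kernels vanish. -/
theorem tendsto_offKernel (hm : 1 ≤ m) (hn : 2 * m < n) (V : Space n → ℝ) (x y : Space n) :
    Tendsto (fun lam => offKernel m V lam x y) (𝓝[>] 0) (𝓝 (zeroKernel m V x y)) := by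
  refine Tendsto.mul (Tendsto.mul tendsto_const_nhds ?_) tendsto_const_nhds
  simp only [freeKernel]
  rcases (norm_nonneg (x - y)).eq_or_lt with h0 | h0
  · rw [← h0, zero_pow (by omega)]
    simp
  rw [mul_comm (profileZero n m : ℂ)]
  refine Tendsto.mul tendsto_const_nhds ?_
  obtain ⟨C, hC, h⟩ := exists_norm_profile_sub_le hm hn
  rw [tendsto_iff_norm_sub_tendsto_zero]
  have h1 : Tendsto (fun lam : ℝ => C * (lam * ‖x - y‖)) (𝓝[>] 0) (𝓝 0) := by
    have : Tendsto (fun lam : ℝ => C * (lam * ‖x - y‖)) (𝓝 0) (𝓝 (C * (0 * ‖x - y‖))) :=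
      (by fun_prop : Continuous fun lam : ℝ => C * (lam * ‖x - y‖)).tendsto 0
    rw [zero_mul, mul_zero] at this
    exact this.mono_left nhdsWithin_le_nhds
  refine squeeze_zero' (Eventually.of_forall fun _ => norm_nonneg _) ?_ h1
  have h2 : Ioo 0 (2 / ‖x - y‖) ∈ 𝓝[>] (0 : ℝ) := Ioo_mem_nhdsGT (by positivity)
  filter_upwards [h2] with lam hlam
  have hpos : 0 < lam * ‖x - y‖ := mul_pos hlam.1 h0
  have e : (lam : ℂ) * (‖x - y‖ : ℂ) = ((lam * ‖x - y‖ : ℝ) : ℂ) := by push_cast; rfl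
  have hnorm : ‖(lam : ℂ) * (‖x - y‖ : ℂ)‖ = lam * ‖x - y‖ := by
    rw [e, Complex.norm_real, Real.norm_of_nonneg hpos.le]
  have h3 := h (lam * ‖x - y‖ : ℂ) (by rw [e]; simpa [cone] using hpos)
    (by rw [hnorm]; exact ((lt_div_iff₀ h0).1 hlam.2).le)
  rwa [hnorm] at h3

/-- The standing assumptions on dimension, order and decay: `|V|^{1/2} ≤ c ⟨x⟩^{-τ}`. -/
structure Admissible (m : ℕ) (V : Space n → ℝ) (c τ : ℝ) : Prop where
  one_le : 1 ≤ m
  two_mul_lt : 2 * m < n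
  measurable : Measurable V
  nonneg : 0 ≤ c
  vRoot_le : ∀ x, vRoot V x ≤ c * weight τ x
  decay : (n : ℝ) < 2 * (τ - growth n)

/-! ### The operator `v R₀⁺(λ^{2m}) v` and its limit at zero energy. -/

namespace Admissible

variable {V : Space n → ℝ} {c τ : ℝ}

theorem order_lt (h : Admissible m V c τ) : n - 2 * m < n := by
  have := h.one_le
  have := h.two_mul_lt
  omega

theorem symKer (h : Admissible m V c τ) :
    SymKer (numDeriv n) 1 (τ - growth n) (n - 2 * m) (offKernel m V) :=
  symKer_offKernel h.one_le h.two_mul_lt h.measurable h.nonneg h.vRoot_le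

theorem sandwich_eq (h : Admissible m V c τ) {lam : ℝ} (hlam : lam ∈ Ioo 0 1) :
    sandwich m V lam = kernelOp 0 (offKernel m V lam) := by
  refine HasKernel.kernelOp_eq (HasKernel.congr
    (h.symKer.hasKernel_kernelOp h.decay h.order_lt hlam) fun x => ?_)
  filter_upwards [ae_ne_of_pos (Nat.zero_lt_of_lt h.two_mul_lt) x] with y hy
  exact (sandwichKernel_eq h.one_le h.two_mul_lt V hlam.1 hy).symm

theorem hasKernel_sandwich (h : Admissible m V c τ) {lam : ℝ} (hlam : lam ∈ Ioo 0 1) :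
    HasKernel (sandwich m V lam) 0 (offKernel m V lam) := by
  rw [h.sandwich_eq hlam]
  exact h.symKer.hasKernel_kernelOp h.decay h.order_lt hlam

theorem hasKernel_opM (h : Admissible m V c τ) {lam : ℝ} (hlam : lam ∈ Ioo 0 1) :
    HasKernel (opM m V lam) (signU V) (sandwichKernel m V lam) := by
  have h1 := (hasKernel_opU h.measurable).add (h.hasKernel_sandwich hlam)
  simp only [Pi.zero_apply, add_zero, zero_add] at h1
  refine h1.congr fun x => ?_
  filter_upwards [ae_ne_of_pos (Nat.zero_lt_of_lt h.two_mul_lt) x] with y hy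
  exact (sandwichKernel_eq h.one_le h.two_mul_lt V hlam.1 hy).symm

theorem tendsto_sandwich (ha : Admissible m V c τ) :
    Tendsto (sandwich m V) (𝓝[>] 0) (𝓝 (kernelOp 0 (zeroKernel m V))) := by
  obtain ⟨A, hA, hdom⟩ := dominatedMap_kernelOp ha.decay ha.order_lt
  obtain ⟨hmeas, C, hC, hK⟩ := ha.symKer
  refine tendsto_of_seq_tendsto fun u hu => ?_
  have hev : ∀ᶠ i in atTop, u i ∈ Ioo (0 : ℝ) 1 := hu (Ioo_mem_nhdsGT one_pos)
  classical
  -- Members of the sequence outside `(0, 1)` are replaced by the limit kernel, so that the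
  -- domination holds for every index.
  set k : ℕ → Space n × Space n → ℂ := fun i p =>
    if u i ∈ Ioo (0 : ℝ) 1 then offKernel m V (u i) p.1 p.2 else zeroKernel m V p.1 p.2 with hk
  set D := max C (c * c * |profileZero n m| * (1 + 2 ^ growth n)) with hD
  have hpos : ∀ p : Space n × Space n, 0 ≤ major (τ - growth n) (n - 2 * m) p.1 p.2 :=
    fun p => (major_pos _ _ _ _).le
  have h := hdom.tendsto k (fun p => zeroKernel m V p.1 p.2) D (hC.trans (le_max_left _ _))
    (fun i => ?_) (measurable_zeroKernel m ha.measurable) (fun i p => ?_) (fun p => ?_)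
  · refine h.congr' ?_
    filter_upwards [hev] with i hi
    rw [Function.comp_apply, ha.sandwich_eq hi]
    simp only [hk, if_pos hi]
  · by_cases hi : u i ∈ Ioo (0 : ℝ) 1
    · simp only [hk, if_pos hi]
      exact hmeas _ hi
    · simp only [hk, if_neg hi]
      exact measurable_zeroKernel m ha.measurable
  · by_cases hi : u i ∈ Ioo (0 : ℝ) 1
    · simp only [hk, if_pos hi]
      exact ((hK p.1 p.2).norm_le hi).trans (mul_le_mul_of_nonneg_right (le_max_left _ _) (hpos p))
    · simp only [hk, if_neg hi]
      exact (norm_zeroKernel_le ha.nonneg ha.vRoot_le p.1 p.2).trans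
        (mul_le_mul_of_nonneg_right (le_max_right _ _) (hpos p))
  · refine ((tendsto_offKernel ha.one_le ha.two_mul_lt V p.1 p.2).comp hu).congr' ?_
    filter_upwards [hev] with i hi
    simp only [hk, if_pos hi, Function.comp]

theorem exists_symB_sandwich (ha : Admissible m V c τ) :
    ∃ C, 0 ≤ C ∧ SymB 1 (numDeriv n) 1 C (fun lam => sandwich m V lam) := by
  obtain ⟨A, hA, hdom⟩ := dominatedMap_kernelOp ha.decay ha.order_lt
  obtain ⟨hmeas, C, hC, hK⟩ := ha.symKer
  refine ⟨A * C, by positivity, ?_⟩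
  have h := SymB.realise hdom hC (k := fun t p => offKernel m V t p.1 p.2) hmeas
    fun p => hK p.1 p.2
  exact h.congr fun t ht => ha.sandwich_eq ht

end Admissible

end HigherSchrodinger

namespace HigherSchrodinger

variable {n m : ℕ}

theorem SymB.add {X : Type*} [NormedAddCommGroup X] [NormedSpace ℝ X] {e N : ℕ} {L C C' : ℝ}
    {f g : ℝ → X} (hf : SymB e N L C f) (hg : SymB e N L C' g) :
    SymB e N L (C + C') fun t => f t + g t := by
  refine symB_of_chain (F := fun j t => iteratedDeriv j f t + iteratedDeriv j g t)
    (fun j hj t ht => ?_) ?_ ?_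
  · exact (hasDerivAt_iteratedDeriv isOpen_Ioo hf.1 hj ht).add
      (hasDerivAt_iteratedDeriv isOpen_Ioo hg.1 hj ht)
  · exact (continuousOn_iteratedDeriv isOpen_Ioo hf.1 le_rfl).add
      (continuousOn_iteratedDeriv isOpen_Ioo hg.1 le_rfl)
  · intro j hj t ht
    have h1 := mul_le_mul_of_nonneg_left (norm_add_le (iteratedDeriv j f t) (iteratedDeriv j g t))
      (pow_nonneg ht.1.le (j - e))
    linarith [hf.2 j hj t ht, hg.2 j hj t ht]

/-! ### Weighted bounds for the Riesz potential -/

theorem three_halves_le_growth (n : ℕ) : 3 / 2 ≤ growth n := by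
  have : (n : ℝ) / 2 ≤ ⌈(n : ℝ) / 2⌉₊ := Nat.le_ceil _
  rw [growth, numDeriv]
  push_cast
  linarith

/-- An integrable convolution majorant. -/
noncomputable def convMajor (α : ℕ) (z : Space n) : ℝ :=
  (1 + (‖z‖ ^ α)⁻¹) * weight (((n : ℝ) + 1) / 2) z ^ 2

theorem lintegral_convMajor_lt_top {α : ℕ} (hα : α < n) :
    ∫⁻ z : Space n, ENNReal.ofReal (convMajor α z) < ⊤ := by
  obtain ⟨D, hD⟩ := exists_lintegral_inv_norm_pow_mul_le (n := n) hα
  set σ := ((n : ℝ) + 1) / 2 with hσ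
  have hI : ∫⁻ x : Space n, ENNReal.ofReal (weight σ x) ^ 2 < ⊤ :=
    lintegral_weight_sq_lt_top (by rw [hσ]; linarith)
  have hw1 : ∀ z : Space n, ENNReal.ofReal (weight σ z) ^ 2 ≤ 1 := fun z =>
    pow_le_one₀ zero_le (ENNReal.ofReal_le_one.2 (weight_le_one (by positivity) z))
  have h := hD _ 1 hw1 0
  have hm : Measurable fun x : Space n => ENNReal.ofReal (weight σ x) ^ 2 :=
    (measurable_weight σ).ennreal_ofReal.pow_const 2
  have e : ∀ z : Space n, ENNReal.ofReal (convMajor α z) = ENNReal.ofReal (weight σ z) ^ 2 +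
      ENNReal.ofReal ((‖0 - z‖ ^ α)⁻¹) * ENNReal.ofReal (weight σ z) ^ 2 := by
    intro z
    rw [convMajor, ← hσ, ENNReal.ofReal_mul (by positivity),
      ENNReal.ofReal_add (by positivity) (by positivity), ENNReal.ofReal_pow (weight_pos σ z).le,
      ENNReal.ofReal_one, zero_sub, norm_neg]
    ring
  simp_rw [e]
  rw [lintegral_add_left hm]
  refine lt_of_le_of_lt (add_le_add le_rfl h) ?_
  simp [hI]

theorem convMajor_nonneg (α : ℕ) (z : Space n) : 0 ≤ convMajor α z := by
  unfold convMajor; positivity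

theorem measurable_convMajor (α : ℕ) : Measurable (convMajor α : Space n → ℝ) :=
  Measurable.mul (by fun_prop) ((measurable_weight _).pow_const 2)

/-- Schur's test with constant test function, which is Young's inequality for an integrable
convolution kernel. -/
theorem sqBdd_convMajor (α : ℕ) :
    SqBdd (fun x y : Space n => ENNReal.ofReal (convMajor α (x - y)))
      ((∫⁻ z : Space n, ENNReal.ofReal (convMajor α z)) ^ 2) := by
  have hm : Measurable fun p : Space n × Space n => ENNReal.ofReal (convMajor α (p.1 - p.2)) :=
    ((measurable_convMajor α).comp (measurable_fst.sub measurable_snd)).ennreal_ofReal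
  refine sqBdd_of_schur hm (p := fun _ => 1) measurable_const (by simp) (by simp) ?_ ?_
  · intro x
    simp only [mul_one]
    rw [lintegral_sub_left_eq_self (fun z => ENNReal.ofReal (convMajor α z)) x]
  · intro y
    simp only [mul_one]
    rw [lintegral_sub_right_eq_self (fun z => ENNReal.ofReal (convMajor α z)) y]

theorem bracket_le_add_norm_sub (x y : Space n) : bracket x ≤ bracket y + ‖x - y‖ := by
  have h1 : ‖x‖ ≤ ‖y‖ + ‖x - y‖ := by
    have := norm_add_le y (x - y)
    rwa [add_sub_cancel] at this
  have hy : ‖y‖ ≤ bracket y := Real.le_sqrt_of_sq_le (by linarith)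
  have hy2 : bracket y ^ 2 = 1 + ‖y‖ ^ 2 := Real.sq_sqrt (by positivity)
  refine Real.sqrt_le_iff.2 ⟨add_nonneg (bracket_pos y).le (norm_nonneg _), ?_⟩
  have h2 : ‖x‖ ^ 2 ≤ (‖y‖ + ‖x - y‖) ^ 2 := pow_le_pow_left₀ (norm_nonneg _) h1 2
  nlinarith [norm_nonneg (x - y), norm_nonneg y]

/-- Three regions. Where `⟨x⟩ ≤ 2|x-y|`, the singular factor turns into further decay in `x` and the
kernel separates. Otherwise, for `|x-y| ≤ 1` only the local singularity counts; for `|x-y| > 1` both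
brackets are at least `|x-y|`, and the weights supply `2m + 1` powers, for a total decay
`|x-y|^{-(n+1)}`, which is integrable. -/
theorem weighted_riesz_le (hn : 2 * m < n) {s τ : ℝ} (hs : 0 ≤ s) (hτ : 0 ≤ τ)
    (hsτ : 2 * (m : ℝ) + 1 ≤ s + τ) (x y : Space n) :
    weight s x * (‖x - y‖ ^ (n - 2 * m))⁻¹ * weight τ y ≤
      2 ^ (n + 1) * convMajor (n - 2 * m) (x - y) +
        2 ^ (n - 2 * m) * (weight (s + (n - 2 * m : ℕ)) x * weight τ y) := by
  set α := n - 2 * m with hα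
  set r := ‖x - y‖ with hr
  have hr0 : 0 ≤ r := norm_nonneg _
  have hx := bracket_pos x
  have hx1 := one_le_bracket x
  have hwx := weight_pos s x
  have hwy := weight_pos τ y
  have hwx1 := weight_le_one hs x
  have hwy1 := weight_le_one hτ y
  have hG := convMajor_nonneg α (x - y)
  have hF : 0 ≤ weight (s + α) x * weight τ y := (mul_pos (weight_pos _ x) hwy).le
  rcases le_or_gt (bracket x) (2 * r) with hfar | hnear
  · have h1 : (r ^ α)⁻¹ ≤ 2 ^ α * (bracket x ^ α)⁻¹ := by
      rw [inv_le_comm₀ (by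
        have : 0 < r := by linarith
        positivity) (by positivity), mul_inv, inv_inv, inv_mul_le_iff₀ (by positivity), ← mul_pow]
      exact pow_le_pow_left₀ hx.le hfar _
    have h2 : weight (s + α) x = weight s x * (bracket x ^ α)⁻¹ := by
      rw [weight, weight, neg_add, Real.rpow_add hx, Real.rpow_neg hx.le α, Real.rpow_natCast]
    calc _ ≤ weight s x * (2 ^ α * (bracket x ^ α)⁻¹) * weight τ y := by gcongr
      _ = 2 ^ α * (weight (s + α) x * weight τ y) := by rw [h2]; ring
      _ ≤ _ := le_add_of_nonneg_left (by positivity)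
  · refine le_trans ?_ (le_add_of_nonneg_right (by positivity))
    have hb : weight (((n : ℝ) + 1) / 2) (x - y) ^ 2 = (bracket (x - y) ^ (n + 1))⁻¹ := by
      rw [weight, ← Real.rpow_natCast, ← Real.rpow_mul (bracket_pos _).le, ← Real.rpow_natCast,
        ← Real.rpow_neg (bracket_pos _).le]
      congr 1
      push_cast; ring
    have hb1 := bracket_pos (x - y)
    have hR : 0 ≤ (r ^ α)⁻¹ := by positivity
    rcases le_or_gt r 1 with h1 | h1
    · have h2 : bracket (x - y) ≤ 2 := by
        rw [bracket, Real.sqrt_le_left (by norm_num), ← hr]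
        nlinarith
      have h3 : 1 ≤ 2 ^ (n + 1) * (bracket (x - y) ^ (n + 1))⁻¹ := by
        rw [le_mul_inv_iff₀ (by positivity), one_mul]
        exact pow_le_pow_left₀ hb1.le h2 _
      calc weight s x * (r ^ α)⁻¹ * weight τ y ≤ 1 * (r ^ α)⁻¹ * 1 := by gcongr
        _ ≤ (1 + (r ^ α)⁻¹) * 1 := by linarith
        _ ≤ (1 + (r ^ α)⁻¹) * (2 ^ (n + 1) * (bracket (x - y) ^ (n + 1))⁻¹) := by gcongr
        _ = _ := by rw [convMajor, hb, ← hr]; ring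
    · have hrp : 0 < r := one_pos.trans h1
      have h2 : bracket (x - y) ≤ 2 * r := by
        rw [bracket, Real.sqrt_le_left (by positivity), ← hr]
        nlinarith
      -- Here `⟨x⟩ > 2r` and `⟨x⟩ ≤ ⟨y⟩ + r`.
      have hry : r ≤ bracket y := by linarith [bracket_le_add_norm_sub x y]
      have hrx : r ≤ bracket x := by
        rcases le_total r (bracket x) with h | h
        · exact h
        · linarith
      have h3 : ∀ (t : ℝ) (z : Space n), 0 ≤ t → r ≤ bracket z → weight t z ≤ r ^ (-t) :=
        fun t z ht hz => Real.rpow_le_rpow_of_nonpos hrp hz (by linarith)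
      have h4 : weight s x * weight τ y ≤ (r ^ (2 * m + 1))⁻¹ := by
        calc _ ≤ r ^ (-s) * r ^ (-τ) :=
              mul_le_mul (h3 s x hs hrx) (h3 τ y hτ hry) hwy.le (by positivity)
          _ = r ^ (-(s + τ)) := by rw [← Real.rpow_add hrp]; congr 1; ring
          _ ≤ r ^ (-((2 * m + 1 : ℕ) : ℝ)) :=
              Real.rpow_le_rpow_of_exponent_le h1.le (by push_cast; linarith)
          _ = _ := by rw [Real.rpow_neg hrp.le, Real.rpow_natCast]
      have h5 : (r ^ (n + 1))⁻¹ ≤ 2 ^ (n + 1) * (bracket (x - y) ^ (n + 1))⁻¹ := by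
        rw [inv_le_comm₀ (by positivity) (by positivity), mul_inv, inv_inv,
          inv_mul_le_iff₀ (by positivity), ← mul_pow]
        exact pow_le_pow_left₀ hb1.le h2 _
      calc _ = (weight s x * weight τ y) * (r ^ α)⁻¹ := by ring
        _ ≤ (r ^ (2 * m + 1))⁻¹ * (r ^ α)⁻¹ := by gcongr
        _ = (r ^ (n + 1))⁻¹ := by rw [← mul_inv, ← pow_add]; congr 2; omega
        _ ≤ 1 * (2 ^ (n + 1) * (bracket (x - y) ^ (n + 1))⁻¹) := by rw [one_mul]; exact h5
        _ ≤ (1 + (r ^ α)⁻¹) * (2 ^ (n + 1) * (bracket (x - y) ^ (n + 1))⁻¹) := by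
            gcongr; linarith
        _ = _ := by rw [convMajor, hb, ← hr]; ring

/-- The convolution part is bounded by Young's inequality and the separated part is Hilbert–Schmidt;
`2(s + n - 2m) > n` is what makes the weight in `x` square integrable. -/
theorem exists_sqBdd_weighted_riesz (hm : 1 ≤ m) (hn : 2 * m < n) {s τ : ℝ} (hs : 0 ≤ s)
    (hτ : (n : ℝ) < 2 * τ) (hsτ : 2 * (m : ℝ) + 1 ≤ s + τ)
    (hsn : (n : ℝ) < 2 * (s + (n - 2 * m : ℕ))) : ∃ B : ℝ≥0∞, B ≠ ⊤ ∧
      SqBdd (fun x y : Space n =>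
        ENNReal.ofReal (weight s x * (‖x - y‖ ^ (n - 2 * m))⁻¹ * weight τ y)) B := by
  set α := n - 2 * m with hα
  have hτ0 : 0 ≤ τ := by linarith [(Nat.cast_nonneg n : (0 : ℝ) ≤ n)]
  have hαn : α < n := by omega
  have h1 := (sqBdd_convMajor (n := n) α).const_mul (c := ENNReal.ofReal (2 ^ (n + 1))) (by simp)
  have hwm : Measurable fun p : Space n × Space n =>
      ENNReal.ofReal (weight (s + α) p.1) * ENNReal.ofReal (weight τ p.2) :=
    Measurable.mul ((measurable_weight _).ennreal_ofReal.comp measurable_fst)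
      ((measurable_weight _).ennreal_ofReal.comp measurable_snd)
  have h2 := (sqBdd_of_hilbertSchmidt (k := fun x y : Space n =>
    ENNReal.ofReal (weight (s + α) x) * ENNReal.ofReal (weight τ y)) hwm).const_mul
      (c := ENNReal.ofReal (2 ^ α)) (by simp)
  have hfin : ∫⁻ x : Space n, ∫⁻ y : Space n,
      (ENNReal.ofReal (weight (s + α) x) * ENNReal.ofReal (weight τ y)) ^ 2 < ⊤ := by
    have hw2 : Measurable fun y : Space n => ENNReal.ofReal (weight τ y) ^ 2 :=
      (measurable_weight τ).ennreal_ofReal.pow_const 2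
    have hw1 : Measurable fun y : Space n => ENNReal.ofReal (weight (s + α) y) ^ 2 :=
      (measurable_weight _).ennreal_ofReal.pow_const 2
    simp_rw [mul_pow, lintegral_const_mul _ hw2, lintegral_mul_const _ hw1]
    exact ENNReal.mul_lt_top (lintegral_weight_sq_lt_top hsn) (lintegral_weight_sq_lt_top hτ)
  have hm1 : Measurable (Function.uncurry fun x y : Space n =>
      ENNReal.ofReal (2 ^ (n + 1)) * ENNReal.ofReal (convMajor α (x - y))) := by
    have : Measurable fun p : Space n × Space n => ENNReal.ofReal (convMajor α (p.1 - p.2)) :=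
      ((measurable_convMajor α).comp (measurable_fst.sub measurable_snd)).ennreal_ofReal
    exact this.const_mul _
  refine ⟨_, ?_, (h1.add h2 hm1).mono (fun x => ae_of_all _ fun y => ?_) le_rfl⟩
  · have := lintegral_convMajor_lt_top hαn
    refine ENNReal.mul_ne_top (by simp) (ENNReal.add_ne_top.2 ⟨?_, ?_⟩)
    · exact ENNReal.mul_ne_top (by simp) (by simp [this.ne])
    · exact ENNReal.mul_ne_top (by simp) hfin.ne
  · have hx := weight_pos (s + α) x
    have hy := weight_pos τ y
    have hG := convMajor_nonneg α (x - y)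
    rw [← ENNReal.ofReal_mul (by positivity), ← ENNReal.ofReal_mul hx.le,
      ← ENNReal.ofReal_mul (by positivity), ← ENNReal.ofReal_add (by positivity) (by positivity)]
    exact ENNReal.ofReal_le_ofReal (weighted_riesz_le hn hs hτ0 hsτ x y)

/-! ### The zero energy state of a null vector -/

/-- `ψ = (-Δ)^{-m} v f`. -/
noncomputable def zeroState (m : ℕ) (V : Space n → ℝ) (f : Space n → ℂ) (x : Space n) : ℂ :=
  ∫ y, (profileZero n m : ℂ) * (((‖x - y‖ ^ (n - 2 * m))⁻¹ : ℝ) : ℂ) * ((vRoot V y : ℂ) * f y)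

theorem measurable_zeroState (m : ℕ) {V : Space n → ℝ} (hV : Measurable V) (f : L2 n) :
    Measurable (zeroState m V f) := by
  refine (StronglyMeasurable.integral_prod_right' (f := fun p : Space n × Space n =>
    (profileZero n m : ℂ) * (((‖p.1 - p.2‖ ^ (n - 2 * m))⁻¹ : ℝ) : ℂ) *
      ((vRoot V p.2 : ℂ) * f p.2)) (Measurable.stronglyMeasurable ?_)).measurable
  have h1 : Measurable fun p : Space n × Space n =>
      (profileZero n m : ℂ) * (((‖p.1 - p.2‖ ^ (n - 2 * m))⁻¹ : ℝ) : ℂ) := by fun_prop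
  exact h1.mul (((Complex.measurable_ofReal.comp (measurable_vRoot hV)).comp measurable_snd).mul
    ((Lp.stronglyMeasurable f).measurable.comp measurable_snd))

theorem memLp_zeroState (hm : 1 ≤ m) (hn : 2 * m < n) {V : Space n → ℝ} (hV : Measurable V)
    {c τ : ℝ} (hc : 0 ≤ c) (hv : ∀ x, vRoot V x ≤ c * weight τ x) (f : L2 n) {s : ℝ} (hs : 0 ≤ s)
    (hτ : (n : ℝ) < 2 * τ) (hsτ : 2 * (m : ℝ) + 1 ≤ s + τ)
    (hsn : (n : ℝ) < 2 * (s + (n - 2 * m : ℕ))) :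
    MemLp (fun x => ((bracket x ^ (-s) : ℝ) : ℂ) * zeroState m V f x) 2 := by
  obtain ⟨B, hB, h⟩ := exists_sqBdd_weighted_riesz hm hn hs hτ hsτ hsn
  have h1 := (h.const_mul (c := ENNReal.ofReal (|profileZero n m| * c)) ENNReal.ofReal_ne_top) _
    (measurable_enorm_coe f)
  rw [lintegral_enorm_sq] at h1
  have hmeas : Measurable fun x => ((bracket x ^ (-s) : ℝ) : ℂ) * zeroState m V f x :=
    Measurable.mul (Complex.measurable_ofReal.comp (measurable_weight s))
      (measurable_zeroState m hV f)
  refine memLp_two_of_lintegral hmeas.aestronglyMeasurable (lt_of_le_of_lt ?_ (h1.trans_lt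
    (ENNReal.mul_lt_top (ENNReal.mul_lt_top
      (ENNReal.pow_lt_top ENNReal.ofReal_lt_top) hB.lt_top) (by simp))))
  refine lintegral_mono fun x => pow_le_pow_left₀ zero_le ?_ 2
  rw [zeroState, ← integral_const_mul]
  refine (enorm_integral_le_lintegral_enorm _).trans (lintegral_mono fun y => ?_)
  have hx := weight_pos s x
  have hy := weight_pos τ y
  have hv0 := vRoot_nonneg V y
  beta_reduce
  rw [← ENNReal.ofReal_mul (by positivity), ← ofReal_norm (f y), ← ENNReal.ofReal_mul (by positivity),
    ← ofReal_norm]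
  refine ENNReal.ofReal_le_ofReal ?_
  have hr : 0 ≤ (‖x - y‖ ^ (n - 2 * m))⁻¹ := by positivity
  change ‖((weight s x : ℝ) : ℂ) * _‖ ≤ _
  rw [norm_mul, norm_mul, norm_mul, norm_mul, Complex.norm_real, Complex.norm_real,
    Complex.norm_real, Complex.norm_real, Real.norm_of_nonneg hx.le, Real.norm_of_nonneg hr,
    Real.norm_of_nonneg hv0, Real.norm_eq_abs]
  calc _ ≤ weight s x * (|profileZero n m| * (‖x - y‖ ^ (n - 2 * m))⁻¹ *
        ((c * weight τ y) * ‖f y‖)) := by gcongr; exact hv y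
    _ = _ := by ring

theorem integrable_vRoot_mul {V : Space n → ℝ} (hV : Measurable V) {c τ : ℝ}
    (hv : ∀ x, vRoot V x ≤ c * weight τ x) (hτ : (n : ℝ) < 2 * τ) (f : L2 n) :
    Integrable fun y => (vRoot V y : ℂ) * f y := by
  have h1 : MemLp (fun y => (vRoot V y : ℂ)) 2 := by
    refine memLp_of_le_mul (memLp_weight hτ) (Complex.measurable_ofReal.comp (measurable_vRoot hV))
      (C := c) fun x => ?_
    rw [Complex.norm_real, Real.norm_of_nonneg (vRoot_nonneg V x)]
    exact hv x
  exact h1.integrable_mul (Lp.memLp f)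

theorem coe_laplacian_iterate (Φ : SchwartzMap (Space n) ℂ) (k : ℕ) :
    ((Laplacian.laplacian^[k] Φ : SchwartzMap (Space n) ℂ) : Space n → ℂ) =
      Laplacian.laplacian^[k] (Φ : Space n → ℂ) := by
  induction k generalizing Φ with
  | zero => rfl
  | succ k ih =>
    rw [Function.iterate_succ_apply, Function.iterate_succ_apply, ih]
    congr 1
    ext x
    exact SchwartzMap.laplacian_apply Φ x

/-- The product entering the distributional equation is integrable, and Fubini applies. -/
theorem integral_zeroState_mul (hm : 1 ≤ m) (hn : 2 * m < n) {V : Space n → ℝ}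
    {f : Space n → ℂ} (hf : Integrable fun y => (vRoot V y : ℂ) * f y)
    (Φ : SchwartzMap (Space n) ℂ) :
    Integrable (fun x => zeroState m V f x * ((-1) ^ m * Laplacian.laplacian^[m] Φ x)) ∧
    ∫ x, zeroState m V f x * ((-1) ^ m * Laplacian.laplacian^[m] Φ x) =
      ∫ y, (vRoot V y : ℂ) * f y * Φ y := by
  set g : SchwartzMap (Space n) ℂ := Laplacian.laplacian^[m] Φ with hg
  set α := n - 2 * m with hα
  set q : Space n → ℂ := fun y => (vRoot V y : ℂ) * f y with hq
  set F : Space n → Space n → ℂ := fun x y =>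
    (profileZero n m : ℂ) * (((‖x - y‖ ^ α)⁻¹ : ℝ) : ℂ) * q y * ((-1) ^ m * g x) with hF
  obtain ⟨D, hD⟩ := exists_lintegral_inv_norm_pow_mul_le (n := n) (γ := α) (by omega)
  obtain ⟨W, hW⟩ : ∃ W : ℝ, ∀ x, ‖g x‖ ≤ W := by
    obtain ⟨W, -, hW⟩ := g.decay 0 0
    exact ⟨W, fun x => by simpa using hW x⟩
  have hgI : ∫⁻ x, ‖g x‖ₑ < ⊤ := g.integrable.2
  have hFm : AEStronglyMeasurable (fun p : Space n × Space n => F p.2 p.1)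
      ((volume : Measure (Space n)).prod volume) := by
    refine AEStronglyMeasurable.mul (AEStronglyMeasurable.mul ?_ ?_) ?_
    · exact (by fun_prop : Measurable fun p : Space n × Space n =>
        (profileZero n m : ℂ) * (((‖p.2 - p.1‖ ^ α)⁻¹ : ℝ) : ℂ)).aestronglyMeasurable
    · exact hf.1.comp_fst
    · exact (by fun_prop : Continuous fun p : Space n × Space n =>
        ((-1) ^ m * g p.2)).aestronglyMeasurable
  have hInt' : Integrable (fun p : Space n × Space n => F p.2 p.1)
      ((volume : Measure (Space n)).prod volume) := by
    refine ⟨hFm, ?_⟩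
    rw [HasFiniteIntegral, lintegral_prod _ hFm.enorm]
    have hb : ∀ y, ∫⁻ x, ‖F x y‖ₑ ≤ ‖(profileZero n m : ℂ)‖ₑ *
        (D * ENNReal.ofReal W + ∫⁻ x, ‖g x‖ₑ) * ‖q y‖ₑ := by
      intro y
      have e : ∀ x, ‖F x y‖ₑ = ‖(profileZero n m : ℂ)‖ₑ * ‖q y‖ₑ *
          (ENNReal.ofReal ((‖y - x‖ ^ α)⁻¹) * ‖g x‖ₑ) := by
        intro x
        have e1 : ‖(((‖x - y‖ ^ α)⁻¹ : ℝ) : ℂ)‖ₑ = ENNReal.ofReal ((‖y - x‖ ^ α)⁻¹) := by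
          rw [← ofReal_norm, Complex.norm_real, Real.norm_of_nonneg (by positivity), norm_sub_rev]
        have e2 : ‖((-1 : ℂ)) ^ m‖ₑ = 1 := by
          rw [← ofReal_norm]; simp
        simp only [hF, enorm_mul, e1, e2]
        ring
      simp_rw [e]
      have hmy : Measurable fun x => ENNReal.ofReal ((‖y - x‖ ^ α)⁻¹) * ‖g x‖ₑ :=
        Measurable.mul (measurable_inv_norm_pow α y) g.continuous.measurable.enorm
      rw [lintegral_const_mul _ hmy]
      have := hD (fun x => ‖g x‖ₑ) (ENNReal.ofReal W) (fun x => by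
        rw [← ofReal_norm]; exact ENNReal.ofReal_le_ofReal (hW x)) y
      calc _ ≤ ‖(profileZero n m : ℂ)‖ₑ * ‖q y‖ₑ * (D * ENNReal.ofReal W + ∫⁻ x, ‖g x‖ₑ) := by
            gcongr
        _ = _ := by ring
    refine (lintegral_mono hb).trans_lt ?_
    have htop : ‖(profileZero n m : ℂ)‖ₑ * (D * ENNReal.ofReal W + ∫⁻ x, ‖g x‖ₑ) ≠ ⊤ :=
      ENNReal.mul_ne_top (by simp) (ENNReal.add_ne_top.2 ⟨ENNReal.mul_ne_top (by simp) (by simp),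
        hgI.ne⟩)
    rw [lintegral_const_mul' _ _ htop]
    exact ENNReal.mul_lt_top htop.lt_top hf.2
  have hInt : Integrable (Function.uncurry F) ((volume : Measure (Space n)).prod volume) :=
    hInt'.swap
  have hx : ∀ x, zeroState m V f x * ((-1) ^ m * g x) = ∫ y, F x y := by
    intro x
    rw [zeroState, ← integral_mul_const]
  have hy : ∀ y, ∫ x, F x y = q y * Φ y := by
    intro y
    rw [← integral_riesz hm hn Φ y, ← integral_const_mul]
    refine integral_congr_ae (ae_of_all _ fun x => ?_)
    simp only [hF, norm_sub_rev x y]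
    ring
  refine ⟨?_, ?_⟩
  · simp_rw [hx]
    exact hInt.integral_prod_left
  · simp_rw [hx]
    rw [integral_integral_swap hInt]
    simp_rw [hy, hq]

/-! ### Invertibility of `M⁺(λ)` near zero energy. -/

namespace Admissible

variable {V : Space n → ℝ} {c τ : ℝ}

theorem n_add_three_le (ha : Admissible m V c τ) : (n : ℝ) + 3 < 2 * τ := by
  linarith [three_halves_le_growth n, ha.decay]

theorem hasKernel_zeroKernel (ha : Admissible m V c τ) :
    HasKernel (kernelOp 0 (zeroKernel m V)) 0 (zeroKernel m V) :=
  hasKernel_kernelOp ha.decay ha.order_lt (measurable_zeroKernel m ha.measurable)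
    (by have := ha.nonneg; positivity) (norm_zeroKernel_le ha.nonneg ha.vRoot_le)

/-- A null vector of `U + v (-Δ)^{-m} v` produces a zero energy state. -/
theorem eq_zero_of_opU_add_eq_zero (ha : Admissible m V c τ) (hreg : ZeroIsRegular m V) {f : L2 n}
    (hf : opU V f + kernelOp 0 (zeroKernel m V) f = 0) : f = 0 := by
  have hm := ha.one_le
  have hn := ha.two_mul_lt
  have hτ3 := ha.n_add_three_le
  have hτ : (n : ℝ) < 2 * τ := by linarith
  have hα : ((n - 2 * m : ℕ) : ℝ) = n - 2 * m := by
    rw [Nat.cast_sub hn.le]; push_cast; ring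
  have hvf := integrable_vRoot_mul ha.measurable ha.vRoot_le hτ f
  -- Since `U² = 1`, the null equation reads `f = -U v ψ`. It gives `v f = -V ψ`, the zero energy
  -- equation, and at the end recovers `f = 0` from `ψ = 0`.
  have hrel : ∀ᵐ x, f x = -(signU V x * ((vRoot V x : ℂ) * zeroState m V f x)) := by
    have h0 : (opU V f + kernelOp 0 (zeroKernel m V) f : L2 n) =ᵐ[volume] 0 := by
      rw [hf]; exact Lp.coeFn_zero _ _ _
    filter_upwards [h0, Lp.coeFn_add (opU V f) (kernelOp 0 (zeroKernel m V) f),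
      coeFn_opU ha.measurable f, ha.hasKernel_zeroKernel f] with x h1 h2 h3 h4
    have h5 : ∫ y, zeroKernel m V x y * f y = (vRoot V x : ℂ) * zeroState m V f x := by
      rw [zeroState, ← integral_const_mul]
      refine integral_congr_ae (ae_of_all _ fun y => ?_)
      simp only [zeroKernel]
      ring
    rw [h1, Pi.add_apply, h3, h4.2, h5] at h2
    simp only [Pi.zero_apply, zero_mul, zero_add] at h2
    have h6 : signU V x * f x = -((vRoot V x : ℂ) * zeroState m V f x) :=
      eq_neg_of_add_eq_zero_left h2.symm
    rw [← mul_neg, ← h6, ← mul_assoc, signU_mul_self, one_mul]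
  have hsol : IsZeroSolution m V (zeroState m V f) := by
    intro φ hφ hφc
    set Φ := hφc.toSchwartzMap hφ with hΦ
    have hcoe : (Φ : Space n → ℂ) = φ := rfl
    obtain ⟨h1, h2⟩ := integral_zeroState_mul hm hn hvf Φ
    have hbd : ∃ W : ℝ, ∀ x, ‖φ x‖ ≤ W := hφc.exists_bound_of_continuous hφ.continuous
    obtain ⟨W, hW⟩ := hbd
    have h3 : Integrable fun y => (vRoot V y : ℂ) * f y * φ y :=
      hvf.mul_bdd hφ.continuous.aestronglyMeasurable (ae_of_all _ hW)
    have h4 : (fun x => zeroState m V f x * ((V x : ℂ) * φ x)) =ᵐ[volume]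
        fun y => -((vRoot V y : ℂ) * f y * φ y) := by
      filter_upwards [hrel] with x hx
      have e : (vRoot V x : ℂ) * f x = -(signU V x * ((vRoot V x : ℂ) * vRoot V x) *
          zeroState m V f x) := by rw [hx]; ring
      rw [e, ofReal_eq_signU_mul]
      ring
    rw [coe_laplacian_iterate, hcoe] at h1 h2
    simp_rw [mul_add]
    rw [integral_add h1 (h3.neg.congr h4.symm), h2, integral_congr_ae h4, integral_neg]
    exact add_neg_cancel _
  have hψ : zeroState m V f =ᵐ[volume] 0 := by
    refine hreg _ hsol ?_
    -- For `n > 4m` the state is itself square integrable. For `n ≤ 4m` it is so with every weight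
    -- `s > 2m - n/2`, which is exactly the class of resonances.
    rcases lt_or_ge (4 * m) n with h4 | h4
    · left
      have h4' : 4 * (m : ℝ) + 1 ≤ n := by exact_mod_cast h4
      have := memLp_zeroState hm hn ha.measurable ha.nonneg ha.vRoot_le f (s := 0) le_rfl hτ
        (by linarith) (by rw [hα]; linarith)
      simpa using this
    · right
      intro s hs
      have h4' : (n : ℝ) ≤ 4 * m := by exact_mod_cast h4
      exact memLp_zeroState hm hn ha.measurable ha.nonneg ha.vRoot_le f (by linarith) hτ
        (by linarith) (by rw [hα]; linarith)
  refine Lp.ext ?_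
  filter_upwards [hrel, hψ, Lp.coeFn_zero ℂ 2 (volume : Measure (Space n))] with x h1 h2 h3
  rw [h1, h2, h3]
  simp

theorem isUnit_opU (ha : Admissible m V c τ) : IsUnit (opU V) :=
  ⟨⟨opU V, opU V, opU_mul_self ha.measurable, opU_mul_self ha.measurable⟩, rfl⟩

/-- The factorisation `U + S = U (1 + U S)` with `U S` compact leaves only the eigenvalue `-1` to be
excluded, by the Fredholm alternative; an eigenvector would be a null vector of `U + S`. -/
theorem isUnit_zero (ha : Admissible m V c τ) (hreg : ZeroIsRegular m V) :
    IsUnit (opU V + kernelOp 0 (zeroKernel m V)) := by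
  set S := kernelOp 0 (zeroKernel m V) with hS
  have hUU := opU_mul_self ha.measurable
  have hcomp : IsCompactOperator S :=
    isCompactOperator_of_major ha.decay ha.order_lt (measurable_zeroKernel m ha.measurable)
      (by have := ha.nonneg; positivity) (norm_zeroKernel_le ha.nonneg ha.vRoot_le)
  have hT : IsCompactOperator (opU V * S : L2 n →L[ℂ] L2 n) := hcomp.clm_comp (opU V)
  have e : opU V + S = opU V * (1 + opU V * S) := by
    rw [mul_add, mul_one, ← mul_assoc, hUU, one_mul]
  rw [e]
  refine ha.isUnit_opU.mul ?_
  rcases hT.hasEigenvalue_or_mem_resolventSet (μ := (-1 : ℂ)) (by norm_num) with h | h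
  · exfalso
    obtain ⟨f, hf⟩ := h.exists_hasEigenvector
    have h1 : opU V (S f) = -f := by simpa using hf.apply_eq_smul
    refine hf.2 (ha.eq_zero_of_opU_add_eq_zero hreg ?_)
    have h2 : opU V (opU V (S f)) = S f := by
      have := congrArg (fun T : L2 n →L[ℂ] L2 n => T (S f)) hUU
      simpa using this
    rw [← hS, ← h2, h1, map_neg, add_neg_cancel]
  · rw [spectrum.mem_resolventSet_iff] at h
    have := h.neg
    simpa [add_comm] using this

/-- `M⁺(λ)` is uniformly invertible near zero energy. -/
theorem exists_isUnit_opM (ha : Admissible m V c τ) (hreg : ZeroIsRegular m V) :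
    ∃ L, 0 < L ∧ L ≤ 1 ∧ ∃ B, ∀ lam ∈ Ioo 0 L,
      IsUnit (opM m V lam) ∧ ‖Ring.inverse (opM m V lam)‖ ≤ B := by
  obtain ⟨u, hu⟩ := ha.isUnit_zero hreg
  -- The limit in norm is a unit. The units form an open set on which inversion is continuous, hence
  -- the uniform bound.
  have hlim : Tendsto (opM m V) (𝓝[>] 0) (𝓝 (u : L2 n →L[ℂ] L2 n)) := by
    rw [hu]
    exact tendsto_const_nhds.add ha.tendsto_sandwich
  have h1 : ∀ᶠ lam in 𝓝[>] (0 : ℝ), IsUnit (opM m V lam) :=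
    hlim.eventually (Units.isOpen.mem_nhds u.isUnit)
  have h2 : ∀ᶠ lam in 𝓝[>] (0 : ℝ), ‖Ring.inverse (opM m V lam)‖ ≤
      ‖Ring.inverse (u : L2 n →L[ℂ] L2 n)‖ + 1 := by
    have := ((NormedRing.inverse_continuousAt u).tendsto.comp hlim).norm
    filter_upwards [this.eventually (gt_mem_nhds (lt_add_one _))] with lam h using h.le
  obtain ⟨L, hL, h⟩ := mem_nhdsGT_iff_exists_Ioo_subset.1 (h1.and h2)
  refine ⟨min L 1, lt_min hL one_pos, min_le_right _ _, _, fun lam hlam =>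
    h ⟨hlam.1, hlam.2.trans_le (min_le_left _ _)⟩⟩

theorem exists_symB_inverse (ha : Admissible m V c τ) (hreg : ZeroIsRegular m V) :
    ∃ L, 0 < L ∧ L ≤ 1 ∧ (∀ lam ∈ Ioo 0 L, IsUnit (opM m V lam)) ∧ ∃ C, 0 ≤ C ∧
      SymB 1 (numDeriv n) L C (fun lam => Ring.inverse (opM m V lam)) := by
  obtain ⟨L, hL, hL1, B, hB⟩ := ha.exists_isUnit_opM hreg
  obtain ⟨C, hC, hS⟩ := ha.exists_symB_sandwich
  have h1 : SymB 1 (numDeriv n) L (‖opU V‖ + C) (opM m V) :=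
    (symB_const (opU V)).add (hS.restrict hL1)
  exact ⟨L, hL, hL1, fun lam hlam => (hB lam hlam).1,
    h1.ringInverse hL1 (by positivity) (fun t ht => (hB t ht).1) fun t ht => (hB t ht).2⟩

end Admissible

end HigherSchrodinger

namespace HigherSchrodinger

variable {n m : ℕ}

/-! ### Operators between two families of kernels -/

theorem SymKer.add {N : ℕ} {L σ : ℝ} {γ : ℕ} {K K' : ℝ → Space n → Space n → ℂ}
    (h : SymKer N L σ γ K) (h' : SymKer N L σ γ K') :
    SymKer N L σ γ fun t x y => K t x y + K' t x y := by
  obtain ⟨h1, C, hC, h2⟩ := h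
  obtain ⟨h1', C', hC', h2'⟩ := h'
  exact ⟨fun t ht => (h1 t ht).add (h1' t ht), C + C', by positivity, fun x y =>
    ((h2 x y).add (h2' x y)).mono (by rw [add_mul])⟩

/-- The square of the singularity has order `2γ < n` and is still locally integrable, and the decay
in `y` survives. -/
theorem exists_lintegral_major_sq_le {σ : ℝ} (hσ : (n : ℝ) < 2 * σ) {γ : ℕ} (hγ : 2 * γ < n) :
    ∃ D : NNReal, ∀ y : Space n, ∫⁻ z, ENNReal.ofReal (major σ γ z y) ^ 2 ≤
      D * ENNReal.ofReal (weight σ y) ^ 2 := by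
  have hσ0 : 0 ≤ σ := by linarith [(Nat.cast_nonneg n : (0 : ℝ) ≤ n)]
  obtain ⟨D, hD⟩ := exists_lintegral_inv_norm_pow_mul_le (n := n) hγ
  set w : Space n → ℝ≥0∞ := fun z => ENNReal.ofReal (weight σ z) ^ 2
  have hw1 : ∀ z, w z ≤ 1 := fun z =>
    pow_le_one₀ zero_le (ENNReal.ofReal_le_one.2 (weight_le_one hσ0 z))
  have hwm : Measurable w := (measurable_weight σ).ennreal_ofReal.pow_const 2
  set I := ∫⁻ z, w z with hI
  have hItop : I < ⊤ := lintegral_weight_sq_lt_top hσ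
  have hne : 2 * (I + (D * 1 + I)) ≠ ⊤ := by
    simp [hItop.ne, ENNReal.mul_eq_top, ENNReal.add_eq_top]
  refine ⟨(2 * (I + (D * 1 + I))).toNNReal, fun y => ?_⟩
  rw [ENNReal.coe_toNNReal hne]
  have e : ∀ z, ENNReal.ofReal (major σ γ z y) ^ 2 ≤
      2 * w y * (w z + ENNReal.ofReal ((‖y - z‖ ^ (2 * γ))⁻¹) * w z) := by
    intro z
    have hz := weight_pos σ z
    have hy := weight_pos σ y
    have hR : 0 ≤ (‖z - y‖ ^ γ)⁻¹ := by positivity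
    have h1 : ENNReal.ofReal (1 + (‖z - y‖ ^ γ)⁻¹) ^ 2 ≤
        2 * (1 + ENNReal.ofReal ((‖y - z‖ ^ (2 * γ))⁻¹)) := by
      rw [ENNReal.ofReal_add zero_le_one hR]
      refine (add_sq_le_two_mul _ _).trans_eq ?_
      rw [ENNReal.ofReal_one, one_pow, ← ENNReal.ofReal_pow hR, inv_pow, ← pow_mul,
        norm_sub_rev, mul_comm γ]
    rw [major, ENNReal.ofReal_mul (by positivity), ENNReal.ofReal_mul hz.le, mul_pow, mul_pow]
    calc _ ≤ w z * w y * (2 * (1 + ENNReal.ofReal ((‖y - z‖ ^ (2 * γ))⁻¹))) := by gcongr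
      _ = _ := by ring
  refine (lintegral_mono e).trans ?_
  have hm1 : Measurable fun z => w z + ENNReal.ofReal ((‖y - z‖ ^ (2 * γ))⁻¹) * w z :=
    hwm.add ((measurable_inv_norm_pow _ y).mul hwm)
  rw [lintegral_const_mul _ hm1, lintegral_add_left hwm]
  calc _ ≤ 2 * w y * (I + (D * 1 + I)) := by
        gcongr
        exact hD w 1 hw1 y
    _ = _ := by ring

theorem norm_toL2_le_of_lintegral {u : Space n → ℂ} (hu : MemLp u 2) {D : NNReal} {b : ℝ}
    (hb : 0 ≤ b) (h : ∫⁻ z, ‖u z‖ₑ ^ 2 ≤ D * ENNReal.ofReal b ^ 2) : ‖toL2 u‖ ≤ Real.sqrt D * b := by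
  have hD0 : (0 : ℝ) ≤ D := D.coe_nonneg
  rw [← enorm_toL2_sq hu] at h
  rw [← ofReal_norm, ← ENNReal.ofReal_coe_nnreal, ← ENNReal.ofReal_pow (norm_nonneg _),
    ← ENNReal.ofReal_pow hb, ← ENNReal.ofReal_mul hD0,
    ENNReal.ofReal_le_ofReal_iff (by positivity)] at h
  refine (Real.le_sqrt_of_sq_le h).trans_eq ?_
  rw [Real.sqrt_mul hD0, Real.sqrt_sq hb]

theorem exists_norm_toL2_major_le {σ : ℝ} (hσ : (n : ℝ) < 2 * σ) {γ : ℕ} (hγ : 2 * γ < n) :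
    ∃ D, 0 ≤ D ∧ ∀ y : Space n, MemLp (fun z => (major σ γ z y : ℂ)) 2 ∧
      ‖toL2 fun z => (major σ γ z y : ℂ)‖ ≤ D * weight σ y := by
  obtain ⟨D, hD⟩ := exists_lintegral_major_sq_le (n := n) hσ hγ
  refine ⟨Real.sqrt D, Real.sqrt_nonneg _, fun y => ?_⟩
  have hy := weight_pos σ y
  have e : ∫⁻ z, ‖(major σ γ z y : ℂ)‖ₑ ^ 2 ≤ D * ENNReal.ofReal (weight σ y) ^ 2 := by
    refine le_trans (le_of_eq (lintegral_congr fun z => ?_)) (hD y)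
    rw [← ofReal_norm, Complex.norm_real, Real.norm_of_nonneg (major_pos σ γ z y).le]
  have hmeas' : Measurable fun z : Space n => major σ γ z y :=
    ((measurable_weight σ).mul_const _).mul (by fun_prop)
  have hmeas : Measurable fun z => (major σ γ z y : ℂ) := Complex.measurable_ofReal.comp hmeas'
  have hmem : MemLp (fun z => (major σ γ z y : ℂ)) 2 :=
    memLp_two_of_lintegral hmeas.aestronglyMeasurable
      (e.trans_lt (ENNReal.mul_lt_top (by simp) (by simp)))
  exact ⟨hmem, norm_toL2_le_of_lintegral hmem hy.le e⟩

/-- Columns of a family of kernels as a family of vectors of `L²`. -/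
theorem SymKer.exists_symB_column {N : ℕ} {L σ : ℝ} (hσ : (n : ℝ) < 2 * σ) {γ : ℕ} (hγ : 2 * γ < n)
    {K : ℝ → Space n → Space n → ℂ} (h : SymKer N L σ γ K) :
    ∃ C, 0 ≤ C ∧ ∀ y, SymB 1 N L (C * weight σ y) (fun t => toL2 fun z => K t z y) ∧
      ∀ t ∈ Ioo 0 L, MemLp (fun z => K t z y) 2 := by
  obtain ⟨D, hD, hg⟩ := exists_norm_toL2_major_le (n := n) hσ hγ
  obtain ⟨hm, C, hC, hK⟩ := h
  have hcol : ∀ y, ∀ t ∈ Ioo 0 L, Measurable fun z => K t z y := fun y t ht =>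
    (hm t ht).comp (measurable_id.prodMk measurable_const)
  refine ⟨D * C, by positivity, fun y => ⟨?_, fun t ht => ?_⟩⟩
  · refine (SymB.realise (dominatedMap_toL2 (hg y).1) hC (hcol y) fun z => hK z y).mono ?_
    calc _ ≤ D * weight σ y * C := by gcongr; exact (hg y).2
      _ = _ := by ring
  · exact memLp_of_le_mul (hg y).1 (hcol y t ht) fun z => (hK z y).norm_le ht

/-- The transposed and conjugated family. -/
theorem SymKer.conj_swap {N : ℕ} {L σ : ℝ} {γ : ℕ} {K : ℝ → Space n → Space n → ℂ}
    (h : SymKer N L σ γ K) : SymKer N L σ γ fun t x y => (starRingEnd ℂ) (K t y x) := by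
  obtain ⟨hm, C, hC, hK⟩ := h
  refine ⟨fun t ht => Complex.continuous_conj.measurable.comp
    ((hm t ht).comp (measurable_snd.prodMk measurable_fst)), C, hC, fun x y => ?_⟩
  have h1 := (hK y x).clm (Complex.conjCLE : ℂ →L[ℝ] ℂ) (by
    refine ContinuousLinearMap.opNorm_le_bound _ zero_le_one fun z => ?_
    simp)
  rw [major_symm σ γ x y]
  exact h1

/-- The kernel of `A M B` for integral operators `A` and `B`. -/
noncomputable def sandwichedKernel (A : Space n → Space n → ℂ) (M : L2 n →L[ℂ] L2 n)
    (B : Space n → Space n → ℂ) (x y : Space n) : ℂ :=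
  inner ℂ (toL2 fun z => (starRingEnd ℂ) (A x z)) (M (toL2 fun z => B z y))

/-- The kernel at `(x, y)` is bilinear in a row, the middle operator and a column, so Leibniz' rule
applies. Rows and columns have norms of order `⟨x⟩^{-σ}` and `⟨y⟩^{-σ}`, and only the norm of the
middle operator enters: the diagonal singularity disappears. -/
theorem SymKer.sandwichedKernel {N : ℕ} {L σ : ℝ} (hσ : (n : ℝ) < 2 * σ) (hL : L ≤ 1) {γ : ℕ}
    (hγ : 2 * γ < n) {A B : ℝ → Space n → Space n → ℂ} (hA : SymKer N L σ γ A)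
    (hB : SymKer N L σ γ B) {M : ℝ → (L2 n →L[ℂ] L2 n)} {C : ℝ} (hC : 0 ≤ C)
    (hM : SymB 1 N L C M) :
    SymKer N L σ 0 fun t => HigherSchrodinger.sandwichedKernel (A t) (M t) (B t) := by
  obtain ⟨C₁, hC₁, h₁⟩ := hA.conj_swap.exists_symB_column hσ hγ
  obtain ⟨C₂, hC₂, h₂⟩ := hB.exists_symB_column hσ hγ
  refine ⟨fun t ht => ?_, ?_⟩
  · have hr : StronglyMeasurable fun x => toL2 fun z => (starRingEnd ℂ) (A t x z) :=
      stronglyMeasurable_toL2 (K := fun x z => (starRingEnd ℂ) (A t x z))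
        (Complex.continuous_conj.measurable.comp (hA.1 t ht)) fun x => (h₁ x).2 t ht
    have hc : StronglyMeasurable fun y => toL2 fun z => B t z y :=
      stronglyMeasurable_toL2 (K := fun y z => B t z y)
        ((hB.1 t ht).comp (measurable_snd.prodMk measurable_fst)) fun y => (h₂ y).2 t ht
    exact ((hr.comp_measurable measurable_fst).inner
      (((M t).continuous.comp_stronglyMeasurable hc).comp_measurable measurable_snd)).measurable
  -- Evaluation and inner product are taken as real bilinear maps: the parameter `λ` is real, and
  -- the inner product is conjugate linear on the left.
  · set ev : (L2 n →L[ℂ] L2 n) →L[ℝ] L2 n →L[ℝ] L2 n :=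
      ContinuousLinearMap.restrictScalarsL ℂ (L2 n) (L2 n) ℝ ℝ with hev
    set ip : L2 n →L[ℝ] L2 n →L[ℝ] ℂ :=
      (isBoundedBilinearMap_inner (𝕜 := ℂ) (E := L2 n)).toContinuousLinearMap with hip
    refine ⟨2 ^ N * ‖ip‖ * C₁ * (2 ^ N * ‖ev‖ * C * C₂), by positivity, fun x y => ?_⟩
    have hx := weight_pos σ x
    have hy := weight_pos σ y
    have h3 := SymB.bilin ev hL hC (by positivity) hM (h₂ y).1
    have h4 := SymB.bilin ip hL (by positivity) (by positivity) (h₁ x).1 h3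
    refine h4.mono ?_
    have e : weight σ x * weight σ y ≤ major σ 0 x y := by
      rw [major]
      exact le_mul_of_one_le_right (by positivity) (by simp)
    calc _ = 2 ^ N * ‖ip‖ * C₁ * (2 ^ N * ‖ev‖ * C * C₂) * (weight σ x * weight σ y) := by ring
      _ ≤ _ := by gcongr

/-- With `Tf` written as a Bochner integral of columns, bounded operators and functionals can be
moved inside. The identity is checked weakly, by Fubini. -/
theorem HasKernel.eq_integral_smul {T : L2 n →L[ℂ] L2 n} {K : Space n → Space n → ℂ}
    (hT : HasKernel T 0 K) (hK : Measurable (Function.uncurry K)) {B : ℝ≥0∞} (hB : B ≠ ⊤)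
    (hs : SqBdd (fun x y => ‖K x y‖ₑ) B) (hmem : ∀ y, MemLp (fun z => K z y) 2) (f : L2 n)
    (hInt : Integrable fun y => f y • toL2 fun z => K z y) :
    T f = ∫ y, f y • toL2 fun z => K z y := by
  refine ext_inner_left ℂ fun g => ?_
  set F : Space n → ℝ≥0∞ := fun z => ∫⁻ y, ‖K z y‖ₑ * ‖f y‖ₑ with hF
  have hFm : Measurable F := Measurable.lintegral_prod_right'
    (f := fun p : Space n × Space n => ‖K p.1 p.2‖ₑ * ‖f p.2‖ₑ)
    (hK.enorm.mul ((measurable_enorm_coe f).comp measurable_snd))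
  have h1 := hs _ (measurable_enorm_coe f)
  rw [lintegral_enorm_sq] at h1
  have h2 : ∫⁻ z, ‖g z‖ₑ * F z < ⊤ := by
    have h3 := lintegral_mul_sq_le volume (measurable_enorm_coe g).aemeasurable hFm.aemeasurable
    rw [lintegral_enorm_sq] at h3
    have h4 : (∫⁻ z, ‖g z‖ₑ * F z) ^ 2 < ⊤ := h3.trans_lt (ENNReal.mul_lt_top (by simp)
      (h1.trans_lt (ENNReal.mul_lt_top hB.lt_top (by simp))))
    by_contra h0
    rw [not_lt, top_le_iff] at h0
    simp [h0] at h4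
  have hgm := (Lp.stronglyMeasurable g).measurable
  have hfm := (Lp.stronglyMeasurable f).measurable
  have hGm : Measurable fun p : Space n × Space n =>
      (starRingEnd ℂ) (g p.1) * (K p.1 p.2 * f p.2) :=
    (Complex.continuous_conj.measurable.comp (hgm.comp measurable_fst)).mul
      (hK.mul (hfm.comp measurable_snd))
  have hprod : Integrable (Function.uncurry fun z y => (starRingEnd ℂ) (g z) * (K z y * f y))
      ((volume : Measure (Space n)).prod volume) := by
    refine ⟨hGm.aestronglyMeasurable, ?_⟩
    change ∫⁻ p : Space n × Space n, ‖(starRingEnd ℂ) (g p.1) * (K p.1 p.2 * f p.2)‖ₑ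
      ∂((volume : Measure (Space n)).prod volume) < ⊤
    rw [lintegral_prod _ hGm.enorm.aemeasurable]
    refine lt_of_eq_of_lt (lintegral_congr fun z => ?_) h2
    have e : ‖(starRingEnd ℂ) (g z)‖ₑ = ‖g z‖ₑ := by
      rw [← ofReal_norm, ← ofReal_norm, RCLike.norm_conj]
    simp only [enorm_mul, e]
    have hmz : Measurable fun y => ‖K z y‖ₑ * ‖f y‖ₑ :=
      Measurable.mul (hK.comp (measurable_const.prodMk measurable_id)).enorm
        (measurable_enorm_coe f)
    exact lintegral_const_mul _ hmz
  have hright : inner ℂ g (∫ y, f y • toL2 fun z => K z y) =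
      ∫ y, ∫ z, (starRingEnd ℂ) (g z) * (K z y * f y) := by
    rw [← integral_inner hInt]
    refine integral_congr_ae (ae_of_all _ fun y => ?_)
    beta_reduce
    rw [inner_smul_right, ← inner_conj_symm, inner_toL2 (hmem y), ← integral_conj,
      ← integral_const_mul]
    refine integral_congr_ae (ae_of_all _ fun z => ?_)
    simp only [map_mul, Complex.conj_conj]
    ring
  rw [hright, ← integral_integral_swap hprod, L2.inner_def]
  refine integral_congr_ae ?_
  filter_upwards [hT f] with z hz
  rw [RCLike.inner_apply, hz.2, integral_const_mul]
  simp only [Pi.zero_apply, zero_mul, zero_add]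
  ring

/-- For fixed `x` the map `h ↦ ⟨A(x,·)*, M h⟩` is a bounded functional, which is applied to the
Bochner integral of the columns of `B`. No kernel of `M` is needed. -/
theorem HasKernel.sandwichedKernel {N : ℕ} {L σ : ℝ} (hσ : (n : ℝ) < 2 * σ) {γ : ℕ}
    (hγ : 2 * γ < n) {A B : ℝ → Space n → Space n → ℂ} (hA : SymKer N L σ γ A)
    (hB : SymKer N L σ γ B) {t : ℝ} (ht : t ∈ Ioo 0 L) {TA TB : L2 n →L[ℂ] L2 n}
    (hTA : HasKernel TA 0 (A t)) (hTB : HasKernel TB 0 (B t)) (M : L2 n →L[ℂ] L2 n) :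
    HasKernel (TA * M * TB) 0 (HigherSchrodinger.sandwichedKernel (A t) M (B t)) := by
  obtain ⟨C₁, hC₁, h₁⟩ := hA.conj_swap.exists_symB_column hσ hγ
  obtain ⟨C₂, hC₂, h₂⟩ := hB.exists_symB_column hσ hγ
  have hγn : γ < n := by omega
  obtain ⟨D, hD, hs⟩ := hB.exists_sqBdd hσ hγn ht
  intro f
  have hc : StronglyMeasurable fun y => toL2 fun z => B t z y :=
    stronglyMeasurable_toL2 (K := fun y z => B t z y)
      ((hB.1 t ht).comp (measurable_snd.prodMk measurable_fst)) fun y => (h₂ y).2 t ht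
  have hwf : Integrable fun y => (weight σ y : ℂ) * f y :=
    (memLp_weight hσ).integrable_mul (Lp.memLp f)
  have hInt : Integrable fun y => f y • toL2 fun z => B t z y := by
    refine (hwf.norm.const_mul C₂).mono'
      ((Lp.stronglyMeasurable f).smul hc).aestronglyMeasurable (ae_of_all _ fun y => ?_)
    rw [norm_smul, norm_mul, Complex.norm_real, Real.norm_of_nonneg (weight_pos σ y).le]
    calc _ ≤ ‖f y‖ * (C₂ * weight σ y) := by gcongr; exact (h₂ y).1.norm_le ht
      _ = _ := by ring
  have hTf := hTB.eq_integral_smul (hB.1 t ht) hD hs (fun y => (h₂ y).2 t ht) f hInt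
  filter_upwards [hTA (M (TB f))] with x hx
  set ℓ : L2 n →L[ℂ] ℂ := (innerSL ℂ (toL2 fun z => (starRingEnd ℂ) (A t x z))).comp M with hℓ
  have hker : ∀ y, ℓ (f y • toL2 fun z => B t z y) =
      HigherSchrodinger.sandwichedKernel (A t) M (B t) x y * f y := by
    intro y
    rw [map_smul, smul_eq_mul, mul_comm]
    rfl
  have h3 := ℓ.integrable_comp hInt
  have h4 := ℓ.integral_comp_comm hInt
  simp_rw [hker] at h3 h4
  refine ⟨h3, ?_⟩
  change (TA (M (TB f))) x = _
  rw [hx.2, h4, ← hTf, hℓ]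
  change _ = _ + inner ℂ (toL2 fun z => (starRingEnd ℂ) (A t x z)) (M (TB f))
  rw [inner_toL2 ((h₁ x).2 t ht)]
  simp

/-! ### Powers -/

/-- Each further factor lowers the order by one, down to zero by truncated subtraction. -/
theorem exists_symKer_pow {N : ℕ} {L σ : ℝ} (hσ : (n : ℝ) < 2 * σ) (hL : L ≤ 1) {α : ℕ}
    (hα : α + 1 < n) {P : ℝ → (L2 n →L[ℂ] L2 n)} {K : ℝ → Space n → Space n → ℂ}
    (hK : SymKer N L σ α K) (hP : ∀ t ∈ Ioo 0 L, HasKernel (P t) 0 (K t)) (k : ℕ) :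
    ∃ Q : ℝ → Space n → Space n → ℂ, SymKer N L σ (α - k) Q ∧
      ∀ t ∈ Ioo 0 L, HasKernel (P t * P t ^ k) 0 (Q t) := by
  induction k with
  | zero => exact ⟨K, hK, by simpa using hP⟩
  | succ k ih =>
    obtain ⟨Q, hQ, hPQ⟩ := ih
    refine ⟨fun t => compKer (K t) (Q t),
      hK.comp hσ hL hα ((Nat.sub_le α k).trans (Nat.le_succ α)) hQ, fun t ht => ?_⟩
    obtain ⟨B₁, hB₁, hs₁⟩ := hK.exists_sqBdd hσ (by omega) ht
    obtain ⟨B₂, hB₂, hs₂⟩ := hQ.exists_sqBdd hσ ((Nat.sub_le α k).trans_lt (by omega)) ht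
    rw [pow_succ']
    exact (hP t ht).comp (by omega) (hPQ t ht) (hK.1 t ht) (hQ.1 t ht) hB₁ hB₂ hs₁ hs₂

/-! ### The hypotheses from symbol bounds -/

/-- One factor `C` accounts for the undifferentiated kernel and one for the supremum over
derivatives, whose weight `λ^{j-1}` is that of `SymB 1`. -/
theorem tildeKernel_le {L σ C : ℝ} {γ : ℕ} (hC : 0 ≤ C) {K : ℝ → Space n → Space n → ℂ}
    (hK : ∀ x y, SymB 1 (numDeriv n) L (C * major σ γ x y) fun t => K t x y) (x y : Space n) :
    tildeKernel L K x y ≤ ENNReal.ofReal (2 * C) * ENNReal.ofReal (major σ γ x y) := by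
  have hpos := major_pos σ γ x y
  rw [← ENNReal.ofReal_mul (by positivity)]
  refine iSup₂_le fun lam hlam => ?_
  have e : 2 * C * major σ γ x y = C * major σ γ x y + C * major σ γ x y := by ring
  rw [e, ENNReal.ofReal_add (by positivity) (by positivity)]
  refine add_le_add ?_ (iSup₂_le fun j hj => ?_)
  · rw [← ofReal_norm]
    exact ENNReal.ofReal_le_ofReal ((hK x y).norm_le hlam)
  · rw [← ofReal_norm, norm_mul, norm_pow, Complex.norm_real, Real.norm_of_nonneg hlam.1.le]
    exact ENNReal.ofReal_le_ofReal ((hK x y).2 j hj.2 lam hlam)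

theorem satisfiesHypotheses_of_symKer {L σ : ℝ} (hσ : (n : ℝ) < 2 * σ) {γ : ℕ} (hγ : γ < n)
    {K : ℝ → Space n → Space n → ℂ} (hK : SymKer (numDeriv n) L σ γ K) {a : Space n → ℂ}
    (ha : ∀ x, ‖a x‖ ≤ 1) {Γ : ℝ → (L2 n →L[ℂ] L2 n)}
    (hΓ : ∀ t ∈ Ioo 0 L, HasKernel (Γ t) a (K t)) (h4 : 4 * m ≤ n → γ = 0 ∧ a = 0) :
    SatisfiesHypotheses m L a Γ := by
  have ha' : ∀ x, ‖a x‖ₑ ≤ 1 := fun x => by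
    rw [← ofReal_norm]; exact ENNReal.ofReal_le_one.2 (ha x)
  have hsq := fun t (ht : t ∈ Ioo 0 L) => hK.exists_sqBdd hσ hγ ht
  obtain ⟨hm, C, hC, hS⟩ := hK
  refine ⟨K, hm, fun x y => (hS x y).1, hΓ, fun t ht => ?_, fun _ => ?_, fun h => ?_⟩
  · obtain ⟨B, hB, hs⟩ := hsq t ht
    exact nonnegKernelBounded_of_sqBdd ha' hB hs
  · obtain ⟨A, hA⟩ := exists_sqBdd_major (n := n) hσ hγ
    exact nonnegKernelBounded_of_sqBdd ha'
      (ENNReal.mul_ne_top (ENNReal.pow_ne_top ENNReal.ofReal_ne_top) ENNReal.coe_ne_top)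
      ((hA.const_mul (c := ENNReal.ofReal (2 * C)) ENNReal.ofReal_ne_top).mono
        (fun x => ae_of_all _ fun y => tildeKernel_le hC hS x y) le_rfl)
  -- For `γ = 0` the majorant is `2⟨x⟩^{-σ}⟨y⟩^{-σ}`, hence the constant `4C`; the excess decay is
  -- `ε = σ - n/2 > 0`.
  · obtain ⟨rfl, rfl⟩ := h4 h
    refine ⟨ae_of_all _ fun _ => rfl, σ - n / 2, by linarith, 4 * C, fun x y => ?_⟩
    refine (tildeKernel_le hC hS x y).trans ?_
    rw [← ENNReal.ofReal_mul (by positivity)]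
    refine ENNReal.ofReal_le_ofReal (le_of_eq ?_)
    have e : -((n : ℝ) / 2) - (σ - n / 2) = -σ := by ring
    rw [major, weight, weight, pow_zero, inv_one, e]
    ring

/-! ### The operators `Γ_k` -/

namespace Admissible

variable {V : Space n → ℝ} {c τ : ℝ}

theorem exists_symKer_factors (ha : Admissible m V c τ) (k : ℕ) :
    ∃ A B : ℝ → Space n → Space n → ℂ,
      SymKer (numDeriv n) 1 (τ - growth n) (n - 2 * m - k) A ∧
      SymKer (numDeriv n) 1 (τ - growth n) (n - 2 * m - k) B ∧
      ∀ lam ∈ Ioo 0 1, HasKernel ((opU V * sandwich m V lam) * (opU V * sandwich m V lam) ^ k) 0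
        (A lam) ∧ HasKernel ((sandwich m V lam * opU V) ^ k * (sandwich m V lam * opU V)) 0
        (B lam) := by
  have hα : n - 2 * m + 1 < n := by
    have := ha.one_le
    have := ha.two_mul_lt
    omega
  have hU := hasKernel_opU ha.measurable
  have hUm := measurable_signU ha.measurable
  have hU1 : ∀ x, ‖signU V x‖ ≤ 1 := fun x => (norm_signU V x).le
  obtain ⟨A, hA, hA'⟩ := exists_symKer_pow ha.decay le_rfl hα (ha.symKer.mul_left hUm hU1)
    (P := fun lam => opU V * sandwich m V lam)
    (fun lam hlam => (ha.hasKernel_sandwich hlam).mul_left hU) k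
  obtain ⟨B, hB, hB'⟩ := exists_symKer_pow ha.decay le_rfl hα (ha.symKer.mul_right hUm hU1)
    (P := fun lam => sandwich m V lam * opU V)
    (fun lam hlam => (ha.hasKernel_sandwich hlam).mul_right hU) k
  refine ⟨A, B, hA, hB, fun lam hlam => ⟨hA' lam hlam, ?_⟩⟩
  rw [← pow_succ, pow_succ']
  exact hB' lam hlam

/-- `Γ_k`, `k ≥ 1`, once the outer factors are square integrable. -/
theorem satisfiesHypotheses_succ (ha : Admissible m V c τ) {L C : ℝ} (hL : L ≤ 1) (hC : 0 ≤ C)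
    (hM : SymB 1 (numDeriv n) L C fun lam => Ring.inverse (opM m V lam)) {k : ℕ}
    (hk : 2 * (n - 2 * m - k) < n) : SatisfiesHypotheses m L 0 (opGamma m V (k + 1)) := by
  obtain ⟨A, B, hA, hB, hAB⟩ := ha.exists_symKer_factors k
  have hA' := hA.mono hL le_rfl
  have hB' := hB.mono hL le_rfl
  refine satisfiesHypotheses_of_symKer ha.decay (Nat.zero_lt_of_lt hk)
    (hA'.sandwichedKernel ha.decay hL hk hB' hC hM) (by simp) (fun lam hlam => ?_)
    fun _ => ⟨rfl, rfl⟩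
  obtain ⟨h1, h2⟩ := hAB lam ⟨hlam.1, hlam.2.trans_le hL⟩
  rw [opGamma, mul_assoc]
  exact HasKernel.sandwichedKernel ha.decay hk hA' hB' hlam h1 h2 _

/-- Solving `(U + S) W = 1 = W (U + S)` for `W` from both sides with `U² = 1`. The singular part `U`
is isolated, and what remains is an integral operator plus a term in which `W` stands between two
integral operators. -/
theorem inverse_opM_eq (ha : Admissible m V c τ) {lam : ℝ} (h : IsUnit (opM m V lam)) :
    Ring.inverse (opM m V lam) = opU V + (-(opU V * sandwich m V lam * opU V) +
      (opU V * sandwich m V lam) * Ring.inverse (opM m V lam) * (sandwich m V lam * opU V)) := by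
  have hUU := opU_mul_self ha.measurable
  have h1 := Ring.mul_inverse_cancel _ h
  have h2 := Ring.inverse_mul_cancel _ h
  set W := Ring.inverse (opM m V lam)
  rw [opM, add_mul] at h1
  rw [opM, mul_add] at h2
  have h3 : W = opU V - opU V * sandwich m V lam * W := by
    have := congrArg (fun T => opU V * T) h1
    simp only [mul_add, mul_one, ← mul_assoc, hUU, one_mul] at this
    exact eq_sub_of_add_eq this
  have h4 : W = opU V - W * sandwich m V lam * opU V := by
    have := congrArg (fun T => T * opU V) h2
    simp only [add_mul, one_mul, mul_assoc, hUU, mul_one] at this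
    rw [mul_assoc]
    exact eq_sub_of_add_eq this
  nth_rw 1 [h3]
  nth_rw 1 [h4]
  noncomm_ring

/-- `Γ_0` in low dimensions. -/
theorem satisfiesHypotheses_zero (ha : Admissible m V c τ) {L C : ℝ} (hL : L ≤ 1) (hC : 0 ≤ C)
    (hM : SymB 1 (numDeriv n) L C fun lam => Ring.inverse (opM m V lam))
    (hu : ∀ lam ∈ Ioo 0 L, IsUnit (opM m V lam)) (h4 : n < 4 * m) :
    SatisfiesHypotheses m L (signU V) (opGamma m V 0) := by
  have hn := ha.two_mul_lt
  have hγ : 2 * (n - 2 * m) < n := by omega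
  have hU := hasKernel_opU ha.measurable
  have hUm := measurable_signU ha.measurable
  have hU1 : ∀ x, ‖signU V x‖ ≤ 1 := fun x => (norm_signU V x).le
  have hS := ha.symKer.mono hL le_rfl
  have hA := hS.mul_left hUm hU1
  have hB := hS.mul_right hUm hU1
  have hUSU := (hA.mul_right hUm hU1).mul_left (a := fun _ => -1) measurable_const (by simp)
  -- The sandwiched kernel has no singularity; its order is raised so that it can be added to the
  -- kernel of `-U S U`.
  have hcore := (hA.sandwichedKernel ha.decay hL hγ hB hC hM).mono le_rfl (Nat.zero_le (n - 2 * m))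
  refine satisfiesHypotheses_of_symKer ha.decay ha.order_lt (hUSU.add hcore) hU1
    (fun lam hlam => ?_) fun h => by omega
  have hlam' : lam ∈ Ioo (0 : ℝ) 1 := ⟨hlam.1, hlam.2.trans_le hL⟩
  have hT := ha.hasKernel_sandwich hlam'
  rw [show opGamma m V 0 lam = _ from ha.inverse_opM_eq (hu lam hlam)]
  have h1 := HasKernel.sandwichedKernel ha.decay hγ hA hB hlam (hT.mul_left hU) (hT.mul_right hU)
    (Ring.inverse (opM m V lam))
  have h2 := ((hT.mul_left hU).mul_right hU).neg
  have h3 := hU.add (h2.add h1)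
  simpa using h3

end Admissible

/-! ### The decay threshold and the conclusion. -/

theorem odd_growth_le (h : Odd n) : growth n ≤ 2 := by
  obtain ⟨k, rfl⟩ := h
  have : ⌈((2 * k + 1 : ℕ) : ℝ) / 2⌉₊ ≤ k + 1 := Nat.ceil_le.2 (by push_cast; linarith)
  have : (⌈((2 * k + 1 : ℕ) : ℝ) / 2⌉₊ : ℝ) ≤ k + 1 := by exact_mod_cast this
  rw [growth, numDeriv]
  push_cast at this ⊢
  linarith

theorem even_growth_le (h : Even n) : growth n ≤ 3 / 2 := by
  obtain ⟨k, rfl⟩ := h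
  have : ⌈((k + k : ℕ) : ℝ) / 2⌉₊ ≤ k := Nat.ceil_le.2 (by push_cast; linarith)
  have : (⌈((k + k : ℕ) : ℝ) / 2⌉₊ : ℝ) ≤ k := by exact_mod_cast this
  rw [growth, numDeriv]
  push_cast at this ⊢
  linarith

/-- With `τ = β/2` the requirement `n < 2(τ - growth n)` is `β > n + 2 growth n`, which the two
growth bounds turn into `n + 4` for odd and `n + 3` for even `n`. -/
theorem admissible_of_decay (hm : 1 ≤ m) (hn : 2 * m < n) {V : Space n → ℝ} {β : ℝ}
    (hV : Measurable V) {C : ℝ} (hC : ∀ x, |V x| ≤ C * bracket x ^ (-β))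
    (ho : Odd n → (n : ℝ) + 4 < β) (he : Even n → (n : ℝ) + 3 < β) :
    Admissible m V (Real.sqrt C) (β / 2) where
  one_le := hm
  two_mul_lt := hn
  measurable := hV
  nonneg := Real.sqrt_nonneg _
  vRoot_le := vRoot_le hC
  decay := by
    rcases Nat.even_or_odd n with h | h
    · linarith [even_growth_le h, he h]
    · linarith [odd_growth_le h, ho h]

end HigherSchrodinger

open HigherSchrodinger in
theorem lemma2p2 (n m : ℕ) (hm : 1 ≤ m) (hn : 2 * m < n) :
    ∃ k0 : ℕ, ∀ (V : Space n → ℝ) (β : ℝ), Measurable V →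
      (∃ C : ℝ, ∀ x, |V x| ≤ C * bracket x ^ (-β)) →
      (Odd n → (n : ℝ) + 4 < β) → (Even n → (n : ℝ) + 3 < β) →
      ZeroIsRegular m V →
      ∃ lam0 : ℝ, 0 < lam0 ∧
        (∀ lam ∈ Set.Ioo 0 lam0,
          HasKernel (opM m V lam) (signU V) (sandwichKernel m V lam) ∧ IsUnit (opM m V lam)) ∧
        (n < 4 * m → ∀ k : ℕ,
          SatisfiesHypotheses m lam0 (if k = 0 then signU V else 0) (opGamma m V k)) ∧
        (4 * m ≤ n → ∀ k : ℕ, k0 ≤ k →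
          SatisfiesHypotheses m lam0 (if k = 0 then signU V else 0) (opGamma m V k)) := by
  -- The choice `k0 = n` is generous: for `k ≥ n` the order `n - 2m - (k - 1)` is truncated to zero,
  -- so the factors have square integrable rows and columns. It also excludes `k = 0`.
  refine ⟨n, fun V β hV hdecay ho he hreg => ?_⟩
  obtain ⟨C, hC⟩ := hdecay
  have ha := admissible_of_decay hm hn hV hC ho he
  obtain ⟨L, hL, hL1, hu, B, hB, hM⟩ := ha.exists_symB_inverse hreg
  refine ⟨L, hL, fun lam hlam => ⟨ha.hasKernel_opM ⟨hlam.1, hlam.2.trans_le hL1⟩, hu lam hlam⟩,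
    fun h4 k => ?_, fun h4 k hk => ?_⟩
  · cases k with
    | zero => exact ha.satisfiesHypotheses_zero hL1 hB hM hu h4
    | succ k => exact ha.satisfiesHypotheses_succ hL1 hB hM (by omega)
  · cases k with
    | zero => omega
    | succ k => exact ha.satisfiesHypotheses_succ hL1 hB hM (by omega)
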